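/- \textbf{Graded HKR theorem.} Let $k=\mathbb R$ or $\mathbb C$, let $C$ be a smooth manifold (Hausdorff, second countable, without boundary) and let $E=\bigoplus_{j\in\mathbb Z}E_j\to C$ be a smooth $\mathbb Z$-graded $k$-vector bundle of finite total rank. Let $N=E^*$ be the corresponding graded supermanifold and $$A=C^\infty(N)=\Gamma(C,S(E))=\bigoplus_{d\in\mathbb Z}\Gamma(C,S(E)^d)$$ its graded commutative $k$-algebra of functions, where $S(E)=S(E^{\mathrm{even}})\otimes\wedge(E^{\mathrm{odd}})$ is the bundle of graded symmetric algebras of the fibres of $E$. Write $|a|$ for the degree of a homogeneous element and use the Koszul sign rule throughout. Let $C^{d,m}(A,A)=\mathrm{Hom}^d_k(A^{\otimes m},A)$, with the Hochschild differential $b\colon C^{d,m}(A,A)\to C^{d,m+1}(A,A)$, $$b\phi(a_1,\dots,a_{m+1})=(-1)^{d|a_1|}a_1\phi(a_2,\dots,a_{m+1})+\sum_{j=1}^m(-1)^j\phi(a_1,\dots,a_ja_{j+1},\dots,a_{m+1})+(-1)^{m+1}\phi(a_1,\dots,a_m)a_{m+1}.$$ Let $C^{d,m}_{\mathrm{Diff}}(A,A)\subset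 C^{d,m}(A,A)$ be the space of multidifferential operators, i.e. of finite sums of cochains $c\cdot\mu\circ(D_1\otimes\cdots\otimes D_m)$ of degree $d$, where $c\in A$, $\mu$ is the product of $A$, and each $D_i$ is a differential operator, i.e. a sum of compositions of graded derivations of $A$ and multiplications by elements of $A$. They form a subcomplex $C_{\mathrm{Diff}}(A,A)=\bigoplus_n\bigoplus_{d+m=n}C^{d,m}_{\mathrm{Diff}}(A,A)$ of the Hochschild complex. Let $C^{d,m}_{\mathrm{HKR}}(A,A)\subset C^{d,m}(A,A)$ be the space of cochains that are derivations in the last argument and alternating in the graded sense. Let $\mathrm{Der}(A)$ be the graded $A$-module of graded derivations of $A$ and let $\wedge_A\mathrm{Der}(A)=\bigoplus_m\wedge^m_A\mathrm{Der}(A)$ be its graded exterior algebra over $A$ (with $\wedge^0_A\mathrm{Der}(A)=A$), regarded as a complex with zero differential in which the part of $\wedge^m_A\mathrm{Der}(A)$ of degree $d$ is placed in degree $d+m$. The HKR map is $$\phi_1\wedge\cdots\wedge\phi_m\mapsto\mu\circ\frac1{m!}\sum_{\sigma\in S_m}\mathrm{sign}(\sigma)\,\epsilon(\sigma;\phi)\,\phi_{\sigma(1)}\otimes\cdots\otimes\phi_{\sigma(m)},$$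 extended $A$-linearly, where $\epsilon(\sigma;\phi)$ is the Koszul sign of the permutation of the $\phi_i$. Then for all $m$ and $d$ the HKR map is a bijection from the degree $d$ part of $\wedge^m_A\mathrm{Der}(A)$ onto $C^{d,m}_{\mathrm{HKR}}(A,A)$; one has $C^{d,m}_{\mathrm{HKR}}(A,A)\subset C^{d,m}_{\mathrm{Diff}}(A,A)$; and the HKR map $$\wedge_A\mathrm{Der}(A)\simeq C_{\mathrm{HKR}}(A,A)\hookrightarrow C_{\mathrm{Diff}}(A,A)$$ is a quasi-isomorphism of complexes. -/

import Mathlib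

open scoped DirectSum Manifold ContDiff

universe u v w

/-! ## Graded algebra -/

section GradedAlg

variable {k : Type} [Field k] {A : Type u} [Ring A] [Algebra k A]

/-- Graded commutativity of a `ℤ`-graded algebra: `a b = (-1)^{|a||b|} b a`. -/
class GradedCommutative (𝒜 : ℤ → Submodule k A) : Prop where
  comm : ∀ {i j : ℤ} {a b : A}, a ∈ 𝒜 i → b ∈ 𝒜 j → a * b = (i * j).negOnePow • (b * a)

/-- Linear endomorphisms of degree `d`. -/
def homEnd (𝒜 : ℤ → Submodule k A) (d : ℤ) : Submodule k (Module.End k A) where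
  carrier := {φ | ∀ (i : ℤ) (a : A), a ∈ 𝒜 i → φ a ∈ 𝒜 (i + d)}
  add_mem' h h' i a ha := add_mem (h i a ha) (h' i a ha)
  zero_mem' _ _ _ := zero_mem _
  smul_mem' c _ h i a ha := Submodule.smul_mem _ c (h i a ha)

/-- Graded derivations of degree `d`. -/
def gradedDer (𝒜 : ℤ → Submodule k A) (d : ℤ) : Submodule k (Module.End k A) where
  carrier := {φ | φ ∈ homEnd 𝒜 d ∧ ∀ (i : ℤ) (a b : A), a ∈ 𝒜 i →
    φ (a * b) = φ a * b + (d * i).negOnePow • (a * φ b)}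
  add_mem' := by
    rintro φ ψ ⟨h, h'⟩ ⟨g, g'⟩
    refine ⟨add_mem h g, fun i a b ha => ?_⟩
    simp only [LinearMap.add_apply, h' i a b ha, g' i a b ha, mul_add, add_mul, smul_add]
    abel
  zero_mem' := ⟨zero_mem _, fun i a b _ => by simp⟩
  smul_mem' := by
    rintro c φ ⟨h, h'⟩
    refine ⟨Submodule.smul_mem _ c h, fun i a b ha => ?_⟩
    simp only [LinearMap.smul_apply, h' i a b ha, smul_add, smul_mul_assoc, mul_smul_comm]
    rw [smul_comm c]

/-- Differential operators of degree `d`: the operators generated, under sums and compositions, by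
multiplications by homogeneous elements and homogeneous derivations. -/
inductive IsDiffOp (𝒜 : ℤ → Submodule k A) : ℤ → Module.End k A → Prop
  | mul {d : ℤ} {a : A} (ha : a ∈ 𝒜 d) : IsDiffOp 𝒜 d (LinearMap.mulLeft k a)
  | der {d : ℤ} {φ : Module.End k A} (hφ : φ ∈ gradedDer 𝒜 d) : IsDiffOp 𝒜 d φ
  | comp {d e : ℤ} {D D' : Module.End k A} (h : IsDiffOp 𝒜 d D) (h' : IsDiffOp 𝒜 e D') :
      IsDiffOp 𝒜 (d + e) (D ∘ₗ D')
  | add {d : ℤ} {D D' : Module.End k A} (h : IsDiffOp 𝒜 d D) (h' : IsDiffOp 𝒜 d D') :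
      IsDiffOp 𝒜 d (D + D')

variable (𝒜 : ℤ → Submodule k A) [GradedAlgebra 𝒜]

/-- The operator `a ↦ (-1)^{d |a|} a`, the Koszul sign for moving an object of degree `d` past
`a`. -/
noncomputable def koszulTwist (d : ℤ) : Module.End k A :=
  DirectSum.toModule k ℤ A (fun i => (d * i).negOnePow • (𝒜 i).subtype) ∘ₗ
    (DirectSum.decomposeLinearEquiv 𝒜).toLinearMap

variable {𝒜} in
theorem koszulTwist_of_mem {d i : ℤ} {a : A} (ha : a ∈ 𝒜 i) :
    koszulTwist 𝒜 d a = (d * i).negOnePow • a := by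
  lift a to 𝒜 i using ha
  simp [koszulTwist]

variable {𝒜} in
theorem ext_homogeneous {M : Type*} [AddCommGroup M] [Module k M] {f g : A →ₗ[k] M}
    (h : ∀ i, ∀ a ∈ 𝒜 i, f a = g a) : f = g := by
  ext a
  induction a using DirectSum.Decomposition.inductionOn 𝒜 with
  | zero => simp
  | homogeneous m => exact h _ _ m.2
  | add m m' h h' => simp [h, h']

variable {𝒜} in
theorem koszulTwist_mem {d i : ℤ} {a : A} (ha : a ∈ 𝒜 i) : koszulTwist 𝒜 d a ∈ 𝒜 i := by
  rw [koszulTwist_of_mem ha, Units.smul_def]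
  exact zsmul_mem ha _

theorem koszulTwist_zero (a : A) : koszulTwist 𝒜 0 a = a := by
  have : koszulTwist 𝒜 0 = LinearMap.id :=
    ext_homogeneous (𝒜 := 𝒜) fun i a ha => by simp [koszulTwist_of_mem ha]
  simp [this]

theorem koszulTwist_add (d e : ℤ) (a : A) :
    koszulTwist 𝒜 (d + e) a = koszulTwist 𝒜 d (koszulTwist 𝒜 e a) := by
  have : koszulTwist 𝒜 (d + e) = koszulTwist 𝒜 d ∘ₗ koszulTwist 𝒜 e :=
    ext_homogeneous (𝒜 := 𝒜) fun i a ha => by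
      rw [LinearMap.comp_apply, koszulTwist_of_mem (koszulTwist_mem ha),
        koszulTwist_of_mem ha, koszulTwist_of_mem ha, smul_smul, ← Int.negOnePow_add, add_mul]
  rw [this]; rfl

theorem koszulTwist_mul (d : ℤ) (a b : A) :
    koszulTwist 𝒜 d (a * b) = koszulTwist 𝒜 d a * koszulTwist 𝒜 d b := by
  have : (LinearMap.mul k A).compr₂ (koszulTwist 𝒜 d) =
      (LinearMap.mul k A).compl₁₂ (koszulTwist 𝒜 d) (koszulTwist 𝒜 d) :=
    ext_homogeneous (𝒜 := 𝒜) fun i a ha => ext_homogeneous (𝒜 := 𝒜) fun j b hb => by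
      simp only [LinearMap.compr₂_apply, LinearMap.mul_apply', LinearMap.compl₁₂_apply]
      rw [koszulTwist_of_mem ha, koszulTwist_of_mem hb,
        koszulTwist_of_mem (SetLike.mul_mem_graded ha hb), mul_add, Int.negOnePow_add, mul_smul,
        smul_mul_smul_comm, smul_smul]
  exact LinearMap.congr_fun₂ this a b

theorem koszulTwist_mul_comm [GradedCommutative 𝒜] {d : ℤ} {c : A} (hc : c ∈ 𝒜 d) (a : A) :
    koszulTwist 𝒜 d a * c = c * a := by
  have : LinearMap.mulRight k c ∘ₗ koszulTwist 𝒜 d = LinearMap.mulLeft k c :=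
    ext_homogeneous (𝒜 := 𝒜) fun i a ha => by
      simp only [LinearMap.comp_apply, LinearMap.mulRight_apply, LinearMap.mulLeft_apply]
      rw [koszulTwist_of_mem ha, smul_mul_assoc, GradedCommutative.comm hc ha]
  exact LinearMap.congr_fun this a

variable {𝒜} in
theorem homEnd_koszulTwist {d e : ℤ} {φ : Module.End k A} (hφ : φ ∈ homEnd 𝒜 d) (a : A) :
    φ (koszulTwist 𝒜 e a) = (d * e).negOnePow • koszulTwist 𝒜 e (φ a) := by
  have : φ ∘ₗ koszulTwist 𝒜 e = (d * e).negOnePow • (koszulTwist 𝒜 e ∘ₗ φ) :=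
    ext_homogeneous (𝒜 := 𝒜) fun i a ha => by
      simp only [LinearMap.comp_apply, LinearMap.smul_apply]
      rw [koszulTwist_of_mem ha, koszulTwist_of_mem (hφ i a ha), smul_smul, Units.smul_def,
        map_zsmul, ← Units.smul_def, ← Int.negOnePow_add]
      congr 1
      rw [mul_add, mul_comm e d, ← add_assoc, add_right_comm, Int.negOnePow_add,
        Int.negOnePow_even _ (Even.add_self (d * e)), one_mul]
  exact LinearMap.congr_fun this a

variable {𝒜} in
theorem gradedDer_leibniz {d : ℤ} {φ : Module.End k A} (hφ : φ ∈ gradedDer 𝒜 d) (a b : A) :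
    φ (a * b) = φ a * b + koszulTwist 𝒜 d a * φ b := by
  have : (LinearMap.mul k A).compr₂ φ = (LinearMap.mul k A).compl₁₂ φ LinearMap.id +
      (LinearMap.mul k A).compl₁₂ (koszulTwist 𝒜 d) φ :=
    ext_homogeneous (𝒜 := 𝒜) fun i a ha => by
      ext b
      simp only [LinearMap.compr₂_apply, LinearMap.mul_apply', LinearMap.compl₁₂_apply,
        LinearMap.add_apply, LinearMap.id_apply]
      rw [koszulTwist_of_mem ha, smul_mul_assoc, hφ.2 i a b ha]
  exact LinearMap.congr_fun₂ this a b

variable {𝒜} in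
theorem IsDiffOp.mem_homEnd {d : ℤ} {D : Module.End k A} (h : IsDiffOp 𝒜 d D) :
    D ∈ homEnd 𝒜 d := by
  induction h with
  | mul ha => intro i b hb; rw [add_comm]; exact SetLike.mul_mem_graded ha hb
  | der hφ => exact hφ.1
  | @comp d e _ _ _ _ h h' =>
    intro i a ha
    have := h _ _ (h' i a ha)
    rwa [add_assoc, add_comm e d] at this
  | add _ _ h h' => exact add_mem h h'

theorem IsDiffOp.id : IsDiffOp 𝒜 0 (LinearMap.id : Module.End k A) := by
  have := IsDiffOp.mul (𝒜 := 𝒜) (SetLike.GradedOne.one_mem (A := 𝒜))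
  rwa [show LinearMap.mulLeft k (1 : A) = LinearMap.id by ext; simp] at this

/-! ## Cochains -/

/-- Cochains of arity `m`, i.e. linear maps `A^{⊗ m} → A`. -/
abbrev Cochain (k : Type) (A : Type u) [Field k] [Ring A] [Algebra k A] (m : ℕ) : Type u :=
  MultilinearMap k (fun _ : Fin m => A) A

/-- `(a₀, …, a_m) ↦ f a₀ * φ (a₁, …, a_m)`. -/
def consMul {m : ℕ} (f : Module.End k A) (φ : Cochain k A m) : Cochain k A (m + 1) :=
  LinearMap.uncurryLeft (M := fun _ : Fin (m + 1) => A)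
    { toFun := fun a => f a • φ
      map_add' := fun a b => by simp [add_smul]
      map_smul' := fun c a => by ext; simp }

@[simp] theorem consMul_apply {m : ℕ} (f : Module.End k A) (φ : Cochain k A m)
    (a : Fin (m + 1) → A) : consMul f φ a = f (a 0) * φ (Fin.tail a) := rfl

/-- The cup product `D ∪ φ = μ ∘ (D ⊗ φ)` of an operator `D` and a cochain `φ` of degree `e`,
`(a₀, …, a_m) ↦ (-1)^{e |a₀|} D a₀ * φ (a₁, …, a_m)`. -/
noncomputable def cupLeft {m : ℕ} (D : Module.End k A) (e : ℤ) (φ : Cochain k A m) :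
    Cochain k A (m + 1) :=
  consMul (D ∘ₗ koszulTwist 𝒜 e) φ

/-- For operators `D i` of degree `d i`, the cochain `μ ∘ (D₀ ⊗ ⋯ ⊗ D_{m-1})`, that is,
`(a₀, …, a_{m-1}) ↦ ± D₀ a₀ * ⋯ * D_{m-1} a_{m-1}` with the Koszul sign
`(-1)^{∑_{i<j} |a_i| d_j}`. -/
noncomputable def mulTensor : {m : ℕ} → (Fin m → ℤ) → (Fin m → Module.End k A) → Cochain k A m
  | 0, _, _ => MultilinearMap.constOfIsEmpty k _ 1
  | _ + 1, d, D => cupLeft 𝒜 (D 0) (∑ i, Fin.tail d i) (mulTensor (Fin.tail d) (Fin.tail D))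

/-- Multidifferential operators of arity `m` and degree `d`: sums of terms
`c · μ ∘ (D₀ ⊗ ⋯ ⊗ D_{m-1})` with `c ∈ A` and `D i` differential operators. -/
noncomputable def diffCochain (d : ℤ) (m : ℕ) : Submodule k (Cochain k A m) :=
  Submodule.span k {φ | ∃ (d₀ : ℤ) (c : A) (e : Fin m → ℤ) (D : Fin m → Module.End k A),
    c ∈ 𝒜 d₀ ∧ (∀ i, IsDiffOp 𝒜 (e i) (D i)) ∧ d₀ + ∑ i, e i = d ∧ φ = c • mulTensor 𝒜 e D}

/-- Alternating multiderivations of arity `m` and degree `d` (homogeneous HKR cocycles). -/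
def hkrCochain (𝒜 : ℤ → Submodule k A) (d : ℤ) (m : ℕ) : Submodule k (Cochain k A m) where
  carrier := {φ |
    (∀ (i : Fin m → ℤ) (a : Fin m → A), (∀ j, a j ∈ 𝒜 (i j)) → φ a ∈ 𝒜 (d + ∑ j, i j)) ∧
    (∀ (l : Fin m), (l : ℕ) + 1 = m → ∀ (i : Fin m → ℤ) (a : Fin m → A), (∀ j, a j ∈ 𝒜 (i j)) →
      ∀ b : A, φ (Function.update a l (a l * b)) = φ a * b +
        ((d + ∑ j ∈ Finset.univ.erase l, i j) * i l).negOnePow •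
          (a l * φ (Function.update a l b))) ∧
    (∀ (l l' : Fin m), (l : ℕ) + 1 = l' → ∀ (i : Fin m → ℤ) (a : Fin m → A),
      (∀ j, a j ∈ 𝒜 (i j)) →
        φ a = -((i l * i l').negOnePow • φ (a ∘ Equiv.swap l l')))}
  add_mem' := by
    rintro φ ψ ⟨h1, h2, h3⟩ ⟨g1, g2, g3⟩
    refine ⟨fun i a ha => add_mem (h1 i a ha) (g1 i a ha), fun l hl i a ha b => ?_,
      fun l l' hl i a ha => ?_⟩
    · simp only [_root_.add_apply, h2 l hl i a ha b, g2 l hl i a ha b, add_mul, mul_add,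
        smul_add]
      abel
    · simp only [_root_.add_apply, smul_add, neg_add]
      rw [h3 l l' hl i a ha, g3 l l' hl i a ha]
  zero_mem' := by simp
  smul_mem' := by
    rintro c φ ⟨h1, h2, h3⟩
    refine ⟨fun i a ha => Submodule.smul_mem _ c (h1 i a ha), fun l hl i a ha b => ?_,
      fun l l' hl i a ha => ?_⟩
    · simp only [_root_.smul_apply, h2 l hl i a ha b, smul_add, smul_mul_assoc,
        mul_smul_comm]
      rw [smul_comm c]
    · simp only [_root_.smul_apply]
      rw [h3 l l' hl i a ha, smul_neg, smul_comm c]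

/-! ## The Hochschild differential -/

/-- `(a₀, a₁, a₂, …) ↦ φ (a₀ * a₁, a₂, …)`. -/
def mergeFirst (m : ℕ) : Cochain k A (m + 1) →ₗ[k] Cochain k A (m + 2) where
  toFun φ := LinearMap.uncurryLeft (M := fun _ : Fin (m + 2) => A)
    ((multilinearCurryLeftEquiv k (fun _ : Fin (m + 1) => A) A).symm.toLinearMap ∘ₗ
      (LinearMap.llcomp k A A _ φ.curryLeft) ∘ₗ LinearMap.mul k A)
  map_add' _ _ := rfl
  map_smul' _ _ := rfl

/-- The alternating sum of the terms of the Hochschild differential other than the first one,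
by recursion on the arity. -/
def hochschildTail : (m : ℕ) → Cochain k A m →ₗ[k] Cochain k A (m + 1)
  | 0 =>
    { toFun := fun φ => -consMul (LinearMap.mulLeft k (φ Fin.elim0))
        (MultilinearMap.constOfIsEmpty k _ 1)
      map_add' := fun φ ψ => by
        ext a
        change -((φ Fin.elim0 + ψ Fin.elim0) * a 0 * 1) =
          -(φ Fin.elim0 * a 0 * 1) + -(ψ Fin.elim0 * a 0 * 1)
        rw [add_mul, add_mul, neg_add]
      map_smul' := fun c φ => by
        ext a
        change -((c • φ Fin.elim0) * a 0 * 1) = c • -(φ Fin.elim0 * a 0 * 1)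
        rw [smul_mul_assoc, smul_mul_assoc, smul_neg] }
  | m + 1 => -mergeFirst m -
      (multilinearCurryLeftEquiv k (fun _ : Fin (m + 2) => A) A).symm.toLinearMap ∘ₗ
        LinearMap.llcomp k A _ _ (hochschildTail m) ∘ₗ
          (multilinearCurryLeftEquiv k (fun _ : Fin (m + 1) => A) A).toLinearMap

@[simp] theorem mergeFirst_apply {m : ℕ} (φ : Cochain k A (m + 1)) (a : Fin (m + 2) → A) :
    mergeFirst m φ a = φ (Fin.cons (a 0 * a 1) (Fin.tail (Fin.tail a))) := rfl

theorem hochschildTail_zero_apply (φ : Cochain k A 0) (a : Fin 1 → A) :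
    hochschildTail 0 φ a = -(φ Fin.elim0 * a 0) := by
  change -(φ Fin.elim0 * a 0 * 1) = _
  rw [mul_one]

theorem hochschildTail_succ_apply {m : ℕ} (φ : Cochain k A (m + 1)) (a : Fin (m + 2) → A) :
    hochschildTail (m + 1) φ a = -φ (Fin.cons (a 0 * a 1) (Fin.tail (Fin.tail a))) -
      hochschildTail m (φ.curryLeft (a 0)) (Fin.tail a) := rfl

theorem hochschildTail_apply {m : ℕ} (φ : Cochain k A m) (a : Fin (m + 1) → A) :
    hochschildTail m φ a =
      ∑ j : Fin m, (-1 : A) ^ ((j : ℕ) + 1) * φ (j.castSucc.contractNth (· * ·) a) +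
        (-1 : A) ^ (m + 1) * (φ (Fin.init a) * a (Fin.last m)) := by
  induction m with
  | zero =>
    rw [hochschildTail_zero_apply]
    simp only [Finset.univ_eq_empty, Finset.sum_empty, zero_add, pow_one, neg_mul, one_mul]
    congr 3
    exact Subsingleton.elim _ _
  | succ m ih =>
    rw [hochschildTail_succ_apply, ih, Fin.sum_univ_succ]
    have h0 : (Fin.castSucc (0 : Fin (m + 1))).contractNth (· * ·) a =
        Fin.cons (a 0 * a 1) (Fin.tail (Fin.tail a)) := by
      ext j
      refine Fin.cases ?_ (fun j => ?_) j
      · simp [Fin.contractNth]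
      · simp [Fin.contractNth, Fin.tail]
    have h1 : ∀ j : Fin m, (Fin.cons (a 0) (j.castSucc.contractNth (· * ·) (Fin.tail a)) :
        Fin (m + 1) → A) = j.succ.castSucc.contractNth (· * ·) a := by
      intro j
      ext l
      refine Fin.cases ?_ (fun l => ?_) l
      · simp [Fin.contractNth]
      · simp [Fin.contractNth, Fin.tail]
    have h2 : (Fin.cons (a 0) (Fin.init (Fin.tail a)) : Fin (m + 1) → A) = Fin.init a := by
      ext l
      refine Fin.cases ?_ (fun l => ?_) l
      · simp [Fin.init]
      · simp [Fin.init, Fin.tail]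
    simp only [MultilinearMap.curryLeft_apply, h0, h1, h2]
    simp [pow_succ, Fin.tail, Finset.sum_neg_distrib]
    abel

/-- The Hochschild differential of a cochain `φ` of degree `d`. -/
noncomputable def hochschildB (d : ℤ) {m : ℕ} (φ : Cochain k A m) : Cochain k A (m + 1) where
  toFun a := koszulTwist 𝒜 d (a 0) * φ (Fin.tail a) +
    (∑ j : Fin m, (-1 : A) ^ ((j : ℕ) + 1) * φ (j.castSucc.contractNth (· * ·) a) +
      (-1 : A) ^ (m + 1) * (φ (Fin.init a) * a (Fin.last m)))
  map_update_add' a i x y := by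
    have := (consMul (koszulTwist 𝒜 d) φ + hochschildTail m φ).map_update_add a i x y
    simpa only [_root_.add_apply, consMul_apply, hochschildTail_apply] using this
  map_update_smul' a i c x := by
    have := (consMul (koszulTwist 𝒜 d) φ + hochschildTail m φ).map_update_smul a i c x
    simpa only [_root_.add_apply, consMul_apply, hochschildTail_apply] using this

theorem hochschildB_eq (d : ℤ) {m : ℕ} (φ : Cochain k A m) :
    hochschildB 𝒜 d φ = consMul (koszulTwist 𝒜 d) φ + hochschildTail m φ := by
  ext a
  rw [_root_.add_apply, hochschildTail_apply]
  rfl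

theorem cochain_ext {m : ℕ} {φ ψ : Cochain k A (m + 1)}
    (h : ∀ a, φ.curryLeft a = ψ.curryLeft a) : φ = ψ := by
  ext a
  have := congrArg (fun χ => χ (Fin.tail a)) (h (a 0))
  simpa using this

theorem curryLeft_consMul {m : ℕ} (f : Module.End k A) (φ : Cochain k A m) (a : A) :
    (consMul f φ).curryLeft a = f a • φ := rfl

theorem curryLeft_mergeFirst {m : ℕ} (φ : Cochain k A (m + 1)) (a b : A) :
    ((mergeFirst m φ).curryLeft a).curryLeft b = φ.curryLeft (a * b) := rfl

theorem curryLeft_hochschildTail {m : ℕ} (φ : Cochain k A (m + 1)) (a : A) :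
    (hochschildTail (m + 1) φ).curryLeft a =
      -(mergeFirst m φ).curryLeft a - hochschildTail m (φ.curryLeft a) := rfl

theorem hochschildTail_smul {m : ℕ} (c : A) (φ : Cochain k A m) :
    hochschildTail m (c • φ) = c • hochschildTail m φ := by
  induction m with
  | zero =>
    ext a
    simp [hochschildTail_zero_apply, mul_assoc]
  | succ m ih =>
    refine cochain_ext fun a => ?_
    have h : (c • hochschildTail (m + 1) φ).curryLeft a =
        c • (hochschildTail (m + 1) φ).curryLeft a := rfl
    rw [h, curryLeft_hochschildTail, curryLeft_hochschildTail, smul_sub, smul_neg, ← ih]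
    rfl

theorem hochschildTail_hochschildTail {m : ℕ} (φ : Cochain k A m) :
    hochschildTail (m + 1) (hochschildTail m φ) = 0 := by
  induction m with
  | zero =>
    ext a
    rw [hochschildTail_succ_apply, hochschildTail_zero_apply, hochschildTail_zero_apply]
    simp [hochschildTail_zero_apply, Fin.tail, mul_assoc]
  | succ m ih =>
    refine cochain_ext fun a => ?_
    rw [curryLeft_hochschildTail, curryLeft_hochschildTail, map_sub, ih, map_neg, sub_zero]
    rw [sub_neg_eq_add]
    refine (neg_add_eq_zero (a := (mergeFirst (m + 1) (hochschildTail (m + 1) φ)).curryLeft a)).2 ?_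
    refine cochain_ext fun b => ?_
    rw [curryLeft_mergeFirst, curryLeft_hochschildTail, curryLeft_hochschildTail,
      curryLeft_mergeFirst]
    congr 2
    refine cochain_ext fun c => ?_
    rw [curryLeft_mergeFirst, curryLeft_mergeFirst, curryLeft_mergeFirst, mul_assoc]

theorem hochschildB_hochschildB (d : ℤ) {m : ℕ} (φ : Cochain k A m) :
    hochschildB 𝒜 d (hochschildB 𝒜 d φ) = 0 := by
  simp only [hochschildB_eq, map_add, hochschildTail_hochschildTail, add_zero]
  refine cochain_ext fun a => ?_
  change (consMul (koszulTwist 𝒜 d) (consMul (koszulTwist 𝒜 d) φ +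
    hochschildTail m φ)).curryLeft a +
      (hochschildTail (m + 1) (consMul (koszulTwist 𝒜 d) φ)).curryLeft a = 0
  rw [curryLeft_consMul, curryLeft_hochschildTail, curryLeft_consMul, hochschildTail_smul,
    smul_add]
  have : (mergeFirst m (consMul (koszulTwist 𝒜 d) φ)).curryLeft a =
      koszulTwist 𝒜 d a • consMul (koszulTwist 𝒜 d) φ := by
    refine cochain_ext fun b => ?_
    rw [curryLeft_mergeFirst, curryLeft_consMul, koszulTwist_mul, mul_smul]
    rfl
  rw [this]
  abel

/-- The Hochschild differential on cochains of degree `d`, as a linear map. -/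
noncomputable def hochschildBₗ (d : ℤ) (m : ℕ) : Cochain k A m →ₗ[k] Cochain k A (m + 1) where
  toFun := hochschildB 𝒜 d
  map_add' φ ψ := by
    simp only [hochschildB_eq, map_add]
    have : consMul (koszulTwist 𝒜 d) (φ + ψ) =
        consMul (koszulTwist 𝒜 d) φ + consMul (koszulTwist 𝒜 d) ψ := by
      ext; simp [mul_add]
    rw [this]; abel
  map_smul' c φ := by
    simp only [hochschildB_eq, map_smul]
    have : consMul (koszulTwist 𝒜 d) (c • φ) = c • consMul (koszulTwist 𝒜 d) φ := by
      ext; simp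
    rw [this]; simp

/-! ## Multidifferential operators form a subcomplex -/

variable {𝒜}

theorem mulTensor_mem {m : ℕ} {e : Fin m → ℤ} {D : Fin m → Module.End k A}
    (h : ∀ i, IsDiffOp 𝒜 (e i) (D i)) : mulTensor 𝒜 e D ∈ diffCochain 𝒜 (∑ i, e i) m :=
  Submodule.subset_span ⟨0, 1, e, D, SetLike.GradedOne.one_mem, h, zero_add _, (one_smul _ _).symm⟩

theorem smul_mem_diffCochain {m : ℕ} {d d₀ : ℤ} {c : A} (hc : c ∈ 𝒜 d₀) {φ : Cochain k A m}
    (hφ : φ ∈ diffCochain 𝒜 d m) : c • φ ∈ diffCochain 𝒜 (d₀ + d) m := by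
  induction hφ using Submodule.span_induction with
  | mem x hx =>
    obtain ⟨d₁, c₁, e, D, hc₁, hD, rfl, rfl⟩ := hx
    exact Submodule.subset_span ⟨d₀ + d₁, c * c₁, e, D, SetLike.mul_mem_graded hc hc₁, hD,
      add_assoc _ _ _, (mul_smul _ _ _).symm⟩
  | zero => rw [smul_zero]; exact zero_mem _
  | add x y _ _ hx hy => rw [smul_add]; exact add_mem hx hy
  | smul r x _ hx =>
    have : c • r • x = r • c • x := by ext; simp
    rw [this]; exact Submodule.smul_mem _ r hx

/-- The degree `d` part of the span of the bilinear maps `D ∪ D'`. -/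
noncomputable def bidiff (𝒜 : ℤ → Submodule k A) [GradedAlgebra 𝒜] (d : ℤ) :
    Submodule k (A →ₗ[k] A →ₗ[k] A) :=
  Submodule.span k {B | ∃ (e e' : ℤ) (D D' : Module.End k A), IsDiffOp 𝒜 e D ∧ IsDiffOp 𝒜 e' D' ∧
    e + e' = d ∧ B = (LinearMap.mul k A).compl₁₂ (D ∘ₗ koszulTwist 𝒜 e') D'}

theorem IsDiffOp.compr₂_mem {d e : ℤ} {D : Module.End k A} (h : IsDiffOp 𝒜 d D)
    {B : A →ₗ[k] A →ₗ[k] A} (hB : B ∈ bidiff 𝒜 e) : B.compr₂ D ∈ bidiff 𝒜 (d + e) := by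
  induction h generalizing e B with
  | @mul d c hc =>
    induction hB using Submodule.span_induction with
    | mem x hx =>
      obtain ⟨e, e', D, D', hD, hD', rfl, rfl⟩ := hx
      refine Submodule.subset_span ⟨d + e, e', LinearMap.mulLeft k c ∘ₗ D, D', .comp (.mul hc) hD,
        hD', add_assoc _ _ _, ?_⟩
      ext a b
      simp [mul_assoc]
    | zero =>
      have : (0 : A →ₗ[k] A →ₗ[k] A).compr₂ (LinearMap.mulLeft k c) = 0 := by ext; simp
      rw [this]; exact zero_mem _
    | add x y _ _ hx hy =>
      convert add_mem hx hy using 1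
      ext; simp [mul_add]
    | smul r x _ hx =>
      convert Submodule.smul_mem _ r hx using 1
      ext; simp
  | @der d φ hφ =>
    induction hB using Submodule.span_induction with
    | mem x hx =>
      obtain ⟨e, e', D, D', hD, hD', rfl, rfl⟩ := hx
      have h1 : (LinearMap.mul k A).compl₁₂ ((φ ∘ₗ D) ∘ₗ koszulTwist 𝒜 e') D' ∈
          bidiff 𝒜 (d + (e + e')) :=
        Submodule.subset_span ⟨d + e, e', φ ∘ₗ D, D', .comp (.der hφ) hD, hD', by ring, rfl⟩
      have h2 : (LinearMap.mul k A).compl₁₂ (D ∘ₗ koszulTwist 𝒜 (d + e')) (φ ∘ₗ D') ∈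
          bidiff 𝒜 (d + (e + e')) :=
        Submodule.subset_span ⟨e, d + e', D, φ ∘ₗ D', hD, .comp (.der hφ) hD', by ring, rfl⟩
      have h3 := Submodule.smul_mem _ (((e * d).negOnePow : ℤ) : k) h2
      convert add_mem h1 h3 using 1
      ext a b
      simp only [LinearMap.compr₂_apply, LinearMap.compl₁₂_apply, LinearMap.mul_apply',
        LinearMap.add_apply, LinearMap.smul_apply, LinearMap.comp_apply, koszulTwist_add,
        homEnd_koszulTwist hD.mem_homEnd (e := d), gradedDer_leibniz hφ, Int.cast_smul_eq_zsmul, ← Units.smul_def]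
      rw [smul_mul_assoc, smul_smul, Int.units_mul_self, one_smul]
    | zero =>
      have : (0 : A →ₗ[k] A →ₗ[k] A).compr₂ φ = 0 := by ext; simp
      rw [this]; exact zero_mem _
    | add x y _ _ hx hy =>
      convert add_mem hx hy using 1
      ext; simp
    | smul r x _ hx =>
      convert Submodule.smul_mem _ r hx using 1
      ext; simp
  | comp _ _ h h' =>
    rw [add_assoc]
    exact h (h' hB)
  | add _ _ h h' =>
    convert add_mem (h hB) (h' hB) using 1
    ext; simp

theorem IsDiffOp.mul_compr₂_mem {d : ℤ} {D : Module.End k A} (h : IsDiffOp 𝒜 d D) :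
    (LinearMap.mul k A).compr₂ D ∈ bidiff 𝒜 d := by
  have : LinearMap.mul k A ∈ bidiff 𝒜 0 := by
    refine Submodule.subset_span ⟨0, 0, _, _, IsDiffOp.id 𝒜, IsDiffOp.id 𝒜, add_zero _, ?_⟩
    ext a b
    simp [koszulTwist_zero]
  simpa using h.compr₂_mem this

/-! ## Products of derivations are cocycles -/

theorem hochschildTail_mulTensor_der {m : ℕ} {e : Fin m → ℤ} {D : Fin m → Module.End k A}
    (h : ∀ i, D i ∈ gradedDer 𝒜 (e i)) :
    hochschildTail m (mulTensor 𝒜 e D) =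
      -consMul (koszulTwist 𝒜 (∑ i, e i)) (mulTensor 𝒜 e D) := by
  induction m with
  | zero =>
    ext a
    rw [hochschildTail_zero_apply]
    simp [mulTensor, koszulTwist_zero]
  | succ m ih =>
    refine cochain_ext fun a => ?_
    rw [curryLeft_hochschildTail]
    have h1 : (mulTensor 𝒜 e D).curryLeft a = D 0 (koszulTwist 𝒜 (∑ i, Fin.tail e i) a) •
        mulTensor 𝒜 (Fin.tail e) (Fin.tail D) := rfl
    rw [h1, hochschildTail_smul, ih (e := Fin.tail e) (D := Fin.tail D) fun i => h i.succ]
    refine cochain_ext fun b => ?_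
    have h2 : (mulTensor 𝒜 e D).curryLeft (a * b) =
      D 0 (koszulTwist 𝒜 (∑ i, Fin.tail e i) (a * b)) •
        mulTensor 𝒜 (Fin.tail e) (Fin.tail D) := rfl
    have h3 : (mulTensor 𝒜 e D).curryLeft b =
      D 0 (koszulTwist 𝒜 (∑ i, Fin.tail e i) b) •
        mulTensor 𝒜 (Fin.tail e) (Fin.tail D) := rfl
    rw [koszulTwist_mul, gradedDer_leibniz (h 0), add_smul, mul_smul, mul_smul, ← h3,
      ← koszulTwist_add] at h2
    change -(mulTensor 𝒜 e D).curryLeft (a * b) - D 0 (koszulTwist 𝒜 (∑ i, Fin.tail e i) a) •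
      -(koszulTwist 𝒜 (∑ i, Fin.tail e i) b • mulTensor 𝒜 (Fin.tail e) (Fin.tail D)) =
      -(koszulTwist 𝒜 (∑ i, e i) a • (mulTensor 𝒜 e D).curryLeft b)
    rw [h2, Fin.sum_univ_succ e, smul_neg]
    simp only [Fin.tail]
    abel

section Comm

variable [GradedCommutative 𝒜]

theorem cupLeft_smul {m : ℕ} {d e d₀ : ℤ} {c : A} (hc : c ∈ 𝒜 d₀) {D : Module.End k A}
    (hD : D ∈ homEnd 𝒜 d) (φ : Cochain k A m) :
    cupLeft 𝒜 D (d₀ + e) (c • φ) = (d * d₀).negOnePow • c • cupLeft 𝒜 D e φ := by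
  ext a
  simp only [cupLeft, consMul_apply, LinearMap.comp_apply, koszulTwist_add, _root_.smul_apply,
    smul_eq_mul]
  rw [homEnd_koszulTwist hD, smul_mul_assoc, ← mul_assoc, koszulTwist_mul_comm 𝒜 hc, mul_assoc]

theorem cupLeft_mem {m : ℕ} {d e : ℤ} {D : Module.End k A} (hD : IsDiffOp 𝒜 d D)
    {φ : Cochain k A m} (hφ : φ ∈ diffCochain 𝒜 e m) :
    cupLeft 𝒜 D e φ ∈ diffCochain 𝒜 (d + e) (m + 1) := by
  induction hφ using Submodule.span_induction with
  | mem x hx =>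
    obtain ⟨d₀, c, f, D', hc, hD', rfl, rfl⟩ := hx
    rw [cupLeft_smul hc hD.mem_homEnd, Units.smul_def]
    refine zsmul_mem ?_ _
    have h : ∀ i, IsDiffOp 𝒜 ((Fin.cons d f : Fin (m + 1) → ℤ) i)
        ((Fin.cons D D' : Fin (m + 1) → Module.End k A) i) := by
      intro i
      refine Fin.cases ?_ (fun i => ?_) i
      · exact hD
      · exact hD' i
    have := smul_mem_diffCochain hc (mulTensor_mem h)
    rw [Fin.sum_univ_succ] at this
    simp only [Fin.cons_zero, Fin.cons_succ] at this
    rw [← add_assoc, add_comm d₀ d, add_assoc] at this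
    exact this
  | zero =>
    have : cupLeft 𝒜 D e (0 : Cochain k A m) = 0 := by ext; simp [cupLeft]
    rw [this]; exact zero_mem _
  | add x y _ _ hx hy =>
    convert add_mem hx hy using 1
    ext; simp [cupLeft, mul_add]
  | smul r x _ hx =>
    convert Submodule.smul_mem _ r hx using 1
    ext; simp [cupLeft]

theorem exists_of_mem_bidiff {m : ℕ} {d e : ℤ} {φ : Cochain k A m} (hφ : φ ∈ diffCochain 𝒜 e m)
    {B : A →ₗ[k] A →ₗ[k] A} (hB : B ∈ bidiff 𝒜 d) :
    ∃ ψ ∈ diffCochain 𝒜 (d + e) (m + 2), ∀ a : Fin (m + 2) → A,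
      ψ a = B (koszulTwist 𝒜 e (a 0)) (koszulTwist 𝒜 e (a 1)) * φ (Fin.tail (Fin.tail a)) := by
  induction hB using Submodule.span_induction with
  | mem x hx =>
    obtain ⟨f, f', D, D', hD, hD', rfl, rfl⟩ := hx
    refine ⟨cupLeft 𝒜 D (f' + e) (cupLeft 𝒜 D' e φ), ?_, fun a => ?_⟩
    · rw [add_assoc]
      exact cupLeft_mem hD (cupLeft_mem hD' hφ)
    · simp only [cupLeft, consMul_apply, LinearMap.comp_apply, koszulTwist_add,
        LinearMap.compl₁₂_apply, LinearMap.mul_apply', mul_assoc]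
      rfl
  | zero => exact ⟨0, zero_mem _, fun a => by simp⟩
  | add x y _ _ hx hy =>
    obtain ⟨ψ, hψ, h⟩ := hx
    obtain ⟨ψ', hψ', h'⟩ := hy
    exact ⟨ψ + ψ', add_mem hψ hψ', fun a => by simp [h, h', add_mul]⟩
  | smul r x _ hx =>
    obtain ⟨ψ, hψ, h⟩ := hx
    exact ⟨r • ψ, Submodule.smul_mem _ _ hψ, fun a => by simp [h]⟩

theorem hochschildTail_cupLeft_mem {m : ℕ} {d e : ℤ} {D : Module.End k A} (hD : IsDiffOp 𝒜 d D)
    {φ : Cochain k A m} (hφ : φ ∈ diffCochain 𝒜 e m)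
    (h : hochschildTail m φ ∈ diffCochain 𝒜 e (m + 1)) :
    hochschildTail (m + 1) (cupLeft 𝒜 D e φ) ∈ diffCochain 𝒜 (d + e) (m + 2) := by
  obtain ⟨ψ, hψ, hh⟩ := exists_of_mem_bidiff hφ hD.mul_compr₂_mem
  have : hochschildTail (m + 1) (cupLeft 𝒜 D e φ) =
      -ψ - cupLeft 𝒜 D e (hochschildTail m φ) := by
    ext a
    rw [hochschildTail_succ_apply]
    have h1 : (cupLeft 𝒜 D e φ).curryLeft (a 0) = D (koszulTwist 𝒜 e (a 0)) • φ := rfl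
    have h2 : cupLeft 𝒜 D e φ (Fin.cons (a 0 * a 1) (Fin.tail (Fin.tail a))) = ψ a := by
      rw [hh, cupLeft, consMul_apply, LinearMap.comp_apply, Fin.cons_zero, koszulTwist_mul]
      rfl
    rw [h1, h2, hochschildTail_smul]
    rfl
  rw [this]
  exact sub_mem (neg_mem hψ) (cupLeft_mem hD h)

theorem hochschildTail_mulTensor_mem {m : ℕ} {e : Fin m → ℤ} {D : Fin m → Module.End k A}
    (h : ∀ i, IsDiffOp 𝒜 (e i) (D i)) :
    hochschildTail m (mulTensor 𝒜 e D) ∈ diffCochain 𝒜 (∑ i, e i) (m + 1) := by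
  induction m with
  | zero =>
    have h1 := neg_mem (cupLeft_mem (IsDiffOp.id 𝒜) (mulTensor_mem h))
    rw [zero_add (∑ i, e i)] at h1
    convert h1 using 1
    ext a
    rw [hochschildTail_zero_apply]
    simp [mulTensor, cupLeft, koszulTwist_zero]
  | succ m ih =>
    rw [Fin.sum_univ_succ]
    exact hochschildTail_cupLeft_mem (h 0) (mulTensor_mem fun i => h i.succ)
      (ih fun i => h i.succ)

theorem hochschildB_mem {m : ℕ} {d : ℤ} {φ : Cochain k A m} (hφ : φ ∈ diffCochain 𝒜 d m) :
    hochschildB 𝒜 d φ ∈ diffCochain 𝒜 d (m + 1) := by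
  rw [hochschildB_eq]
  refine add_mem ?_ ?_
  · have := cupLeft_mem (IsDiffOp.id 𝒜) hφ
    rw [zero_add] at this
    exact this
  · induction hφ using Submodule.span_induction with
    | mem x hx =>
      obtain ⟨d₀, c, e, D, hc, hD, rfl, rfl⟩ := hx
      rw [hochschildTail_smul]
      exact smul_mem_diffCochain hc (hochschildTail_mulTensor_mem hD)
    | zero => simp
    | add x y _ _ hx hy => rw [map_add]; exact add_mem hx hy
    | smul r x _ hx => rw [map_smul]; exact Submodule.smul_mem _ r hx

theorem hochschildB_smul_mulTensor {m : ℕ} {d₀ : ℤ} {c : A} (hc : c ∈ 𝒜 d₀) {e : Fin m → ℤ}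
    {D : Fin m → Module.End k A} (h : ∀ i, D i ∈ gradedDer 𝒜 (e i)) :
    hochschildB 𝒜 (d₀ + ∑ i, e i) (c • mulTensor 𝒜 e D) = 0 := by
  rw [hochschildB_eq, hochschildTail_smul, hochschildTail_mulTensor_der h]
  ext a
  simp only [_root_.add_apply, consMul_apply, _root_.smul_apply, smul_eq_mul, smul_neg,
    _root_.neg_apply, _root_.zero_apply]
  rw [koszulTwist_add, ← mul_assoc, koszulTwist_mul_comm 𝒜 hc, mul_assoc,
    add_neg_cancel]

end Comm

/-! ## Koszul signs of permutations -/

section Koszul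

/-- The Koszul sign of the reordering `v₀ ⊗ ⋯ ⊗ v_{m-1} ↦ ± v_{σ 0} ⊗ ⋯ ⊗ v_{σ (m-1)}`, where `v i`
has degree `d i`. -/
def koszulSign {m : ℕ} (σ : Equiv.Perm (Fin m)) (d : Fin m → ℤ) : ℤˣ :=
  ∏ p : Fin m × Fin m with p.1 < p.2 ∧ σ p.2 < σ p.1, (d (σ p.1) * d (σ p.2)).negOnePow

theorem koszulSign_eq {m : ℕ} (σ : Equiv.Perm (Fin m)) (d : Fin m → ℤ) :
    koszulSign σ d = ∏ p : Fin m × Fin m with p.1 < p.2,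
      if σ p.2 < σ p.1 then (d (σ p.1) * d (σ p.2)).negOnePow else 1 := by
  rw [koszulSign, ← Finset.filter_filter, Finset.prod_filter]

theorem prod_pairs_comp {m : ℕ} (σ : Equiv.Perm (Fin m)) (h : Fin m → Fin m → ℤˣ)
    (hs : ∀ x y, h x y = h y x) :
    ∏ p : Fin m × Fin m with p.1 < p.2, h (σ p.1) (σ p.2) =
      ∏ p : Fin m × Fin m with p.1 < p.2, h p.1 p.2 := by
  refine Finset.prod_bij' (fun p _ => if σ p.1 < σ p.2 then (σ p.1, σ p.2) else (σ p.2, σ p.1))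
    (fun p _ => if σ.symm p.1 < σ.symm p.2 then (σ.symm p.1, σ.symm p.2)
      else (σ.symm p.2, σ.symm p.1)) ?_ ?_ ?_ ?_ ?_
  · rintro ⟨i, j⟩ hp
    simp only [Finset.mem_filter, Finset.mem_univ, true_and] at hp ⊢
    split_ifs with h1
    · exact h1
    · exact lt_of_le_of_ne (not_lt.1 h1) fun h2 => hp.ne' (σ.injective h2)
  · rintro ⟨i, j⟩ hp
    simp only [Finset.mem_filter, Finset.mem_univ, true_and] at hp ⊢
    split_ifs with h1
    · exact h1
    · exact lt_of_le_of_ne (not_lt.1 h1) fun h2 => hp.ne' (σ.symm.injective h2)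
  · rintro ⟨i, j⟩ hp
    simp only [Finset.mem_filter, Finset.mem_univ, true_and] at hp ⊢
    by_cases h1 : σ i < σ j
    · simp [h1, hp]
    · simp [h1, hp.le]
  · rintro ⟨i, j⟩ hp
    simp only [Finset.mem_filter, Finset.mem_univ, true_and] at hp ⊢
    by_cases h1 : σ.symm i < σ.symm j
    · simp [h1, hp]
    · simp [h1, hp.le]
  · rintro ⟨i, j⟩ hp
    dsimp only
    split_ifs
    · rfl
    · exact hs _ _

theorem koszulSign_mul {m : ℕ} (τ σ : Equiv.Perm (Fin m)) (d : Fin m → ℤ) :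
    koszulSign (τ * σ) d = koszulSign τ d * koszulSign σ (d ∘ τ) := by
  have h := prod_pairs_comp σ (fun x y => if (x < y ↔ τ y < τ x) then
    (d (τ x) * d (τ y)).negOnePow else 1) (fun x y => by
      rcases eq_or_ne x y with rfl | hxy
      · rfl
      have hxy' : τ x ≠ τ y := fun h => hxy (τ.injective h)
      have : (x < y ↔ τ y < τ x) ↔ (y < x ↔ τ x < τ y) := by
        rcases lt_or_gt_of_ne hxy with h1 | h1 <;> rcases lt_or_gt_of_ne hxy' with h2 | h2 <;>
          simp [h1, h2, h1.not_gt, h2.not_gt]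
      simp only [this, mul_comm (d (τ x))])
  have h' : koszulSign τ d = ∏ p : Fin m × Fin m with p.1 < p.2,
      if (p.1 < p.2 ↔ τ p.2 < τ p.1) then (d (τ p.1) * d (τ p.2)).negOnePow else 1 := by
    rw [koszulSign_eq]
    refine Finset.prod_congr rfl fun p hp => ?_
    have := (Finset.mem_filter.1 hp).2
    simp [this]
  rw [h', ← h, koszulSign_eq, koszulSign_eq, ← Finset.prod_mul_distrib]
  refine Finset.prod_congr rfl fun p hp => ?_
  have hne : σ p.1 ≠ σ p.2 := fun h => (Finset.mem_filter.1 hp).2.ne (σ.injective h)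
  have hne' : τ (σ p.1) ≠ τ (σ p.2) := fun h => hne (τ.injective h)
  simp only [Equiv.Perm.mul_apply, Function.comp_apply]
  rcases lt_or_gt_of_ne hne with h1 | h1 <;> rcases lt_or_gt_of_ne hne' with h2 | h2 <;>
    simp [h1, h2, h1.not_gt, h2.not_gt, Int.units_mul_self]

theorem koszulSign_update {m : ℕ} (σ : Equiv.Perm (Fin m)) (d : Fin m → ℤ) (i : Fin m) (b : ℤ) :
    koszulSign σ (Function.update d i (d i + b)) *
        (b * ∑ l with l < σ.symm i, d (σ l)).negOnePow =
      (b * ∑ j with j < i, d j).negOnePow * koszulSign σ d := by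
  have hsum : ∀ (s : Finset (Fin m)) (f : Fin m → ℤ),
      (b * ∑ l ∈ s, f l).negOnePow = ∏ l ∈ s, (b * f l).negOnePow := by
    intro s f
    induction s using Finset.induction_on with
    | empty => simp
    | insert a s ha ih => rw [Finset.sum_insert ha, Finset.prod_insert ha, mul_add,
        Int.negOnePow_add, ih]
  obtain ⟨p, rfl⟩ := σ.surjective i
  have h1 : koszulSign σ (Function.update d (σ p) (d (σ p) + b)) = koszulSign σ d *
      ((∏ q : Fin m × Fin m, if (q.1 < q.2 ∧ σ q.2 < σ q.1) then
        (if q.1 = p then (b * d (σ q.2)).negOnePow else 1) else 1) *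
      (∏ q : Fin m × Fin m, if (q.1 < q.2 ∧ σ q.2 < σ q.1) then
        (if q.2 = p then (b * d (σ q.1)).negOnePow else 1) else 1)) := by
    rw [koszulSign, koszulSign, Finset.prod_filter, Finset.prod_filter, ← Finset.prod_mul_distrib,
      ← Finset.prod_mul_distrib]
    refine Finset.prod_congr rfl fun q _ => ?_
    by_cases hq : q.1 < q.2 ∧ σ q.2 < σ q.1
    · simp only [hq, and_self, if_true]
      rcases eq_or_ne q.1 p with hp | hp
      · have hp2 : q.2 ≠ p := fun h => hq.1.ne (hp.trans h.symm)
        have hp3 : σ q.2 ≠ σ p := fun h => hp2 (σ.injective h)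
        rw [Function.update_of_ne hp3]
        simp only [hp, Function.update_self, hp2, if_true, if_false, mul_one]
        rw [add_mul, Int.negOnePow_add]
      · have hp3 : σ q.1 ≠ σ p := fun h => hp (σ.injective h)
        rw [Function.update_of_ne hp3]
        rcases eq_or_ne q.2 p with hp2 | hp2
        · simp only [hp, hp2, Function.update_self, if_true, if_false, one_mul]
          rw [mul_add, Int.negOnePow_add, mul_comm b]
        · have hp4 : σ q.2 ≠ σ p := fun h => hp2 (σ.injective h)
          rw [Function.update_of_ne hp4]
          simp [hp, hp2]
    · simp [hq]
  have h2 : (∏ q : Fin m × Fin m, if (q.1 < q.2 ∧ σ q.2 < σ q.1) then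
        (if q.1 = p then (b * d (σ q.2)).negOnePow else 1) else 1) =
      ∏ x, if p < x ∧ σ x < σ p then (b * d (σ x)).negOnePow else 1 := by
    rw [Fintype.prod_prod_type, Finset.prod_eq_single p]
    · simp
    · intro x _ hx; simp [hx]
    · simp
  have h3 : (∏ q : Fin m × Fin m, if (q.1 < q.2 ∧ σ q.2 < σ q.1) then
        (if q.2 = p then (b * d (σ q.1)).negOnePow else 1) else 1) =
      ∏ x, if x < p ∧ σ p < σ x then (b * d (σ x)).negOnePow else 1 := by
    rw [Fintype.prod_prod_type_right, Finset.prod_eq_single p]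
    · simp
    · intro x _ hx; simp [hx]
    · simp
  have h4 : ∏ j with j < σ p, (b * d j).negOnePow =
      ∏ x, if σ x < σ p then (b * d (σ x)).negOnePow else 1 := by
    rw [Finset.prod_filter]
    exact (Equiv.prod_comp σ fun j => if j < σ p then (b * d j).negOnePow else 1).symm
  rw [h1, h2, h3, hsum, hsum, h4, mul_assoc, mul_comm, Finset.prod_filter,
    ← Finset.prod_mul_distrib, ← Finset.prod_mul_distrib]
  congr 1
  refine Finset.prod_congr rfl fun x _ => ?_
  rw [Equiv.symm_apply_apply]
  rcases eq_or_ne x p with rfl | hx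
  · simp
  · have hx' : σ x ≠ σ p := fun h => hx (σ.injective h)
    rcases lt_or_gt_of_ne hx with h1 | h1 <;> rcases lt_or_gt_of_ne hx' with h2 | h2 <;>
      simp [h1, h2, h1.not_gt, h2.not_gt, Int.units_mul_self]

end Koszul

/-! ## The graded exterior power of the module of derivations -/

/-- Homogeneous generators `a · φ₀ ∧ ⋯ ∧ φ_{m-1}` of degree `e` of the `m`-th exterior power over
`A` of the graded module of derivations. -/
structure WedgeMonomial (𝒜 : ℤ → Submodule k A) (m : ℕ) (e : ℤ) where
  coeffDeg : ℤ
  coeff : A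
  coeff_mem : coeff ∈ 𝒜 coeffDeg
  deg : Fin m → ℤ
  der : Fin m → Module.End k A
  der_mem : ∀ i, der i ∈ gradedDer 𝒜 (deg i)
  total : coeffDeg + ∑ i, deg i = e

open Finsupp in
/-- The relations between the generators: additivity and homogeneity in the coefficient, additivity
in each derivation, `A`-linearity with Koszul signs
`φ₀ ∧ ⋯ ∧ b φᵢ ∧ ⋯ = (-1)^{|b| (|φ₀| + ⋯ + |φ_{i-1}|)} b · φ₀ ∧ ⋯ ∧ φᵢ ∧ ⋯`, and graded
antisymmetry `σ · (φ₀ ∧ ⋯ ∧ φ_{m-1}) = sign σ • (φ₀ ∧ ⋯ ∧ φ_{m-1})`. -/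
inductive WedgeRel (𝒜 : ℤ → Submodule k A) (m : ℕ) (e : ℤ) : (WedgeMonomial 𝒜 m e →₀ k) → Prop
  | add_coeff {d₀ : ℤ} {a a' : A} {d : Fin m → ℤ} {φ : Fin m → Module.End k A}
      (ha : a ∈ 𝒜 d₀) (ha' : a' ∈ 𝒜 d₀) (hφ : ∀ i, φ i ∈ gradedDer 𝒜 (d i))
      (h : d₀ + ∑ i, d i = e) :
      WedgeRel 𝒜 m e (single ⟨d₀, a + a', add_mem ha ha', d, φ, hφ, h⟩ 1 -
        single ⟨d₀, a, ha, d, φ, hφ, h⟩ 1 - single ⟨d₀, a', ha', d, φ, hφ, h⟩ 1)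
  | smul_coeff {d₀ : ℤ} {a : A} {d : Fin m → ℤ} {φ : Fin m → Module.End k A} (c : k)
      (ha : a ∈ 𝒜 d₀) (hφ : ∀ i, φ i ∈ gradedDer 𝒜 (d i)) (h : d₀ + ∑ i, d i = e) :
      WedgeRel 𝒜 m e (single ⟨d₀, c • a, Submodule.smul_mem _ c ha, d, φ, hφ, h⟩ 1 -
        c • single ⟨d₀, a, ha, d, φ, hφ, h⟩ 1)
  | add_der {d₀ : ℤ} {a : A} {d : Fin m → ℤ} {φ : Fin m → Module.End k A} (i : Fin m)
      {ψ ψ' : Module.End k A} (ha : a ∈ 𝒜 d₀)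
      (h₁ : ∀ j, Function.update φ i (ψ + ψ') j ∈ gradedDer 𝒜 (d j))
      (h₂ : ∀ j, Function.update φ i ψ j ∈ gradedDer 𝒜 (d j))
      (h₃ : ∀ j, Function.update φ i ψ' j ∈ gradedDer 𝒜 (d j))
      (h : d₀ + ∑ i, d i = e) :
      WedgeRel 𝒜 m e (single ⟨d₀, a, ha, d, Function.update φ i (ψ + ψ'), h₁, h⟩ 1 -
        single ⟨d₀, a, ha, d, Function.update φ i ψ, h₂, h⟩ 1 -
        single ⟨d₀, a, ha, d, Function.update φ i ψ', h₃, h⟩ 1)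
  | smul_der {d₀ d₁ : ℤ} {a b : A} {d : Fin m → ℤ} {φ : Fin m → Module.End k A} (i : Fin m)
      (ha : a ∈ 𝒜 d₀) (hb : b ∈ 𝒜 d₁) (hφ : ∀ i, φ i ∈ gradedDer 𝒜 (d i))
      (h₁ : ∀ j, Function.update φ i (b • φ i) j ∈
        gradedDer 𝒜 (Function.update d i (d i + d₁) j))
      (h₂ : d₀ + ∑ j, Function.update d i (d i + d₁) j = e)
      (hab : a * b ∈ 𝒜 (d₀ + d₁)) (h₃ : d₀ + d₁ + ∑ i, d i = e) :
      WedgeRel 𝒜 m e (single ⟨d₀, a, ha, Function.update d i (d i + d₁),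
          Function.update φ i (b • φ i), h₁, h₂⟩ 1 -
        (d₁ * ∑ j with j < i, d j).negOnePow • single ⟨d₀ + d₁, a * b, hab, d, φ, hφ, h₃⟩ 1)
  | perm {d₀ : ℤ} {a : A} {d : Fin m → ℤ} {φ : Fin m → Module.End k A} (σ : Equiv.Perm (Fin m))
      (ha : a ∈ 𝒜 d₀) (hφ : ∀ i, φ i ∈ gradedDer 𝒜 (d i)) (h : d₀ + ∑ i, d i = e)
      (h' : d₀ + ∑ i, (d ∘ σ) i = e) :
      WedgeRel 𝒜 m e (koszulSign σ d • single ⟨d₀, a, ha, d ∘ σ, φ ∘ σ, fun i => hφ (σ i), h'⟩ 1 -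
        Equiv.Perm.sign σ • single ⟨d₀, a, ha, d, φ, hφ, h⟩ 1)

/-- The component of degree `e` of the graded exterior power `⋀^m_A Der(A)`. -/
def DerWedge (𝒜 : ℤ → Submodule k A) (m : ℕ) (e : ℤ) : Type u :=
  (WedgeMonomial 𝒜 m e →₀ k) ⧸ Submodule.span k {r | WedgeRel 𝒜 m e r}

noncomputable instance (𝒜 : ℤ → Submodule k A) (m : ℕ) (e : ℤ) : AddCommGroup (DerWedge 𝒜 m e) :=
  inferInstanceAs
    (AddCommGroup ((WedgeMonomial 𝒜 m e →₀ k) ⧸ Submodule.span k {r | WedgeRel 𝒜 m e r}))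

noncomputable instance (𝒜 : ℤ → Submodule k A) (m : ℕ) (e : ℤ) : Module k (DerWedge 𝒜 m e) :=
  inferInstanceAs
    (Module k ((WedgeMonomial 𝒜 m e →₀ k) ⧸ Submodule.span k {r | WedgeRel 𝒜 m e r}))

theorem mulTensor_update_add {m : ℕ} (d : Fin m → ℤ) (φ : Fin m → Module.End k A) (i : Fin m)
    (ψ ψ' : Module.End k A) :
    mulTensor 𝒜 d (Function.update φ i (ψ + ψ')) =
      mulTensor 𝒜 d (Function.update φ i ψ) + mulTensor 𝒜 d (Function.update φ i ψ') := by
  induction m with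
  | zero => exact i.elim0
  | succ m ih =>
    ext a
    refine Fin.cases ?_ (fun i => ?_) i
    · simp [mulTensor, cupLeft, Fin.tail_update_zero, add_mul]
    · have h : ∀ χ, Function.update φ i.succ χ 0 = φ 0 := fun χ =>
        Function.update_of_ne (Fin.succ_ne_zero i).symm _ _
      simp [mulTensor, cupLeft, Fin.tail_update_succ, ih, mul_add, h]

theorem mulTensor_update_smul [GradedCommutative 𝒜] {m : ℕ} {d : Fin m → ℤ}
    {φ : Fin m → Module.End k A} (hφ : ∀ i, φ i ∈ homEnd 𝒜 (d i)) (i : Fin m) {b : A} {d₁ : ℤ}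
    (hb : b ∈ 𝒜 d₁) :
    mulTensor 𝒜 (Function.update d i (d i + d₁)) (Function.update φ i (b • φ i)) =
      (d₁ * ∑ j with j < i, d j).negOnePow • b • mulTensor 𝒜 d φ := by
  induction m with
  | zero => exact i.elim0
  | succ m ih =>
    refine Fin.cases ?_ (fun i => ?_) i
    · ext a
      simp [mulTensor, cupLeft, Fin.tail_update_zero, mul_assoc]
    · have h1 := ih (d := Fin.tail d) (φ := Fin.tail φ) (fun i => hφ i.succ) i
      have hs : ∑ j with j < i.succ, d j = d 0 + ∑ j with j < i, Fin.tail d j := by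
        rw [Finset.sum_filter, Finset.sum_filter, Fin.sum_univ_succ]
        simp [Fin.tail]
      have hs' : ∑ j, Function.update (Fin.tail d) i (d i.succ + d₁) j =
          d₁ + ∑ j, Fin.tail d j := by
        rw [Finset.sum_update_of_mem (Finset.mem_univ i),
          ← Finset.add_sum_erase _ (Fin.tail d) (Finset.mem_univ i), Finset.sdiff_singleton_eq_erase]
        simp only [Fin.tail]
        ring
      have h2 := cupLeft_smul hb (e := ∑ j, Fin.tail d j) (hφ 0)
        (mulTensor 𝒜 (Fin.tail d) (Fin.tail φ))
      have h3 : ∀ (u : ℤˣ) (e : ℤ) (χ : Cochain k A m),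
          cupLeft 𝒜 (φ 0) e (u • χ) = u • cupLeft 𝒜 (φ 0) e χ := by
        intro u e χ
        ext a
        change _ * (u • χ (Fin.tail a)) = u • (_ * χ (Fin.tail a))
        rw [mul_smul_comm]
      simp only [mulTensor]
      rw [Fin.tail_update_succ, Fin.tail_update_succ, Function.update_of_ne (Fin.succ_ne_zero i).symm, hs',
        show d i.succ = Fin.tail d i from rfl, show φ i.succ = Fin.tail φ i from rfl, h1, h3, h2,
        hs, smul_smul, ← Int.negOnePow_add, mul_add d₁ (d 0), mul_comm (d 0) d₁,
        add_comm (d₁ * d 0)]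

section HKR

variable (𝒜) in
/-- The value of the HKR map on `a · φ₀ ∧ ⋯ ∧ φ_{m-1}`:
`a · μ ∘ (1/m!) ∑_σ sign(σ) (± φ_{σ 0} ⊗ ⋯ ⊗ φ_{σ (m-1)})`. -/
noncomputable def hkrMonomial {m : ℕ} {e : ℤ} (x : WedgeMonomial 𝒜 m e) : Cochain k A m :=
  ((m.factorial : k)⁻¹) • ∑ σ : Equiv.Perm (Fin m), (Equiv.Perm.sign σ * koszulSign σ x.deg) •
    x.coeff • mulTensor 𝒜 (x.deg ∘ σ) (x.der ∘ σ)

variable (𝒜) in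
/-- The HKR map on the free module on the generators. -/
noncomputable def hkrFree (m : ℕ) (e : ℤ) : (WedgeMonomial 𝒜 m e →₀ k) →ₗ[k] Cochain k A m :=
  Finsupp.linearCombination k (hkrMonomial 𝒜)

theorem hkrFree_single {m : ℕ} {e : ℤ} (x : WedgeMonomial 𝒜 m e) :
    hkrFree 𝒜 m e (Finsupp.single x 1) = hkrMonomial 𝒜 x := by
  simp [hkrFree]

theorem hkrFree_units_smul {m : ℕ} {e : ℤ} (u : ℤˣ) (x : WedgeMonomial 𝒜 m e →₀ k) :
    hkrFree 𝒜 m e (u • x) = u • hkrFree 𝒜 m e x := by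
  rw [Units.smul_def, map_zsmul, ← Units.smul_def]

variable [GradedCommutative 𝒜]

theorem hkrFree_of_rel {m : ℕ} {e : ℤ} {r : WedgeMonomial 𝒜 m e →₀ k} (hr : WedgeRel 𝒜 m e r) :
    hkrFree 𝒜 m e r = 0 := by
  induction hr with
  | add_coeff ha ha' hφ h =>
    rw [map_sub, map_sub, hkrFree_single, hkrFree_single, hkrFree_single, sub_sub, sub_eq_zero]
    simp only [hkrMonomial]
    rw [← smul_add, ← Finset.sum_add_distrib]
    refine congrArg (fun s => ((m.factorial : k)⁻¹) • s) ?_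
    refine Finset.sum_congr rfl fun σ _ => ?_
    rw [add_smul, smul_add]
  | smul_coeff c ha hφ h =>
    rw [map_sub, map_smul, hkrFree_single, hkrFree_single, sub_eq_zero]
    simp only [hkrMonomial]
    rw [smul_comm c]
    refine congrArg (fun s => ((m.factorial : k)⁻¹) • s) ?_
    rw [Finset.smul_sum]
    refine Finset.sum_congr rfl fun σ _ => ?_
    have h1 : ∀ (a : A) (χ : Cochain k A m), (c • a) • χ = c • a • χ := fun a χ => by
      ext x
      exact smul_mul_assoc c a (χ x)
    rw [h1]
    exact smul_comm _ c _
  | @add_der d₀ a d φ i ψ ψ' ha h₁ h₂ h₃ h =>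
    rw [map_sub, map_sub, hkrFree_single, hkrFree_single, hkrFree_single, sub_sub, sub_eq_zero]
    simp only [hkrMonomial]
    rw [← smul_add, ← Finset.sum_add_distrib]
    refine congrArg (fun s => ((m.factorial : k)⁻¹) • s) ?_
    refine Finset.sum_congr rfl fun σ _ => ?_
    rw [Function.update_comp_equiv, Function.update_comp_equiv, Function.update_comp_equiv,
      mulTensor_update_add, smul_add, smul_add]
  | @smul_der d₀ d₁ a b d φ i ha hb hφ h₁ h₂ hab h₃ =>
    rw [map_sub, hkrFree_units_smul, hkrFree_single, hkrFree_single, sub_eq_zero]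
    simp only [hkrMonomial]
    rw [smul_comm (Int.negOnePow _)]
    refine congrArg (fun s => ((m.factorial : k)⁻¹) • s) ?_
    rw [Finset.smul_sum]
    refine Finset.sum_congr rfl fun σ _ => ?_
    rw [Function.update_comp_equiv, Function.update_comp_equiv]
    have h4 := mulTensor_update_smul (𝒜 := 𝒜) (d := d ∘ σ) (φ := φ ∘ σ)
      (fun j => (hφ (σ j)).1) (σ.symm i) hb
    simp only [Function.comp_apply, Equiv.apply_symm_apply] at h4
    have h5 := koszulSign_update σ d i d₁
    have h6 : ∀ (u : ℤˣ) (χ : Cochain k A m), a • u • χ = u • a • χ := fun u χ => by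
      ext x
      exact mul_smul_comm u a (χ x)
    rw [h4, h6, smul_smul, smul_smul, mul_assoc, h5, mul_smul a b, mul_left_comm, mul_smul (Int.negOnePow _)]
  | @perm d₀ a d φ σ ha hφ h h' =>
    rw [map_sub, hkrFree_units_smul, hkrFree_units_smul, hkrFree_single, hkrFree_single,
      sub_eq_zero]
    simp only [hkrMonomial]
    rw [smul_comm (koszulSign σ d), smul_comm (Equiv.Perm.sign σ)]
    refine congrArg (fun s => ((m.factorial : k)⁻¹) • s) ?_
    rw [Finset.smul_sum, Finset.smul_sum]
    refine Fintype.sum_equiv (Equiv.mulLeft σ) _ _ fun τ => ?_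
    simp only [Equiv.coe_mulLeft, koszulSign_mul, map_mul, smul_smul]
    have h1 := Int.units_mul_self (Equiv.Perm.sign σ)
    have h2 : koszulSign σ d * (Equiv.Perm.sign τ * koszulSign τ (d ∘ σ)) =
        Equiv.Perm.sign σ * (Equiv.Perm.sign σ * Equiv.Perm.sign τ *
          (koszulSign σ d * koszulSign τ (d ∘ σ))) := by
      rw [mul_assoc (Equiv.Perm.sign σ), ← mul_assoc (Equiv.Perm.sign σ), h1, one_mul,
        mul_left_comm]
    rw [h2]
    rfl

variable (𝒜) in
/-- The HKR map `⋀^m_A Der(A) → Hom(A^{⊗ m}, A)` in degree `e`. -/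
noncomputable def hkrMap (m : ℕ) (e : ℤ) : DerWedge 𝒜 m e →ₗ[k] Cochain k A m :=
  Submodule.liftQ _ (hkrFree 𝒜 m e) (by
    rw [Submodule.span_le]
    intro r hr
    exact hkrFree_of_rel hr)

theorem hkrMap_mem_and {m : ℕ} {e : ℤ} (x : DerWedge 𝒜 m e) :
    hkrMap 𝒜 m e x ∈ diffCochain 𝒜 e m ∧ hochschildBₗ 𝒜 e m (hkrMap 𝒜 m e x) = 0 := by
  obtain ⟨x, rfl⟩ := Submodule.Quotient.mk_surjective _ x
  change hkrFree 𝒜 m e x ∈ diffCochain 𝒜 e m ∧ hochschildBₗ 𝒜 e m (hkrFree 𝒜 m e x) = 0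
  rw [← LinearMap.mem_ker, ← Submodule.mem_inf, hkrFree, Finsupp.linearCombination_apply]
  refine Submodule.sum_mem _ fun y _ => Submodule.smul_mem _ _ ?_
  refine Submodule.smul_mem _ _ (Submodule.sum_mem _ fun σ _ => ?_)
  have hs : y.coeffDeg + ∑ i, (y.deg ∘ σ) i = e := by
    rw [Equiv.sum_comp σ y.deg |> fun h => show ∑ i, (y.deg ∘ σ) i = ∑ i, y.deg i from h]
    exact y.total
  rw [Units.smul_def]
  refine zsmul_mem (Submodule.mem_inf.2 ⟨?_, ?_⟩) _
  · exact Submodule.subset_span ⟨_, _, _, _, y.coeff_mem, fun i => .der (y.der_mem (σ i)), hs, rfl⟩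
  · have := hochschildB_smul_mulTensor y.coeff_mem fun i => y.der_mem (σ i)
    rw [show ∑ i, y.deg (σ i) = ∑ i, (y.deg ∘ σ) i from rfl, hs] at this
    exact this

/-! ## The complexes -/

open CategoryTheory

variable (𝒜) in
/-- The Hochschild differential on multidifferential operators, between the summands of total degree
`n` and `n + 1`. -/
noncomputable def diffHochschild (n : ℤ) (m : ℕ) :
    diffCochain 𝒜 (n - m) m →ₗ[k] diffCochain 𝒜 (n + 1 - (m + 1 : ℕ)) (m + 1) :=
  (hochschildBₗ 𝒜 (n - m) m).restrict fun φ hφ => by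
    have h : n + 1 - ((m + 1 : ℕ) : ℤ) = n - m := by push_cast; ring
    rw [h]
    exact hochschildB_mem hφ

variable (𝒜) in
/-- The differential of the complex of multidifferential operators. -/
noncomputable def diffTotalD (n : ℤ) : (⨁ m : ℕ, diffCochain 𝒜 (n - m) m) →ₗ[k]
    ⨁ m : ℕ, diffCochain 𝒜 (n + 1 - m) m :=
  DirectSum.toModule k ℕ _ fun m =>
    DirectSum.lof k ℕ (fun m : ℕ => diffCochain 𝒜 (n + 1 - m) m) (m + 1) ∘ₗ diffHochschild 𝒜 n m

theorem diffTotalD_comp (n : ℤ) : diffTotalD 𝒜 (n + 1) ∘ₗ diffTotalD 𝒜 n = 0 := by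
  refine DirectSum.linearMap_ext _ fun m => LinearMap.ext fun φ => ?_
  simp only [LinearMap.comp_apply, diffTotalD, DirectSum.toModule_lof]
  have : diffHochschild 𝒜 (n + 1) (m + 1) (diffHochschild 𝒜 n m φ) = 0 := by
    ext1
    have h : n + 1 - ((m + 1 : ℕ) : ℤ) = n - m := by push_cast; ring
    change hochschildB 𝒜 (n + 1 - ((m + 1 : ℕ) : ℤ)) (hochschildB 𝒜 (n - m) φ.1) = 0
    rw [h, hochschildB_hochschildB]
  rw [this, map_zero]
  rfl

variable (𝒜) in
/-- The multidifferential operators of total degree `n`: the direct sum over `m` of the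
multidifferential operators of arity `m` and degree `n - m`. -/
abbrev DiffTotal (n : ℤ) : Type u := ⨁ m : ℕ, diffCochain 𝒜 (n - m) m

noncomputable instance (n : ℤ) : AddCommGroup (DiffTotal 𝒜 n) :=
  Module.addCommMonoidToAddCommGroup k

variable (𝒜) in
/-- The Hochschild complex of multidifferential operators, whose component of total degree `n` is
the direct sum over `m` of the multidifferential operators of arity `m` and degree `n - m`. -/
noncomputable def diffComplex : CochainComplex (ModuleCat.{u} k) ℤ :=
  CochainComplex.of (fun n => ModuleCat.of k (DiffTotal 𝒜 n))
    (fun n => ModuleCat.ofHom (diffTotalD 𝒜 n))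
    (fun n => by rw [← ModuleCat.ofHom_comp, diffTotalD_comp]; rfl)

/-- The complex `⋀_A Der(A)` with zero differential; the component of total degree `n` is the direct
sum over `m` of the part of degree `n - m` of `⋀^m_A Der(A)`. -/
noncomputable def wedgeComplex (𝒜 : ℤ → Submodule k A) : CochainComplex (ModuleCat.{u} k) ℤ :=
  CochainComplex.of (fun n => ModuleCat.of k (⨁ m : ℕ, DerWedge 𝒜 m (n - m)))
    (fun _ => 0) (fun _ => by simp)

variable (𝒜) in
/-- The HKR map in total degree `n`. -/
noncomputable def hkrTotal (n : ℤ) : (⨁ m : ℕ, DerWedge 𝒜 m (n - m)) →ₗ[k]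
    ⨁ m : ℕ, diffCochain 𝒜 (n - m) m :=
  DirectSum.lmap fun m => (hkrMap 𝒜 m (n - m)).codRestrict _ fun x => (hkrMap_mem_and x).1

theorem diffTotalD_hkrTotal (n : ℤ) : diffTotalD 𝒜 n ∘ₗ hkrTotal 𝒜 n = 0 := by
  refine DirectSum.linearMap_ext _ fun m => LinearMap.ext fun x => ?_
  simp only [LinearMap.comp_apply, diffTotalD, hkrTotal, DirectSum.lmap_lof,
    DirectSum.toModule_lof]
  have : diffHochschild 𝒜 n m ((hkrMap 𝒜 m (n - m)).codRestrict _
      (fun x => (hkrMap_mem_and x).1) x) = 0 := by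
    ext1
    exact (hkrMap_mem_and x).2
  rw [this, map_zero]
  rfl

variable (𝒜) in
/-- The HKR map as a morphism of complexes. -/
noncomputable def hkrHom : wedgeComplex 𝒜 ⟶ diffComplex 𝒜 :=
  CochainComplex.ofHom (fun n => ModuleCat.ofHom (hkrTotal 𝒜 n)) fun n => by
    simp only [wedgeComplex, diffComplex, CochainComplex.of_d, Limits.zero_comp]
    rw [← ModuleCat.ofHom_comp, diffTotalD_hkrTotal]
    rfl

end HKR

end GradedAlg

/-! ## The graded symmetric algebra -/

section GSym

variable (k : Type) [Field k] (W : ℤ → Type v) [∀ j, AddCommGroup (W j)] [∀ j, Module k (W j)]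

/-- The relations `v w = (-1)^{|v||w|} w v` in the tensor algebra. -/
inductive GSymRel : TensorAlgebra k (⨁ j, W j) → TensorAlgebra k (⨁ j, W j) → Prop
  | comm {i j : ℤ} (v : W i) (w : W j) : GSymRel
      (TensorAlgebra.ι k (DirectSum.lof k ℤ W i v) * TensorAlgebra.ι k (DirectSum.lof k ℤ W j w))
      ((i * j).negOnePow •
        (TensorAlgebra.ι k (DirectSum.lof k ℤ W j w) * TensorAlgebra.ι k (DirectSum.lof k ℤ W i v)))

/-- The graded symmetric algebra `S(W)` of a graded vector space `W = ⨁ j, W j`. -/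
def GSym : Type v := RingQuot (GSymRel k W)

noncomputable instance : Ring (GSym k W) := inferInstanceAs (Ring (RingQuot (GSymRel k W)))

noncomputable instance : Algebra k (GSym k W) :=
  inferInstanceAs (Algebra k (RingQuot (GSymRel k W)))

namespace GSym

variable {W} in
/-- The inclusion `W j → S(W)`. -/
noncomputable def gen (j : ℤ) : W j →ₗ[k] GSym k W :=
  (RingQuot.mkAlgHom k (GSymRel k W)).toLinearMap ∘ₗ TensorAlgebra.ι k ∘ₗ DirectSum.lof k ℤ W j

theorem gen_mul_gen {i j : ℤ} (v : W i) (w : W j) :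
    gen k i v * gen k j w = (i * j).negOnePow • (gen k j w * gen k i v) := by
  have h := RingQuot.mkAlgHom_rel k (GSymRel.comm (k := k) v w)
  rw [Units.smul_def, map_zsmul, map_mul, map_mul, ← Units.smul_def] at h
  exact h

/-- The component of degree `d` of `S(W)`, spanned by the products `v₁ ⋯ v_r` of homogeneous
elements of `W` of degrees adding up to `d`. -/
noncomputable def homPart (d : ℤ) : Submodule k (GSym k W) :=
  Submodule.span k {x | ∃ l : List (Σ j, W j),
    (l.map Sigma.fst).sum = d ∧ x = (l.map fun p => gen k p.1 p.2).prod}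

theorem one_mem_homPart : (1 : GSym k W) ∈ homPart k W 0 :=
  Submodule.subset_span ⟨[], by simp⟩

theorem mul_mem_homPart {d e : ℤ} {x y : GSym k W} (hx : x ∈ homPart k W d)
    (hy : y ∈ homPart k W e) : x * y ∈ homPart k W (d + e) := by
  have := Submodule.mul_mem_mul hx hy
  rw [homPart, homPart, Submodule.span_mul_span] at this
  refine Submodule.span_mono ?_ this
  rintro _ ⟨_, ⟨l, rfl, rfl⟩, _, ⟨l', rfl, rfl⟩, rfl⟩
  exact ⟨l ++ l', by simp⟩

theorem gen_mul_prod {i : ℤ} (v : W i) (l : List (Σ j, W j)) :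
    gen k i v * (l.map fun p => gen k p.1 p.2).prod =
      (i * (l.map Sigma.fst).sum).negOnePow • ((l.map fun p => gen k p.1 p.2).prod * gen k i v) := by
  induction l with
  | nil => simp
  | cons p l ih =>
    simp only [List.map_cons, List.prod_cons, List.sum_cons]
    rw [← mul_assoc, gen_mul_gen, smul_mul_assoc, mul_assoc, ih, mul_smul_comm, smul_smul,
      ← Int.negOnePow_add, mul_add, mul_assoc]

theorem homPart_comm {d e : ℤ} {x y : GSym k W} (hx : x ∈ homPart k W d)
    (hy : y ∈ homPart k W e) : x * y = (d * e).negOnePow • (y * x) := by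
  induction hx using Submodule.span_induction with
  | zero => simp
  | add a b _ _ ha hb => rw [add_mul, ha, hb, mul_add, smul_add]
  | smul c a _ ha => rw [smul_mul_assoc, ha, mul_smul_comm, smul_comm]
  | mem x hx =>
    obtain ⟨l, rfl, rfl⟩ := hx
    induction hy using Submodule.span_induction with
    | zero => simp
    | add a b _ _ ha hb => rw [mul_add, ha, hb, add_mul, smul_add]
    | smul c a _ ha => rw [mul_smul_comm, ha, smul_mul_assoc, smul_comm]
    | mem y hy =>
      obtain ⟨l', rfl, rfl⟩ := hy
      induction l with
      | nil => simp
      | cons p l ih =>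
        simp only [List.map_cons, List.prod_cons, List.sum_cons]
        rw [mul_assoc, ih, mul_smul_comm, ← mul_assoc, gen_mul_prod, smul_mul_assoc, smul_smul,
          mul_assoc, ← Int.negOnePow_add, add_mul, add_comm]

end GSym

end GSym

/-! ## A direct sum of submodules of an algebra as a graded algebra -/

section DirectSumGraded

variable {k : Type} [Field k] {B : Type u} [Ring B] [Algebra k B] (ℬ : ℤ → Submodule k B)
  [SetLike.GradedMonoid ℬ]

/-- The direct sum `⨁ d, ℬ d` as an algebra, with the product induced from `B`. -/
def GradedSum : Type u := ⨁ d, ℬ d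

namespace GradedSum

noncomputable instance : Ring (GradedSum ℬ) := inferInstanceAs (Ring (⨁ d, ℬ d))

noncomputable instance : Algebra k (GradedSum ℬ) := inferInstanceAs (Algebra k (⨁ d, ℬ d))

/-- The inclusion of the summand `ℬ d`. -/
noncomputable def incl (d : ℤ) : ℬ d →ₗ[k] GradedSum ℬ where
  toFun := DirectSum.of (fun d => ℬ d) d
  map_add' := map_add (DirectSum.of (fun d => ℬ d) d)
  map_smul' c x := (DirectSum.lof k ℤ (fun d => ℬ d) d).map_smul c x

variable {ℬ} in
theorem hom_ext {M : Type*} [AddCommMonoid M] {f g : GradedSum ℬ →+ M}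
    (h : ∀ d (x : ℬ d), f (incl ℬ d x) = g (incl ℬ d x)) : f = g :=
  DirectSum.addHom_ext (γ := M) (f := f) (g := g) h

theorem incl_mul {d e : ℤ} (x : ℬ d) (y : ℬ e) : incl ℬ d x * incl ℬ e y =
    incl ℬ (d + e) ⟨x * y, SetLike.mul_mem_graded x.2 y.2⟩ :=
  DirectSum.of_mul_of (A := fun d => ℬ d) x y

/-- The summand of degree `d` of the direct sum `⨁ d, ℬ d`. -/
noncomputable def summand (d : ℤ) : Submodule k (GradedSum ℬ) := LinearMap.range (incl ℬ d)

/-- The decomposition of an element of `⨁ d, ℬ d` into its homogeneous components. -/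
noncomputable def decomp : GradedSum ℬ →+ ⨁ d, summand ℬ d :=
  DirectSum.toAddMonoid (β := fun d => ℬ d) fun d =>
    (DirectSum.of (fun d => summand ℬ d) d).comp
      ((incl ℬ d).rangeRestrict.toAddMonoidHom)

theorem decomp_incl (d : ℤ) (x : ℬ d) :
    decomp ℬ (incl ℬ d x) = DirectSum.of (fun d => summand ℬ d) d ⟨incl ℬ d x, x, rfl⟩ :=
  DirectSum.toAddMonoid_of (β := fun d => ℬ d) _ d x

noncomputable instance : GradedAlgebra (summand ℬ) where
  one_mem := ⟨⟨1, SetLike.GradedOne.one_mem⟩, rfl⟩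
  mul_mem := by
    rintro i j _ _ ⟨x, rfl⟩ ⟨y, rfl⟩
    exact ⟨_, (incl_mul ℬ x y).symm⟩
  toDecomposition := DirectSum.Decomposition.ofAddHom (summand ℬ) (decomp ℬ)
    (hom_ext fun d x => by
      simp only [AddMonoidHom.comp_apply, decomp_incl, DirectSum.coeAddMonoidHom_of,
        AddMonoidHom.id_apply])
    (DirectSum.addHom_ext fun d x => by
      obtain ⟨_, x, rfl⟩ := x
      simp only [AddMonoidHom.comp_apply, decomp_incl, DirectSum.coeAddMonoidHom_of,
        AddMonoidHom.id_apply])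

theorem gradedCommutative (h : ∀ {i j : ℤ} {a b : B}, a ∈ ℬ i → b ∈ ℬ j →
    a * b = (i * j).negOnePow • (b * a)) : GradedCommutative (summand ℬ) where
  comm := by
    rintro i j _ _ ⟨x, rfl⟩ ⟨y, rfl⟩
    rw [incl_mul, incl_mul, Units.smul_def, ← map_zsmul]
    have h1 : ∀ (d e : ℤ) (z : ℬ d) (w : ℬ e), d = e → (z : B) = w → incl ℬ d z = incl ℬ e w := by
      rintro d _ z w rfl hzw
      rw [Subtype.ext hzw]
    refine h1 _ _ _ _ (add_comm i j) ?_
    have := h x.2 y.2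
    simpa [Units.smul_def] using this

end GradedSum

end DirectSumGraded

/-! ## Functions on a graded supermanifold -/

section Supermanifold

open Bundle Topology

variable (k : Type) [RCLike k] (n : ℕ) {C : Type u} [TopologicalSpace C]
  [ChartedSpace (EuclideanSpace ℝ (Fin n)) C]
  (F : ℤ → Type w) [∀ j, NormedAddCommGroup (F j)] [∀ j, NormedSpace ℝ (F j)]
  (E : ℤ → C → Type v) [∀ j x, AddCommGroup (E j x)] [∀ j x, Module k (E j x)]
  [∀ j x, TopologicalSpace (E j x)] [∀ j, TopologicalSpace (TotalSpace (F j) (E j))]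
  [∀ j, FiberBundle (F j) (E j)]

/-- Not necessarily smooth sections of the bundle `S(E)` of graded symmetric algebras of the fibres
of `E = ⨁ j, E j`. -/
abbrev SymSection : Type (max u v) := (x : C) → GSym k (fun j => E j x)

/-- The algebra of sections of `S(E)` generated by smooth functions and smooth sections of the
bundles `E j`. -/
noncomputable def polySections : Subalgebra k (SymSection k E) :=
  Algebra.adjoin k
    ({s | ∃ f : C → k, ContMDiff (𝓡 n) 𝓘(ℝ, k) ∞ f ∧ s = fun x => algebraMap k _ (f x)} ∪
      {s | ∃ (j : ℤ) (e : (x : C) → E j x),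
        ContMDiff (𝓡 n) ((𝓡 n).prod 𝓘(ℝ, F j)) ∞ (fun x => TotalSpace.mk' (F j) x (e x)) ∧
        s = fun x => GSym.gen k j (e x)})

/-- Smooth sections of `S(E)` which are homogeneous of degree `d`. A section is smooth if near each
point it is a polynomial in smooth sections of the bundles `E j` with smooth coefficients. -/
noncomputable def homSections (d : ℤ) : Submodule k (SymSection k E) where
  carrier := {s | (∀ x, s x ∈ GSym.homPart k (fun j => E j x) d) ∧
    ∀ x, ∃ t ∈ polySections k n F E, ∀ᶠ y in 𝓝 x, s y = t y}
  add_mem' := by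
    rintro s s' ⟨h1, h2⟩ ⟨h1', h2'⟩
    refine ⟨fun x => add_mem (h1 x) (h1' x), fun x => ?_⟩
    obtain ⟨t, ht, h⟩ := h2 x
    obtain ⟨t', ht', h'⟩ := h2' x
    refine ⟨t + t', add_mem ht ht', ?_⟩
    filter_upwards [h, h'] with y hy hy'
    rw [Pi.add_apply, Pi.add_apply, hy, hy']
  zero_mem' := ⟨fun x => zero_mem _, fun x => ⟨0, zero_mem _, by simp⟩⟩
  smul_mem' := by
    rintro c s ⟨h1, h2⟩
    refine ⟨fun x => Submodule.smul_mem _ c (h1 x), fun x => ?_⟩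
    obtain ⟨t, ht, h⟩ := h2 x
    refine ⟨c • t, Subalgebra.smul_mem _ ht c, ?_⟩
    filter_upwards [h] with y hy
    rw [Pi.smul_apply, Pi.smul_apply, hy]

instance homSectionsGraded : SetLike.GradedMonoid (homSections k n F E) where
  one_mem := ⟨fun x => GSym.one_mem_homPart k _, fun x => ⟨1, one_mem _, by simp⟩⟩
  mul_mem := by
    rintro i j s s' ⟨h1, h2⟩ ⟨h1', h2'⟩
    refine ⟨fun x => GSym.mul_mem_homPart k _ (h1 x) (h1' x), fun x => ?_⟩
    obtain ⟨t, ht, h⟩ := h2 x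
    obtain ⟨t', ht', h'⟩ := h2' x
    refine ⟨t * t', mul_mem ht ht', ?_⟩
    filter_upwards [h, h'] with y hy hy'
    rw [Pi.mul_apply, Pi.mul_apply, hy, hy']

/-- The graded algebra `C^∞(N) = Γ(C, S(E)) = ⨁ d, Γ(C, S(E)^d)` of functions on the graded
supermanifold `N = E^*`. -/
abbrev SuperFun : Type (max u v) := GradedSum (homSections k n F E)

/-- The grading of `C^∞(N)`. -/
noncomputable abbrev superGrading : ℤ → Submodule k (SuperFun k n F E) :=
  GradedSum.summand (homSections k n F E)

instance superGrading_comm : GradedCommutative (superGrading k n F E) :=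
  GradedSum.gradedCommutative _ fun hs hs' => by
    ext x
    exact GSym.homPart_comm k _ (hs.1 x) (hs'.1 x)

end Supermanifold

set_option linter.unusedSectionVars false

/-! ## Calculus in the first slot of a cochain -/

namespace GradedHKR

section FirstSlot

variable {k : Type} [Field k] {A : Type u} [Ring A] [Algebra k A]

/-! The proof separates algebra from geometry; the interface is `LocalCoords`. Such a system
consists of a function ρ of degree zero, homogeneous elements x_t and derivations X_t with X_s(x_t)
= δ_{st} ρ and ρ D = ∑ D(x_t) X_t for every graded derivation D. Geometry (`exists_localCoords`)
provides 2^n of these systems with ∑ ρ = 1; algebra (`hkr_of_localCoords`) deduces the theorem from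
them.

Surjectivity on cohomology rests on a Koszul-type elimination. A Hochschild cochain of arity m is
the same as a cochain of arity m + 1 which is A-linear in its first slot (`consMul`), and under this
identification the Hochschild differential becomes, up to sign, `hochschildTail`, the part of the
differential which does not use the left module structure (`hochschildTail_consMul`). On all
differential cochains this differential is exact in arity at least two, by putting 1 in the first
slot (`eq_hochschildTail_of_closed`). Between the two extremes lie the subcomplexes `commuting S` of
cochains which commute, in the first slot, with multiplication by x_t for t ∈ S. For S empty nothing
is imposed. For S the set of all coordinates the cochains are A-linear up to a power of ρ: a
derivation which kills all coordinates is killed by ρ, and the order drops step by step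
(`exists_pow_smul_eq_consMul`).

Adding a coordinate x_s to S means passing to the kernel of the commutator with x_s, `adL`. In the
first slot this commutator and composition with X_s satisfy the Weyl (for odd x_s: Clifford)
relation with ρ in place of 1. Hence for even x_s the commutator is onto up to powers of ρ; this
uses finiteness of the order and characteristic zero (`exists_adL_eq_of_even`). For odd x_s it
squares to zero and its image contains its kernel up to powers of ρ (`exists_adL_eq_of_odd`). The
resulting connecting map lowers the arity, and lifting a first-slot-linear class μ back produces the
cup product X_s ∪ μ. By induction on S and the arity, every cocycle becomes, after multiplication by
a power of ρ, a sum of products of derivations and a coboundary (`exists_multiDer_add_cobd`,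
`exists_pow_smul_mem`). Powers of the finitely many ρ still generate the unit ideal in degree zero
(`of_forall_pow`), so the powers disappear globally. As D ∪ D' and ∓D' ∪ D differ by the coboundary
of D ∘ D', products of derivations may be antisymmetrised, which puts them in the image of the HKR
map (`multiDer_le`).

For injectivity on cohomology, the graded antisymmetrisation of a coboundary vanishes: merged
neighbours cancel by graded commutativity, and the two outer terms cancel after a rotation
(`sum_perm_hochschildB`). An alternating cochain is, up to a factorial, its own antisymmetrisation,
so an alternating multiderivation which is a coboundary is zero. The same fact identifies the image
of the HKR map with the alternating multiderivations (`range_hkrMap_eq`). Injectivity of the HKR map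
itself follows from an explicit left inverse: evaluate on coordinates and wedge the values with the
X_t (`hkrInverse_hkrMap`).

On the geometric side, finitely many systems suffice even if C is not compact: C is covered by 2^n
open sets on each of which the centre of a chart and of trivialisations is chosen in a locally
constant way (`exists_coloured_cover`). There the X_t are partial derivatives and contractions with
dual frame vectors, cut off by ρ. Completeness holds because derivations are local and, by
Hadamard's lemma, a derivation which kills the coordinates kills everything. -/

theorem map_sign_smul {M N F : Type*} [AddCommGroup M] [AddCommGroup N] [FunLike F M N]
    [AddMonoidHomClass F M N] (f : F) (s : ℤˣ) (x : M) : f (s • x) = s • f x := by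
  rw [Units.smul_def, map_zsmul, ← Units.smul_def]

theorem sign_smul_eq {m : ℕ} (s : ℤˣ) (φ : Cochain k A m) : s • φ = ((s : ℤ) : k) • φ := by
  ext a
  change s • φ a = ((s : ℤ) : k) • φ a
  rw [Int.cast_smul_eq_zsmul, Units.smul_def]

theorem smul_algebra_smul_comm {m : ℕ} (c : A) (r : k) (φ : Cochain k A m) :
    c • r • φ = r • c • φ := by
  ext; simp

theorem smul_sign_smul {m : ℕ} (s : ℤˣ) (c : A) (φ : Cochain k A m) :
    c • s • φ = s • c • φ := by
  rw [sign_smul_eq, sign_smul_eq, smul_algebra_smul_comm]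

theorem sign_smul_smul {m : ℕ} (s : ℤˣ) (c : A) (φ : Cochain k A m) :
    (s • c) • φ = s • c • φ := by
  ext a
  exact smul_mul_assoc s c (φ a)

theorem map_sign_smul_cochain {m m' : ℕ} (f : Cochain k A m →ₗ[k] Cochain k A m') (s : ℤˣ)
    (φ : Cochain k A m) : f (s • φ) = s • f φ := by
  rw [sign_smul_eq, sign_smul_eq, map_smul]

theorem curryLeft_map_sign_smul {m : ℕ} (s : ℤˣ) (φ : Cochain k A (m + 1)) (a : A) :
    φ.curryLeft (s • a) = s • φ.curryLeft a := by
  rw [sign_smul_eq, ← map_smul, Int.cast_smul_eq_zsmul, Units.smul_def]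

theorem sign_smul_mem_cochain {m : ℕ} (p : Submodule k (Cochain k A m)) (s : ℤˣ)
    {x : Cochain k A m} (hx : x ∈ p) : s • x ∈ p := by
  rw [sign_smul_eq]; exact p.smul_mem _ hx

theorem sign_smul_mem {M : Type*} [AddCommGroup M] [Module k M] (p : Submodule k M) (s : ℤˣ)
    {x : M} (hx : x ∈ p) : s • x ∈ p := by
  rw [Units.smul_def]; exact zsmul_mem hx _

theorem negOnePow_eq_of_even_sub {i j : ℤ} (h : Even (i - j)) : i.negOnePow = j.negOnePow :=
  (Int.negOnePow_eq_iff i j).2 h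

/-- Precomposition of a cochain with an operator in the first slot. -/
def precomp {m : ℕ} (D : Module.End k A) : Cochain k A (m + 1) →ₗ[k] Cochain k A (m + 1) where
  toFun φ := LinearMap.uncurryLeft (M := fun _ : Fin (m + 1) => A) (φ.curryLeft ∘ₗ D)
  map_add' _ _ := rfl
  map_smul' _ _ := rfl

theorem curryLeft_precomp {m : ℕ} (D : Module.End k A) (φ : Cochain k A (m + 1)) (a : A) :
    (precomp D φ).curryLeft a = φ.curryLeft (D a) := rfl

theorem precomp_smul {m : ℕ} (D : Module.End k A) (c : A) (φ : Cochain k A (m + 1)) :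
    precomp D (c • φ) = c • precomp D φ := rfl

theorem curryLeft_smul {m : ℕ} (c : A) (φ : Cochain k A (m + 1)) (a : A) :
    (c • φ).curryLeft a = c • φ.curryLeft a := rfl

theorem curryLeft_sub {m : ℕ} (φ ψ : Cochain k A (m + 1)) (a : A) :
    (φ - ψ).curryLeft a = φ.curryLeft a - ψ.curryLeft a := rfl

theorem curryLeft_add {m : ℕ} (φ ψ : Cochain k A (m + 1)) (a : A) :
    (φ + ψ).curryLeft a = φ.curryLeft a + ψ.curryLeft a := rfl

theorem curryLeft_neg {m : ℕ} (φ : Cochain k A (m + 1)) (a : A) :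
    (-φ).curryLeft a = -φ.curryLeft a := rfl

theorem curryLeft_sign_smul {m : ℕ} (s : ℤˣ) (φ : Cochain k A (m + 1)) (a : A) :
    (s • φ).curryLeft a = s • φ.curryLeft a := rfl

variable (𝒜 : ℤ → Submodule k A) [GradedAlgebra 𝒜]

/-- The graded commutator with the multiplication by `y` in the first slot of a cochain of
degree `d`. -/
noncomputable def adL {m : ℕ} (d : ℤ) (y : A) : Cochain k A (m + 1) →ₗ[k] Cochain k A (m + 1) where
  toFun φ := precomp (LinearMap.mulLeft k y) φ - koszulTwist 𝒜 d y • φ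
  map_add' φ ψ := by rw [map_add, smul_add]; abel
  map_smul' c φ := by
    rw [map_smul, RingHom.id_apply, smul_sub, smul_algebra_smul_comm]

theorem adL_apply {m : ℕ} (d : ℤ) (y : A) (φ : Cochain k A (m + 1)) :
    adL 𝒜 d y φ = precomp (LinearMap.mulLeft k y) φ - koszulTwist 𝒜 d y • φ := rfl

theorem curryLeft_adL {m : ℕ} (d : ℤ) (y : A) (φ : Cochain k A (m + 1)) (a : A) :
    (adL 𝒜 d y φ).curryLeft a = φ.curryLeft (y * a) - koszulTwist 𝒜 d y • φ.curryLeft a := rfl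

variable {𝒜}

theorem koszulTwist_add_of_mem {d e i : ℤ} {y : A} (hy : y ∈ 𝒜 i) :
    koszulTwist 𝒜 (d + e) y = (e * i).negOnePow • koszulTwist 𝒜 d y := by
  rw [koszulTwist_add, koszulTwist_of_mem hy, map_sign_smul]

theorem koszulTwist_of_mem_zero {d : ℤ} {y : A} (hy : y ∈ 𝒜 0) : koszulTwist 𝒜 d y = y := by
  rw [koszulTwist_of_mem hy, mul_zero, Int.negOnePow_zero, one_smul]

theorem koszulTwist_one (d : ℤ) : koszulTwist 𝒜 d (1 : A) = 1 :=
  koszulTwist_of_mem_zero SetLike.GradedOne.one_mem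

/-- Multiplications commute in the graded sense, hence so do the commutators with them. This keeps
`commuting S` stable under all these commutators; for y = z of odd degree it says that the
commutator squares to minus its square. -/
theorem adL_adL [GradedCommutative 𝒜] {m : ℕ} {d i j : ℤ} {y z : A} (hy : y ∈ 𝒜 i) (hz : z ∈ 𝒜 j)
    (φ : Cochain k A (m + 1)) :
    adL 𝒜 (d + j) y (adL 𝒜 d z φ) = (i * j).negOnePow • adL 𝒜 (d + i) z (adL 𝒜 d y φ) := by
  refine cochain_ext fun a => ?_
  have h1 : z * (y * a) = (i * j).negOnePow • (y * (z * a)) := by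
    rw [← mul_assoc, GradedCommutative.comm hz hy, smul_mul_assoc, mul_assoc, mul_comm j]
  have h2 : koszulTwist 𝒜 d z * koszulTwist 𝒜 d y =
      (i * j).negOnePow • (koszulTwist 𝒜 d y * koszulTwist 𝒜 d z) := by
    rw [GradedCommutative.comm (koszulTwist_mem hz) (koszulTwist_mem hy), mul_comm j]
  have h3 : koszulTwist 𝒜 d z • koszulTwist 𝒜 d y • φ.curryLeft a =
      (i * j).negOnePow • koszulTwist 𝒜 d y • koszulTwist 𝒜 d z • φ.curryLeft a := by
    rw [smul_smul, h2, sign_smul_smul, mul_smul]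
  rw [curryLeft_sign_smul]
  simp only [curryLeft_adL]
  rw [koszulTwist_add_of_mem hy, koszulTwist_add_of_mem hz, h1, curryLeft_map_sign_smul,
    mul_comm j i]
  simp only [smul_sub, sign_smul_smul, smul_smul (_ : ℤˣ), Int.units_mul_self, one_smul]
  rw [h3]
  abel

theorem adL_smul [GradedCommutative 𝒜] {m : ℕ} {d e : ℤ} (y : A) {c : A} (hc : c ∈ 𝒜 e)
    (φ : Cochain k A (m + 1)) : adL 𝒜 (d + e) y (c • φ) = c • adL 𝒜 d y φ := by
  refine cochain_ext fun a => ?_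
  simp only [curryLeft_adL, curryLeft_smul]
  rw [smul_sub, smul_smul, smul_smul, add_comm d e, koszulTwist_add, koszulTwist_mul_comm 𝒜 hc]

/-- This is the operator identity [X, y] = X(y), read in the first slot; with coordinates it becomes
the Weyl or Clifford relation used in the elimination. -/
theorem adL_precomp {m : ℕ} {d e i : ℤ} {y : A} (hy : y ∈ 𝒜 i) {X : Module.End k A}
    (hX : X ∈ gradedDer 𝒜 e) (φ : Cochain k A (m + 1)) :
    adL 𝒜 (d + e) y (precomp X φ) = precomp (LinearMap.mulLeft k (X y)) φ +
      (e * i).negOnePow • precomp X (adL 𝒜 d y φ) := by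
  refine cochain_ext fun a => ?_
  rw [curryLeft_add, curryLeft_sign_smul]
  simp only [curryLeft_adL, curryLeft_precomp, LinearMap.mulLeft_apply]
  rw [hX.2 i y a hy, map_add, curryLeft_map_sign_smul, koszulTwist_add_of_mem hy, sign_smul_smul, smul_sub]
  abel

theorem adL_precomp_mulLeft [GradedCommutative 𝒜] {m : ℕ} {d e i : ℤ} {y z : A} (hy : y ∈ 𝒜 i)
    (hz : z ∈ 𝒜 e) (φ : Cochain k A (m + 1)) :
    adL 𝒜 (d + e) y (precomp (LinearMap.mulLeft k z) φ) =
      (e * i).negOnePow • precomp (LinearMap.mulLeft k z) (adL 𝒜 d y φ) := by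
  refine cochain_ext fun a => ?_
  rw [curryLeft_sign_smul]
  simp only [curryLeft_adL, curryLeft_precomp, LinearMap.mulLeft_apply]
  rw [← mul_assoc, GradedCommutative.comm hz hy, smul_mul_assoc, mul_assoc, curryLeft_map_sign_smul,
    koszulTwist_add_of_mem hy, sign_smul_smul, smul_sub]

/-! ### Finite order -/

variable (𝒜) in
/-- Cochains of degree `d` which are differential operators of order `< r` in the first slot. -/
def OrdLT {m : ℕ} : ℕ → ℤ → Cochain k A (m + 1) → Prop
  | 0, _, φ => φ = 0
  | r + 1, d, φ => ∀ (i : ℤ) (y : A), y ∈ 𝒜 i → OrdLT r (d + i) (adL 𝒜 d y φ)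

theorem OrdLT.zero {m : ℕ} (r : ℕ) (d : ℤ) : OrdLT 𝒜 r d (0 : Cochain k A (m + 1)) := by
  induction r generalizing d with
  | zero => rfl
  | succ r ih => intro i y hy; rw [map_zero]; exact ih _

theorem OrdLT.succ {m : ℕ} {r : ℕ} {d : ℤ} {φ : Cochain k A (m + 1)} (h : OrdLT 𝒜 r d φ) :
    OrdLT 𝒜 (r + 1) d φ := by
  induction r generalizing d φ with
  | zero => intro i y hy; rw [h, map_zero]; rfl
  | succ r ih => intro i y hy; exact ih (h i y hy)

theorem OrdLT.mono {m : ℕ} {r s : ℕ} (hrs : r ≤ s) {d : ℤ} {φ : Cochain k A (m + 1)}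
    (h : OrdLT 𝒜 r d φ) : OrdLT 𝒜 s d φ := by
  induction hrs with
  | refl => exact h
  | step _ ih => exact ih.succ

theorem OrdLT.add {m : ℕ} {r : ℕ} {d : ℤ} {φ ψ : Cochain k A (m + 1)} (h : OrdLT 𝒜 r d φ)
    (h' : OrdLT 𝒜 r d ψ) : OrdLT 𝒜 r d (φ + ψ) := by
  induction r generalizing d φ ψ with
  | zero => rw [h, h', add_zero]; rfl
  | succ r ih => intro i y hy; rw [map_add]; exact ih (h i y hy) (h' i y hy)

theorem OrdLT.algebra_smul {m : ℕ} {r : ℕ} {d : ℤ} {φ : Cochain k A (m + 1)} (c : k)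
    (h : OrdLT 𝒜 r d φ) : OrdLT 𝒜 r d (c • φ) := by
  induction r generalizing d φ with
  | zero => rw [h, smul_zero]; rfl
  | succ r ih => intro i y hy; rw [map_smul]; exact ih (h i y hy)

theorem OrdLT.sign_smul {m : ℕ} {r : ℕ} {d : ℤ} {φ : Cochain k A (m + 1)} (s : ℤˣ)
    (h : OrdLT 𝒜 r d φ) : OrdLT 𝒜 r d (s • φ) := by
  rw [sign_smul_eq]; exact h.algebra_smul _

theorem OrdLT.smul [GradedCommutative 𝒜] {m : ℕ} {r : ℕ} {d e : ℤ} {φ : Cochain k A (m + 1)} {c : A}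
    (hc : c ∈ 𝒜 e) (h : OrdLT 𝒜 r d φ) : OrdLT 𝒜 r (d + e) (c • φ) := by
  induction r generalizing d φ with
  | zero => rw [h, smul_zero]; rfl
  | succ r ih =>
    intro i y hy
    rw [adL_smul y hc, add_right_comm]
    exact ih (h i y hy)

theorem OrdLT.precomp_mulLeft [GradedCommutative 𝒜] {m : ℕ} {r : ℕ} {d e : ℤ}
    {φ : Cochain k A (m + 1)} {c : A} (hc : c ∈ 𝒜 e) (h : OrdLT 𝒜 r d φ) :
    OrdLT 𝒜 r (d + e) (precomp (LinearMap.mulLeft k c) φ) := by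
  induction r generalizing d φ with
  | zero => rw [h, map_zero]; rfl
  | succ r ih =>
    intro i y hy
    rw [adL_precomp_mulLeft hy hc, add_right_comm]
    exact (ih (h i y hy)).sign_smul _

/-- By [X, y] = X(y), a commutator of the composite is one summand composed with a multiplication,
which has the old order, plus one in which the cochain has already lost an order. -/
theorem OrdLT.precomp_der [GradedCommutative 𝒜] {m : ℕ} {r : ℕ} {d e : ℤ}
    {φ : Cochain k A (m + 1)} {X : Module.End k A} (hX : X ∈ gradedDer 𝒜 e) (h : OrdLT 𝒜 r d φ) :
    OrdLT 𝒜 (r + 1) (d + e) (precomp X φ) := by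
  induction r generalizing d φ with
  | zero => rw [h, map_zero]; exact .zero _ _
  | succ r ih =>
    intro i y hy
    rw [adL_precomp hy hX]
    have h1 := h.precomp_mulLeft (hX.1 i y hy)
    rw [add_comm i e, ← add_assoc] at h1
    have h2 := (ih (h i y hy)).sign_smul (e * i).negOnePow
    rw [add_right_comm] at h2
    exact h1.add h2

theorem exists_ordLT_precomp [GradedCommutative 𝒜] {m : ℕ} {e : ℤ} {D : Module.End k A}
    (hD : IsDiffOp 𝒜 e D) {r : ℕ} {d : ℤ} {φ : Cochain k A (m + 1)} (h : OrdLT 𝒜 r d φ) :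
    ∃ s, OrdLT 𝒜 s (d + e) (precomp D φ) := by
  induction hD generalizing r d φ with
  | mul ha => exact ⟨r, h.precomp_mulLeft ha⟩
  | der hX => exact ⟨r + 1, h.precomp_der hX⟩
  | @comp d₁ d₂ D D' _ _ ih ih' =>
    obtain ⟨s, hs⟩ := ih h
    obtain ⟨t, ht⟩ := ih' hs
    exact ⟨t, by rwa [← add_assoc]⟩
  | add _ _ ih ih' =>
    obtain ⟨s, hs⟩ := ih h
    obtain ⟨t, ht⟩ := ih' h
    refine ⟨max s t, ?_⟩
    have := (hs.mono (le_max_left s t)).add (ht.mono (le_max_right s t))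
    convert this using 1
    refine cochain_ext fun a => ?_
    rw [curryLeft_add]
    simp only [curryLeft_precomp, LinearMap.add_apply, map_add]

/-! ### Differential cochains in the first slot -/

/-- The sign arises from moving D past the Koszul twist by the degree e of the remaining factors. -/
theorem precomp_cupLeft {m : ℕ} {e e' : ℤ} {D : Module.End k A} (hD : D ∈ homEnd 𝒜 e')
    (D' : Module.End k A) (ψ : Cochain k A m) :
    precomp D (cupLeft 𝒜 D' e ψ) = (e' * e).negOnePow • cupLeft 𝒜 (D' ∘ₗ D) e ψ := by
  refine cochain_ext fun a => ?_
  rw [curryLeft_sign_smul, curryLeft_precomp]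
  simp only [cupLeft, curryLeft_consMul, LinearMap.comp_apply]
  rw [homEnd_koszulTwist hD, map_sign_smul, sign_smul_smul, smul_smul (_ : ℤˣ),
    Int.units_mul_self, one_smul]

theorem precomp_mem_diffCochain {m : ℕ} {d e : ℤ} {D : Module.End k A} (hD : IsDiffOp 𝒜 e D)
    {φ : Cochain k A (m + 1)} (hφ : φ ∈ diffCochain 𝒜 d (m + 1)) :
    precomp D φ ∈ diffCochain 𝒜 (d + e) (m + 1) := by
  induction hφ using Submodule.span_induction with
  | mem x hx =>
    obtain ⟨d₀, c, f, D', hc, hD', rfl, rfl⟩ := hx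
    rw [precomp_smul, mulTensor, precomp_cupLeft hD.mem_homEnd, smul_sign_smul]
    refine sign_smul_mem_cochain _ _ (Submodule.subset_span ⟨d₀, c, Fin.cons (f 0 + e) (Fin.tail f),
      Fin.cons (D' 0 ∘ₗ D) (Fin.tail D'), hc, ?_, ?_, rfl⟩)
    · intro i
      refine Fin.cases ?_ (fun i => ?_) i
      · exact .comp (hD' 0) hD
      · exact hD' i.succ
    · rw [Fin.sum_univ_succ, Fin.sum_univ_succ f]
      simp only [Fin.cons_zero, Fin.cons_succ, Fin.tail]
      ring
  | zero => rw [map_zero]; exact zero_mem _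
  | add x y _ _ hx hy => rw [map_add]; exact add_mem hx hy
  | smul r x _ hx => rw [map_smul]; exact Submodule.smul_mem _ r hx

theorem adL_mem_diffCochain {m : ℕ} {d i : ℤ} {y : A} (hy : y ∈ 𝒜 i) {φ : Cochain k A (m + 1)}
    (hφ : φ ∈ diffCochain 𝒜 d (m + 1)) : adL 𝒜 d y φ ∈ diffCochain 𝒜 (d + i) (m + 1) := by
  refine sub_mem (precomp_mem_diffCochain (.mul hy) hφ) ?_
  rw [add_comm d i]
  exact smul_mem_diffCochain (koszulTwist_mem hy) hφ

theorem isDiffOp_apply_one {d : ℤ} {D : Module.End k A} (hD : IsDiffOp 𝒜 d D) : D 1 ∈ 𝒜 d := by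
  have := hD.mem_homEnd 0 1 SetLike.GradedOne.one_mem
  rwa [zero_add] at this

theorem curryLeft_one_mem_diffCochain {m : ℕ} {d : ℤ} {φ : Cochain k A (m + 1)}
    (hφ : φ ∈ diffCochain 𝒜 d (m + 1)) : φ.curryLeft 1 ∈ diffCochain 𝒜 d m := by
  induction hφ using Submodule.span_induction with
  | mem x hx =>
    obtain ⟨d₀, c, f, D', hc, hD', rfl, rfl⟩ := hx
    have : (c • mulTensor 𝒜 f D').curryLeft 1 =
        (c * D' 0 1) • mulTensor 𝒜 (Fin.tail f) (Fin.tail D') := by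
      rw [curryLeft_smul, mulTensor, cupLeft, curryLeft_consMul, LinearMap.comp_apply,
        koszulTwist_one, smul_smul]
    rw [this]
    refine Submodule.subset_span ⟨d₀ + f 0, _, Fin.tail f, _,
      SetLike.mul_mem_graded hc (isDiffOp_apply_one (hD' 0)), fun i => hD' i.succ, ?_, rfl⟩
    rw [Fin.sum_univ_succ, add_assoc]
    rfl
  | zero => exact zero_mem _
  | add x y _ _ hx hy => exact add_mem hx hy
  | smul r x _ hx => exact Submodule.smul_mem _ r hx

theorem consMul_koszulTwist_eq {m : ℕ} (d : ℤ) (φ : Cochain k A m) :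
    consMul (koszulTwist 𝒜 d) φ = cupLeft 𝒜 LinearMap.id d φ := rfl

/-- These cochains are A-linear in the first slot, that is, of order zero there: they commute with
all multiplications at once. -/
theorem adL_consMul {m : ℕ} (d : ℤ) (y : A) (φ : Cochain k A m) :
    adL 𝒜 d y (consMul (koszulTwist 𝒜 d) φ) = 0 := by
  refine cochain_ext fun a => ?_
  rw [curryLeft_adL, curryLeft_consMul, curryLeft_consMul, koszulTwist_mul, mul_smul, sub_self]
  rfl

/-- Up to a sign and a left coefficient, a generating cochain is obtained from one which is A-linear
in the first slot, so of order less than 1, by composing that slot with a differential operator. -/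
theorem exists_ordLT [GradedCommutative 𝒜] {m : ℕ} {d : ℤ} {φ : Cochain k A (m + 1)}
    (hφ : φ ∈ diffCochain 𝒜 d (m + 1)) : ∃ r, OrdLT 𝒜 r d φ := by
  induction hφ using Submodule.span_induction with
  | mem x hx =>
    obtain ⟨d₀, c, f, D', hc, hD', rfl, rfl⟩ := hx
    have h1 : OrdLT 𝒜 1 (∑ i, Fin.tail f i) (consMul (koszulTwist 𝒜 (∑ i, Fin.tail f i))
        (mulTensor 𝒜 (Fin.tail f) (Fin.tail D'))) := fun i y hy => adL_consMul _ _ _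
    obtain ⟨r, hr⟩ := exists_ordLT_precomp (hD' 0) h1
    rw [consMul_koszulTwist_eq, precomp_cupLeft (hD' 0).mem_homEnd] at hr
    have h2 := (hr.sign_smul (f 0 * ∑ i, Fin.tail f i).negOnePow).smul hc
    rw [smul_smul, Int.units_mul_self, one_smul, add_comm _ d₀, add_comm _ (f 0)] at h2
    rw [Fin.sum_univ_succ]
    exact ⟨r, h2⟩
  | zero => exact ⟨0, rfl⟩
  | add x y _ _ hx hy =>
    obtain ⟨s, hs⟩ := hx
    obtain ⟨t, ht⟩ := hy
    exact ⟨max s t, (hs.mono (le_max_left s t)).add (ht.mono (le_max_right s t))⟩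
  | smul r x _ hx =>
    obtain ⟨s, hs⟩ := hx
    exact ⟨s, hs.algebra_smul r⟩

/-! ### The differential -/

/-- `hochschildTail` only multiplies the first argument from the right, so by associativity it does
not see left multiplications there. This is why all the subcomplexes of commuting cochains are
stable under the differential. -/
theorem hochschildTail_precomp_mulLeft {m : ℕ} (y : A) (φ : Cochain k A (m + 1)) :
    hochschildTail (m + 1) (precomp (LinearMap.mulLeft k y) φ) =
      precomp (LinearMap.mulLeft k y) (hochschildTail (m + 1) φ) := by
  refine cochain_ext fun a => cochain_ext fun b => ?_
  rw [curryLeft_precomp, curryLeft_hochschildTail, curryLeft_hochschildTail, curryLeft_sub,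
    curryLeft_sub, curryLeft_neg, curryLeft_neg, curryLeft_mergeFirst, curryLeft_mergeFirst,
    curryLeft_precomp, curryLeft_precomp]
  simp only [LinearMap.mulLeft_apply, mul_assoc]

theorem hochschildTail_adL {m : ℕ} (d : ℤ) (y : A) (φ : Cochain k A (m + 1)) :
    hochschildTail (m + 1) (adL 𝒜 d y φ) = adL 𝒜 d y (hochschildTail (m + 1) φ) := by
  rw [adL_apply, adL_apply, map_sub, hochschildTail_precomp_mulLeft, hochschildTail_smul]

/-- The bridge between the two complexes: the merge of the first two slots of an A-linear cochain
supplies precisely the missing left-module term of the Hochschild differential. -/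
theorem hochschildTail_consMul {m : ℕ} (d : ℤ) (φ : Cochain k A m) :
    hochschildTail (m + 1) (consMul (koszulTwist 𝒜 d) φ) =
      -consMul (koszulTwist 𝒜 d) (hochschildB 𝒜 d φ) := by
  refine cochain_ext fun a => ?_
  rw [curryLeft_hochschildTail, curryLeft_neg, curryLeft_consMul, curryLeft_consMul,
    hochschildTail_smul, hochschildB_eq, smul_add]
  have : (mergeFirst m (consMul (koszulTwist 𝒜 d) φ)).curryLeft a =
      koszulTwist 𝒜 d a • consMul (koszulTwist 𝒜 d) φ := by
    refine cochain_ext fun b => ?_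
    rw [curryLeft_mergeFirst, curryLeft_consMul, koszulTwist_mul, mul_smul]
    rfl
  rw [this]
  abel

/-- Putting 1 in the first slot is a contracting homotopy, since merging 1 with the next argument
gives φ back. The arity is at least two so that there is a next argument; arity one is treated in
`eq_consMul_of_closed`. -/
theorem eq_hochschildTail_of_closed {m : ℕ} {φ : Cochain k A (m + 2)}
    (h : hochschildTail (m + 2) φ = 0) : φ = -hochschildTail (m + 1) (φ.curryLeft 1) := by
  have h1 : (hochschildTail (m + 2) φ).curryLeft 1 = 0 := by rw [h]; rfl
  rw [curryLeft_hochschildTail] at h1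
  have h2 : (mergeFirst (m + 1) φ).curryLeft 1 = φ := by
    refine cochain_ext fun b => ?_
    rw [curryLeft_mergeFirst, one_mul]
  rw [h2, sub_eq_zero] at h1
  rw [← h1, neg_neg]

theorem hochschildTail_mem_diffCochain [GradedCommutative 𝒜] {m : ℕ} {d : ℤ} {φ : Cochain k A m}
    (hφ : φ ∈ diffCochain 𝒜 d m) : hochschildTail m φ ∈ diffCochain 𝒜 d (m + 1) := by
  have h1 := hochschildB_mem hφ
  rw [hochschildB_eq, consMul_koszulTwist_eq] at h1
  have h2 := cupLeft_mem (IsDiffOp.id 𝒜) hφ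
  rw [zero_add] at h2
  simpa using sub_mem h1 h2

end FirstSlot

end GradedHKR

/-! ## Local coordinates and the elimination of coordinates -/

namespace GradedHKR

/-- Homogeneous elements `x t` and homogeneous derivations `X t` which, after multiplication by
`ρ`, form a system of coordinates and the dual basis of the module of derivations. -/
structure LocalCoords {k : Type} [Field k] {A : Type u} [Ring A] [Algebra k A]
    (𝒜 : ℤ → Submodule k A) (ι : Type) [Fintype ι] [DecidableEq ι] where
  ρ : A
  ρ_mem : ρ ∈ 𝒜 0
  x : ι → A
  deg : ι → ℤ
  x_mem : ∀ t, x t ∈ 𝒜 (deg t)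
  X : ι → Module.End k A
  X_mem : ∀ t, X t ∈ gradedDer 𝒜 (-deg t)
  X_x : ∀ s t, X s (x t) = if s = t then ρ else 0
  complete : ∀ (e : ℤ) (D : Module.End k A), D ∈ gradedDer 𝒜 e → ρ • D = ∑ t, D (x t) • X t

/-! ### Sums of products of derivations with coefficients -/

section MultiDer

variable {k : Type} [Field k] {A : Type u} [Ring A] [Algebra k A]
variable (𝒜 : ℤ → Submodule k A) [GradedAlgebra 𝒜]

/-- The span of the cochains `c · μ ∘ (D₀ ⊗ ⋯ ⊗ D_{m-1})` for derivations `D i`. -/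
noncomputable def multiDer (d : ℤ) (m : ℕ) : Submodule k (Cochain k A m) :=
  Submodule.span k {φ | ∃ (d₀ : ℤ) (c : A) (e : Fin m → ℤ) (D : Fin m → Module.End k A),
    c ∈ 𝒜 d₀ ∧ (∀ i, D i ∈ gradedDer 𝒜 (e i)) ∧ d₀ + ∑ i, e i = d ∧ φ = c • mulTensor 𝒜 e D}

variable {𝒜}

theorem multiDer_le_diffCochain (d : ℤ) (m : ℕ) : multiDer 𝒜 d m ≤ diffCochain 𝒜 d m := by
  refine Submodule.span_mono ?_
  rintro _ ⟨d₀, c, e, D, hc, hD, h, rfl⟩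
  exact ⟨d₀, c, e, D, hc, fun i => .der (hD i), h, rfl⟩

theorem diffCochain_zero_le_multiDer (d : ℤ) : diffCochain 𝒜 d 0 ≤ multiDer 𝒜 d 0 := by
  refine Submodule.span_mono ?_
  rintro _ ⟨d₀, c, e, D, hc, hD, h, rfl⟩
  exact ⟨d₀, c, e, D, hc, fun i => i.elim0, h, rfl⟩

theorem smul_mem_multiDer {m : ℕ} {d d₀ : ℤ} {c : A} (hc : c ∈ 𝒜 d₀) {φ : Cochain k A m}
    (hφ : φ ∈ multiDer 𝒜 d m) : c • φ ∈ multiDer 𝒜 (d₀ + d) m := by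
  induction hφ using Submodule.span_induction with
  | mem x hx =>
    obtain ⟨d₁, c₁, e, D, hc₁, hD, rfl, rfl⟩ := hx
    exact Submodule.subset_span ⟨d₀ + d₁, c * c₁, e, D, SetLike.mul_mem_graded hc hc₁, hD,
      add_assoc _ _ _, (mul_smul _ _ _).symm⟩
  | zero => rw [smul_zero]; exact zero_mem _
  | add x y _ _ hx hy => rw [smul_add]; exact add_mem hx hy
  | smul r x _ hx => rw [smul_algebra_smul_comm]; exact Submodule.smul_mem _ r hx

variable [GradedCommutative 𝒜]

theorem hochschildB_of_mem_multiDer {m : ℕ} {d : ℤ} {φ : Cochain k A m}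
    (hφ : φ ∈ multiDer 𝒜 d m) : hochschildB 𝒜 d φ = 0 := by
  change φ ∈ LinearMap.ker (hochschildBₗ 𝒜 d m)
  refine Submodule.span_le.2 ?_ hφ
  rintro _ ⟨d₀, c, e, D, hc, hD, rfl, rfl⟩
  exact hochschildB_smul_mulTensor hc hD

theorem cupLeft_mem_multiDer {m : ℕ} {d e : ℤ} {D : Module.End k A} (hD : D ∈ gradedDer 𝒜 d)
    {φ : Cochain k A m} (hφ : φ ∈ multiDer 𝒜 e m) :
    cupLeft 𝒜 D e φ ∈ multiDer 𝒜 (d + e) (m + 1) := by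
  induction hφ using Submodule.span_induction with
  | mem x hx =>
    obtain ⟨d₀, c, f, D', hc, hD', rfl, rfl⟩ := hx
    rw [cupLeft_smul hc hD.1]
    refine sign_smul_mem_cochain _ _ (Submodule.subset_span
      ⟨d₀, c, Fin.cons d f, Fin.cons D D', hc, ?_, ?_, rfl⟩)
    · intro i
      refine Fin.cases ?_ (fun i => ?_) i
      · exact hD
      · exact hD' i
    · rw [Fin.sum_univ_succ]
      simp only [Fin.cons_zero, Fin.cons_succ]
      ring
  | zero =>
    have : cupLeft 𝒜 D e (0 : Cochain k A m) = 0 := by ext; simp [cupLeft]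
    rw [this]; exact zero_mem _
  | add x y _ _ hx hy =>
    convert add_mem hx hy using 1
    ext; simp [cupLeft, mul_add]
  | smul r x _ hx =>
    convert Submodule.smul_mem _ r hx using 1
    ext; simp [cupLeft]

/-- Only the cocycle condition for φ and the Leibniz rule for D enter. Applied to X_s ∪ μ, this
recognises the differential of the lift of a first-slot-linear class as a first-slot-linear
multiderivation. -/
theorem hochschildTail_cupLeft_der {m : ℕ} {d e : ℤ} {D : Module.End k A} (hD : D ∈ gradedDer 𝒜 d)
    {φ : Cochain k A m} (hφ : hochschildB 𝒜 e φ = 0) :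
    hochschildTail (m + 1) (cupLeft 𝒜 D e φ) =
      -consMul (koszulTwist 𝒜 (d + e)) (cupLeft 𝒜 D e φ) := by
  have h0 : hochschildTail m φ = -consMul (koszulTwist 𝒜 e) φ := by
    rw [hochschildB_eq] at hφ
    exact (neg_eq_of_add_eq_zero_right hφ).symm
  refine cochain_ext fun a => cochain_ext fun b => ?_
  rw [curryLeft_hochschildTail, curryLeft_sub, curryLeft_neg, curryLeft_mergeFirst]
  simp only [cupLeft, curryLeft_consMul, curryLeft_neg, LinearMap.comp_apply, curryLeft_smul]
  rw [hochschildTail_smul, curryLeft_smul, h0, curryLeft_neg, curryLeft_consMul,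
    koszulTwist_mul, gradedDer_leibniz hD, add_smul, mul_smul, mul_smul, ← koszulTwist_add,
    smul_neg]
  abel

end MultiDer

/-! ### Subcomplexes of cochains commuting with some of the coordinates -/

section CharZero

variable {k : Type} [Field k] {A : Type u} [Ring A] [Algebra k A]
variable {𝒜 : ℤ → Submodule k A} [GradedAlgebra 𝒜]
variable {ι : Type} [Fintype ι] [DecidableEq ι] (c : LocalCoords 𝒜 ι)

namespace LocalCoords

/-- Differential cochains of degree `d` which commute in the first slot with the multiplications
by the coordinates in `S`. -/
noncomputable def commuting (S : Finset ι) (d : ℤ) (m : ℕ) : Submodule k (Cochain k A (m + 1)) :=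
  diffCochain 𝒜 d (m + 1) ⊓ ⨅ t ∈ S, LinearMap.ker (adL 𝒜 d (c.x t))

variable {c}

theorem mem_commuting {S : Finset ι} {d : ℤ} {m : ℕ} {φ : Cochain k A (m + 1)} :
    φ ∈ c.commuting S d m ↔ φ ∈ diffCochain 𝒜 d (m + 1) ∧ ∀ t ∈ S, adL 𝒜 d (c.x t) φ = 0 := by
  simp [commuting, Submodule.mem_iInf]

theorem commuting_insert {S : Finset ι} {s : ι} {d : ℤ} {m : ℕ} {φ : Cochain k A (m + 1)} :
    φ ∈ c.commuting (insert s S) d m ↔ φ ∈ c.commuting S d m ∧ adL 𝒜 d (c.x s) φ = 0 := by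
  simp only [mem_commuting, Finset.mem_insert, forall_eq_or_imp]
  tauto

theorem consMul_mem_commuting [GradedCommutative 𝒜] {S : Finset ι} {d : ℤ} {m : ℕ}
    {φ : Cochain k A m} (hφ : φ ∈ diffCochain 𝒜 d m) :
    consMul (koszulTwist 𝒜 d) φ ∈ c.commuting S d m := by
  refine mem_commuting.2 ⟨?_, fun t _ => adL_consMul _ _ _⟩
  have := cupLeft_mem (IsDiffOp.id 𝒜) hφ
  rwa [zero_add] at this

section Comm

variable [GradedCommutative 𝒜]

theorem adL_mem_commuting {S : Finset ι} {d i : ℤ} {m : ℕ} {y : A} (hy : y ∈ 𝒜 i)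
    {φ : Cochain k A (m + 1)} (hφ : φ ∈ c.commuting S d m) :
    adL 𝒜 d y φ ∈ c.commuting S (d + i) m := by
  rw [mem_commuting] at hφ ⊢
  refine ⟨adL_mem_diffCochain hy hφ.1, fun t ht => ?_⟩
  rw [adL_adL (c.x_mem t) hy, hφ.2 t ht, map_zero, smul_zero]

theorem hochschildTail_mem_commuting {S : Finset ι} {d : ℤ} {m : ℕ}
    {φ : Cochain k A (m + 1)} (hφ : φ ∈ c.commuting S d m) :
    hochschildTail (m + 1) φ ∈ c.commuting S d (m + 1) := by
  rw [mem_commuting] at hφ ⊢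
  refine ⟨hochschildTail_mem_diffCochain hφ.1, fun t ht => ?_⟩
  rw [← hochschildTail_adL, hφ.2 t ht, map_zero]

theorem smul_mem_commuting {S : Finset ι} {d : ℤ} {m : ℕ} {r : A} (hr : r ∈ 𝒜 0)
    {φ : Cochain k A (m + 1)} (hφ : φ ∈ c.commuting S d m) : r • φ ∈ c.commuting S d m := by
  rw [mem_commuting] at hφ ⊢
  refine ⟨?_, fun t ht => ?_⟩
  · have := smul_mem_diffCochain hr hφ.1
    rwa [zero_add] at this
  · have := adL_smul (d := d) (c.x t) hr φ
    rw [add_zero] at this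
    rw [this, hφ.2 t ht, smul_zero]

theorem precomp_mulLeft_mem_commuting {S : Finset ι} {d : ℤ} {m : ℕ} {r : A} (hr : r ∈ 𝒜 0)
    {φ : Cochain k A (m + 1)} (hφ : φ ∈ c.commuting S d m) :
    precomp (LinearMap.mulLeft k r) φ ∈ c.commuting S d m := by
  rw [mem_commuting] at hφ ⊢
  refine ⟨?_, fun t ht => ?_⟩
  · have := precomp_mem_diffCochain (.mul hr) hφ.1
    rwa [add_zero] at this
  · have := adL_precomp_mulLeft (d := d) (c.x_mem t) hr φ
    rw [add_zero] at this
    rw [this, hφ.2 t ht, map_zero, smul_zero]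

/-- The commutator of X_s with x_t is multiplication by X_s(x_t), which is zero for t ≠ s; this is
where s ∉ S is needed. -/
theorem precomp_X_mem_commuting {S : Finset ι} {d d' : ℤ} {m : ℕ} {s : ι} (hs : s ∉ S)
    {φ : Cochain k A (m + 1)} (hφ : φ ∈ c.commuting S d m) (hd : d' + c.deg s = d) :
    precomp (c.X s) φ ∈ c.commuting S d' m := by
  have hd' : d' = d + -c.deg s := by omega
  subst hd'
  rw [mem_commuting] at hφ ⊢
  refine ⟨precomp_mem_diffCochain (.der (c.X_mem s)) hφ.1, fun t ht => ?_⟩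
  have hst : s ≠ t := fun h => hs (h ▸ ht)
  rw [adL_precomp (c.x_mem t) (c.X_mem s), hφ.2 t ht, c.X_x, if_neg hst, map_zero, smul_zero,
    add_zero]
  refine cochain_ext fun a => ?_
  rw [curryLeft_precomp, LinearMap.mulLeft_apply, zero_mul, map_zero]
  rfl

theorem ρ_pow_mem (M : ℕ) : c.ρ ^ M ∈ 𝒜 0 := by
  have := SetLike.pow_mem_graded M c.ρ_mem
  rwa [smul_zero] at this

/-- A cochain of finite order becomes divisible by `ρ` on the right after multiplication by a power
of `ρ` on the left. -/
theorem exists_precomp_ρ_eq {m : ℕ} (P : Submodule k (Cochain k A (m + 1)))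
    (hP : ∀ φ ∈ P, c.ρ • φ ∈ P) (hP' : ∀ φ ∈ P, precomp (LinearMap.mulLeft k c.ρ) φ ∈ P)
    {r : ℕ} {d : ℤ} {φ : Cochain k A (m + 1)} (hr : OrdLT 𝒜 r d φ) (hφ : φ ∈ P) :
    ∃ (M : ℕ) (ψ : Cochain k A (m + 1)), ψ ∈ P ∧
      c.ρ ^ M • φ = precomp (LinearMap.mulLeft k c.ρ) ψ := by
  have hpow : ∀ (M : ℕ) (φ : Cochain k A (m + 1)), φ ∈ P → c.ρ ^ M • φ ∈ P := by
    intro M φ hφ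
    induction M with
    | zero => rwa [pow_zero, one_smul]
    | succ M ih => rw [pow_succ', mul_smul]; exact hP _ ih
  induction r generalizing φ with
  | zero => exact ⟨0, 0, zero_mem _, by rw [hr, smul_zero, map_zero]⟩
  | succ r ih =>
    have h1 := hr 0 c.ρ c.ρ_mem
    rw [add_zero] at h1
    have h2 : adL 𝒜 d c.ρ φ = precomp (LinearMap.mulLeft k c.ρ) φ - c.ρ • φ := by
      rw [adL_apply, koszulTwist_of_mem_zero c.ρ_mem]
    -- The difference between multiplying by ρ inside the first slot and outside is a commutator,
    -- hence of lower order. By induction ρ^M times it is divisible by ρ inside, and solving for the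
    -- outer product gives ρ^{M+1} φ.
    obtain ⟨M, ψ, hψ, h⟩ := ih h1 (by rw [h2]; exact sub_mem (hP' _ hφ) (hP _ hφ))
    refine ⟨M + 1, c.ρ ^ M • φ - ψ, sub_mem (hpow M φ hφ) hψ, ?_⟩
    rw [map_sub, ← h, h2, precomp_smul, smul_sub, pow_succ, mul_smul]
    abel

end Comm

end LocalCoords

end CharZero

end GradedHKR

namespace GradedHKR

theorem mul_comm_of_mem_zero {k : Type} [Field k] {A : Type u} [Ring A] [Algebra k A]
    {𝒜 : ℤ → Submodule k A} [GradedAlgebra 𝒜] [GradedCommutative 𝒜] {r : A} (hr : r ∈ 𝒜 0)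
    (a : A) : a * r = r * a := by
  have := koszulTwist_mul_comm 𝒜 hr a
  rwa [koszulTwist_zero] at this

/-! ### Elimination of the coordinates one at a time -/

section Elimination

variable {k : Type} [Field k] [CharZero k] {A : Type u} [Ring A] [Algebra k A]
variable {𝒜 : ℤ → Submodule k A} [GradedAlgebra 𝒜] [GradedCommutative 𝒜]
variable {ι : Type} [Fintype ι] [DecidableEq ι] {c : LocalCoords 𝒜 ι}

theorem eq_zero_of_eq_neg (k : Type) [Field k] [CharZero k] {A : Type u} [Ring A] [Algebra k A]
    {a : A} (h : a = -a) : a = 0 := by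
  have h1 : (2 : k) • a = 0 := by
    rw [two_smul]
    nth_rewrite 1 [h]
    exact neg_add_cancel a
  exact (smul_eq_zero.1 h1).resolve_left two_ne_zero

theorem eq_zero_of_eq_neg_one_smul {m : ℕ} {φ : Cochain k A m} (h : φ = (-1 : ℤˣ) • φ) :
    φ = 0 := by
  ext a
  have h1 : φ a = (-1 : ℤˣ) • φ a := congrArg (fun χ => χ a) h
  rw [Units.neg_smul, one_smul] at h1
  exact eq_zero_of_eq_neg k h1

namespace LocalCoords

theorem pow_smul_mem_commuting {S : Finset ι} {d : ℤ} {m : ℕ} (M : ℕ)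
    {φ : Cochain k A (m + 1)} (hφ : φ ∈ c.commuting S d m) : c.ρ ^ M • φ ∈ c.commuting S d m :=
  smul_mem_commuting (ρ_pow_mem M) hφ

/-- The relation [X_s, x_s] = ρ. The sign (-1)^{-|x_s|²} is simplified using that a square has the
parity of its base. -/
theorem adL_precomp_X_self {d d' : ℤ} {m : ℕ} {s : ι} (hd : d' + c.deg s = d)
    (φ : Cochain k A (m + 1)) :
    adL 𝒜 d' (c.x s) (precomp (c.X s) φ) = precomp (LinearMap.mulLeft k c.ρ) φ +
      (c.deg s).negOnePow • precomp (c.X s) (adL 𝒜 d (c.x s) φ) := by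
  have hd' : d' = d + -c.deg s := by omega
  subst hd'
  rw [adL_precomp (c.x_mem s) (c.X_mem s), c.X_x, if_pos rfl]
  congr 2
  exact negOnePow_eq_of_even_sub (by
    rcases Int.even_or_odd (c.deg s) with h | h
    · exact (by simpa using h.mul_left _ : Even (-c.deg s * c.deg s)).sub h
    · exact ((h.neg).mul h).sub_odd h)

/-- In odd directions the image of the commutator with the coordinate contains, up to a power of
`ρ`, its kernel. -/
theorem exists_adL_eq_of_odd {S : Finset ι} {d d' : ℤ} {m : ℕ} {s : ι} (hs : s ∉ S)
    (hd : d' + c.deg s = d) {φ : Cochain k A (m + 1)} (hφ : φ ∈ c.commuting (insert s S) d m) :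
    ∃ (M : ℕ) (ψ : Cochain k A (m + 1)), ψ ∈ c.commuting S d' m ∧
      adL 𝒜 d' (c.x s) ψ = c.ρ ^ M • φ := by
  -- Write ρ^M φ as ψ with ρ inserted in the first slot, ψ still commuting with x_s. Then composing
  -- ψ with X_s is a preimage, because the second summand of the commutation relation vanishes.
  obtain ⟨r, hr⟩ := exists_ordLT (mem_commuting.1 hφ).1
  obtain ⟨M, ψ, hψ, h⟩ := exists_precomp_ρ_eq (c.commuting (insert s S) d m)
    (fun _ h => smul_mem_commuting c.ρ_mem h)
    (fun _ h => precomp_mulLeft_mem_commuting c.ρ_mem h) hr hφ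
  rw [commuting_insert] at hψ
  refine ⟨M, precomp (c.X s) ψ, precomp_X_mem_commuting hs hψ.1 hd, ?_⟩
  rw [adL_precomp_X_self hd, hψ.2, map_zero, smul_zero, add_zero, h]

/-- The commutator with a coordinate of even degree, which does not depend on the degree of the
cochain. -/
noncomputable def evenAd (c : LocalCoords 𝒜 ι) (s : ι) (m : ℕ) :
    Module.End k (Cochain k A (m + 1)) := adL 𝒜 0 (c.x s)

theorem adL_eq_evenAd {s : ι} (h : Even (c.deg s)) (d : ℤ) {m : ℕ} (φ : Cochain k A (m + 1)) :
    adL 𝒜 d (c.x s) φ = c.evenAd s m φ := by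
  rw [evenAd, adL_apply, adL_apply, koszulTwist_zero, koszulTwist_of_mem (c.x_mem s),
    Int.negOnePow_even _ (h.mul_left d), one_smul]

theorem exists_evenAd_pow_eq_zero {s : ι} (h : Even (c.deg s)) {r : ℕ} {d : ℤ} {m : ℕ}
    {φ : Cochain k A (m + 1)} (hφ : OrdLT 𝒜 r d φ) : (c.evenAd s m ^ r) φ = 0 := by
  induction r generalizing d φ with
  | zero => exact hφ
  | succ r ih =>
    have := ih (hφ _ _ (c.x_mem s))
    rwa [adL_eq_evenAd h] at this

theorem evenAd_mem {S : Finset ι} {d : ℤ} {m : ℕ} {s : ι} (h : Even (c.deg s))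
    {φ : Cochain k A (m + 1)} (hφ : φ ∈ c.commuting S d m) :
    c.evenAd s m φ ∈ c.commuting S (d + c.deg s) m := by
  rw [← adL_eq_evenAd h d]
  exact adL_mem_commuting (c.x_mem s) hφ

theorem evenAd_precomp_ρ {s : ι} {m : ℕ} :
    c.evenAd s m * precomp (LinearMap.mulLeft k c.ρ) =
      precomp (LinearMap.mulLeft k c.ρ) * c.evenAd s m := by
  refine LinearMap.ext fun φ => ?_
  have := adL_precomp_mulLeft (d := 0) (c.x_mem s) c.ρ_mem φ
  rw [zero_mul, Int.negOnePow_zero, one_smul, add_zero] at this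
  exact this

theorem evenAd_smul {s : ι} {m : ℕ} (φ : Cochain k A (m + 1)) (M : ℕ) :
    c.evenAd s m (c.ρ ^ M • φ) = c.ρ ^ M • c.evenAd s m φ := by
  have := adL_smul (d := 0) (c.x s) (ρ_pow_mem (c := c) M) φ
  rwa [add_zero] at this

theorem evenAd_pow_smul {s : ι} {m : ℕ} (φ : Cochain k A (m + 1)) (M r : ℕ) :
    (c.evenAd s m ^ r) (c.ρ ^ M • φ) = c.ρ ^ M • (c.evenAd s m ^ r) φ := by
  induction r generalizing φ with
  | zero => rfl
  | succ r ih => rw [pow_succ, Module.End.mul_apply, evenAd_smul, ih]; rfl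

/-- A Weyl relation in the endomorphism ring of the cochains, free of signs because x_s is even; it
makes the commutator behave like d/dt, with X_s as multiplication by t and ρ as 1. -/
theorem evenAd_precomp_X {s : ι} {m : ℕ} (h : Even (c.deg s)) :
    c.evenAd s m * precomp (c.X s) =
      precomp (LinearMap.mulLeft k c.ρ) + precomp (c.X s) * c.evenAd s m := by
  refine LinearMap.ext fun φ => ?_
  have := adL_precomp_X_self (sub_add_cancel 0 (c.deg s)) φ
  rw [adL_eq_evenAd h, adL_eq_evenAd h, Int.negOnePow_even _ h, one_smul] at this
  exact this

/-- The usual formula for powers of one generator in a Weyl algebra with central term r. The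
truncated exponent i - 1 at i = 0 is harmless, its factor being 0. -/
theorem pow_mul_eq_of_commutator {R : Type*} [Ring R] {a b r : R} (h : a * b = r + b * a)
    (hr : a * r = r * a) (i : ℕ) : a ^ i * b = b * a ^ i + i • (r * a ^ (i - 1)) := by
  induction i with
  | zero => simp
  | succ i ih =>
    rw [pow_succ', mul_assoc, ih, mul_add, ← mul_assoc, h, mul_smul_comm, ← mul_assoc, hr,
      add_mul, add_tsub_cancel_right, succ_nsmul]
    rcases i with _ | i
    · simp [add_comm]
    · rw [add_tsub_cancel_right, mul_assoc r, ← pow_succ', mul_assoc b, ← pow_succ']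
      abel

/-- In even directions the commutator with the coordinate is surjective up to a power of `ρ`. -/
theorem exists_adL_eq_of_even {S : Finset ι} {d d' : ℤ} {m : ℕ} {s : ι} (h : Even (c.deg s))
    (hs : s ∉ S) (hd : d' + c.deg s = d) {φ : Cochain k A (m + 1)} (hφ : φ ∈ c.commuting S d m) :
    ∃ (M : ℕ) (ψ : Cochain k A (m + 1)), ψ ∈ c.commuting S d' m ∧
      adL 𝒜 d' (c.x s) ψ = c.ρ ^ M • φ := by
  simp only [adL_eq_evenAd h]
  -- Finite order makes the commutator T with x_s nilpotent on φ, and the induction is on the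
  -- nilpotency index.
  suffices H : ∀ (r : ℕ) (φ : Cochain k A (m + 1)), φ ∈ c.commuting S d m →
      (c.evenAd s m ^ r) φ = 0 → ∃ (M : ℕ) (ψ : Cochain k A (m + 1)), ψ ∈ c.commuting S d' m ∧
        c.evenAd s m ψ = c.ρ ^ M • φ by
    obtain ⟨r, hr⟩ := exists_ordLT (mem_commuting.1 hφ).1
    exact H r φ hφ (exists_evenAd_pow_eq_zero h hr)
  intro r
  induction r with
  | zero =>
    intro φ _ h0
    exact ⟨0, 0, zero_mem _, by rw [show φ = 0 from h0, smul_zero, map_zero]⟩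
  | succ r ih =>
    intro φ hφ h0
    obtain ⟨q, hq⟩ := exists_ordLT (mem_commuting.1 hφ).1
    obtain ⟨M, g, hg, hgφ⟩ := exists_precomp_ρ_eq
      (c.commuting S d m ⊓ LinearMap.ker (c.evenAd s m ^ (r + 1)))
      (fun χ hχ => ⟨smul_mem_commuting c.ρ_mem hχ.1, by
        have h1 : (c.evenAd s m ^ (r + 1)) χ = 0 := hχ.2
        have := evenAd_pow_smul (c := c) (s := s) χ 1 (r + 1)
        rw [pow_one, h1, smul_zero] at this
        exact this⟩)
      (fun χ hχ => ⟨precomp_mulLeft_mem_commuting c.ρ_mem hχ.1, by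
        have h1 : (c.evenAd s m ^ (r + 1)) χ = 0 := hχ.2
        have h2 : Commute (c.evenAd s m ^ (r + 1)) (precomp (LinearMap.mulLeft k c.ρ)) :=
          Commute.pow_left evenAd_precomp_ρ _
        have := LinearMap.congr_fun h2.eq χ
        rw [Module.End.mul_apply, Module.End.mul_apply, h1, map_zero] at this
        exact this⟩) hq ⟨hφ, h0⟩
    have hg2 : (c.evenAd s m ^ (r + 1)) g = 0 := hg.2
    set R := precomp (m := m) (LinearMap.mulLeft k c.ρ) with hR
    -- Let Y be composition with X_s, so that TY = R + YT, and let ρ^M φ = R g. The naive preimage Y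
    -- g has the error Y T g. Since T^{r+1} g = 0, the Weyl formula gives T^r(Y T g) = r R T^r g, so
    -- subtracting r R g leaves an error killed by T^r, to which the induction applies. What remains
    -- is (r + 1) R g, and r + 1 is invertible in characteristic zero.
    have hν : precomp (c.X s) (c.evenAd s m g) - (r : k) • R g ∈ c.commuting S d m :=
      sub_mem (precomp_X_mem_commuting hs (evenAd_mem h hg.1) rfl)
        (Submodule.smul_mem _ _ (precomp_mulLeft_mem_commuting c.ρ_mem hg.1))
    have hν0 : (c.evenAd s m ^ r) (precomp (c.X s) (c.evenAd s m g) - (r : k) • R g) = 0 := by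
      have h1 := LinearMap.congr_fun (pow_mul_eq_of_commutator
        (R := Module.End k (Cochain k A (m + 1)))
        (evenAd_precomp_X (c := c) (m := m) h) evenAd_precomp_ρ r) (c.evenAd s m g)
      have h2 : Commute (c.evenAd s m ^ r) R := Commute.pow_left evenAd_precomp_ρ _
      have h3 := LinearMap.congr_fun h2.eq g
      have h4 : (c.evenAd s m ^ r) (c.evenAd s m g) = 0 := by
        rw [← Module.End.mul_apply, ← pow_succ, hg2]
      simp only [Module.End.mul_apply, LinearMap.add_apply, LinearMap.smul_apply, h4, map_zero,
        zero_add] at h1 h3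
      rw [map_sub, map_smul, h1, h3, Nat.cast_smul_eq_nsmul, sub_eq_zero]
      rcases r with _ | r
      · simp
      · rw [add_tsub_cancel_right, ← Module.End.mul_apply (c.evenAd s m ^ r), ← pow_succ]
    obtain ⟨M', η, hη, hη'⟩ := ih _ hν hν0
    have hr1 : ((r : k) + 1) ≠ 0 := by exact_mod_cast Nat.succ_ne_zero r
    refine ⟨M' + M, ((r : k) + 1)⁻¹ • (c.ρ ^ M' • precomp (c.X s) g - η),
      Submodule.smul_mem _ _ (sub_mem (pow_smul_mem_commuting _
        (precomp_X_mem_commuting hs hg.1 hd)) hη), ?_⟩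
    have h1 := LinearMap.congr_fun (evenAd_precomp_X (c := c) (m := m) h) g
    simp only [Module.End.mul_apply, LinearMap.add_apply] at h1
    rw [map_smul, map_sub, evenAd_smul, h1, hη']
    rw [show ∀ φ ψ : Cochain k A (m + 1), c.ρ ^ M' • φ - c.ρ ^ M' • ψ = c.ρ ^ M' • (φ - ψ) from
      fun φ ψ => (smul_sub _ _ _).symm]
    have h2 : R g + precomp (c.X s) (c.evenAd s m g) - (precomp (c.X s) (c.evenAd s m g) -
        (r : k) • R g) = ((r : k) + 1) • R g := by
      rw [add_smul, one_smul]; abel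
    rw [h2, smul_algebra_smul_comm, smul_smul, inv_mul_cancel₀ hr1, one_smul, pow_add, mul_smul,
      hgφ]

/-- The coboundaries in the complex of cochains commuting with the coordinates in `S`. -/
noncomputable def cobd (c : LocalCoords 𝒜 ι) (S : Finset ι) (d : ℤ) :
    (m : ℕ) → Submodule k (Cochain k A (m + 1))
  | 0 => ⊥
  | m + 1 => (c.commuting S d m).map (hochschildTail (m + 1))

/-- Evaluating the closedness at (1, a) gives φ(a) = φ(1) a. Since φ(1) is homogeneous of degree d,
it can be moved to the right of a at the cost of the Koszul twist. -/
theorem eq_consMul_of_closed {d : ℤ} {φ : Cochain k A 1} (hφ : φ ∈ diffCochain 𝒜 d 1)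
    (h : hochschildTail 1 φ = 0) :
    φ = consMul (koszulTwist 𝒜 d) (φ.curryLeft 1) := by
  have hd : φ (fun _ => 1) ∈ 𝒜 d := by
    have h1 := curryLeft_one_mem_diffCochain hφ
    have h2 : ∀ ψ ∈ diffCochain 𝒜 d 0, ψ Fin.elim0 ∈ 𝒜 d := by
      intro ψ hψ
      induction hψ using Submodule.span_induction with
      | mem x hx =>
        obtain ⟨d₀, c, f, D', hc, -, rfl, rfl⟩ := hx
        simpa [mulTensor] using hc
      | zero => exact zero_mem _
      | add x y _ _ hx hy => exact add_mem hx hy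
      | smul r x _ hx => exact Submodule.smul_mem _ r hx
    have h3 := h2 _ h1
    rw [MultilinearMap.curryLeft_apply] at h3
    convert h3 using 2
    ext i
    exact Fin.cases rfl (fun j => j.elim0) i
  ext a
  have h1 := congrArg (fun χ => χ (Fin.cons 1 a)) h
  simp only [hochschildTail_succ_apply, hochschildTail_zero_apply, MultilinearMap.curryLeft_apply,
    _root_.zero_apply, sub_neg_eq_add] at h1
  have h2 : (Fin.cons (1 : A) (Fin.elim0 : Fin 0 → A) : Fin 1 → A) = fun _ => 1 := by
    ext i; exact Fin.cases rfl (fun j => j.elim0) i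
  have h3 : Fin.tail a = Fin.elim0 := Subsingleton.elim _ _
  rw [consMul_apply, MultilinearMap.curryLeft_apply, h3, h2, koszulTwist_mul_comm 𝒜 hd]
  have h4 : (Fin.cons ((Fin.cons 1 a : Fin 2 → A) 0 * (Fin.cons 1 a : Fin 2 → A) 1)
      (Fin.tail (Fin.tail (Fin.cons 1 a : Fin 2 → A))) : Fin 1 → A) = a := by
    ext i; exact Fin.cases (by simp) (fun j => j.elim0) i
  rw [h4] at h1
  have h5 : (Fin.cons ((Fin.cons 1 a : Fin 2 → A) 0) (Fin.elim0 : Fin 0 → A) : Fin 1 → A) =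
      fun _ => 1 := by
    ext i; exact Fin.cases rfl (fun j => j.elim0) i
  rw [h5] at h1
  have h6 : φ a = φ (fun _ => 1) * a 0 := by
    rw [neg_add_eq_zero] at h1
    exact h1
  exact h6

theorem consMul_smul_of_mem_zero {m : ℕ} {r : A} (hr : r ∈ 𝒜 0) (f : Module.End k A)
    (φ : Cochain k A m) : consMul f (r • φ) = r • consMul f φ := by
  ext a
  simp only [consMul_apply, _root_.smul_apply, smul_eq_mul, ← mul_assoc, mul_comm_of_mem_zero hr]

theorem smul_mem_multiDer_zero {m : ℕ} {d : ℤ} {r : A} (hr : r ∈ 𝒜 0) {φ : Cochain k A m}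
    (hφ : φ ∈ multiDer 𝒜 d m) : r • φ ∈ multiDer 𝒜 d m := by
  have := smul_mem_multiDer hr hφ
  rwa [zero_add] at this

/-- A cocycle `ψ` whose coboundary commutes with `x s` can be corrected so as to commute with
`x s`, up to a power of `ρ` and multiderivations. -/
theorem exists_correction {S : Finset ι} {s : ι} (hs : s ∉ S) {d : ℤ} {m : ℕ}
    {ψ : Cochain k A (m + 1)} (hψ : ψ ∈ c.commuting S d m)
    (h : ∃ (M : ℕ) (μ : Cochain k A m), μ ∈ multiDer 𝒜 (d + c.deg s) m ∧
      c.ρ ^ M • adL 𝒜 d (c.x s) ψ - consMul (koszulTwist 𝒜 (d + c.deg s)) μ ∈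
        (c.cobd (if Even (c.deg s) then S else insert s S) (d + c.deg s) m)) :
    ∃ (M : ℕ) (μ : Cochain k A (m + 1)) (ψ' : Cochain k A (m + 1)), μ ∈ multiDer 𝒜 d (m + 1) ∧
      ψ' ∈ c.commuting (insert s S) d m ∧ c.ρ ^ M • hochschildTail (m + 1) ψ =
        consMul (koszulTwist 𝒜 d) μ + hochschildTail (m + 1) ψ' := by
  obtain ⟨M, μ, hμ, h⟩ := h
  set e := d + c.deg s with he
  -- The coboundary part of the commutator is lifted through `adL`, which commutes with the
  -- differential. The lift η is itself a coboundary, hence closed, and does not affect the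
  -- differential of ψ.
  obtain ⟨M', η, hη, hη0, h⟩ : ∃ (M' : ℕ) (η : Cochain k A (m + 1)), η ∈ c.commuting S d m ∧
      hochschildTail (m + 1) η = 0 ∧ c.ρ ^ M' • (c.ρ ^ M • adL 𝒜 d (c.x s) ψ -
        consMul (koszulTwist 𝒜 e) μ) = adL 𝒜 d (c.x s) η := by
    cases m with
    | zero =>
      rw [cobd, Submodule.mem_bot] at h
      exact ⟨0, 0, zero_mem _, map_zero _, by rw [h, smul_zero, map_zero]⟩
    | succ m =>
      obtain ⟨χ, hχ, h⟩ := h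
      have : ∃ (M : ℕ) (ψ : Cochain k A (m + 1)), ψ ∈ c.commuting S d m ∧
          adL 𝒜 d (c.x s) ψ = c.ρ ^ M • χ := by
        split_ifs at hχ with hev
        · exact exists_adL_eq_of_even hev hs he.symm hχ
        · exact exists_adL_eq_of_odd hs he.symm hχ
      obtain ⟨M', η, hη, h'⟩ := this
      refine ⟨M', hochschildTail (m + 1) η, hochschildTail_mem_commuting hη,
        hochschildTail_hochschildTail _, ?_⟩
      rw [← h, ← hochschildTail_adL, h', hochschildTail_smul]
  have hX : IsDiffOp 𝒜 (-c.deg s) (c.X s) := .der (c.X_mem s)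
  -- A lift of the first-slot-linear part. Since X_s(x_s) = ρ, its commutator with x_s is the given
  -- part times an additional ρ. Its differential is not zero, but first-slot linear with underlying
  -- multiderivation ∓X_s ∪ μ.
  set θ := precomp (c.X s) (consMul (koszulTwist 𝒜 e) (c.ρ ^ M' • μ)) with hθ
  have hμ' : c.ρ ^ M' • μ ∈ multiDer 𝒜 e m := smul_mem_multiDer_zero (ρ_pow_mem _) hμ
  have hθ1 : θ ∈ c.commuting S d m := precomp_X_mem_commuting hs
    (consMul_mem_commuting (multiDer_le_diffCochain _ _ hμ')) he.symm
  have hθ2 : adL 𝒜 d (c.x s) θ = c.ρ ^ (1 + M') • consMul (koszulTwist 𝒜 e) μ := by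
    rw [hθ, adL_precomp_X_self he.symm, adL_consMul, map_zero, smul_zero, add_zero, pow_add,
      pow_one, mul_smul, ← consMul_smul_of_mem_zero (ρ_pow_mem M')]
    refine cochain_ext fun a => ?_
    rw [curryLeft_precomp, curryLeft_smul, curryLeft_consMul, curryLeft_consMul,
      LinearMap.mulLeft_apply, koszulTwist_mul, koszulTwist_of_mem_zero c.ρ_mem, mul_smul]
  have hθ3 : hochschildTail (m + 1) θ = consMul (koszulTwist 𝒜 d)
      (-((-c.deg s * e).negOnePow • cupLeft 𝒜 (c.X s) e (c.ρ ^ M' • μ))) := by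
    rw [hθ, consMul_koszulTwist_eq, precomp_cupLeft (c.X_mem s).1, LinearMap.id_comp,
      map_sign_smul_cochain, hochschildTail_cupLeft_der (c.X_mem s)
        (hochschildB_of_mem_multiDer hμ'), show -c.deg s + e = d by rw [he]; ring]
    refine cochain_ext fun a => ?_
    rw [curryLeft_sign_smul, curryLeft_neg, curryLeft_consMul, curryLeft_consMul, smul_neg,
      smul_neg, smul_sign_smul]
  -- M comes from the hypothesis, M' from lifting the coboundary, and the extra 1 from X_s(x_s) = ρ.
  -- For the same reason η is multiplied by one factor ρ.
  refine ⟨1 + M' + M, -((-c.deg s * e).negOnePow • cupLeft 𝒜 (c.X s) e (c.ρ ^ M' • μ)),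
    c.ρ ^ (1 + M' + M) • ψ - c.ρ • η - θ, ?_, ?_, ?_⟩
  · have := cupLeft_mem_multiDer (c.X_mem s) hμ'
    rw [show -c.deg s + e = d by rw [he]; ring] at this
    exact neg_mem (sign_smul_mem_cochain _ _ this)
  · refine commuting_insert.2 ⟨sub_mem (sub_mem (pow_smul_mem_commuting _ hψ)
      (smul_mem_commuting c.ρ_mem hη)) hθ1, ?_⟩
    have h1 := adL_smul (d := d) (c.x s) (ρ_pow_mem (c := c) (1 + M' + M)) ψ
    have h2 := adL_smul (d := d) (c.x s) c.ρ_mem η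
    rw [add_zero] at h1 h2
    rw [map_sub, map_sub, hθ2, h1, h2, ← h, smul_sub, smul_sub, pow_add, pow_add, pow_one,
      mul_smul, mul_smul, mul_smul]
    abel
  · rw [map_sub, map_sub, hθ3, hochschildTail_smul, hochschildTail_smul, hη0, smul_zero, sub_zero]
    abel

/-- Cocycles commuting with some of the coordinates are, up to a power of `ρ`, sums of
multiderivations and coboundaries. -/
theorem exists_multiDer_add_cobd (S : Finset ι) : ∀ (m : ℕ) (d : ℤ) (φ : Cochain k A (m + 1)),
    φ ∈ c.commuting S d m → hochschildTail (m + 1) φ = 0 →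
    ∃ (M : ℕ) (μ : Cochain k A m), μ ∈ multiDer 𝒜 d m ∧
      c.ρ ^ M • φ - consMul (koszulTwist 𝒜 d) μ ∈ c.cobd S d m := by
  have hzero : ∀ (S : Finset ι) (d : ℤ) (φ : Cochain k A 1),
      φ ∈ c.commuting S d 0 → hochschildTail 1 φ = 0 →
      ∃ (M : ℕ) (μ : Cochain k A 0), μ ∈ multiDer 𝒜 d 0 ∧
        c.ρ ^ M • φ - consMul (koszulTwist 𝒜 d) μ ∈ c.cobd S d 0 := by
    intro S d φ hφ h
    have hφ' := (mem_commuting.1 hφ).1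
    refine ⟨0, φ.curryLeft 1, diffCochain_zero_le_multiDer _
      (curryLeft_one_mem_diffCochain hφ'), ?_⟩
    rw [pow_zero, one_smul, ← eq_consMul_of_closed hφ' h, sub_self]
    exact zero_mem _
  induction S using Finset.induction_on with
  | empty =>
    intro m
    cases m with
    | zero => exact hzero ∅
    | succ m =>
      intro d φ hφ h
      -- With no commutation imposed the complex is exact in arity at least two, and evaluation at 1
      -- gives the primitive.
      refine ⟨0, 0, zero_mem _, -φ.curryLeft 1, mem_commuting.2 ⟨neg_mem
        (curryLeft_one_mem_diffCochain (mem_commuting.1 hφ).1), by simp⟩, ?_⟩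
      have h0 : consMul (koszulTwist 𝒜 d) (0 : Cochain k A (m + 1)) = 0 := by ext; simp
      rw [map_neg, ← eq_hochschildTail_of_closed h, pow_zero, one_smul, h0, sub_zero]
  | insert s S hs ih =>
    intro m
    induction m with
    | zero => exact hzero _
    | succ m ihm =>
      intro d φ hφ h
      rw [commuting_insert] at hφ
      -- The primitive ψ only commutes with the coordinates in S. Its commutator with x_s is again
      -- closed, of arity one less than φ, and represents the image of φ under the connecting map.
      obtain ⟨M, μ, hμ, ψ, hψ, hψφ⟩ := ih (m + 1) d φ hφ.1 h
      have hu : adL 𝒜 d (c.x s) (hochschildTail (m + 1) ψ) = 0 := by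
        have h1 := adL_smul (d := d) (c.x s) (ρ_pow_mem (c := c) M) φ
        rw [add_zero] at h1
        rw [hψφ, map_sub, h1, hφ.2, smul_zero, adL_consMul, sub_zero]
      rw [← hochschildTail_adL] at hu
      have hu' := adL_mem_commuting (c.x_mem s) hψ
      -- For even x_s the commutator is onto, so the quotient complex is `commuting S` again and the
      -- hypothesis on S applies. For odd x_s the commutator lies in the smaller complex, since it
      -- squares to zero, and the induction on the arity applies.
      obtain ⟨M', μ', ψ', hμ', hψ', h'⟩ := exists_correction hs hψ (by
        split_ifs with hev
        · exact ih m _ _ hu' hu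
        · refine ihm _ _ (commuting_insert.2 ⟨hu', ?_⟩) hu
          have h1 := adL_adL (d := d) (c.x_mem s) (c.x_mem s) ψ
          have hodd := Int.not_even_iff_odd.1 hev
          rw [Int.negOnePow_odd _ (hodd.mul hodd)] at h1
          exact eq_zero_of_eq_neg_one_smul h1)
      refine ⟨M' + M, c.ρ ^ M' • μ + μ', add_mem (smul_mem_multiDer_zero (ρ_pow_mem _) hμ) hμ',
        ψ', hψ', ?_⟩
      have h2 : consMul (koszulTwist 𝒜 d) (c.ρ ^ M' • μ + μ') =
          c.ρ ^ M' • consMul (koszulTwist 𝒜 d) μ + consMul (koszulTwist 𝒜 d) μ' := by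
        rw [← consMul_smul_of_mem_zero (ρ_pow_mem M')]
        ext a; simp [mul_add]
      rw [hψφ, smul_sub] at h'
      rw [h2, pow_add, mul_smul, ← sub_sub, h']
      abel

end LocalCoords

end Elimination

end GradedHKR

namespace GradedHKR

/-! ### Decomposition of cocycles in coordinates, and gluing over a partition of unity -/

section Decomposition

variable {k : Type} [Field k] {A : Type u} [Ring A] [Algebra k A]
variable {𝒜 : ℤ → Submodule k A} [GradedAlgebra 𝒜]

theorem cochain_ext_homogeneous {m : ℕ} {φ ψ : Cochain k A m}
    (h : ∀ (i : Fin m → ℤ) (a : Fin m → A), (∀ j, a j ∈ 𝒜 (i j)) → φ a = ψ a) : φ = ψ := by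
  induction m with
  | zero =>
    ext a
    exact h Fin.elim0 a fun j => j.elim0
  | succ m ih =>
    have : φ.curryLeft = ψ.curryLeft := by
      refine ext_homogeneous (𝒜 := 𝒜) fun i a ha => ih fun j b hb => ?_
      refine h (Fin.cons i j) (Fin.cons a b) fun l => ?_
      refine Fin.cases ?_ (fun l => ?_) l
      · exact ha
      · exact hb l
    exact cochain_ext fun a => by rw [this]

theorem mulTensor_mem_homogeneous {m : ℕ} {e : Fin m → ℤ} {D : Fin m → Module.End k A}
    (h : ∀ i, D i ∈ homEnd 𝒜 (e i)) {i : Fin m → ℤ} {a : Fin m → A} (ha : ∀ j, a j ∈ 𝒜 (i j)) :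
    mulTensor 𝒜 e D a ∈ 𝒜 (∑ j, e j + ∑ j, i j) := by
  induction m with
  | zero => simpa [mulTensor] using SetLike.GradedOne.one_mem (A := 𝒜)
  | succ m ih =>
    have h1 := ih (e := Fin.tail e) (D := Fin.tail D) (fun j => h j.succ) (i := Fin.tail i)
      (a := Fin.tail a) fun j => ha j.succ
    have h2 := SetLike.mul_mem_graded (h 0 _ _ (koszulTwist_mem (d := ∑ i, Fin.tail e i) (ha 0))) h1
    rw [Fin.sum_univ_succ, Fin.sum_univ_succ i]
    have h3 : e 0 + ∑ j : Fin m, e j.succ + (i 0 + ∑ j : Fin m, i j.succ) =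
        i 0 + e 0 + (∑ j, Fin.tail e j + ∑ j, Fin.tail i j) := by
      simp only [Fin.tail]; ring
    rw [h3]
    exact h2

theorem diffCochain_apply_mem {m : ℕ} {d : ℤ} {φ : Cochain k A m} (hφ : φ ∈ diffCochain 𝒜 d m)
    {i : Fin m → ℤ} {a : Fin m → A} (ha : ∀ j, a j ∈ 𝒜 (i j)) : φ a ∈ 𝒜 (d + ∑ j, i j) := by
  induction hφ using Submodule.span_induction with
  | mem x hx =>
    obtain ⟨d₀, c, f, D', hc, hD', rfl, rfl⟩ := hx
    rw [add_assoc]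
    exact SetLike.mul_mem_graded hc (mulTensor_mem_homogeneous (fun i => (hD' i).mem_homEnd) ha)
  | zero => exact zero_mem _
  | add x y _ _ hx hy => exact add_mem hx hy
  | smul r x _ hx => exact Submodule.smul_mem _ r hx

/-- The operator obtained from a cochain by fixing all arguments but the first. -/
def firstSlot {m : ℕ} (φ : Cochain k A (m + 1)) (b : Fin m → A) : Module.End k A where
  toFun y := φ.curryLeft y b
  map_add' y z := by rw [map_add]; rfl
  map_smul' r y := by rw [map_smul]; rfl

variable [GradedCommutative 𝒜]

/-- Expansion of a cochain which is a derivation in the first slot with respect to a dual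
family of the module of derivations. -/
theorem smul_eq_sum_cupLeft {ι : Type*} [Fintype ι] {r : A} {x : ι → A} {n : ι → ℤ}
    {X : ι → Module.End k A} (hx : ∀ t, x t ∈ 𝒜 (n t)) (hX : ∀ t, X t ∈ gradedDer 𝒜 (-n t))
    (hc : ∀ (e : ℤ) (D : Module.End k A), D ∈ gradedDer 𝒜 e → r • D = ∑ t, D (x t) • X t)
    {m : ℕ} {d : ℤ} {φ : Cochain k A (m + 1)}
    (hhom : ∀ (i : Fin (m + 1) → ℤ) (a : Fin (m + 1) → A), (∀ j, a j ∈ 𝒜 (i j)) →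
      φ a ∈ 𝒜 (d + ∑ j, i j))
    (hder : ∀ (i : ℤ) (y z : A), y ∈ 𝒜 i → φ.curryLeft (y * z) =
      koszulTwist 𝒜 d y • φ.curryLeft z + koszulTwist 𝒜 (d + i) z • φ.curryLeft y) :
    r • φ = ∑ t, ((d + 1) * n t).negOnePow • cupLeft 𝒜 (X t) (d + n t) (φ.curryLeft (x t)) := by
  refine cochain_ext_homogeneous (𝒜 := 𝒜) fun i a ha => ?_
  set b := Fin.tail a with hb
  set e := ∑ j, Fin.tail i j with he
  have hhom' : ∀ (j : ℤ) (y : A), y ∈ 𝒜 j → φ.curryLeft y b ∈ 𝒜 (d + j + e) := by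
    intro j y hy
    have := hhom (Fin.cons j (Fin.tail i)) (Fin.cons y b) (fun l => by
      refine Fin.cases ?_ (fun l => ?_) l
      · exact hy
      · exact ha l.succ)
    rw [Fin.sum_univ_succ, Fin.cons_zero, ← add_assoc] at this
    exact this
  -- With the other arguments b frozen, the twist by their total degree e turns the first slot into
  -- a genuine graded derivation of degree d + e, to which the expansion in the X_t applies.
  set D : Module.End k A := firstSlot φ b ∘ₗ koszulTwist 𝒜 e with hD
  have hDapp : ∀ (j : ℤ) (y : A), y ∈ 𝒜 j → D y = (e * j).negOnePow • φ.curryLeft y b := by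
    intro j y hy
    rw [hD, LinearMap.comp_apply, koszulTwist_of_mem hy, map_sign_smul]
    rfl
  have hDder : D ∈ gradedDer 𝒜 (d + e) := by
    refine ⟨fun j y hy => ?_, fun j y z hy => ?_⟩
    · rw [hDapp j y hy]
      have := sign_smul_mem (k := k) (𝒜 _) (e * j).negOnePow (hhom' j y hy)
      rwa [show d + j + e = j + (d + e) by ring] at this
    · have h1 : D (y * z) = (e * j).negOnePow •
          (φ.curryLeft (y * koszulTwist 𝒜 e z) : Cochain k A m) b := by
        rw [hD, LinearMap.comp_apply, koszulTwist_mul, koszulTwist_of_mem hy, smul_mul_assoc,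
          map_sign_smul]
        rfl
      rw [h1, hder j y _ hy]
      have h2 : (koszulTwist 𝒜 d y • φ.curryLeft (koszulTwist 𝒜 e z) +
          koszulTwist 𝒜 (d + j) (koszulTwist 𝒜 e z) • φ.curryLeft y : Cochain k A m) b =
          koszulTwist 𝒜 d y * D z +
            koszulTwist 𝒜 (d + j) (koszulTwist 𝒜 e z) * φ.curryLeft y b := rfl
      rw [h2, ← koszulTwist_add, koszulTwist_mul_comm 𝒜 (hhom' j y hy), hDapp j y hy,
        koszulTwist_of_mem hy, smul_mul_assoc, smul_mul_assoc, smul_add, smul_smul, add_comm,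
        ← Int.negOnePow_add, add_mul, add_comm (e * j)]
  have key := LinearMap.congr_fun (hc _ D hDder) (koszulTwist 𝒜 e (a 0))
  have hL : (r • D) (koszulTwist 𝒜 e (a 0)) = (r • φ) a := by
    rw [LinearMap.smul_apply, hD, LinearMap.comp_apply, ← koszulTwist_add,
      koszulTwist_of_mem (ha 0), Int.negOnePow_even _ ((Even.add_self e).mul_right _), one_smul]
    change r * φ (Fin.cons (a 0) (Fin.tail a)) = r * φ a
    rw [Fin.cons_self_tail]
  rw [← hL, key, LinearMap.sum_apply]
  have hR : ∀ t, (D (x t) • X t) (koszulTwist 𝒜 e (a 0)) =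
      (((d + 1) * n t).negOnePow • cupLeft 𝒜 (X t) (d + n t) (φ.curryLeft (x t))) a := by
    intro t
    have h1 : (((d + 1) * n t).negOnePow • cupLeft 𝒜 (X t) (d + n t) (φ.curryLeft (x t))) a =
      ((d + 1) * n t).negOnePow • (X t (koszulTwist 𝒜 (d + n t) (a 0)) *
        φ.curryLeft (x t) b) := rfl
    have h2 := hX t |>.1 _ _ (ha 0)
    have h3 := hhom' _ _ (hx t)
    rw [h1, LinearMap.smul_apply, smul_eq_mul, hDapp _ _ (hx t), homEnd_koszulTwist (hX t).1,
      homEnd_koszulTwist (hX t).1, koszulTwist_of_mem h2, koszulTwist_of_mem h2]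
    simp only [smul_mul_assoc, mul_smul_comm, smul_smul]
    rw [GradedCommutative.comm h3 h2, smul_smul]
    simp only [← Int.negOnePow_add]
    congr 1
    refine negOnePow_eq_of_even_sub ?_
    have h4 := (Int.even_mul_pred_self (n t)).add (even_two_mul (e * (i 0 + -n t)))
    refine (congrArg Even ?_).mpr h4
    ring
  rw [Finset.sum_congr rfl fun t _ => hR t]
  exact (_root_.sum_apply _ _ _).symm

theorem hochschildB_smul {m : ℕ} {d₀ d : ℤ} {r : A} (hr : r ∈ 𝒜 d₀) (φ : Cochain k A m) :
    hochschildB 𝒜 (d₀ + d) (r • φ) = r • hochschildB 𝒜 d φ := by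
  rw [hochschildB_eq, hochschildB_eq, hochschildTail_smul, smul_add]
  congr 1
  ext a
  simp only [consMul_apply, _root_.smul_apply, smul_eq_mul, ← mul_assoc]
  rw [koszulTwist_add, koszulTwist_mul_comm 𝒜 hr]

variable (𝒜) in
/-- The coboundaries of multidifferential operators. -/
noncomputable def diffCobd (d : ℤ) : (m : ℕ) → Submodule k (Cochain k A m)
  | 0 => ⊥
  | m + 1 => (diffCochain 𝒜 d m).map (hochschildBₗ 𝒜 d m)

theorem smul_mem_diffCobd {m : ℕ} {d₀ d : ℤ} {r : A} (hr : r ∈ 𝒜 d₀) {φ : Cochain k A m}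
    (hφ : φ ∈ diffCobd 𝒜 d m) : r • φ ∈ diffCobd 𝒜 (d₀ + d) m := by
  cases m with
  | zero =>
    rw [diffCobd, Submodule.mem_bot] at hφ ⊢
    rw [hφ, smul_zero]
  | succ m =>
    obtain ⟨ψ, hψ, rfl⟩ := hφ
    exact ⟨r • ψ, smul_mem_diffCochain hr hψ, hochschildB_smul hr ψ⟩

section LocalCoords

variable [CharZero k] {ι : Type} [Fintype ι] [DecidableEq ι] {c : LocalCoords 𝒜 ι}

namespace LocalCoords

/-- Order less than 1 means that every multiplication can be pulled out of the first slot, so the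
value at 1 determines the cochain. -/
theorem eq_consMul_of_ordLT_one {d : ℤ} {m : ℕ} {φ : Cochain k A (m + 1)} (h : OrdLT 𝒜 1 d φ) :
    φ = consMul (koszulTwist 𝒜 d) (φ.curryLeft 1) := by
  have h1 : φ.curryLeft = (consMul (koszulTwist 𝒜 d) (φ.curryLeft 1)).curryLeft := by
    refine ext_homogeneous (𝒜 := 𝒜) fun i a ha => ?_
    have h2 := congrArg (fun χ => MultilinearMap.curryLeft χ 1) (h i a ha)
    simp only [curryLeft_adL, mul_one] at h2
    rw [curryLeft_consMul]
    exact sub_eq_zero.1 h2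
  exact cochain_ext fun a => by rw [← h1]

/-- After subtracting its A-linear part, a first-order operator is a derivation in the first slot.
Since φ commutes with all coordinates, this derivation kills them all, and completeness of the X_t
shows that ρ times it is zero. -/
theorem ordLT_one_smul {d : ℤ} {m : ℕ} {φ : Cochain k A (m + 1)}
    (hφ : φ ∈ c.commuting Finset.univ d m) (h : OrdLT 𝒜 2 d φ) : OrdLT 𝒜 1 d (c.ρ • φ) := by
  set φ' := φ - consMul (koszulTwist 𝒜 d) (φ.curryLeft 1) with hφ'
  have h1 : φ' ∈ diffCochain 𝒜 d (m + 1) := by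
    have := cupLeft_mem (IsDiffOp.id 𝒜)
      (curryLeft_one_mem_diffCochain (mem_commuting.1 hφ).1)
    rw [zero_add] at this
    exact sub_mem (mem_commuting.1 hφ).1 this
  have hval : ∀ y, φ'.curryLeft y = (adL 𝒜 d y φ).curryLeft 1 := by
    intro y
    rw [hφ', curryLeft_sub, curryLeft_consMul, curryLeft_adL, mul_one]
  have h2 : ∀ (i : ℤ) (y z : A), y ∈ 𝒜 i → φ'.curryLeft (y * z) =
      koszulTwist 𝒜 d y • φ'.curryLeft z + koszulTwist 𝒜 (d + i) z • φ'.curryLeft y := by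
    intro i y z hy
    have h3 := congrArg (fun χ => MultilinearMap.curryLeft χ z)
      (eq_consMul_of_ordLT_one (h i y hy))
    simp only [curryLeft_consMul] at h3
    rw [hval y, ← h3, curryLeft_adL, hφ', curryLeft_sub, curryLeft_sub, curryLeft_consMul,
      curryLeft_consMul, koszulTwist_mul, mul_smul, smul_sub]
    abel
  have h3 := smul_eq_sum_cupLeft c.x_mem c.X_mem c.complete
    (fun i a ha => diffCochain_apply_mem h1 ha) h2
  have h4 : ∀ t, φ'.curryLeft (c.x t) = 0 := fun t => by
    rw [hval, (mem_commuting.1 hφ).2 t (Finset.mem_univ t)]; rfl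
  have h5 : c.ρ • φ' = 0 := by
    rw [h3]
    refine Finset.sum_eq_zero fun t _ => ?_
    rw [h4]
    have : cupLeft 𝒜 (c.X t) (d + c.deg t) (0 : Cochain k A m) = 0 := by ext; simp [cupLeft]
    rw [this, smul_zero]
  intro i y hy
  rw [hφ', smul_sub, sub_eq_zero] at h5
  have h6 := adL_smul (d := d) y c.ρ_mem (consMul (koszulTwist 𝒜 d) (φ.curryLeft 1))
  rw [adL_consMul, smul_zero, add_zero] at h6
  rw [h5]
  exact h6

/-- Commutators stay in the commuting subcomplex and lower the order, so everything reduces to first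
order; each factor ρ buys one order. -/
theorem ordLT_smul {d : ℤ} {m r : ℕ} {φ : Cochain k A (m + 1)}
    (hφ : φ ∈ c.commuting Finset.univ d m) (h : OrdLT 𝒜 (r + 2) d φ) :
    OrdLT 𝒜 (r + 1) d (c.ρ • φ) := by
  induction r generalizing d φ with
  | zero => exact ordLT_one_smul hφ h
  | succ r ih =>
    intro i y hy
    have h6 := adL_smul (d := d) y c.ρ_mem φ
    rw [add_zero] at h6
    rw [h6]
    exact ih (adL_mem_commuting hy hφ) (h i y hy)

/-- A differential cochain commuting with all coordinates is linear over `A` in the first slot,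
up to a power of `ρ`. -/
theorem exists_pow_smul_eq_consMul {d : ℤ} {m : ℕ} {φ : Cochain k A (m + 1)}
    (hφ : φ ∈ c.commuting Finset.univ d m) : ∃ (M : ℕ) (ψ : Cochain k A m),
      ψ ∈ diffCochain 𝒜 d m ∧ c.ρ ^ M • φ = consMul (koszulTwist 𝒜 d) ψ := by
  suffices H : ∀ (r : ℕ) (φ : Cochain k A (m + 1)), φ ∈ c.commuting Finset.univ d m →
      OrdLT 𝒜 (r + 1) d φ → OrdLT 𝒜 1 d (c.ρ ^ r • φ) by
    obtain ⟨r, hr⟩ := exists_ordLT (mem_commuting.1 hφ).1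
    exact ⟨r, _, curryLeft_one_mem_diffCochain (mem_commuting.1 (pow_smul_mem_commuting r hφ)).1,
      eq_consMul_of_ordLT_one (H r φ hφ hr.succ)⟩
  intro r
  induction r with
  | zero => intro φ _ h; rwa [pow_zero, one_smul]
  | succ r ih =>
    intro φ hφ h
    rw [pow_succ, mul_smul]
    exact ih _ (smul_mem_commuting c.ρ_mem hφ) (ordLT_smul hφ h)

/-- A multidifferential cocycle is, up to a power of `ρ`, a multiderivation up to a coboundary. -/
theorem exists_pow_smul_mem {d : ℤ} {m : ℕ} {φ : Cochain k A m} (hφ : φ ∈ diffCochain 𝒜 d m)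
    (h : hochschildB 𝒜 d φ = 0) (c : LocalCoords 𝒜 ι) :
    ∃ M : ℕ, c.ρ ^ M • φ ∈ multiDer 𝒜 d m ⊔ diffCobd 𝒜 d m := by
  -- Viewed as an A-linear cochain with one more slot, φ commutes with all coordinates, so the
  -- elimination applies with the full set of coordinates.
  have h0 : hochschildTail (m + 1) (consMul (koszulTwist 𝒜 d) φ) = 0 := by
    rw [hochschildTail_consMul, h]
    refine cochain_ext fun a => ?_
    rw [curryLeft_neg, curryLeft_consMul, smul_zero, neg_zero]
    rfl
  have hone : ∀ χ : Cochain k A m, (consMul (koszulTwist 𝒜 d) χ).curryLeft 1 = χ := fun χ => by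
    rw [curryLeft_consMul, koszulTwist_one, one_smul]
  obtain ⟨M, μ, hμ, hψ⟩ := exists_multiDer_add_cobd (c := c) Finset.univ m d _
    (consMul_mem_commuting hφ) h0
  cases m with
  | zero =>
    exact ⟨0, by
      rw [pow_zero, one_smul]
      exact Submodule.mem_sup_left (diffCochain_zero_le_multiDer _ hφ)⟩
  | succ m =>
    obtain ⟨ψ, hψ, hψ'⟩ := hψ
    -- The primitive commutes with all coordinates, so up to a power of ρ it is A-linear in the
    -- first slot and comes from a Hochschild cochain χ. Setting the first slot to 1 then returns to
    -- the Hochschild complex.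
    obtain ⟨M', χ, hχ, hχ'⟩ := exists_pow_smul_eq_consMul hψ
    refine ⟨M' + M, ?_⟩
    have h1 : c.ρ ^ M' • (c.ρ ^ M • consMul (koszulTwist 𝒜 d) φ - consMul (koszulTwist 𝒜 d) μ) =
        -consMul (koszulTwist 𝒜 d) (hochschildB 𝒜 d χ) := by
      rw [← hψ', ← hochschildTail_smul, hχ', hochschildTail_consMul]
    have h2 := congrArg (fun χ => MultilinearMap.curryLeft χ 1) h1
    simp only [curryLeft_smul, curryLeft_sub, curryLeft_neg, hone] at h2
    rw [smul_sub, sub_eq_iff_eq_add] at h2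
    rw [pow_add, mul_smul, h2, add_comm (-hochschildB 𝒜 d χ)]
    exact Submodule.add_mem_sup (smul_mem_multiDer_zero (ρ_pow_mem _) hμ)
      (neg_mem ⟨χ, hχ, rfl⟩)

end LocalCoords

end LocalCoords

/-- If the ρ_c generate the unit ideal, so do any of their powers; P plays the role of membership in
an ideal of the degree-zero part, without naming the ideal. -/
theorem of_forall_pow {κ : Type*} [Finite κ] [DecidableEq κ] {ρ u : κ → A}
    (hρ : ∀ c, ρ c ∈ 𝒜 0) (hu : ∀ c, u c ∈ 𝒜 0) (h1 : ∃ s : Finset κ, ∑ c ∈ s, u c * ρ c = 1)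
    (P : A → Prop) (h0 : P 0) (hadd : ∀ a b, P a → P b → P (a + b))
    (hmul : ∀ a b, a ∈ 𝒜 0 → P b → P (a * b)) (M : κ → ℕ) (h : ∀ c, P (ρ c ^ M c)) : P 1 := by
  obtain ⟨s, h1⟩ := h1
  have hsum : ∀ (t : Finset κ) (w : A), (∀ c, P (ρ c * w)) → P (∑ c ∈ t, u c * (ρ c * w)) := by
    intro t w hw
    induction t using Finset.induction_on with
    | empty => simpa using h0
    | insert c t hc ih =>
      rw [Finset.sum_insert hc]
      exact hadd _ _ (hmul _ _ (hu c) (hw c)) ih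
  have hone : ∀ w : A, (∀ c, P (ρ c * w)) → P w := by
    intro w hw
    have := hsum s w hw
    simp only [← mul_assoc] at this
    rwa [← Finset.sum_mul, h1, one_mul] at this
  have := Fintype.ofFinite κ
  -- The extra factor w absorbs copies of ρ_c: expanding w by the partition of unity leads to the
  -- elements ρ_c w, for which the exponent of ρ_c may be lowered by one.
  suffices H : ∀ (n : ℕ) (M : κ → ℕ) (w : A), ∑ c, M c = n → (∀ c, P (ρ c ^ M c * w)) → P w from
    H _ M 1 rfl fun c => by rw [mul_one]; exact h c
  intro n
  induction n with
  | zero =>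
    intro M w hM hw
    refine hone w fun c => hmul _ _ (hρ c) ?_
    have h2 := hw c
    rwa [Finset.sum_eq_zero_iff.1 hM c (Finset.mem_univ c), pow_zero, one_mul] at h2
  | succ n ih =>
    intro M w hM hw
    refine hone w fun c => ?_
    by_cases hc : M c = 0
    · have h2 := hw c
      rw [hc, pow_zero, one_mul] at h2
      exact hmul _ _ (hρ c) h2
    · refine ih (Function.update M c (M c - 1)) (ρ c * w) ?_ fun c' => ?_
      · rw [Finset.sum_update_of_mem (Finset.mem_univ c), Finset.sdiff_singleton_eq_erase]
        rw [← Finset.add_sum_erase _ M (Finset.mem_univ c)] at hM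
        omega
      · by_cases hcc : c' = c
        · subst hcc
          rw [Function.update_self, ← mul_assoc, ← pow_succ, Nat.sub_add_cancel (by omega)]
          exact hw c'
        · rw [Function.update_of_ne hcc, ← mul_assoc, mul_comm_of_mem_zero (hρ c),
            mul_assoc]
          exact hmul _ _ (hρ c) (hw c')

end Decomposition

end GradedHKR

namespace GradedHKR

/-! ### Antisymmetry of products of derivations up to coboundaries -/

section Swaps

variable {k : Type} [Field k] {A : Type u} [Ring A] [Algebra k A]
variable {𝒜 : ℤ → Submodule k A} [GradedAlgebra 𝒜] [GradedCommutative 𝒜]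

/-- A derivation is a Hochschild 1-cocycle, so cupping with it on the left anticommutes with the
differential and preserves coboundaries. -/
theorem hochschildB_cupLeft {m : ℕ} {d e : ℤ} {D : Module.End k A} (hD : D ∈ gradedDer 𝒜 d)
    (φ : Cochain k A m) :
    hochschildB 𝒜 (d + e) (cupLeft 𝒜 D e φ) = -cupLeft 𝒜 D e (hochschildB 𝒜 e φ) := by
  rw [hochschildB_eq]
  refine cochain_ext fun a => ?_
  rw [curryLeft_add, curryLeft_consMul, curryLeft_hochschildTail, curryLeft_neg]
  refine cochain_ext fun b => ?_
  rw [curryLeft_add, curryLeft_sub, curryLeft_neg, curryLeft_mergeFirst, curryLeft_neg,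
    hochschildB_eq]
  simp only [cupLeft, curryLeft_consMul, LinearMap.comp_apply, curryLeft_smul, curryLeft_add]
  rw [hochschildTail_smul, curryLeft_smul, koszulTwist_mul, gradedDer_leibniz hD, add_smul,
    mul_smul, mul_smul, ← koszulTwist_add, smul_add]
  abel

/-- Up to coboundaries, neighbouring derivations in a product anticommute. -/
theorem mulTensor_swap_zero {m : ℕ} {e : Fin (m + 2) → ℤ} {D : Fin (m + 2) → Module.End k A}
    (h : ∀ i, D i ∈ gradedDer 𝒜 (e i)) :
    mulTensor 𝒜 e D + (e 0 * e 1).negOnePow • mulTensor 𝒜 (e ∘ Equiv.swap 0 1)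
      (D ∘ Equiv.swap 0 1) = hochschildB 𝒜 (∑ i, e i) (-cupLeft 𝒜 (D 0 ∘ₗ D 1)
        (∑ i, Fin.tail (Fin.tail e) i) (mulTensor 𝒜 (Fin.tail (Fin.tail e))
          (Fin.tail (Fin.tail D)))) := by
  set R := mulTensor 𝒜 (Fin.tail (Fin.tail e)) (Fin.tail (Fin.tail D)) with hR
  set E := ∑ i, Fin.tail (Fin.tail e) i with hE
  have hR0 : hochschildTail m R = -consMul (koszulTwist 𝒜 E) R :=
    hochschildTail_mulTensor_der fun i => h i.succ.succ
  have hte : Fin.tail (Fin.tail (e ∘ Equiv.swap 0 1)) = Fin.tail (Fin.tail e) := by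
    ext i
    simp only [Fin.tail, Function.comp_apply]
    rw [Equiv.swap_apply_of_ne_of_ne (Fin.succ_ne_zero _)]
    intro h
    exact Fin.succ_ne_zero i (Fin.succ_injective _ h)
  have htD : Fin.tail (Fin.tail (D ∘ Equiv.swap 0 1)) = Fin.tail (Fin.tail D) := by
    ext1 i
    simp only [Fin.tail, Function.comp_apply]
    rw [Equiv.swap_apply_of_ne_of_ne (Fin.succ_ne_zero _)]
    intro h
    exact Fin.succ_ne_zero i (Fin.succ_injective _ h)
  have hval : ∀ a b : A, ((mulTensor 𝒜 e D).curryLeft a).curryLeft b =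
      D 0 (koszulTwist 𝒜 (e 1) (koszulTwist 𝒜 E a)) • D 1 (koszulTwist 𝒜 E b) • R := by
    intro a b
    rw [← koszulTwist_add]
    have : ∑ i, Fin.tail e i = e 1 + E := Fin.sum_univ_succ _
    rw [← this]
    rfl
  have hval' : ∀ a b : A, ((mulTensor 𝒜 (e ∘ Equiv.swap 0 1)
      (D ∘ Equiv.swap 0 1)).curryLeft a).curryLeft b =
      D 1 (koszulTwist 𝒜 (e 0) (koszulTwist 𝒜 E a)) • D 0 (koszulTwist 𝒜 E b) • R := by
    intro a b
    rw [← koszulTwist_add]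
    have h1 : ∑ i, Fin.tail (e ∘ Equiv.swap 0 1) i = e 0 + E := by
      rw [Fin.sum_univ_succ]
      change e (Equiv.swap 0 1 1) + ∑ i, Fin.tail (Fin.tail (e ∘ Equiv.swap 0 1)) i = _
      rw [hte, Equiv.swap_apply_right]
    rw [← h1, hR, hE, ← hte, ← htD]
    rfl
  -- In the differential of the primitive the terms with D₀D₁ on one argument cancel. What survives
  -- are the two cross terms of the Leibniz rule for the composite D₀D₁, one for each order of the
  -- two derivations.
  refine cochain_ext fun a => cochain_ext fun b => ?_
  rw [hochschildB_eq, map_neg]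
  rw [curryLeft_add, curryLeft_add, curryLeft_add, curryLeft_add, curryLeft_sign_smul,
    curryLeft_sign_smul, hval, hval', curryLeft_neg, curryLeft_neg, curryLeft_hochschildTail,
    curryLeft_sub, curryLeft_neg, curryLeft_mergeFirst, curryLeft_consMul, curryLeft_smul,
    curryLeft_neg]
  simp only [cupLeft, curryLeft_consMul, LinearMap.comp_apply]
  rw [hochschildTail_smul, hR0, curryLeft_smul, curryLeft_neg, curryLeft_consMul,
    koszulTwist_mul, gradedDer_leibniz (h 1), map_add, gradedDer_leibniz (h 0),
    gradedDer_leibniz (h 0), homEnd_koszulTwist (h 1).1 (e := e 0),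
    Fin.sum_univ_succ, Fin.sum_univ_succ]
  have hE' : ∑ i : Fin m, e i.succ.succ = E := rfl
  have h01 : e (Fin.succ 0) = e 1 := rfl
  rw [hE', h01, koszulTwist_add, koszulTwist_add]
  simp only [add_smul, mul_smul, sign_smul_smul, mul_comm (e 1) (e 0), smul_smul (_ : ℤˣ),
    Int.units_mul_self, one_smul, smul_neg]
  abel

theorem cupLeft_sign_smul {m : ℕ} (D : Module.End k A) (e : ℤ) (s : ℤˣ) (φ : Cochain k A m) :
    cupLeft 𝒜 D e (s • φ) = s • cupLeft 𝒜 D e φ := by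
  ext a
  change _ * (s • φ (Fin.tail a)) = s • (_ * φ (Fin.tail a))
  rw [mul_smul_comm]

theorem cupLeft_add {m : ℕ} (D : Module.End k A) (e : ℤ) (φ ψ : Cochain k A m) :
    cupLeft 𝒜 D e (φ + ψ) = cupLeft 𝒜 D e φ + cupLeft 𝒜 D e ψ := by
  ext a
  exact mul_add _ _ _

theorem cupLeft_mem_diffCobd {m : ℕ} {d e : ℤ} {D : Module.End k A} (hD : D ∈ gradedDer 𝒜 d)
    {φ : Cochain k A m} (hφ : φ ∈ diffCobd 𝒜 e m) :
    cupLeft 𝒜 D e φ ∈ diffCobd 𝒜 (d + e) (m + 1) := by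
  cases m with
  | zero =>
    rw [diffCobd, Submodule.mem_bot] at hφ
    have : cupLeft 𝒜 D e (0 : Cochain k A 0) = 0 := by ext; simp [cupLeft]
    rw [hφ, this]
    exact zero_mem _
  | succ m =>
    obtain ⟨ψ, hψ, rfl⟩ := hφ
    refine ⟨-cupLeft 𝒜 D e ψ, neg_mem (cupLeft_mem (.der hD) hψ), ?_⟩
    rw [map_neg]
    change -hochschildB 𝒜 (d + e) (cupLeft 𝒜 D e ψ) = _
    rw [hochschildB_cupLeft hD, neg_neg]
    rfl

theorem sum_comp_perm {m : ℕ} (e : Fin m → ℤ) (σ : Equiv.Perm (Fin m)) :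
    ∑ i, (e ∘ σ) i = ∑ i, e i := Equiv.sum_comp σ e

/-- A swap further to the right is reduced to the front by cupping with the first derivation, which
preserves coboundaries. -/
theorem mulTensor_swap {m : ℕ} (l : Fin m) {e : Fin (m + 1) → ℤ}
    {D : Fin (m + 1) → Module.End k A} (h : ∀ i, D i ∈ gradedDer 𝒜 (e i)) :
    mulTensor 𝒜 e D + (e l.castSucc * e l.succ).negOnePow •
      mulTensor 𝒜 (e ∘ Equiv.swap l.castSucc l.succ) (D ∘ Equiv.swap l.castSucc l.succ) ∈
        diffCobd 𝒜 (∑ i, e i) (m + 1) := by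
  induction m with
  | zero => exact l.elim0
  | succ m ih =>
    refine Fin.cases ?_ (fun l => ?_) l
    · have h1 := neg_mem (cupLeft_mem (d := e 0 + e 1) (.comp (.der (h 0)) (.der (h 1)))
        (mulTensor_mem (e := Fin.tail (Fin.tail e)) (D := Fin.tail (Fin.tail D))
          fun i => .der (h i.succ.succ)))
      have h2 : e 0 + e 1 + ∑ i, Fin.tail (Fin.tail e) i = ∑ i, e i := by
        rw [Fin.sum_univ_succ e, Fin.sum_univ_succ, ← add_assoc]
        rfl
      rw [h2] at h1
      exact ⟨_, h1, (mulTensor_swap_zero h).symm⟩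
    · have h1 := cupLeft_mem_diffCobd (h 0) (ih l (e := Fin.tail e) (D := Fin.tail D)
        fun i => h i.succ)
      have hsw : ∀ i : Fin (m + 1), Equiv.swap l.succ.castSucc l.succ.succ i.succ =
          (Equiv.swap l.castSucc l.succ i).succ := by
        intro i
        rw [← Fin.succ_castSucc]
        exact ((Fin.succ_injective _).swap_apply _ _ _)
      have hsw0 : Equiv.swap l.succ.castSucc l.succ.succ 0 = 0 := by
        rw [← Fin.succ_castSucc]
        exact Equiv.swap_apply_of_ne_of_ne (Fin.succ_ne_zero _).symm (Fin.succ_ne_zero _).symm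
      have hs : e 0 + ∑ i, Fin.tail e i = ∑ i, e i := (Fin.sum_univ_succ e).symm
      rw [cupLeft_add, cupLeft_sign_smul, hs] at h1
      have hte : Fin.tail (e ∘ Equiv.swap l.succ.castSucc l.succ.succ) =
          Fin.tail e ∘ Equiv.swap l.castSucc l.succ := by
        ext i; simp only [Fin.tail, Function.comp_apply, hsw]
      have htD : Fin.tail (D ∘ Equiv.swap l.succ.castSucc l.succ.succ) =
          Fin.tail D ∘ Equiv.swap l.castSucc l.succ := by
        ext1 i; simp only [Fin.tail, Function.comp_apply, hsw]
      have h2 : mulTensor 𝒜 (e ∘ Equiv.swap l.succ.castSucc l.succ.succ)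
          (D ∘ Equiv.swap l.succ.castSucc l.succ.succ) = cupLeft 𝒜 (D 0) (∑ i, Fin.tail e i)
            (mulTensor 𝒜 (Fin.tail e ∘ Equiv.swap l.castSucc l.succ)
              (Fin.tail D ∘ Equiv.swap l.castSucc l.succ)) := by
        rw [mulTensor, hte, htD, sum_comp_perm, Function.comp_apply, hsw0]
      rw [h2]
      exact h1

theorem koszulSign_swap {m : ℕ} (l : Fin m) (e : Fin (m + 1) → ℤ) :
    koszulSign (Equiv.swap l.castSucc l.succ) e = (e l.castSucc * e l.succ).negOnePow := by
  rw [koszulSign, Finset.prod_eq_single (l.castSucc, l.succ)]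
  · simp only [Equiv.swap_apply_left, Equiv.swap_apply_right]
    rw [mul_comm]
  · rintro ⟨p, q⟩ hpq hne
    exfalso
    simp only [Finset.mem_filter, Finset.mem_univ, true_and] at hpq
    obtain ⟨h1, h2⟩ := hpq
    simp only [Equiv.swap_apply_def] at h2
    have hne' : ¬(p = l.castSucc ∧ q = l.succ) := fun h => hne (by rw [h.1, h.2])
    simp only [Fin.ext_iff, Fin.lt_def, Fin.val_castSucc, Fin.val_succ] at *
    split_ifs at h2 <;> simp_all <;> omega
  · intro h
    refine absurd ?_ h
    simp only [Finset.mem_filter, Finset.mem_univ, true_and, Equiv.swap_apply_left,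
      Equiv.swap_apply_right, and_self]
    exact Fin.castSucc_lt_succ

/-- Up to coboundaries, products of derivations are antisymmetric. -/
theorem mulTensor_perm {m : ℕ} (σ : Equiv.Perm (Fin m)) : ∀ {e : Fin m → ℤ}
    {D : Fin m → Module.End k A}, (∀ i, D i ∈ gradedDer 𝒜 (e i)) →
    mulTensor 𝒜 (e ∘ σ) (D ∘ σ) - (Equiv.Perm.sign σ * koszulSign σ e) • mulTensor 𝒜 e D ∈
      diffCobd 𝒜 (∑ i, e i) m := by
  have hone : ∀ {m : ℕ} {e : Fin m → ℤ}
      {D : Fin m → Module.End k A}, mulTensor 𝒜 (e ∘ (1 : Equiv.Perm (Fin m)))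
        (D ∘ (1 : Equiv.Perm (Fin m))) - (Equiv.Perm.sign (1 : Equiv.Perm (Fin m)) *
          koszulSign 1 e) • mulTensor 𝒜 e D ∈ diffCobd 𝒜 (∑ i, e i) m := by
    intro m e D
    have h1 : koszulSign 1 e = 1 := by
      rw [koszulSign]
      refine Finset.prod_eq_one fun p hp => ?_
      obtain ⟨-, h1, h2⟩ := Finset.mem_filter.1 hp
      exact absurd (h1.trans h2) (lt_irrefl _)
    rw [h1, Equiv.Perm.sign_one, one_mul, one_smul]
    simp
  cases m with
  | zero =>
    intro e D _
    rw [Subsingleton.elim σ 1]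
    exact hone
  | succ m =>
    have hσ : σ ∈ Submonoid.closure
        (Set.range fun i : Fin m => Equiv.swap i.castSucc i.succ) := by
      rw [Equiv.Perm.mclosure_swap_castSucc_succ]; trivial
    induction hσ using Submonoid.closure_induction with
    | mem x hx =>
      obtain ⟨l, rfl⟩ := hx
      intro e D h
      have h1 := sign_smul_mem_cochain _ (e l.castSucc * e l.succ).negOnePow (mulTensor_swap l h)
      rw [smul_add, smul_smul, Int.units_mul_self, one_smul] at h1
      dsimp only
      rw [koszulSign_swap, Equiv.Perm.sign_swap Fin.castSucc_lt_succ.ne, neg_one_mul,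
        Units.neg_smul, sub_neg_eq_add]
      exact (congrArg (· ∈ diffCobd 𝒜 (∑ i, e i) (m + 1)) (add_comm _ _)).mp h1
    | one => intro e D _; exact hone
    | mul τ σ _ _ hτ hσ =>
      intro e D h
      have h1 := hσ (e := e ∘ τ) (D := D ∘ τ) fun i => h (τ i)
      have h2 := sign_smul_mem_cochain _ (Equiv.Perm.sign σ * koszulSign σ (e ∘ τ)) (hτ h)
      rw [sum_comp_perm] at h1
      have h3 := add_mem h1 h2
      rw [smul_sub, sub_add_sub_cancel, smul_smul] at h3
      rw [koszulSign_mul, Equiv.Perm.sign_mul]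
      have h4 : Equiv.Perm.sign τ * Equiv.Perm.sign σ * (koszulSign τ e * koszulSign σ (e ∘ τ)) =
          Equiv.Perm.sign σ * koszulSign σ (e ∘ τ) * (Equiv.Perm.sign τ * koszulSign τ e) := by
        rw [mul_mul_mul_comm, mul_comm (Equiv.Perm.sign σ * _)]
      rw [h4]
      exact h3

/-- Multiderivations are, up to coboundaries, in the image of the HKR map. -/
theorem multiDer_le [CharZero k] (d : ℤ) (m : ℕ) :
    multiDer 𝒜 d m ≤ LinearMap.range (hkrMap 𝒜 m d) ⊔ diffCobd 𝒜 d m := by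
  refine Submodule.span_le.2 ?_
  rintro _ ⟨d₀, c, e, D, hc, hD, hd, rfl⟩
  set x : WedgeMonomial 𝒜 m d := ⟨d₀, c, hc, e, D, hD, hd⟩ with hx
  have h1 : hkrMonomial 𝒜 x ∈ LinearMap.range (hkrMap 𝒜 m d) :=
    ⟨Submodule.Quotient.mk (Finsupp.single x 1), hkrFree_single x⟩
  have hfac : (m.factorial : k) ≠ 0 := by exact_mod_cast Nat.factorial_ne_zero m
  -- The HKR cochain averages the signed permutations of the product, and each of them is
  -- cohomologous to the product itself.
  have h2 : hkrMonomial 𝒜 x - c • mulTensor 𝒜 e D ∈ diffCobd 𝒜 d m := by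
    have h3 : c • mulTensor 𝒜 e D = ((m.factorial : k)⁻¹) • ∑ σ : Equiv.Perm (Fin m),
        c • mulTensor 𝒜 e D := by
      rw [Finset.sum_const, Finset.card_univ, Fintype.card_perm, Fintype.card_fin,
        ← Nat.cast_smul_eq_nsmul k, smul_smul, inv_mul_cancel₀ hfac, one_smul]
    have h6 : ∀ φ ψ : Cochain k A m, (m.factorial : k)⁻¹ • φ - (m.factorial : k)⁻¹ • ψ =
        (m.factorial : k)⁻¹ • (φ - ψ) := fun _ _ => (smul_sub _ _ _).symm
    rw [h3, hkrMonomial, h6, ← Finset.sum_sub_distrib]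
    refine Submodule.smul_mem _ _ (Submodule.sum_mem _ fun σ _ => ?_)
    have h4 := smul_mem_diffCobd hc (sign_smul_mem_cochain _
      (Equiv.Perm.sign σ * koszulSign σ e) (mulTensor_perm σ hD))
    rw [smul_sub, smul_smul (_ : ℤˣ), Int.units_mul_self, one_smul, smul_sub, smul_sign_smul,
      hd] at h4
    exact h4
  have h5 := Submodule.add_mem_sup h1 (neg_mem h2)
  rwa [neg_sub, add_sub_cancel] at h5

end Swaps

end GradedHKR

/-! ## Alternating multiderivations -/

namespace GradedHKR

theorem negOnePow_mul_sum {ι : Type*} (s : Finset ι) (b : ℤ) (f : ι → ℤ) :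
    (b * ∑ l ∈ s, f l).negOnePow = ∏ l ∈ s, (b * f l).negOnePow := by
  classical
  induction s using Finset.induction_on with
  | empty => simp
  | insert a s ha ih => rw [Finset.sum_insert ha, Finset.prod_insert ha, mul_add,
      Int.negOnePow_add, ih]

theorem koszulSign_one {m : ℕ} (e : Fin m → ℤ) : koszulSign 1 e = 1 := by
  rw [koszulSign]
  refine Finset.prod_eq_one fun p hp => ?_
  obtain ⟨-, h1, h2⟩ := Finset.mem_filter.1 hp
  exact absurd (h1.trans h2) (lt_irrefl _)

theorem finRotate_castSucc {m : ℕ} (p : Fin m) : finRotate (m + 1) p.castSucc = p.succ := by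
  rw [finRotate_apply, Fin.coeSucc_eq_succ]

/-- The inversions of the rotation are exactly the pairs (p, last), whose images are p + 1 and 0; so
the argument 0 passes all the others. -/
theorem koszulSign_finRotate {m : ℕ} (e : Fin (m + 1) → ℤ) :
    koszulSign (finRotate (m + 1)) e = (e 0 * ∑ i, Fin.tail e i).negOnePow := by
  rw [koszulSign, negOnePow_mul_sum]
  symm
  refine Finset.prod_bij (fun p _ => (p.castSucc, Fin.last m)) ?_ ?_ ?_ ?_
  · intro p _
    simp only [Finset.mem_filter, Finset.mem_univ, true_and]
    rw [finRotate_castSucc, finRotate_last]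
    exact ⟨Fin.castSucc_lt_last p, Fin.succ_pos p⟩
  · intro p _ q _ h
    exact Fin.castSucc_injective _ (Prod.ext_iff.1 h).1
  · rintro ⟨p, q⟩ hpq
    obtain ⟨-, h1, h2⟩ := Finset.mem_filter.1 hpq
    have hp : p ≠ Fin.last m := (h1.trans_le (Fin.le_last q)).ne
    obtain ⟨p, rfl⟩ := Fin.exists_castSucc_eq.2 hp
    refine ⟨p, Finset.mem_univ _, Prod.ext rfl ?_⟩
    by_contra hq
    obtain ⟨q, rfl⟩ := Fin.exists_castSucc_eq.2 (Ne.symm hq)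
    dsimp only at h1 h2
    rw [finRotate_castSucc, finRotate_castSucc] at h2
    exact absurd (h1.trans (Fin.succ_lt_succ_iff.1 h2 : q.castSucc < p.castSucc)) (lt_irrefl _)
  · intro p _
    dsimp only
    rw [finRotate_castSucc, finRotate_last, mul_comm]
    rfl

section Alternating

variable {k : Type} [Field k] {A : Type u} [Ring A] [Algebra k A]
variable {𝒜 : ℤ → Submodule k A}

/-- Alternation is imposed for neighbouring arguments only. Neighbouring transpositions generate the
symmetric group, and `koszulSign_mul` makes the signs compatible with products. -/
theorem hkrCochain_perm {m : ℕ} {d : ℤ} {φ : Cochain k A m} (hφ : φ ∈ hkrCochain 𝒜 d m)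
    (σ : Equiv.Perm (Fin m)) : ∀ {i : Fin m → ℤ} {a : Fin m → A}, (∀ j, a j ∈ 𝒜 (i j)) →
    φ a = (Equiv.Perm.sign σ * koszulSign σ i) • φ (a ∘ σ) := by
  cases m with
  | zero =>
    intro i a _
    rw [Subsingleton.elim σ 1, koszulSign_one, Equiv.Perm.sign_one, one_mul, one_smul]
    rfl
  | succ m =>
    have hσ : σ ∈ Submonoid.closure
        (Set.range fun i : Fin m => Equiv.swap i.castSucc i.succ) := by
      rw [Equiv.Perm.mclosure_swap_castSucc_succ]; trivial
    induction hσ using Submonoid.closure_induction with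
    | mem x hx =>
      obtain ⟨l, rfl⟩ := hx
      intro i a ha
      dsimp only
      rw [koszulSign_swap, Equiv.Perm.sign_swap Fin.castSucc_lt_succ.ne, neg_one_mul,
        Units.neg_smul]
      exact hφ.2.2 l.castSucc l.succ (by simp) i a ha
    | one =>
      intro i a _
      rw [koszulSign_one, Equiv.Perm.sign_one, one_mul, one_smul]
      rfl
    | mul τ σ _ _ hτ hσ =>
      intro i a ha
      rw [hτ ha, hσ (i := i ∘ τ) (a := a ∘ τ) fun j => ha (τ j), smul_smul, koszulSign_mul,
        Equiv.Perm.sign_mul, mul_mul_mul_comm]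
      rfl

theorem curryLeft_mem_hkrCochain {m : ℕ} {d n : ℤ} {φ : Cochain k A (m + 1)}
    (hφ : φ ∈ hkrCochain 𝒜 d (m + 1)) {y : A} (hy : y ∈ 𝒜 n) :
    φ.curryLeft y ∈ hkrCochain 𝒜 (d + n) m := by
  obtain ⟨h1, h2, h3⟩ := hφ
  have hc : ∀ {i : Fin m → ℤ} {a : Fin m → A}, (∀ j, a j ∈ 𝒜 (i j)) →
      ∀ j, (Fin.cons y a : Fin (m + 1) → A) j ∈ 𝒜 ((Fin.cons n i : Fin (m + 1) → ℤ) j) := by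
    intro i a ha j
    refine Fin.cases ?_ (fun l => ?_) j
    · exact hy
    · exact ha l
  refine ⟨fun i a ha => ?_, fun l hl i a ha b => ?_, fun l l' hl i a ha => ?_⟩
  · have := h1 _ _ (hc ha)
    rw [Fin.sum_univ_succ, ← add_assoc] at this
    exact this
  · have := h2 l.succ (by simp [hl]) _ _ (hc ha) b
    have he : ∑ j ∈ Finset.univ.erase l.succ, (Fin.cons n i : Fin (m + 1) → ℤ) j =
        n + ∑ j ∈ Finset.univ.erase l, i j := by
      have e1 := Finset.add_sum_erase Finset.univ (Fin.cons n i : Fin (m + 1) → ℤ)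
        (Finset.mem_univ l.succ)
      have e2 := Finset.add_sum_erase Finset.univ i (Finset.mem_univ l)
      rw [Fin.sum_univ_succ] at e1
      simp only [Fin.cons_zero, Fin.cons_succ] at e1
      linarith
    rw [he] at this
    simp only [Fin.cons_succ, ← Fin.cons_update, ← add_assoc] at this
    exact this
  · have := h3 l.succ l'.succ (by simp [hl]) _ _ (hc ha)
    have he : (Fin.cons y a : Fin (m + 1) → A) ∘ Equiv.swap l.succ l'.succ =
        Fin.cons y (a ∘ Equiv.swap l l') := by
      ext j
      refine Fin.cases ?_ (fun j => ?_) j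
      · rw [Function.comp_apply, Equiv.swap_apply_of_ne_of_ne (Fin.succ_ne_zero _).symm
          (Fin.succ_ne_zero _).symm]
        rfl
      · rw [Function.comp_apply, (Fin.succ_injective _).swap_apply]
        rfl
    rw [he] at this
    exact this

variable [GradedAlgebra 𝒜] [GradedCommutative 𝒜]

/-- The Leibniz rule is imposed in the last argument, while expansions start from the first; a
rotation connects the two. -/
theorem hkrCochain_snoc {m : ℕ} {d n : ℤ} {φ : Cochain k A (m + 1)}
    (hφ : φ ∈ hkrCochain 𝒜 d (m + 1)) {y : A} (hy : y ∈ 𝒜 n) {i : Fin m → ℤ} {b : Fin m → A}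
    (hb : ∀ j, b j ∈ 𝒜 (i j)) : φ (Fin.cons y b) =
      ((-1) ^ m * (n * ∑ j, i j).negOnePow) • φ (Fin.snoc b y) := by
  have h := hkrCochain_perm hφ (finRotate (m + 1)) (i := Fin.cons n i) (a := Fin.cons y b)
    fun j => by
      refine Fin.cases ?_ (fun l => ?_) j
      · exact hy
      · exact hb l
  rw [koszulSign_finRotate, sign_finRotate, Fin.cons_zero, Fin.tail_cons] at h
  rw [h, Fin.snoc_eq_cons_rotate]
  rfl

/-- Alternating multiderivations are derivations in the first argument. -/
theorem hkrCochain_curryLeft_mul {m : ℕ} {d : ℤ} {φ : Cochain k A (m + 1)}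
    (hφ : φ ∈ hkrCochain 𝒜 d (m + 1)) {i : ℤ} {y : A} (z : A) (hy : y ∈ 𝒜 i) :
    φ.curryLeft (y * z) =
      koszulTwist 𝒜 d y • φ.curryLeft z + koszulTwist 𝒜 (d + i) z • φ.curryLeft y := by
  refine cochain_ext_homogeneous (𝒜 := 𝒜) fun n b hb => ?_
  have key : ∀ (j : ℤ) (z : A), z ∈ 𝒜 j → φ (Fin.cons (y * z) b) =
      koszulTwist 𝒜 d y * φ (Fin.cons z b) + koszulTwist 𝒜 (d + i) z * φ (Fin.cons y b) := by
    intro j z hz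
    -- The product y z is rotated to the last slot, expanded there, and the two terms are rotated
    -- back. The rotation signs (-1)^m cancel in pairs and the Koszul signs agree modulo 2.
    have h1 := hφ.2.1 (Fin.last m) rfl (Fin.snoc n i) (Fin.snoc b y) (fun l => by
      refine Fin.lastCases ?_ (fun l => ?_) l
      · simpa using hy
      · simpa using hb l) z
    have he : ∑ j ∈ Finset.univ.erase (Fin.last m), (Fin.snoc n i : Fin (m + 1) → ℤ) j =
        ∑ j, n j := by
      have e1 := Finset.add_sum_erase Finset.univ (Fin.snoc n i : Fin (m + 1) → ℤ)
        (Finset.mem_univ (Fin.last m))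
      rw [Fin.sum_univ_castSucc] at e1
      simp only [Fin.snoc_last, Fin.snoc_castSucc] at e1
      linarith
    rw [he] at h1
    simp only [Fin.snoc_last, Fin.update_snoc_last] at h1
    have hyφ := hφ.1 (Fin.cons i n) (Fin.cons y b) (fun l => by
      refine Fin.cases ?_ (fun l => ?_) l
      · exact hy
      · exact hb l)
    rw [Fin.sum_univ_succ] at hyφ
    simp only [Fin.cons_zero, Fin.cons_succ] at hyφ
    have h2 := hkrCochain_snoc hφ (SetLike.mul_mem_graded hy hz) hb
    have h3 := hkrCochain_snoc hφ hy hb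
    have h4 := hkrCochain_snoc hφ hz hb
    have h5 : ∀ (s : ℤˣ) (u v : A), u = s • v → v = s • u := by
      rintro s u v rfl
      rw [smul_smul, Int.units_mul_self, one_smul]
    rw [h2, h1, h5 _ _ _ h3, h5 _ _ _ h4, koszulTwist_of_mem hy, koszulTwist_of_mem hz]
    have h6 := GradedCommutative.comm hyφ hz
    simp only [smul_mul_assoc, mul_smul_comm, smul_add, smul_smul, h6]
    rw [add_comm]
    have h7 : ((-1 : ℤˣ)) ^ m * (-1) ^ m = 1 := Int.units_mul_self _
    congr 2
    · have : (-1) ^ m * ((i + j) * ∑ j, n j).negOnePow * (((d + ∑ j, n j) * i).negOnePow *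
          ((-1) ^ m * (j * ∑ j, n j).negOnePow)) =
          ((-1) ^ m * (-1) ^ m) * (((i + j) * ∑ j, n j).negOnePow *
            (((d + ∑ j, n j) * i).negOnePow * (j * ∑ j, n j).negOnePow)) := by
        simp only [mul_assoc, mul_left_comm]
      rw [this, h7, one_mul]
      simp only [← Int.negOnePow_add]
      refine negOnePow_eq_of_even_sub ⟨i * ∑ j, n j + j * ∑ j, n j, ?_⟩
      ring
    · have : (-1) ^ m * ((i + j) * ∑ j, n j).negOnePow * (((-1) ^ m * (i * ∑ j, n j).negOnePow) *
          ((d + (i + ∑ j, n j)) * j).negOnePow) =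
          ((-1) ^ m * (-1) ^ m) * (((i + j) * ∑ j, n j).negOnePow *
            ((i * ∑ j, n j).negOnePow * ((d + (i + ∑ j, n j)) * j).negOnePow)) := by
        simp only [mul_assoc, mul_left_comm]
      rw [this, h7, one_mul]
      simp only [← Int.negOnePow_add]
      refine negOnePow_eq_of_even_sub ⟨i * ∑ j, n j + j * ∑ j, n j, ?_⟩
      ring
  have hlin : firstSlot φ b ∘ₗ LinearMap.mulLeft k y =
      LinearMap.mulLeft k (koszulTwist 𝒜 d y) ∘ₗ firstSlot φ b +
        LinearMap.mulRight k (φ (Fin.cons y b)) ∘ₗ koszulTwist 𝒜 (d + i) :=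
    ext_homogeneous (𝒜 := 𝒜) fun j z hz => key j z hz
  exact LinearMap.congr_fun hlin z

/-- With respect to a dual family of derivations, alternating multiderivations are sums of products
of derivations. -/
theorem hkrCochain_le_multiDer {ι : Type*} [Fintype ι] {x : ι → A} {n : ι → ℤ}
    {X : ι → Module.End k A} (hx : ∀ t, x t ∈ 𝒜 (n t)) (hX : ∀ t, X t ∈ gradedDer 𝒜 (-n t))
    (hc : ∀ (e : ℤ) (D : Module.End k A), D ∈ gradedDer 𝒜 e → D = ∑ t, D (x t) • X t)
    (m : ℕ) (d : ℤ) : hkrCochain 𝒜 d m ≤ multiDer 𝒜 d m := by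
  induction m generalizing d with
  | zero =>
    intro φ hφ
    have h1 := hφ.1 Fin.elim0 Fin.elim0 fun j => j.elim0
    rw [Finset.univ_eq_empty, Finset.sum_empty, add_zero] at h1
    refine Submodule.subset_span ⟨d, φ Fin.elim0, Fin.elim0, Fin.elim0, h1, fun j => j.elim0,
      by simp, ?_⟩
    ext a
    rw [Subsingleton.elim a Fin.elim0]
    exact (mul_one _).symm
  | succ m ih =>
    intro φ hφ
    -- The family is assumed to expand derivations without denominators, so the general expansion is
    -- used with r = 1. The coefficients φ(x_t, …) are alternating multiderivations of smaller
    -- arity.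
    have h1 := smul_eq_sum_cupLeft (r := 1) hx hX
      (fun e D hD => by rw [one_smul]; exact hc e D hD) hφ.1
      (fun i y z hy => hkrCochain_curryLeft_mul hφ z hy)
    rw [one_smul] at h1
    rw [h1]
    refine Submodule.sum_mem _ fun t _ => sign_smul_mem_cochain _ _ ?_
    have h2 := cupLeft_mem_multiDer (hX t) (ih _ (curryLeft_mem_hkrCochain hφ (hx t)))
    rwa [show -n t + (d + n t) = d by ring] at h2

end Alternating

end GradedHKR

/-! ## The image of the HKR map -/

namespace GradedHKR

/-! ### Antisymmetrisation annihilates coboundaries -/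

section Antisymmetrization

variable {k : Type} [Field k] {A : Type u} [Ring A] [Algebra k A]

theorem contractNth_comp_swap {m : ℕ} (j : Fin m) (a : Fin (m + 1) → A) {s : ℤˣ}
    (h : a j.succ * a j.castSucc = s • (a j.castSucc * a j.succ)) :
    j.castSucc.contractNth (· * ·) (a ∘ Equiv.swap j.castSucc j.succ) =
      Function.update (j.castSucc.contractNth (· * ·) a) j
        (s • (j.castSucc.contractNth (· * ·) a : Fin m → A) j) := by
  ext l
  rcases lt_trichotomy (l : ℕ) j with hl | hl | hl
  · have h1 : l ≠ j := fun h => by rw [h] at hl; exact lt_irrefl _ hl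
    rw [Function.update_of_ne h1, Fin.contractNth_apply_of_lt _ _ _ _ (by simpa using hl),
      Fin.contractNth_apply_of_lt _ _ _ _ (by simpa using hl), Function.comp_apply,
      Equiv.swap_apply_of_ne_of_ne]
    · exact fun h => h1 (Fin.castSucc_injective _ h)
    · intro h
      have := congrArg Fin.val h
      simp at this
      omega
  · obtain rfl : l = j := Fin.ext hl
    rw [Function.update_self, Fin.contractNth_apply_of_eq _ _ _ _ (by simp),
      Fin.contractNth_apply_of_eq _ _ _ _ (by simp), Function.comp_apply, Function.comp_apply,
      Equiv.swap_apply_left, Equiv.swap_apply_right, h]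
  · have h1 : l ≠ j := fun h => by rw [h] at hl; exact lt_irrefl _ hl
    rw [Function.update_of_ne h1, Fin.contractNth_apply_of_gt _ _ _ _ (by simpa using hl),
      Fin.contractNth_apply_of_gt _ _ _ _ (by simpa using hl), Function.comp_apply,
      Equiv.swap_apply_of_ne_of_ne]
    · intro h
      have := congrArg Fin.val h
      simp at this
      omega
    · exact fun h => h1 (Fin.succ_injective _ h)

theorem cochain_update_sign_smul {m : ℕ} (ψ : Cochain k A m) (a : Fin m → A) (j : Fin m) (s : ℤˣ) :
    ψ (Function.update a j (s • a j)) = s • ψ a := by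
  rcases Int.units_eq_one_or s with rfl | rfl
  · rw [one_smul, one_smul, Function.update_eq_self]
  · rw [Units.neg_smul, Units.neg_smul, one_smul, one_smul, MultilinearMap.map_update_neg,
      Function.update_eq_self]

variable [CharZero k] {𝒜 : ℤ → Submodule k A} [GradedAlgebra 𝒜] [GradedCommutative 𝒜]

/-- Reindexing by the swap of the two merged arguments changes the merged product by its Koszul
sign. This cancels the change in the Koszul sign of the permutation, and only the sign of the
transposition remains; the sum is its own negative. -/
theorem sum_perm_merge {m : ℕ} (ψ : Cochain k A m) (j : Fin m) {i : Fin (m + 1) → ℤ}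
    {a : Fin (m + 1) → A} (ha : ∀ l, a l ∈ 𝒜 (i l)) :
    ∑ σ : Equiv.Perm (Fin (m + 1)), (Equiv.Perm.sign σ * koszulSign σ i) •
      ψ (j.castSucc.contractNth (· * ·) (a ∘ σ)) = 0 := by
  refine eq_zero_of_eq_neg k ?_
  refine (Equiv.sum_comp (Equiv.mulRight (Equiv.swap j.castSucc j.succ)) _).symm.trans ?_
  rw [← Finset.sum_neg_distrib]
  refine Finset.sum_congr rfl fun σ _ => ?_
  have h1 : a ∘ ⇑(Equiv.mulRight (Equiv.swap j.castSucc j.succ) σ) =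
      (a ∘ σ) ∘ Equiv.swap j.castSucc j.succ := rfl
  have h2 : (a ∘ σ) j.succ * (a ∘ σ) j.castSucc = ((i ∘ σ) j.castSucc * (i ∘ σ) j.succ).negOnePow •
      ((a ∘ σ) j.castSucc * (a ∘ σ) j.succ) := by
    rw [mul_comm ((i ∘ σ) j.castSucc)]
    exact GradedCommutative.comm (ha _) (ha _)
  rw [h1, contractNth_comp_swap j _ h2, cochain_update_sign_smul, Equiv.coe_mulRight,
    koszulSign_mul, Equiv.Perm.sign_mul, koszulSign_swap,
    Equiv.Perm.sign_swap Fin.castSucc_lt_succ.ne, smul_smul, mul_neg_one, neg_mul, neg_mul,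
    Units.neg_smul, mul_assoc, mul_assoc, Int.units_mul_self, mul_one]

/-- The merging terms vanish separately. Precomposing each permutation with the rotation carries the
last term to the first one, with total sign (-1)^m (-1)^{m+1} = -1 once ψ and the moved argument are
interchanged; homogeneity of ψ is used for that interchange. -/
theorem sum_perm_hochschildB {m : ℕ} {d : ℤ} {ψ : Cochain k A m}
    (hψ : ∀ (i : Fin m → ℤ) (a : Fin m → A), (∀ j, a j ∈ 𝒜 (i j)) → ψ a ∈ 𝒜 (d + ∑ j, i j))
    {i : Fin (m + 1) → ℤ} {a : Fin (m + 1) → A} (ha : ∀ l, a l ∈ 𝒜 (i l)) :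
    ∑ σ : Equiv.Perm (Fin (m + 1)), (Equiv.Perm.sign σ * koszulSign σ i) •
      hochschildB 𝒜 d ψ (a ∘ σ) = 0 := by
  have h0 : ∀ a, hochschildB 𝒜 d ψ a = koszulTwist 𝒜 d (a 0) * ψ (Fin.tail a) +
    (∑ j : Fin m, (-1 : A) ^ ((j : ℕ) + 1) * ψ (j.castSucc.contractNth (· * ·) a) +
      (-1 : A) ^ (m + 1) * (ψ (Fin.init a) * a (Fin.last m))) := fun _ => rfl
  have hm : ∀ (r : ℕ) (x : A), (-1 : A) ^ r * x = ((-1 : ℤˣ) ^ r) • x := fun r x => by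
    rcases Nat.even_or_odd r with h | h
    · rw [h.neg_one_pow, h.neg_one_pow, one_mul, one_smul]
    · rw [h.neg_one_pow, h.neg_one_pow, neg_one_mul, Units.neg_smul, one_smul]
  simp only [h0, hm, smul_add, Finset.sum_add_distrib, Finset.smul_sum]
  have h8 : ∑ σ : Equiv.Perm (Fin (m + 1)), ∑ j : Fin m, (Equiv.Perm.sign σ * koszulSign σ i) •
      (-1 : ℤˣ) ^ ((j : ℕ) + 1) • ψ (j.castSucc.contractNth (· * ·) (a ∘ σ)) = 0 := by
    rw [Finset.sum_comm]
    refine Finset.sum_eq_zero fun j _ => ?_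
    simp only [smul_comm _ ((-1 : ℤˣ) ^ ((j : ℕ) + 1))]
    rw [← Finset.smul_sum, sum_perm_merge ψ j ha, smul_zero]
  rw [h8, zero_add]
  · rw [← Equiv.sum_comp (Equiv.mulRight (finRotate (m + 1)))
      fun σ : Equiv.Perm (Fin (m + 1)) => (Equiv.Perm.sign σ * koszulSign σ i) •
        (-1 : ℤˣ) ^ (m + 1) • (ψ (Fin.init (a ∘ σ)) * (a ∘ σ) (Fin.last m)),
      ← Finset.sum_add_distrib]
    refine Finset.sum_eq_zero fun σ _ => ?_
    have h1 : (a ∘ ⇑(Equiv.mulRight (finRotate (m + 1)) σ)) (Fin.last m) = (a ∘ σ) 0 := by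
      rw [Equiv.coe_mulRight, Function.comp_apply, Equiv.Perm.mul_apply, finRotate_last]
      rfl
    have h2 : Fin.init (a ∘ ⇑(Equiv.mulRight (finRotate (m + 1)) σ)) = Fin.tail (a ∘ σ) := by
      ext l
      simp only [Fin.init, Fin.tail, Equiv.coe_mulRight, Function.comp_apply,
        Equiv.Perm.mul_apply, finRotate_castSucc]
    have h3 : ψ (Fin.tail (a ∘ σ)) ∈ 𝒜 (d + ∑ j, Fin.tail (i ∘ σ) j) := hψ _ _ fun j => ha _
    have h4 : (a ∘ σ) 0 ∈ 𝒜 ((i ∘ σ) 0) := ha _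
    rw [h1, h2, Equiv.coe_mulRight, koszulSign_mul, Equiv.Perm.sign_mul, koszulSign_finRotate,
      sign_finRotate, koszulTwist_of_mem h4, smul_mul_assoc, GradedCommutative.comm h4 h3,
      smul_smul, smul_smul, smul_smul]
    have h5 : Equiv.Perm.sign σ * (-1) ^ m * (koszulSign σ i * ((i ∘ σ) 0 *
        ∑ j, Fin.tail (i ∘ σ) j).negOnePow) * (-1) ^ (m + 1) =
        -(Equiv.Perm.sign σ * koszulSign σ i * ((i ∘ σ) 0 *
          ∑ j, Fin.tail (i ∘ σ) j).negOnePow) := by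
      have h7 : ((-1 : ℤˣ)) ^ m * (-1) ^ m = 1 := Int.units_mul_self _
      calc _ = -((Equiv.Perm.sign σ * koszulSign σ i * ((i ∘ σ) 0 *
          ∑ j, Fin.tail (i ∘ σ) j).negOnePow) * ((-1) ^ m * (-1) ^ m)) := by
            rw [pow_succ, mul_neg_one, mul_neg]
            simp only [mul_assoc, mul_left_comm]
        _ = _ := by rw [h7, mul_one]
    have h6 : Equiv.Perm.sign σ * koszulSign σ i * ((d * (i ∘ σ) 0).negOnePow *
        ((i ∘ σ) 0 * (d + ∑ j, Fin.tail (i ∘ σ) j)).negOnePow) =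
        Equiv.Perm.sign σ * koszulSign σ i * ((i ∘ σ) 0 *
          ∑ j, Fin.tail (i ∘ σ) j).negOnePow := by
      congr 1
      rw [← Int.negOnePow_add]
      refine negOnePow_eq_of_even_sub ⟨d * (i ∘ σ) 0, ?_⟩
      ring
    rw [Nat.add_sub_cancel, h5, mul_assoc (_ * _), h6, Units.neg_smul, add_neg_cancel]

/-- An alternating multiderivation which is a coboundary vanishes. -/
theorem eq_zero_of_mem_diffCobd {m : ℕ} {d : ℤ} {φ : Cochain k A m} (h : φ ∈ hkrCochain 𝒜 d m)
    (h' : φ ∈ diffCobd 𝒜 d m) : φ = 0 := by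
  cases m with
  | zero => exact (Submodule.mem_bot k).1 h'
  | succ m =>
    obtain ⟨ψ, hψ, rfl⟩ := h'
    refine cochain_ext_homogeneous (𝒜 := 𝒜) fun i a ha => ?_
    -- As φ is alternating, every summand equals φ(a), so the vanishing sum is (m + 1)! φ(a).
    have h1 := sum_perm_hochschildB (fun i a => diffCochain_apply_mem hψ (i := i) (a := a)) ha
    have h2 : ∀ σ : Equiv.Perm (Fin (m + 1)), (Equiv.Perm.sign σ * koszulSign σ i) •
        hochschildB 𝒜 d ψ (a ∘ σ) = hochschildB 𝒜 d ψ a := fun σ => (hkrCochain_perm h σ ha).symm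
    rw [Finset.sum_congr rfl fun σ _ => h2 σ, Finset.sum_const, Finset.card_univ,
      Fintype.card_perm, Fintype.card_fin, ← Nat.cast_smul_eq_nsmul k] at h1
    exact (smul_eq_zero.1 h1).resolve_left
      (by exact_mod_cast Nat.factorial_ne_zero (m + 1))

end Antisymmetrization

/-! ### The image of the HKR map consists of alternating multiderivations -/

section Range

variable {k : Type} [Field k] {A : Type u} [Ring A] [Algebra k A]
variable {𝒜 : ℤ → Submodule k A} [GradedAlgebra 𝒜] [GradedCommutative 𝒜]

/-- The last derivation meets its argument without a Koszul twist, so its Leibniz rule can be read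
off directly; the sign comes from moving a l to the front past the preceding factors. -/
theorem mulTensor_update_mul {m : ℕ} {e : Fin m → ℤ} {D : Fin m → Module.End k A}
    (h : ∀ i, D i ∈ gradedDer 𝒜 (e i)) {l : Fin m} (hl : (l : ℕ) + 1 = m) {i : Fin m → ℤ}
    {a : Fin m → A} (ha : ∀ j, a j ∈ 𝒜 (i j)) (b : A) :
    mulTensor 𝒜 e D (Function.update a l (a l * b)) = mulTensor 𝒜 e D a * b +
      ((∑ j, e j + ∑ j ∈ Finset.univ.erase l, i j) * i l).negOnePow •
        (a l * mulTensor 𝒜 e D (Function.update a l b)) := by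
  induction m with
  | zero => exact l.elim0
  | succ m ih =>
    cases m with
    | zero =>
      obtain rfl : l = 0 := Fin.ext (by omega)
      have h1 : ∀ a, mulTensor 𝒜 e D a = D 0 (a 0) := fun a => by
        simp [mulTensor, cupLeft, koszulTwist_zero]
      rw [h1, h1, h1, Function.update_self, Function.update_self, (h 0).2 _ _ _ (ha 0)]
      have h2 : (Finset.univ.erase (0 : Fin (0 + 1))) = ∅ := by decide
      rw [h2, Finset.sum_empty, add_zero]
      simp
    | succ m =>
      obtain rfl : l = Fin.last (m + 1) := Fin.ext (by simpa using hl)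
      have h0 : ∀ x, Function.update a (Fin.last (m + 1)) x 0 = a 0 := fun x =>
        Function.update_of_ne (Fin.last_pos).ne _ _
      have ht : ∀ x, Fin.tail (Function.update a (Fin.last (m + 1)) x) =
          Function.update (Fin.tail a) (Fin.last m) x := fun x => by
        rw [← Fin.succ_last, Fin.tail_update_succ]
      have h1 : ∀ a, mulTensor 𝒜 e D a = D 0 (koszulTwist 𝒜 (∑ i, Fin.tail e i) (a 0)) *
        mulTensor 𝒜 (Fin.tail e) (Fin.tail D) (Fin.tail a) := fun a => rfl
      have h2 := ih (e := Fin.tail e) (D := Fin.tail D) (fun i => h i.succ) (l := Fin.last m)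
        rfl (i := Fin.tail i) (a := Fin.tail a) (fun j => ha j.succ)
      have h3 : Fin.tail a (Fin.last m) = a (Fin.last (m + 1)) := rfl
      have h4 : Fin.tail i (Fin.last m) = i (Fin.last (m + 1)) := rfl
      rw [h3, h4] at h2
      have h5 := (h 0).1 _ _ (koszulTwist_mem (d := ∑ i, Fin.tail e i) (ha 0))
      have he : ∑ j ∈ Finset.univ.erase (Fin.last (m + 1)), i j =
          i 0 + ∑ j ∈ Finset.univ.erase (Fin.last m), Fin.tail i j := by
        have e1 := Finset.add_sum_erase Finset.univ i (Finset.mem_univ (Fin.last (m + 1)))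
        have e2 := Finset.add_sum_erase Finset.univ (Fin.tail i) (Finset.mem_univ (Fin.last m))
        rw [Fin.sum_univ_succ] at e1
        simp only [Fin.tail] at e2 ⊢
        rw [Fin.succ_last] at e2
        linarith
      rw [h1, h1, h1, h0, h0, ht, ht, h2, mul_add, mul_assoc, mul_smul_comm, ← mul_assoc (D 0 _) (a (Fin.last (m + 1))),
        GradedCommutative.comm h5 (ha (Fin.last (m + 1))), smul_mul_assoc, smul_smul,
        ← Int.negOnePow_add, mul_assoc, he, Fin.sum_univ_succ e]
      congr 3
      simp only [Fin.tail]
      ring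

theorem tail_tail_comp_swap {X : Type*} {m : ℕ} (f : Fin (m + 2) → X) :
    Fin.tail (Fin.tail (f ∘ Equiv.swap 0 1)) = Fin.tail (Fin.tail f) := by
  ext j
  simp only [Fin.tail, Function.comp_apply]
  rw [Equiv.swap_apply_of_ne_of_ne (Fin.succ_ne_zero _)
    (show j.succ.succ ≠ 1 from fun h => Fin.succ_ne_zero j (Fin.succ_injective _ h))]

theorem comp_swap_zero {X : Type*} {m : ℕ} (f : Fin (m + 2) → X) :
    (f ∘ Equiv.swap 0 1) 0 = f 1 := congrArg f (Equiv.swap_apply_left _ _)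

theorem tail_comp_swap_zero {X : Type*} {m : ℕ} (f : Fin (m + 2) → X) :
    Fin.tail (f ∘ Equiv.swap 0 1) 0 = f 0 := congrArg f (Equiv.swap_apply_right _ _)

theorem tail_comp_swap_succ {X : Type*} {m : ℕ} (l : Fin m) (f : Fin (m + 2) → X) :
    Fin.tail (f ∘ Equiv.swap l.succ.castSucc l.succ.succ) =
      Fin.tail f ∘ Equiv.swap l.castSucc l.succ := by
  ext j
  simp only [Fin.tail, Function.comp_apply]
  rw [← Fin.succ_castSucc, (Fin.succ_injective _).swap_apply]

theorem comp_swap_succ_zero {X : Type*} {m : ℕ} (l : Fin m) (f : Fin (m + 2) → X) :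
    (f ∘ Equiv.swap l.succ.castSucc l.succ.succ) 0 = f 0 := by
  rw [Function.comp_apply, ← Fin.succ_castSucc, Equiv.swap_apply_of_ne_of_ne
    (Fin.succ_ne_zero _).symm (Fin.succ_ne_zero _).symm]

theorem mulTensor_succ_apply {m : ℕ} (e : Fin (m + 1) → ℤ) (D : Fin (m + 1) → Module.End k A)
    (a : Fin (m + 1) → A) : mulTensor 𝒜 e D a = D 0 (koszulTwist 𝒜 (∑ i, Fin.tail e i) (a 0)) *
      mulTensor 𝒜 (Fin.tail e) (Fin.tail D) (Fin.tail a) := rfl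

/-- Permuting the arguments and permuting the operators give the same product of values up to order.
In degree bookkeeping the two values D₀(a₁) and D₁(a₀) are interchanged by graded commutativity,
which accounts for both signs. -/
theorem mulTensor_comp_swap {m : ℕ} {e : Fin (m + 1) → ℤ} {D : Fin (m + 1) → Module.End k A}
    (h : ∀ i, D i ∈ homEnd 𝒜 (e i)) (l : Fin m) {i : Fin (m + 1) → ℤ} {a : Fin (m + 1) → A}
    (ha : ∀ j, a j ∈ 𝒜 (i j)) :
    (i l.castSucc * i l.succ).negOnePow • mulTensor 𝒜 e D (a ∘ Equiv.swap l.castSucc l.succ) =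
      (e l.castSucc * e l.succ).negOnePow • mulTensor 𝒜 (e ∘ Equiv.swap l.castSucc l.succ)
        (D ∘ Equiv.swap l.castSucc l.succ) a := by
  induction m with
  | zero => exact l.elim0
  | succ m ih =>
    refine Fin.cases ?_ (fun l => ?_) l
    · rw [Fin.castSucc_zero, Fin.succ_zero_eq_one, mulTensor_succ_apply, mulTensor_succ_apply,
        mulTensor_succ_apply, mulTensor_succ_apply, tail_tail_comp_swap a, tail_tail_comp_swap e,
        tail_tail_comp_swap D, comp_swap_zero a, comp_swap_zero D, tail_comp_swap_zero a,
        tail_comp_swap_zero D, Fin.sum_univ_succ, Fin.sum_univ_succ (Fin.tail (e ∘ _)),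
        tail_comp_swap_zero e]
      have h3 : ∀ j, Fin.tail (e ∘ Equiv.swap 0 1) (Fin.succ j) = Fin.tail (Fin.tail e) j :=
        fun j => congrFun (tail_tail_comp_swap e) j
      have h4 : ∀ j, Fin.tail e (Fin.succ j) = Fin.tail (Fin.tail e) j := fun _ => rfl
      have hb0 : Fin.tail a 0 = a 1 := rfl
      have hD0 : Fin.tail D 0 = D 1 := rfl
      have he0 : Fin.tail e 0 = e 1 := rfl
      simp only [h3, h4, hb0, hD0, he0]
      have ha0 := ha 0
      have ha1 := ha 1
      have hD1 := h 0 _ _ ha1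
      have hD2 := h 1 _ _ ha0
      rw [koszulTwist_of_mem ha0, koszulTwist_of_mem ha1, koszulTwist_of_mem ha0,
        koszulTwist_of_mem ha1]
      simp only [map_sign_smul, smul_mul_assoc, mul_smul_comm, smul_smul, ← Int.negOnePow_add,
        ← mul_assoc]
      rw [GradedCommutative.comm hD1 hD2, smul_mul_assoc, smul_smul, ← Int.negOnePow_add]
      congr 1
      refine negOnePow_eq_of_even_sub ⟨i 0 * i 1 + e 1 * i 1, ?_⟩
      ring
    · rw [mulTensor_succ_apply e D, mulTensor_succ_apply (e ∘ _), tail_comp_swap_succ l a,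
        tail_comp_swap_succ l e, tail_comp_swap_succ l D, comp_swap_succ_zero l a,
        comp_swap_succ_zero l D, sum_comp_perm, ← mul_smul_comm, ← mul_smul_comm]
      congr 1
      exact ih (e := Fin.tail e) (D := Fin.tail D) (fun j => h j.succ) l (i := Fin.tail i)
        (fun j => ha j.succ)

/-- Each permuted summand has the Leibniz rule in the last slot by itself. For alternation, a swap
of the arguments is traded for a swap of the derivations and absorbed by reindexing the sum over
permutations. -/
theorem range_hkrMap_le (m : ℕ) (d : ℤ) : LinearMap.range (hkrMap 𝒜 m d) ≤ hkrCochain 𝒜 d m := by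
  rintro _ ⟨x, rfl⟩
  obtain ⟨x, rfl⟩ := Submodule.Quotient.mk_surjective _ x
  change hkrFree 𝒜 m d x ∈ _
  rw [hkrFree, Finsupp.linearCombination_apply]
  refine Submodule.sum_mem _ fun y _ => Submodule.smul_mem _ _ ?_
  obtain ⟨d₀, c, hc, e, D, hD, rfl⟩ := y
  set T : Equiv.Perm (Fin m) → Cochain k A m := fun σ =>
    (Equiv.Perm.sign σ * koszulSign σ e) • c • mulTensor 𝒜 (e ∘ σ) (D ∘ σ) with hT
  have hTa : ∀ σ a, T σ a = (Equiv.Perm.sign σ * koszulSign σ e) •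
    (c * mulTensor 𝒜 (e ∘ σ) (D ∘ σ) a) := fun _ _ => rfl
  have hsum : ∀ (σ : Equiv.Perm (Fin m)), ∑ i, (e ∘ σ) i = ∑ i, e i := sum_comp_perm e
  have hDσ : ∀ (σ : Equiv.Perm (Fin m)) i, (D ∘ σ) i ∈ gradedDer 𝒜 ((e ∘ σ) i) :=
    fun σ i => hD (σ i)
  refine Submodule.smul_mem _ _ (show ∑ σ, T σ ∈ _ from ⟨fun i a ha => ?_, fun l hl i a ha b => ?_,
    fun l l' hl i a ha => ?_⟩)
  · rw [_root_.sum_apply]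
    refine Submodule.sum_mem _ fun σ _ => sign_smul_mem (k := k) _ _ ?_
    have := SetLike.mul_mem_graded hc (mulTensor_mem_homogeneous (fun i => (hDσ σ i).1) ha)
    rwa [hsum, ← add_assoc] at this
  · rw [_root_.sum_apply, _root_.sum_apply, _root_.sum_apply, Finset.sum_mul, Finset.mul_sum,
      Finset.smul_sum, ← Finset.sum_add_distrib]
    refine Finset.sum_congr rfl fun σ _ => ?_
    rw [hTa, hTa, hTa, mulTensor_update_mul (hDσ σ) hl ha, hsum, mul_add, smul_add, ← mul_assoc,
      smul_mul_assoc, mul_smul_comm _ c, mul_smul_comm _ (a l), smul_comm _ (Int.negOnePow _),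
      ← mul_assoc c, GradedCommutative.comm hc (ha l), smul_mul_assoc, mul_assoc (a l),
      smul_comm _ (d₀ * i l).negOnePow, smul_smul (Int.negOnePow _) (Int.negOnePow _),
      ← Int.negOnePow_add, ← add_mul, add_comm _ d₀, ← add_assoc]
  · cases m with
    | zero => exact l.elim0
    | succ m =>
      have hl' : (l : ℕ) < m := by have := l'.2; omega
      obtain ⟨l, rfl⟩ : ∃ p : Fin m, p.castSucc = l := ⟨⟨l, hl'⟩, rfl⟩
      obtain rfl : l' = l.succ := Fin.ext (by simpa using hl.symm)
      rw [_root_.sum_apply, _root_.sum_apply, Finset.smul_sum, ← Finset.sum_neg_distrib,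
        ← Equiv.sum_comp (Equiv.mulRight (Equiv.swap l.castSucc l.succ))]
      refine Finset.sum_congr rfl fun σ _ => ?_
      rw [hTa, hTa, Equiv.coe_mulRight, koszulSign_mul, Equiv.Perm.sign_mul, koszulSign_swap,
        Equiv.Perm.sign_swap Fin.castSucc_lt_succ.ne, smul_comm (Int.negOnePow _),
        ← mul_smul_comm (Int.negOnePow _) c, mulTensor_comp_swap (fun j => (hDσ σ j).1) l ha,
        mul_smul_comm, smul_smul, mul_neg_one, neg_mul, Units.neg_smul, mul_assoc]
      rfl

end Range

section Equality

variable {k : Type} [Field k] [CharZero k] {A : Type u} [Ring A] [Algebra k A]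
variable {𝒜 : ℤ → Submodule k A} [GradedAlgebra 𝒜] [GradedCommutative 𝒜]

/-- With respect to a finite dual family of derivations, the image of the HKR map is the space of
alternating multiderivations. -/
theorem range_hkrMap_eq {ι : Type*} [Fintype ι] {x : ι → A} {n : ι → ℤ}
    {X : ι → Module.End k A} (hx : ∀ t, x t ∈ 𝒜 (n t)) (hX : ∀ t, X t ∈ gradedDer 𝒜 (-n t))
    (hc : ∀ (e : ℤ) (D : Module.End k A), D ∈ gradedDer 𝒜 e → D = ∑ t, D (x t) • X t)
    (m : ℕ) (d : ℤ) : LinearMap.range (hkrMap 𝒜 m d) = hkrCochain 𝒜 d m := by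
  -- An alternating multiderivation is an HKR image plus a coboundary. The coboundary is again an
  -- alternating multiderivation, being a difference of two, and therefore vanishes.
  refine le_antisymm (range_hkrMap_le m d) fun φ hφ => ?_
  obtain ⟨χ, hχ, β, hβ, rfl⟩ := Submodule.mem_sup.1
    (multiDer_le d m (hkrCochain_le_multiDer hx hX hc m d hφ))
  have h1 : β ∈ hkrCochain 𝒜 d m := by
    have := sub_mem hφ (range_hkrMap_le m d hχ)
    rwa [add_sub_cancel_left] at this
  rw [eq_zero_of_mem_diffCobd h1 hβ, add_zero]
  exact hχ

end Equality

end GradedHKR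

/-! ## Injectivity of the HKR map -/

namespace GradedHKR

section CrossSum

/-- `∑_{i<j} p i * e j`. -/
def crossSum {m : ℕ} (p e : Fin m → ℤ) : ℤ := ∑ i, ∑ j, if i < j then p i * e j else 0

theorem crossSum_succ {m : ℕ} (p e : Fin (m + 1) → ℤ) :
    crossSum p e = p 0 * ∑ i, Fin.tail e i + crossSum (Fin.tail p) (Fin.tail e) := by
  simp only [crossSum, Fin.sum_univ_succ, Fin.tail, Finset.mul_sum]
  simp

/-- The discrepancy between pulling coefficients out of a wedge and evaluating on coordinates;
modulo 2 it is `crossSum n n`, the sign built into `hkrInverse`. -/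
theorem crossSum_neg_add {m : ℕ} (n e : Fin m → ℤ) :
    crossSum (fun i => -n i) (fun i => n i + e i) = -crossSum n n - crossSum n e := by
  simp only [crossSum, ← Finset.sum_neg_distrib, ← Finset.sum_sub_distrib]
  refine Finset.sum_congr rfl fun i _ => Finset.sum_congr rfl fun j _ => ?_
  split_ifs
  · ring
  · ring

theorem sum_mul_sum_lt {m : ℕ} (f g : Fin m → ℤ) :
    ∑ i, g i * ∑ j with j < i, f j = crossSum f g := by
  rw [crossSum, Finset.sum_comm]
  refine Finset.sum_congr rfl fun i _ => ?_
  rw [Finset.mul_sum, Finset.sum_filter]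
  refine Finset.sum_congr rfl fun j _ => ?_
  split_ifs
  · ring
  · rfl

end CrossSum

/-! ### The exterior power by generators and relations, and a left inverse of the HKR map -/

section Wedge

variable {k : Type} [Field k] {A : Type u} [Ring A] [Algebra k A]
variable {𝒜 : ℤ → Submodule k A}

theorem mulTensor_eq_prod [GradedAlgebra 𝒜] [GradedCommutative 𝒜] {m : ℕ} {p e : Fin m → ℤ} {D : Fin m → Module.End k A}
    {a : Fin m → A} (ha : ∀ i, a i ∈ 𝒜 (p i)) : mulTensor 𝒜 e D a =
      (crossSum p e).negOnePow • (List.ofFn fun i => D i (a i)).prod := by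
  induction m with
  | zero => simp [mulTensor, crossSum]
  | succ m ih =>
    rw [mulTensor_succ_apply, ih (p := Fin.tail p) (a := Fin.tail a) (fun i => ha i.succ), koszulTwist_of_mem (ha 0),
      map_sign_smul, smul_mul_assoc, mul_smul_comm, smul_smul, ← Int.negOnePow_add, List.ofFn_succ,
      List.prod_cons, crossSum_succ, mul_comm (p 0)]
    rfl

/-- The class of `a · D₀ ∧ ⋯ ∧ D_{m-1}`. -/
noncomputable def wedgeMk {m : ℕ} {d d₀ : ℤ} {e : Fin m → ℤ} (h : d₀ + ∑ i, e i = d) {a : A} (ha : a ∈ 𝒜 d₀)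
    {D : Fin m → Module.End k A} (hD : ∀ i, D i ∈ gradedDer 𝒜 (e i)) : DerWedge 𝒜 m d :=
  Submodule.Quotient.mk (Finsupp.single ⟨d₀, a, ha, e, D, hD, h⟩ 1)

theorem wedgeMk_congr {m : ℕ} {d d₀ d₀' : ℤ} {e e' : Fin m → ℤ} {h : d₀ + ∑ i, e i = d}
    (h' : d₀' + ∑ i, e' i = d) {a a' : A} {ha : a ∈ 𝒜 d₀} (ha' : a' ∈ 𝒜 d₀')
    {D D' : Fin m → Module.End k A} {hD : ∀ i, D i ∈ gradedDer 𝒜 (e i)}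
    (hD' : ∀ i, D' i ∈ gradedDer 𝒜 (e' i)) (h1 : d₀ = d₀') (h2 : a = a') (h3 : e = e')
    (h4 : D = D') : wedgeMk h ha hD = wedgeMk h' ha' hD' := by
  subst h1 h2 h3 h4
  rfl

theorem wedge_mk_eq_zero {m : ℕ} {d : ℤ} {r : WedgeMonomial 𝒜 m d →₀ k} (h : WedgeRel 𝒜 m d r) :
    (Submodule.Quotient.mk r : DerWedge 𝒜 m d) = 0 :=
  (Submodule.Quotient.mk_eq_zero _).2 (Submodule.subset_span h)

section Relations

variable {m : ℕ} {d d₀ : ℤ} {e : Fin m → ℤ} {D : Fin m → Module.End k A}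

theorem wedgeMk_add (h : d₀ + ∑ i, e i = d) {a a' : A} (ha : a ∈ 𝒜 d₀) (ha' : a' ∈ 𝒜 d₀)
    (hD : ∀ i, D i ∈ gradedDer 𝒜 (e i)) :
    wedgeMk h (add_mem ha ha') hD = wedgeMk h ha hD + wedgeMk h ha' hD := by
  have := wedge_mk_eq_zero (WedgeRel.add_coeff ha ha' hD h)
  rw [sub_sub] at this
  exact sub_eq_zero.1 this

theorem wedgeMk_smul (h : d₀ + ∑ i, e i = d) (r : k) {a : A} (ha : a ∈ 𝒜 d₀)
    (hD : ∀ i, D i ∈ gradedDer 𝒜 (e i)) :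
    wedgeMk h (Submodule.smul_mem _ r ha) hD = r • wedgeMk h ha hD :=
  sub_eq_zero.1 (wedge_mk_eq_zero (WedgeRel.smul_coeff r ha hD h))

theorem wedgeMk_update_add (h : d₀ + ∑ i, e i = d) {a : A} (ha : a ∈ 𝒜 d₀) (i : Fin m)
    {ψ ψ' : Module.End k A}
    (h₁ : ∀ j, Function.update D i (ψ + ψ') j ∈ gradedDer 𝒜 (e j))
    (h₂ : ∀ j, Function.update D i ψ j ∈ gradedDer 𝒜 (e j))
    (h₃ : ∀ j, Function.update D i ψ' j ∈ gradedDer 𝒜 (e j)) :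
    wedgeMk h ha h₁ = wedgeMk h ha h₂ + wedgeMk h ha h₃ := by
  have := wedge_mk_eq_zero (WedgeRel.add_der i ha h₁ h₂ h₃ h)
  rw [sub_sub] at this
  exact sub_eq_zero.1 this

theorem wedgeMk_update_smul {d₁ : ℤ} {a b : A} (i : Fin m) (ha : a ∈ 𝒜 d₀) (hb : b ∈ 𝒜 d₁)
    (hD : ∀ i, D i ∈ gradedDer 𝒜 (e i))
    (h₁ : ∀ j, Function.update D i (b • D i) j ∈ gradedDer 𝒜 (Function.update e i (e i + d₁) j))
    (h₂ : d₀ + ∑ j, Function.update e i (e i + d₁) j = d)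
    (hab : a * b ∈ 𝒜 (d₀ + d₁)) (h₃ : d₀ + d₁ + ∑ i, e i = d) :
    wedgeMk h₂ ha h₁ = (d₁ * ∑ j with j < i, e j).negOnePow • wedgeMk h₃ hab hD :=
  sub_eq_zero.1 (wedge_mk_eq_zero (WedgeRel.smul_der i ha hb hD h₁ h₂ hab h₃))

theorem wedgeMk_perm (σ : Equiv.Perm (Fin m)) (h : d₀ + ∑ i, e i = d)
    (h' : d₀ + ∑ i, (e ∘ σ) i = d) {a : A} (ha : a ∈ 𝒜 d₀) (hD : ∀ i, D i ∈ gradedDer 𝒜 (e i)) :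
    koszulSign σ e • wedgeMk h' ha (D := D ∘ σ) (fun i => hD (σ i)) =
      Equiv.Perm.sign σ • wedgeMk h ha hD :=
  sub_eq_zero.1 (wedge_mk_eq_zero (WedgeRel.perm σ ha hD h h'))

end Relations

variable [GradedAlgebra 𝒜]

theorem smul_mem_gradedDer [GradedCommutative 𝒜] {p q : ℤ} {b : A} (hb : b ∈ 𝒜 p)
    {X : Module.End k A} (hX : X ∈ gradedDer 𝒜 q) : b • X ∈ gradedDer 𝒜 (p + q) := by
  refine ⟨fun i a ha => ?_, fun i a c ha => ?_⟩
  · have := SetLike.mul_mem_graded hb (hX.1 i a ha)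
    rwa [show p + (i + q) = i + (p + q) by ring] at this
  · simp only [LinearMap.smul_apply, smul_eq_mul]
    rw [hX.2 i a c ha, mul_add, mul_assoc, mul_smul_comm, ← mul_assoc b a, GradedCommutative.comm hb ha,
      smul_mul_assoc, smul_smul, ← Int.negOnePow_add, mul_assoc, add_mul, add_comm (q * i)]

/-- `(D₀, …, D_{m-1}) ↦ a · D₀ ∧ ⋯ ∧ D_{m-1}` as a multilinear map. -/
noncomputable def wedgeMultilinear {m : ℕ} {d d₀ : ℤ} {e : Fin m → ℤ} (h : d₀ + ∑ i, e i = d)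
    {a : A} (ha : a ∈ 𝒜 d₀) :
    MultilinearMap k (fun i => gradedDer 𝒜 (e i)) (DerWedge 𝒜 m d) where
  toFun D := wedgeMk h ha (D := fun i => (D i : Module.End k A)) fun i => (D i).2
  map_update_add' {inst} D i ψ ψ' := by
    obtain rfl : inst = instDecidableEqFin m := Subsingleton.elim _ _
    have h1 : ∀ χ : gradedDer 𝒜 (e i), (fun j => ((Function.update D i χ) j : Module.End k A)) =
        Function.update (fun j => (D j : Module.End k A)) i χ := fun χ => by
      ext1 j
      exact Function.apply_update (fun j (χ : gradedDer 𝒜 (e j)) => (χ : Module.End k A)) D i χ j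
    have h2 : ∀ (χ : gradedDer 𝒜 (e i)) j,
        Function.update (fun j => (D j : Module.End k A)) i χ j ∈ gradedDer 𝒜 (e j) :=
      fun χ j => by rw [← congrFun (h1 χ) j]; exact ((Function.update D i χ) j).2
    have h3 := wedgeMk_update_add h ha i (h2 (ψ + ψ')) (h2 ψ) (h2 ψ')
    rw [wedgeMk_congr h ha (h2 (ψ + ψ')) rfl rfl rfl (h1 _), wedgeMk_congr h ha (h2 ψ) rfl rfl rfl
      (h1 _), wedgeMk_congr h ha (h2 ψ') rfl rfl rfl (h1 _)]
    exact h3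
  map_update_smul' {inst} D i c ψ := by
    obtain rfl : inst = instDecidableEqFin m := Subsingleton.elim _ _
    have h1 : ∀ χ : gradedDer 𝒜 (e i), (fun j => ((Function.update D i χ) j : Module.End k A)) =
        Function.update (fun j => (D j : Module.End k A)) i χ := fun χ => by
      ext1 j
      exact Function.apply_update (fun j (χ : gradedDer 𝒜 (e j)) => (χ : Module.End k A)) D i χ j
    have h2 : ∀ (χ : gradedDer 𝒜 (e i)) j,
        Function.update (fun j => (D j : Module.End k A)) i χ j ∈ gradedDer 𝒜 (e j) :=
      fun χ j => by rw [← congrFun (h1 χ) j]; exact ((Function.update D i χ) j).2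
    -- The relations contain no separate rule for scalars in a derivation; a scalar is treated as a
    -- coefficient of degree zero, pulled out and absorbed in a.
    have hb : algebraMap k A c ∈ 𝒜 0 := SetLike.algebraMap_mem_graded 𝒜 c
    have he : Function.update e i (e i + 0) = e := by rw [add_zero, Function.update_eq_self]
    have hD : Function.update (Function.update (fun j => (D j : Module.End k A)) i ψ) i
        (algebraMap k A c • Function.update (fun j => (D j : Module.End k A)) i ψ i) =
        fun j => ((Function.update D i (c • ψ)) j : Module.End k A) := by
      rw [h1, Function.update_self, Function.update_idem]
      congr 1
      ext x
      exact (Algebra.smul_def c _).symm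
    have h3 := wedgeMk_update_smul (d := d) i ha hb (h2 ψ)
      (fun j => by rw [hD, he]; exact ((Function.update D i (c • ψ)) j).2)
      (by rw [he]; exact h) (SetLike.mul_mem_graded ha hb) (by rw [add_zero]; exact h)
    rw [zero_mul, Int.negOnePow_zero, one_smul] at h3
    rw [wedgeMk_congr h ha (h2 ψ) rfl rfl rfl (h1 _), ← wedgeMk_smul]
    refine (wedgeMk_congr _ _ _ rfl rfl he.symm hD.symm).trans (h3.trans ?_)
    refine wedgeMk_congr _ _ _ (add_zero _) ?_ rfl rfl
    rw [Algebra.smul_def, Algebra.commutes]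

/-- Coefficients can be moved out of a wedge product of derivations. -/
theorem wedgeMk_smul_der [GradedCommutative 𝒜] {m : ℕ} {d d₀ : ℤ} {f g : Fin m → ℤ} {a : A}
    (ha : a ∈ 𝒜 d₀) {b : Fin m → A} (hb : ∀ i, b i ∈ 𝒜 (g i)) {Y : Fin m → Module.End k A}
    (hY : ∀ i, Y i ∈ gradedDer 𝒜 (f i)) (h : d₀ + ∑ i, (g i + f i) = d)
    (h' : d₀ + ∑ i, g i + ∑ i, f i = d) (hab : a * (List.ofFn b).prod ∈ 𝒜 (d₀ + ∑ i, g i)) :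
    wedgeMk h ha (fun i => smul_mem_gradedDer (hb i) (hY i)) =
      (crossSum f g).negOnePow • wedgeMk h' hab hY := by
  have hbY := fun i => smul_mem_gradedDer (hb i) (hY i)
  -- Stage p of the extraction: the coefficients at the positions below p have been moved into a.
  -- Working from the left, the coefficient at position p only passes bare Y_j with j < p, whence
  -- the sign involves the degrees f alone.
  set E : ℕ → Fin m → ℤ := fun p i => if (i : ℕ) < p then f i else g i + f i with hE
  set W : ℕ → Fin m → Module.End k A := fun p i => if (i : ℕ) < p then Y i else b i • Y i with hW
  have hWE : ∀ p i, W p i ∈ gradedDer 𝒜 (E p i) := fun p i => by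
    simp only [hE, hW]
    split_ifs
    · exact hY i
    · exact hbY i
  have hcoeff : ∀ p, p ≤ m → a * ((List.ofFn b).take p).prod ∈
      𝒜 (d₀ + ∑ i with i.val < p, g i) := by
    intro p hp
    refine SetLike.mul_mem_graded ha ?_
    induction p with
    | zero => simpa using SetLike.GradedOne.one_mem (A := 𝒜)
    | succ p ih =>
      have hl : p < (List.ofFn b).length := by simpa using hp
      rw [List.prod_take_succ _ _ hl]
      have h1 := SetLike.mul_mem_graded (ih (by omega)) (hb ⟨p, hp⟩)
      have h2 : Finset.univ.filter (fun i : Fin m => i.val < p + 1) =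
          insert ⟨p, hp⟩ (Finset.univ.filter fun i : Fin m => i.val < p) := by
        ext i
        simp only [Finset.mem_filter, Finset.mem_univ, true_and, Finset.mem_insert, Fin.ext_iff]
        omega
      rw [h2, Finset.sum_insert (by simp), add_comm]
      simpa using h1
  have hdeg : ∀ p, p ≤ m → d₀ + ∑ i with i.val < p, g i + ∑ i, E p i = d := by
    intro p _
    rw [← h, add_assoc, Finset.sum_filter, ← Finset.sum_add_distrib]
    congr 1
    refine Finset.sum_congr rfl fun i _ => ?_
    simp only [hE]
    split_ifs <;> ring
  have main : ∀ p (hp : p ≤ m), wedgeMk h ha hbY =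
      (∑ i with i.val < p, g i * ∑ j with j < i, f j).negOnePow •
        wedgeMk (hdeg p hp) (hcoeff p hp) (hWE p) := by
    intro p
    induction p with
    | zero =>
      intro hp
      have : Finset.univ.filter (fun i : Fin m => i.val < 0) = ∅ := by ext; simp
      have hs : ∑ i : Fin m with i.val < 0, g i * ∑ j with j < i, f j = 0 := by
        rw [this, Finset.sum_empty]
      rw [hs, Int.negOnePow_zero, one_smul]
      refine wedgeMk_congr _ _ _ ?_ ?_ ?_ ?_
      · rw [this, Finset.sum_empty, add_zero]
      · simp
      · ext i; simp [hE]
      · ext1 i; simp [hW]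
    | succ p ih =>
      intro hp
      have hp' : p ≤ m := by omega
      set q : Fin m := ⟨p, hp⟩ with hq
      have hl : p < (List.ofFn b).length := by simpa using hp
      have hset : Finset.univ.filter (fun i : Fin m => i.val < p + 1) =
          insert q (Finset.univ.filter fun i : Fin m => i.val < p) := by
        ext i
        simp only [Finset.mem_filter, Finset.mem_univ, true_and, Finset.mem_insert, Fin.ext_iff, hq]
        omega
      have hqn : q ∉ Finset.univ.filter fun i : Fin m => i.val < p := by simp [hq]
      have hEu : Function.update (E (p + 1)) q (E (p + 1) q + g q) = E p := by
        ext i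
        rcases eq_or_ne i q with rfl | hi
        · rw [Function.update_self]
          simp [hE, hq, add_comm]
        · rw [Function.update_of_ne hi]
          have : (i : ℕ) ≠ p := fun h => hi (Fin.ext h)
          have h3 : (i : ℕ) < p + 1 ↔ (i : ℕ) < p := by omega
          simp only [hE, h3]
      have hWu : Function.update (W (p + 1)) q (b q • W (p + 1) q) = W p := by
        ext1 i
        rcases eq_or_ne i q with rfl | hi
        · rw [Function.update_self]
          simp [hW, hq]
        · rw [Function.update_of_ne hi]
          have : (i : ℕ) ≠ p := fun h => hi (Fin.ext h)
          have h3 : (i : ℕ) < p + 1 ↔ (i : ℕ) < p := by omega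
          simp only [hW, h3]
      have hg : d₀ + ∑ i with i.val < p, g i + g q = d₀ + ∑ i with i.val < p + 1, g i := by
        rw [hset, Finset.sum_insert hqn]; ring
      have hprod : a * ((List.ofFn b).take p).prod * b q =
          a * ((List.ofFn b).take (p + 1)).prod := by
        rw [List.prod_take_succ _ _ hl, mul_assoc]
        simp [hq]
      have h3 := wedgeMk_update_smul (d := d) q (hcoeff p hp') (hb q) (hWE (p + 1))
        (by rw [hEu, hWu]; exact hWE p) (by rw [hEu]; exact hdeg p hp')
        (by rw [hg, hprod]; exact hcoeff _ hp) (by rw [hg]; exact hdeg _ hp)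
      have h4 : wedgeMk (hdeg p hp') (hcoeff p hp') (hWE p) = _ :=
        (wedgeMk_congr _ _ _ rfl rfl hEu.symm hWu.symm).trans h3
      have h5 : ∑ j with j < q, E (p + 1) j = ∑ j with j < q, f j := by
        refine Finset.sum_congr rfl fun j hj => ?_
        have : (j : ℕ) < p := (Finset.mem_filter.1 hj).2
        simp only [hE]
        rw [if_pos (by omega)]
      have hs : ∑ i : Fin m with i.val < p + 1, g i * ∑ j with j < i, f j =
          ∑ i : Fin m with i.val < p, g i * ∑ j with j < i, f j + g q * ∑ j with j < q, f j := by
        rw [hset, Finset.sum_insert hqn, add_comm]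
      rw [ih hp', h4, smul_smul, ← Int.negOnePow_add, h5, hs]
      congr 1
      exact wedgeMk_congr _ _ _ hg hprod rfl rfl
  have hset : Finset.univ.filter (fun i : Fin m => i.val < m) = Finset.univ := by
    ext i; simp
  have hs : ∑ i : Fin m with i.val < m, g i * ∑ j with j < i, f j = crossSum f g := by
    rw [hset, sum_mul_sum_lt]
  rw [main m le_rfl, hs]
  congr 1
  refine wedgeMk_congr _ _ _ ?_ ?_ ?_ ?_
  · rw [hset]
  · rw [List.take_of_length_le (by simp)]
  · ext i; simp [hE]
  · ext1 i; simp [hW]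

variable [GradedCommutative 𝒜] {ι : Type*} [Fintype ι] {x : ι → A} {n : ι → ℤ}
  {X : ι → Module.End k A}

/-- `a ↦ a · X_{I 0} ∧ ⋯ ∧ X_{I (m-1)}`, on the homogeneous component of the appropriate degree. -/
noncomputable def wedgeCoeff (hX : ∀ t, X t ∈ gradedDer 𝒜 (-n t)) {m : ℕ} (d : ℤ) (I : Fin m → ι) :
    𝒜 (d + ∑ i, n (I i)) →ₗ[k] DerWedge 𝒜 m d where
  toFun a := wedgeMk (by rw [Finset.sum_neg_distrib, add_neg_cancel_right]) a.2 fun i => hX (I i)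
  map_add' a b := wedgeMk_add _ _ _ _
  map_smul' r a := wedgeMk_smul _ r _ _

/-- A left inverse of the HKR map built from a dual family of derivations. -/
noncomputable def hkrInverse (x : ι → A) (hX : ∀ t, X t ∈ gradedDer 𝒜 (-n t)) (m : ℕ) (d : ℤ) :
    Cochain k A m →ₗ[k] DerWedge 𝒜 m d :=
  ∑ I : Fin m → ι, ((((crossSum (n ∘ I) (n ∘ I)).negOnePow : ℤ) : k)) • (wedgeCoeff hX d I ∘ₗ
    (DirectSum.component k ℤ (fun i => 𝒜 i) (d + ∑ i, n (I i)) ∘ₗ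
      (DirectSum.decomposeLinearEquiv 𝒜).toLinearMap ∘ₗ
        { toFun := fun φ : Cochain k A m => φ (x ∘ I)
          map_add' := fun _ _ => rfl
          map_smul' := fun _ _ => rfl }))

/-- Expanding each D_i = ∑ D_i(x_t) X_t in the wedge and pulling the coefficients out gives, for
every multi-index I, the product of the D_i(x_{I i}) times the wedge of the X_{I i}. Up to sign that
product is the value of the cochain at x ∘ I. -/
theorem hkrInverse_smul_mulTensor (hx : ∀ t, x t ∈ 𝒜 (n t))
    (hX : ∀ t, X t ∈ gradedDer 𝒜 (-n t))
    (hc : ∀ (e : ℤ) (D : Module.End k A), D ∈ gradedDer 𝒜 e → D = ∑ t, D (x t) • X t)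
    {m : ℕ} {d d₀ : ℤ} {e : Fin m → ℤ} (h : d₀ + ∑ i, e i = d) {a : A} (ha : a ∈ 𝒜 d₀)
    {D : Fin m → Module.End k A} (hD : ∀ i, D i ∈ gradedDer 𝒜 (e i)) :
    hkrInverse x hX m d (a • mulTensor 𝒜 e D) = wedgeMk h ha hD := by
  have hDx : ∀ i t, D i (x t) ∈ 𝒜 (n t + e i) := fun i t => (hD i).1 _ _ (hx t)
  have hDX : ∀ i t, D i (x t) • X t ∈ gradedDer 𝒜 (e i) := fun i t => by
    have := smul_mem_gradedDer (hDx i t) (hX t)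
    rwa [show n t + e i + -n t = e i by ring] at this
  have h1 : wedgeMk h ha hD =
      wedgeMultilinear h ha fun i => ∑ t, (⟨D i (x t) • X t, hDX i t⟩ : gradedDer 𝒜 (e i)) := by
    refine wedgeMk_congr _ _ _ rfl rfl rfl (funext fun i => ?_)
    rw [AddSubmonoidClass.coe_finsetSum]
    exact hc _ _ (hD i)
  rw [h1, MultilinearMap.map_sum, hkrInverse, LinearMap.sum_apply]
  refine Finset.sum_congr rfl fun I _ => ?_
  have hp := fun i => hDx i (I i)
  have hprod : (List.ofFn fun i => D i (x (I i))).prod ∈ 𝒜 (∑ i, (n (I i) + e i)) := by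
    rw [← List.sum_ofFn]
    exact SetLike.list_prod_ofFn_mem_graded _ _ hp
  have h2 := wedgeMk_smul_der (d := d) ha hp (fun i => hX (I i))
    (by rw [← h]; congr 1; exact Finset.sum_congr rfl fun i _ => by ring)
    (by rw [← h, add_assoc, ← Finset.sum_add_distrib]; congr 1;
        exact Finset.sum_congr rfl fun i _ => by ring) (SetLike.mul_mem_graded ha hprod)
  have h3 : wedgeMultilinear h ha (fun i => (⟨D i (x (I i)) • X (I i), hDX i (I i)⟩ :
      gradedDer 𝒜 (e i))) = _ := (wedgeMk_congr _ _ _ rfl rfl (funext fun i => by ring) rfl).trans h2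
  have hdeg : d₀ + ∑ i, (n (I i) + e i) = d + ∑ i, n (I i) := by
    rw [Finset.sum_add_distrib, ← h]; ring
  have hP := SetLike.mul_mem_graded ha hprod
  rw [hdeg] at hP
  have h4 : (a • mulTensor 𝒜 e D) (x ∘ I) = (crossSum (n ∘ I) e).negOnePow •
      (a * (List.ofFn fun i => D i (x (I i))).prod) := by
    rw [_root_.smul_apply, mulTensor_eq_prod (p := n ∘ I) (a := x ∘ I) fun i => hx (I i), smul_eq_mul,
      mul_smul_comm]
    rfl
  have h5 : DirectSum.component k ℤ (fun i => 𝒜 i) (d + ∑ i, n (I i))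
      (DirectSum.decomposeLinearEquiv 𝒜 ((a • mulTensor 𝒜 e D) (x ∘ I))) =
      (crossSum (n ∘ I) e).negOnePow • ⟨_, hP⟩ := by
    rw [h4, map_sign_smul, map_sign_smul]
    congr 1
    exact Subtype.ext (DirectSum.decompose_of_mem_same 𝒜 hP)
  rw [h3, crossSum_neg_add]
  simp only [LinearMap.smul_apply, LinearMap.comp_apply]
  refine (congrArg (fun z => _ • wedgeCoeff hX d I z) h5).trans ?_
  rw [map_sign_smul, Int.cast_smul_eq_zsmul, ← Units.smul_def, smul_smul, ← Int.negOnePow_add]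
  refine congrArg₂ (· • ·) (negOnePow_eq_of_even_sub ?_) (wedgeMk_congr _ _ _ hdeg.symm rfl rfl rfl)
  refine ⟨crossSum (n ∘ I) (n ∘ I) + crossSum (n ∘ I) e, ?_⟩
  change crossSum (n ∘ I) (n ∘ I) + crossSum (n ∘ I) e -
    (-crossSum (n ∘ I) (n ∘ I) - crossSum (n ∘ I) e) = _
  ring

/-- By the permutation relation every signed summand of the HKR cochain is sent to the same wedge,
and the factor 1/m! turns the sum over permutations into that wedge. -/
theorem hkrInverse_hkrMap [CharZero k] (hx : ∀ t, x t ∈ 𝒜 (n t))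
    (hX : ∀ t, X t ∈ gradedDer 𝒜 (-n t))
    (hc : ∀ (e : ℤ) (D : Module.End k A), D ∈ gradedDer 𝒜 e → D = ∑ t, D (x t) • X t)
    {m : ℕ} {d : ℤ} (w : DerWedge 𝒜 m d) : hkrInverse x hX m d (hkrMap 𝒜 m d w) = w := by
  have hfac : (m.factorial : k) ≠ 0 := by exact_mod_cast Nat.factorial_ne_zero m
  obtain ⟨w, rfl⟩ := Submodule.Quotient.mk_surjective _ w
  change (hkrInverse x hX m d ∘ₗ hkrFree 𝒜 m d) w = Submodule.mkQ _ w
  congr 1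
  refine Finsupp.lhom_ext' fun y => LinearMap.ext_ring ?_
  obtain ⟨d₀, c, hc', e, D, hD, hd⟩ := y
  change hkrInverse x hX m d (hkrFree 𝒜 m d (Finsupp.single _ 1)) = wedgeMk hd hc' hD
  rw [hkrFree_single, hkrMonomial, map_smul, map_sum]
  have h1 : ∀ σ : Equiv.Perm (Fin m), hkrInverse x hX m d ((Equiv.Perm.sign σ * koszulSign σ e) •
      c • mulTensor 𝒜 (e ∘ σ) (D ∘ σ)) = wedgeMk hd hc' hD := by
    intro σ
    have hs : d₀ + ∑ i, (e ∘ σ) i = d := by rw [sum_comp_perm, hd]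
    have h2 := hkrInverse_smul_mulTensor hx hX hc hs hc' (D := D ∘ σ) fun i => hD (σ i)
    have h3 := wedgeMk_perm σ hd hs hc' hD
    rw [sign_smul_eq, map_smul, h2, Int.cast_smul_eq_zsmul, ← Units.smul_def, mul_smul, h3,
      smul_smul, Int.units_mul_self, one_smul]
  rw [Finset.sum_congr rfl fun σ _ => h1 σ, Finset.sum_const, Finset.card_univ,
    Fintype.card_perm, Fintype.card_fin, ← Nat.cast_smul_eq_nsmul k, smul_smul,
    inv_mul_cancel₀ hfac, one_smul]

end Wedge

end GradedHKR

/-! ## The HKR theorem from local coordinates -/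

namespace GradedHKR

section QuasiIso

open CategoryTheory

variable {k : Type} [Field k] {A : Type u} [Ring A] [Algebra k A]
variable {𝒜 : ℤ → Submodule k A} [GradedAlgebra 𝒜] [GradedCommutative 𝒜]

theorem diffTotalD_lof (n : ℤ) (m : ℕ) (φ : diffCochain 𝒜 (n - m) m) :
    diffTotalD 𝒜 n (DirectSum.lof k ℕ (fun m : ℕ => diffCochain 𝒜 (n - m) m) m φ) =
      DirectSum.lof k ℕ (fun m : ℕ => diffCochain 𝒜 (n + 1 - m) m) (m + 1)
        (diffHochschild 𝒜 n m φ) := by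
  rw [diffTotalD, DirectSum.toModule_lof]
  rfl

theorem diffTotalD_apply_succ (n : ℤ) (y : DiffTotal 𝒜 n) (m : ℕ) :
    (diffTotalD 𝒜 n y (m + 1) : Cochain k A (m + 1)) = hochschildB 𝒜 (n - m) (y m).1 := by
  induction y using DirectSum.induction_on with
  | zero =>
    rw [map_zero]
    exact (map_zero (hochschildBₗ 𝒜 (n - m) m)).symm
  | of l φ =>
    have h := diffTotalD_lof n l φ
    change diffTotalD 𝒜 n (DirectSum.of _ l φ) = DirectSum.of _ (l + 1) _ at h
    rw [h]
    rcases eq_or_ne l m with rfl | hl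
    · rw [DirectSum.of_eq_same, DirectSum.of_eq_same]
      rfl
    · rw [DirectSum.of_eq_of_ne _ _ _ (by simpa using hl.symm), DirectSum.of_eq_of_ne _ _ _ hl.symm]
      exact (map_zero (hochschildBₗ 𝒜 (n - m) m)).symm
  | add y z hy hz =>
    rw [map_add]
    refine (congrArg₂ (· + ·) hy hz).trans ?_
    exact (map_add (hochschildBₗ 𝒜 (n - m) m) _ _).symm

theorem diffTotalD_apply_zero (n : ℤ) (y : DiffTotal 𝒜 n) : diffTotalD 𝒜 n y 0 = 0 := by
  induction y using DirectSum.induction_on with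
  | zero => rw [map_zero]; rfl
  | of l φ =>
    have h := diffTotalD_lof n l φ
    change diffTotalD 𝒜 n (DirectSum.of _ l φ) = DirectSum.of _ (l + 1) _ at h
    rw [h, DirectSum.of_eq_of_ne _ _ _ (by simp)]
  | add y z hy hz =>
    rw [map_add]
    refine (congrArg₂ (· + ·) hy hz).trans ?_
    exact add_zero _

theorem hkrTotal_apply (n : ℤ) (x : ⨁ m : ℕ, DerWedge 𝒜 m (n - m)) (m : ℕ) :
    (hkrTotal 𝒜 n x m : Cochain k A m) = hkrMap 𝒜 m (n - m) (x m) := rfl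

/-- The source has zero differential, so injectivity on cohomology says that only zero has a
coboundary as image, and surjectivity that cocycles are HKR images plus coboundaries. The Hochschild
differential raises the total degree and the arity together and keeps the internal degree, so both
may be checked arity by arity. -/
theorem quasiIso_hkrHom
    (hinj : ∀ (m : ℕ) (d : ℤ), Function.Injective (hkrMap 𝒜 m d))
    (hcobd : ∀ (m : ℕ) (d : ℤ) (φ : Cochain k A m), φ ∈ LinearMap.range (hkrMap 𝒜 m d) →
      φ ∈ diffCobd 𝒜 d m → φ = 0)
    (hsurj : ∀ (m : ℕ) (d : ℤ) (φ : Cochain k A m), φ ∈ diffCochain 𝒜 d m →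
      hochschildB 𝒜 d φ = 0 → φ ∈ LinearMap.range (hkrMap 𝒜 m d) ⊔ diffCobd 𝒜 d m) :
    QuasiIso (hkrHom 𝒜) := by
  have hmono : ∀ (n : ℤ) (x : ⨁ m : ℕ, DerWedge 𝒜 m (n + 1 - m)) (y : DiffTotal 𝒜 n),
      hkrTotal 𝒜 (n + 1) x = diffTotalD 𝒜 n y → x = 0 := by
    intro n x y h
    refine DFinsupp.ext fun m => hinj m _ ?_
    refine Eq.trans (hcobd m _ _ ⟨x m, rfl⟩ ?_) (map_zero _).symm
    have h1 := congrArg (fun z : DiffTotal 𝒜 (n + 1) => (z m : Cochain k A m)) h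
    dsimp only at h1
    rw [← hkrTotal_apply, h1]
    cases m with
    | zero =>
      rw [diffTotalD_apply_zero]
      exact zero_mem _
    | succ m =>
      rw [diffTotalD_apply_succ]
      have hn : n + 1 - ((m + 1 : ℕ) : ℤ) = n - m := by push_cast; ring
      rw [hn]
      exact ⟨_, (y m).2, rfl⟩
  have hepi : ∀ (n : ℤ) (z : DiffTotal 𝒜 (n + 1)), diffTotalD 𝒜 (n + 1) z = 0 →
      z ∈ LinearMap.range (hkrTotal 𝒜 (n + 1)) ⊔ LinearMap.range (diffTotalD 𝒜 n) := by
    intro n z hz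
    have hz' : ∀ m, DirectSum.lof k ℕ (fun m : ℕ => diffCochain 𝒜 (n + 1 - m) m) m (z m) ∈
        LinearMap.range (hkrTotal 𝒜 (n + 1)) ⊔ LinearMap.range (diffTotalD 𝒜 n) := by
      intro m
      have h1 : hochschildB 𝒜 (n + 1 - m) (z m).1 = 0 := by
        rw [← diffTotalD_apply_succ, hz]
        rfl
      obtain ⟨_, ⟨x, rfl⟩, β, hβ, h2⟩ := Submodule.mem_sup.1 (hsurj m _ _ (z m).2 h1)
      have h3 : DirectSum.lof k ℕ (fun m : ℕ => diffCochain 𝒜 (n + 1 - m) m) m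
          ((hkrMap 𝒜 m _).codRestrict _ (fun x => (hkrMap_mem_and x).1) x) ∈
            LinearMap.range (hkrTotal 𝒜 (n + 1)) :=
        ⟨DirectSum.lof k ℕ (fun m : ℕ => DerWedge 𝒜 m (n + 1 - m)) m x, by
          rw [hkrTotal, DirectSum.lmap_lof]⟩
      have h4 : β ∈ diffCochain 𝒜 (n + 1 - m) m := by
        rw [← eq_sub_iff_add_eq'] at h2
        rw [h2]
        exact sub_mem (z m).2 (hkrMap_mem_and x).1
      have h5 : DirectSum.lof k ℕ (fun m : ℕ => diffCochain 𝒜 (n + 1 - m) m) m ⟨β, h4⟩ ∈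
          LinearMap.range (diffTotalD 𝒜 n) := by
        cases m with
        | zero =>
          have : (⟨β, h4⟩ : diffCochain 𝒜 (n + 1 - (0 : ℕ)) 0) = 0 :=
            Subtype.ext ((Submodule.mem_bot k).1 hβ)
          rw [this, map_zero]
          exact zero_mem _
        | succ m =>
          have hn : n + 1 - ((m + 1 : ℕ) : ℤ) = n - m := by push_cast; ring
          have hβ' := hβ
          rw [hn] at hβ'
          obtain ⟨ψ, hψ, hψ'⟩ := hβ'
          refine ⟨DirectSum.lof k ℕ (fun m : ℕ => diffCochain 𝒜 (n - m) m) m ⟨ψ, hψ⟩, ?_⟩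
          rw [diffTotalD_lof]
          congr 1
          exact Subtype.ext hψ'
      have h6 : z m = (hkrMap 𝒜 m _).codRestrict _ (fun x => (hkrMap_mem_and x).1) x + ⟨β, h4⟩ :=
        Subtype.ext h2.symm
      rw [h6, map_add]
      exact Submodule.add_mem_sup h3 h5
    classical
    have h1 := DirectSum.sum_support_of z
    rw [← h1]
    exact Submodule.sum_mem _ fun m _ => hz' m
  refine ⟨fun j => ?_⟩
  -- Writing the degree as n + 1 gives the incoming differential literally the source n.
  obtain ⟨n, rfl⟩ : ∃ n : ℤ, n + 1 = j := ⟨j - 1, by ring⟩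
  rw [quasiIsoAt_iff_isIso_homologyMap]
  have hd : (diffComplex 𝒜).d n (n + 1) = ModuleCat.ofHom (diffTotalD 𝒜 n) := by
    simp only [diffComplex, CochainComplex.of_d]
  have hd' : (diffComplex 𝒜).d (n + 1) (n + 1 + 1) = ModuleCat.ofHom (diffTotalD 𝒜 (n + 1)) := by
    simp only [diffComplex, CochainComplex.of_d]
  have hw : (wedgeComplex 𝒜).d (n + 1) (n + 1 + 1) = 0 := by
    simp only [wedgeComplex, CochainComplex.of_d]
    rfl
  have h1 : Mono (HomologicalComplex.homologyMap (hkrHom 𝒜) (n + 1)) := by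
    rw [HomologicalComplex.mono_homologyMap_iff_up_to_refinements _ n (n + 1) (n + 1 + 1)
      (by simp) (by simp)]
    intro B x₂ _ y₁ h
    refine ⟨B, 𝟙 B, inferInstance, 0, ?_⟩
    rw [Limits.zero_comp, Category.id_comp]
    ext b
    rw [hd] at h
    have h2 := congrArg (fun f => f.hom b) h
    exact hmono n (x₂.hom b) (y₁.hom b) h2
  have h2 : Epi (HomologicalComplex.homologyMap (hkrHom 𝒜) (n + 1)) := by
    rw [HomologicalComplex.epi_homologyMap_iff_up_to_refinements _ n (n + 1) (n + 1 + 1)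
      (by simp) (by simp)]
    intro B y₂ hy₂
    rw [hd'] at hy₂
    let S : ((⨁ m : ℕ, DerWedge 𝒜 m (n + 1 - m)) × DiffTotal 𝒜 n) →ₗ[k] DiffTotal 𝒜 (n + 1) :=
      (hkrTotal 𝒜 (n + 1)).coprod (diffTotalD 𝒜 n)
    have hS : ∀ b, y₂.hom b ∈ LinearMap.range S := by
      intro b
      rw [LinearMap.range_coprod]
      exact hepi n _ (congrArg (fun f => f.hom b) hy₂)
    -- Over a field the surjection onto the image has a linear section, so the lifts required by the
    -- refinement criterion exist without changing the test object.
    obtain ⟨s, hs⟩ := S.rangeRestrict.exists_rightInverse_of_surjective (LinearMap.range_rangeRestrict S)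
    let t := s ∘ₗ y₂.hom.codRestrict _ hS
    have ht : ∀ b, S (t b) = y₂.hom b := fun b =>
      congrArg Subtype.val (LinearMap.congr_fun hs (y₂.hom.codRestrict _ hS b))
    refine ⟨B, 𝟙 B, inferInstance, ModuleCat.ofHom (LinearMap.fst k _ _ ∘ₗ t), ?_,
      ModuleCat.ofHom (LinearMap.snd k _ _ ∘ₗ t), ?_⟩
    · rw [hw]
      exact Limits.comp_zero
    · rw [hd, Category.id_comp]
      ext b
      exact (ht b).symm
  exact isIso_of_mono_of_epi _

end QuasiIso

/-! ### The algebraic theorem -/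

section Main

variable {k : Type} [Field k] [CharZero k] {A : Type u} [Ring A] [Algebra k A]
variable {𝒜 : ℤ → Submodule k A} [GradedAlgebra 𝒜] [GradedCommutative 𝒜]

/-- The graded HKR theorem for a graded commutative algebra which locally has coordinates. -/
theorem hkr_of_localCoords {κ ι : Type} [Fintype κ] [DecidableEq κ] [Fintype ι] [DecidableEq ι]
    (c : κ → LocalCoords 𝒜 ι) {u : κ → A} (hu : ∀ i, u i ∈ 𝒜 0) (h1 : ∑ i, u i * (c i).ρ = 1) :
    (∀ (m : ℕ) (d : ℤ),
      Function.Injective (hkrMap 𝒜 m d) ∧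
      LinearMap.range (hkrMap 𝒜 m d) = hkrCochain 𝒜 d m ∧
      hkrCochain 𝒜 d m ≤ diffCochain 𝒜 d m) ∧
    QuasiIso (hkrHom 𝒜) := by
  have hx : ∀ t : κ × ι, (c t.1).x t.2 ∈ 𝒜 ((c t.1).deg t.2) := fun t => (c t.1).x_mem t.2
  have hX : ∀ t : κ × ι, u t.1 • (c t.1).X t.2 ∈ gradedDer 𝒜 (-(c t.1).deg t.2) := fun t => by
    have := smul_mem_gradedDer (hu t.1) ((c t.1).X_mem t.2)
    rwa [zero_add] at this
  -- From ∑ u_i ρ_i = 1 the local expansions add up to a global one, indexed by pairs. The resulting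
  -- family is not dual to the coordinates, but the expansion is all that the lemmas on the HKR
  -- image and its inverse use.
  have hc : ∀ (e : ℤ) (D : Module.End k A), D ∈ gradedDer 𝒜 e →
      D = ∑ t : κ × ι, D ((c t.1).x t.2) • u t.1 • (c t.1).X t.2 := by
    intro e D hD
    calc D = ∑ i, (u i * (c i).ρ) • D := by rw [← Finset.sum_smul, h1, one_smul]
      _ = ∑ i, ∑ t, D ((c i).x t) • u i • (c i).X t := by
        refine Finset.sum_congr rfl fun i _ => ?_
        rw [mul_smul, (c i).complete e D hD, Finset.smul_sum]
        refine Finset.sum_congr rfl fun t _ => ?_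
        rw [← mul_smul, ← mul_smul, mul_comm_of_mem_zero (hu i)]
      _ = _ := by rw [Fintype.sum_prod_type]
  have hinj : ∀ (m : ℕ) (d : ℤ), Function.Injective (hkrMap 𝒜 m d) := fun m d =>
    Function.LeftInverse.injective (g := hkrInverse _ hX m d) (hkrInverse_hkrMap hx hX hc)
  have hrange := range_hkrMap_eq hx hX hc
  refine ⟨fun m d => ⟨hinj m d, hrange m d, ?_⟩, quasiIso_hkrHom hinj ?_ ?_⟩
  · exact (hkrCochain_le_multiDer hx hX hc m d).trans (multiDer_le_diffCochain d m)
  · intro m d φ hφ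
    rw [hrange] at hφ
    exact eq_zero_of_mem_diffCobd hφ
  · intro m d φ hφ hB
    -- The coefficients r of degree zero for which r φ is a multiderivation plus a coboundary form
    -- an ideal. It contains a power of each ρ_i, hence 1.
    choose M hM using fun i => LocalCoords.exists_pow_smul_mem hφ hB (c i)
    have h2 := of_forall_pow (fun i => (c i).ρ_mem) hu ⟨Finset.univ, h1⟩
      (fun a => a • φ ∈ multiDer 𝒜 d m ⊔ diffCobd 𝒜 d m)
      (by rw [zero_smul]; exact zero_mem _)
      (fun a b ha hb => by rw [add_smul]; exact add_mem ha hb)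
      (fun a b ha hb => by
        obtain ⟨μ, hμ, β, hβ, h3⟩ := Submodule.mem_sup.1 hb
        rw [mul_smul, ← h3, smul_add]
        have h4 := smul_mem_multiDer ha hμ
        have h5 := smul_mem_diffCobd ha hβ
        rw [zero_add] at h4 h5
        exact Submodule.add_mem_sup h4 h5) M hM
    rw [one_smul] at h2
    exact sup_le (multiDer_le d m) le_sup_right h2

end Main

end GradedHKR

/-! ## Coloured covers of manifolds -/

namespace GradedHKR

open Topology Set

section Cover

/-- At each point, at most `N` of the sets `U i` meet. -/
def MultLE {X : Type*} {ι : Type*} (U : ι → Set X) (N : ℕ) (x : X) : Prop :=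
  ∃ s : Finset ι, s.card ≤ N ∧ ∀ i, x ∈ U i → i ∈ s

theorem MultLE.mono {X ι : Type*} {U W : ι → Set X} {N : ℕ} {x : X} (h : MultLE U N x)
    (hW : ∀ i, W i ⊆ U i) : MultLE W N x :=
  let ⟨s, hs, h'⟩ := h
  ⟨s, hs, fun i hi => h' i (hW i hi)⟩

/-- Cover by the cubes of radius ε centred on the lattice ε ℤ^n, where 2ε is a Lebesgue number, and
assign each cube meeting K to one member containing it. In the sup metric a point lies in at most
2^n such cubes, so grouping them by member gives the bound. Cubes that miss K receive an arbitrary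
label and are left out of the union. -/
theorem exists_shrinking_of_isCompact_pi {n : ℕ} {ι : Type*} {K : Set (Fin n → ℝ)}
    (hK : IsCompact K) {V : ι → Set (Fin n → ℝ)} (hV : ∀ i, IsOpen (V i)) (hc : K ⊆ ⋃ i, V i) :
    ∃ W : ι → Set (Fin n → ℝ), (∀ i, IsOpen (W i)) ∧ (∀ i, W i ⊆ V i) ∧ K ⊆ ⋃ i, W i ∧
      ∀ x, MultLE W (2 ^ n) x := by
  classical
  rcases K.eq_empty_or_nonempty with rfl | ⟨x₀, hx₀⟩
  · exact ⟨fun _ => ∅, by simp, by simp, by simp, fun x => ⟨∅, by simp, by simp⟩⟩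
  obtain ⟨i₀, -⟩ := mem_iUnion.1 (hc hx₀)
  obtain ⟨δ, hδ, h⟩ := lebesgue_number_lemma_of_metric hK hV hc
  set ε := δ / 2 with hε
  have hε0 : 0 < ε := by positivity
  let Q : (Fin n → ℤ) → Set (Fin n → ℝ) := fun z => Metric.ball (fun l => ε * z l) ε
  have hQ : ∀ z, ∃ i, (Q z ∩ K).Nonempty → Q z ⊆ V i := by
    intro z
    by_cases hz : (Q z ∩ K).Nonempty
    · obtain ⟨q, hq, hqK⟩ := hz
      obtain ⟨i, hi⟩ := h q hqK
      refine ⟨i, fun _ => Subset.trans (fun y hy => ?_) hi⟩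
      have h1 := Metric.mem_ball.1 hy
      have h2 := Metric.mem_ball'.1 hq
      have h3 := dist_triangle y (fun l => ε * z l) q
      rw [Metric.mem_ball]
      linarith
    · exact ⟨i₀, fun h => absurd h hz⟩
  choose i hi using hQ
  refine ⟨fun j => ⋃ z, ⋃ (_ : (Q z ∩ K).Nonempty ∧ i z = j), Q z,
    fun j => isOpen_iUnion fun z => isOpen_iUnion fun _ => Metric.isOpen_ball,
    fun j => iUnion_subset fun z => iUnion_subset fun hz => hz.2 ▸ hi z hz.1, fun q hq => ?_,
    fun x => ?_⟩
  · have hqQ : q ∈ Q (fun l => ⌊q l / ε⌋) := by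
      refine Metric.mem_ball.2 ((dist_pi_lt_iff hε0).2 fun l => ?_)
      have h1 := Int.floor_le (q l / ε)
      have h2 := Int.lt_floor_add_one (q l / ε)
      rw [le_div_iff₀ hε0] at h1
      rw [div_lt_iff₀ hε0] at h2
      rw [Real.dist_eq, abs_lt]
      constructor <;> nlinarith
    exact mem_iUnion.2 ⟨i _, mem_iUnion.2 ⟨_, mem_iUnion.2 ⟨⟨⟨q, hqQ, hq⟩, rfl⟩, hqQ⟩⟩⟩
  -- Along each axis an open interval (ε(z - 1), ε(z + 1)) can contain x_l only for z = ⌊x_l/ε⌋ or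
  -- the next integer.
  · refine ⟨(Fintype.piFinset fun l => ({⌊x l / ε⌋, ⌊x l / ε⌋ + 1} : Finset ℤ)).image i, ?_,
      fun j hj => ?_⟩
    · refine Finset.card_image_le.trans ?_
      rw [Fintype.card_piFinset]
      refine (Finset.prod_le_pow_card _ _ 2 fun l _ => Finset.card_le_two).trans ?_
      simp
    · simp only [mem_iUnion] at hj
      obtain ⟨z, ⟨-, rfl⟩, hz⟩ := hj
      refine Finset.mem_image_of_mem _ (Fintype.mem_piFinset.2 fun l => ?_)
      have h1 := (dist_pi_lt_iff hε0).1 (Metric.mem_ball.1 hz) l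
      rw [Real.dist_eq, abs_lt] at h1
      have h3 : x l / ε - 1 < z l := by
        rw [sub_lt_iff_lt_add, div_lt_iff₀ hε0]; nlinarith
      have h4 : (z l : ℝ) < x l / ε + 1 := by
        rw [← sub_lt_iff_lt_add, lt_div_iff₀ hε0]; nlinarith
      have h5 : ⌊x l / ε⌋ - 1 < z l := by
        have := Int.floor_le (x l / ε)
        have h : ((⌊x l / ε⌋ - 1 : ℤ) : ℝ) < z l := by push_cast; linarith
        exact_mod_cast h
      have h6 : z l < ⌊x l / ε⌋ + 2 := by
        have := Int.lt_floor_add_one (x l / ε)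
        have h : (z l : ℝ) < ((⌊x l / ε⌋ + 2 : ℤ) : ℝ) := by push_cast; linarith
        exact_mod_cast h
      rw [Finset.mem_insert, Finset.mem_singleton]
      omega

theorem exists_shrinking_of_isCompact {n : ℕ} {C ι : Type*} [TopologicalSpace C]
    (e : OpenPartialHomeomorph C (Fin n → ℝ)) {K : Set C} (hK : IsCompact K) (hKe : K ⊆ e.source)
    {U : ι → Set C} (hU : ∀ i, IsOpen (U i)) (hc : K ⊆ ⋃ i, U i) :
    ∃ W : ι → Set C, (∀ i, IsOpen (W i)) ∧ (∀ i, W i ⊆ U i) ∧ K ⊆ ⋃ i, W i ∧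
      ∀ x, MultLE W (2 ^ n) x := by
  obtain ⟨W, hW, hWV, hKW, hm⟩ := exists_shrinking_of_isCompact_pi
    (hK.image_of_continuousOn (e.continuousOn.mono hKe))
    (V := fun i => e.target ∩ e.symm ⁻¹' U i)
    (fun i => e.isOpen_inter_preimage_symm (hU i)) (by
      rintro _ ⟨x, hx, rfl⟩
      obtain ⟨i, hi⟩ := mem_iUnion.1 (hc hx)
      refine mem_iUnion.2 ⟨i, e.map_source (hKe hx), ?_⟩
      rwa [mem_preimage, e.left_inv (hKe hx)])
  refine ⟨fun i => e.source ∩ e ⁻¹' W i, fun i => e.isOpen_inter_preimage (hW i),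
    fun i x hx => ?_, fun x hx => ?_, fun x => ?_⟩
  · have := (hWV i hx.2).2
    rwa [mem_preimage, e.left_inv hx.1] at this
  · obtain ⟨i, hi⟩ := mem_iUnion.1 (hKW (mem_image_of_mem e hx))
    exact mem_iUnion.2 ⟨i, hKe hx, hi⟩
  · obtain ⟨s, hs, h⟩ := hm (e x)
    exact ⟨s, hs, fun i hi => h i hi.2⟩

/-- If every open cover can be shrunk to one of multiplicity at most `N` near each set of a
locally finite sequence of closed sets covering the space, then every open cover has an indexed
refinement of multiplicity at most `N`. -/
theorem exists_shrinking_of_locallyFinite {C ι : Type*} [TopologicalSpace C] {N : ℕ}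
    {K : ℕ → Set C} (hK : ∀ j, IsClosed (K j)) (hf : LocallyFinite K) (hKc : ⋃ j, K j = univ)
    (hs : ∀ (j : ℕ) (U : ι → Set C), (∀ i, IsOpen (U i)) → ⋃ i, U i = univ →
      ∃ W : ι → Set C, (∀ i, IsOpen (W i)) ∧ (∀ i, W i ⊆ U i) ∧ K j ⊆ ⋃ i, W i ∧
        ∀ x, MultLE W N x)
    {U : ι → Set C} (hU : ∀ i, IsOpen (U i)) (hc : ⋃ i, U i = univ) :
    ∃ W : ι → Set C, (∀ i, IsOpen (W i)) ∧ (∀ i, W i ⊆ U i) ∧ ⋃ i, W i = univ ∧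
      ∀ x, MultLE W N x := by
  let 𝒞 := {U : ι → Set C // (∀ i, IsOpen (U i)) ∧ ⋃ i, U i = univ}
  have step : ∀ (j : ℕ) (U : 𝒞), ∃ U' : 𝒞, (∀ i, U'.1 i ⊆ U.1 i) ∧
      (∀ i, ∀ x ∉ K j, x ∈ U.1 i → x ∈ U'.1 i) ∧ ∀ x ∈ K j, MultLE U'.1 N x := by
    rintro j ⟨U, hU, hc⟩
    obtain ⟨W, hW, hWU, hKW, hm⟩ := hs j U hU hc
    -- Shrink over K j only: off K j the old sets are kept, so the family still covers and earlier
    -- improvements, which only require smaller sets, survive.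
    refine ⟨⟨fun i => U i ∩ ((K j)ᶜ ∪ W i), fun i => (hU i).inter
      ((hK j).isOpen_compl.union (hW i)), eq_univ_of_forall fun x => ?_⟩,
      fun i => inter_subset_left, fun i x hx hxU => ⟨hxU, Or.inl hx⟩, fun x hx => ?_⟩
    · by_cases hx : x ∈ K j
      · obtain ⟨i, hi⟩ := mem_iUnion.1 (hKW hx)
        exact mem_iUnion.2 ⟨i, hWU i hi, Or.inr hi⟩
      · obtain ⟨i, hi⟩ := mem_iUnion.1 (hc.symm ▸ mem_univ x : x ∈ ⋃ i, U i)
        exact mem_iUnion.2 ⟨i, hi, Or.inl hx⟩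
    · obtain ⟨s, hs, h⟩ := hm x
      exact ⟨s, hs, fun i hi => h i (hi.2.resolve_left fun h => h hx)⟩
  choose f hf1 hf2 hf3 using step
  let S : ℕ → 𝒞 := fun j => Nat.rec ⟨U, hU, hc⟩ f j
  have hS : ∀ j, S (j + 1) = f j (S j) := fun j => rfl
  have hanti : ∀ i, Antitone fun j => (S j).1 i := fun i =>
    antitone_nat_of_succ_le fun j => by
      change (S (j + 1)).1 i ⊆ (S j).1 i
      rw [hS]; exact hf1 _ _ _
  -- By local finiteness only finitely many K j meet t, so the decreasing family is constant on t
  -- after a finite stage. Hence the intersections are open and still cover.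
  have hstab : ∀ x, ∃ t ∈ 𝓝 x, ∃ j₀, ∀ y ∈ t, ∀ i, y ∈ (S j₀).1 i → ∀ j, y ∈ (S j).1 i := by
    intro x
    obtain ⟨t, ht, hfin⟩ := hf x
    obtain ⟨j₀, hj₀⟩ := hfin.bddAbove
    refine ⟨t, ht, j₀ + 1, fun y hy i hyi j => ?_⟩
    rcases le_total j (j₀ + 1) with h | h
    · exact hanti i h hyi
    · induction j, h using Nat.le_induction with
      | base => exact hyi
      | succ j hj ih =>
        rw [hS]
        refine hf2 _ _ _ _ (fun hyK => ?_) ih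
        have := hj₀ (show j ∈ {j | (K j ∩ t).Nonempty} from ⟨y, hyK, hy⟩)
        omega
  refine ⟨fun i => ⋂ j, (S j).1 i, fun i => isOpen_iff_mem_nhds.2 fun x hx => ?_,
    fun i => iInter_subset (fun j => (S j).1 i) 0, eq_univ_of_forall fun x => ?_, fun x => ?_⟩
  · obtain ⟨t, ht, j₀, h⟩ := hstab x
    filter_upwards [ht, ((S j₀).2.1 i).mem_nhds (mem_iInter.1 hx j₀)] with y hy hy'
    exact mem_iInter.2 (h y hy i hy')
  · obtain ⟨t, ht, j₀, h⟩ := hstab x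
    obtain ⟨i, hi⟩ := mem_iUnion.1 ((S j₀).2.2.symm ▸ mem_univ x : x ∈ ⋃ i, (S j₀).1 i)
    exact mem_iUnion.2 ⟨i, mem_iInter.2 (h x (mem_of_mem_nhds ht) i hi)⟩
  · obtain ⟨j, hj⟩ := mem_iUnion.1 (hKc.symm ▸ mem_univ x : x ∈ ⋃ j, K j)
    have h := hf3 j (S j) x hj
    rw [← hS] at h
    exact h.mono fun i => iInter_subset (fun j => (S j).1 i) (j + 1)

/-- The locally finite closed sets are compact sets inside chart domains. Local finiteness makes
them countable, and they are enumerated through an injection into ℕ with the empty set at unused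
indices. The charts are read in `Fin n → ℝ`, whose metric has cubes as balls. -/
theorem exists_shrinking_of_chartedSpace {n : ℕ} {C : Type u} {ι : Type*} [TopologicalSpace C]
    [T2Space C] [SecondCountableTopology C] [ChartedSpace (EuclideanSpace ℝ (Fin n)) C]
    {U : ι → Set C} (hU : ∀ i, IsOpen (U i)) (hc : ⋃ i, U i = univ) :
    ∃ W : ι → Set C, (∀ i, IsOpen (W i)) ∧ (∀ i, W i ⊆ U i) ∧ ⋃ i, W i = univ ∧
      ∀ x, MultLE W (2 ^ n) x := by
  have : LocallyCompactSpace C := ChartedSpace.locallyCompactSpace (EuclideanSpace ℝ (Fin n)) C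
  obtain ⟨α, c, B, hB, hBc, hBf⟩ := refinement_of_locallyCompact_sigmaCompact_of_nhds_basis
    (X := C) (ι := fun _ => Set C) (B := fun _ s => s) (fun x => (compact_basis_nhds x).restrict_subset
      (chart_source_mem_nhds (EuclideanSpace ℝ (Fin n)) x))
  have hcount : Countable α := countable_univ_iff.1
    (hBf.countable_univ fun a => ⟨c a, mem_of_mem_nhds (hB a).1.1⟩)
  obtain ⟨f, hfi⟩ := exists_injective_nat α
  have hext : ∀ j, (∃ a, f a = j ∧ Function.extend f B (fun _ => ∅) j = B a) ∨
      Function.extend f B (fun _ => ∅) j = ∅ := by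
    intro j
    by_cases h : ∃ a, f a = j
    · obtain ⟨a, rfl⟩ := h
      exact Or.inl ⟨a, rfl, hfi.extend_apply _ _ _⟩
    · exact Or.inr (Function.extend_apply' _ _ _ h)
  refine exists_shrinking_of_locallyFinite (K := Function.extend f B fun _ => ∅) (fun j => ?_)
    (fun x => ?_) (eq_univ_of_forall fun x => ?_) (fun j U hU hc => ?_) hU hc
  · rcases hext j with ⟨a, -, h⟩ | h
    · rw [h]; exact (hB a).1.2.isClosed
    · rw [h]; exact isClosed_empty
  · obtain ⟨t, ht, hfin⟩ := hBf x
    refine ⟨t, ht, (hfin.image f).subset fun j hj => ?_⟩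
    rcases hext j with ⟨a, rfl, h⟩ | h
    · rw [mem_ofPred_eq, h] at hj
      exact ⟨a, hj, rfl⟩
    · rw [mem_ofPred_eq, h] at hj
      simp at hj
  · obtain ⟨a, ha⟩ := mem_iUnion.1 (hBc.symm ▸ mem_univ x : x ∈ ⋃ a, B a)
    exact mem_iUnion.2 ⟨f a, by rwa [hfi.extend_apply]⟩
  · rcases hext j with ⟨a, -, h⟩ | h
    · rw [h]
      exact exists_shrinking_of_isCompact ((chartAt (EuclideanSpace ℝ (Fin n)) (c a)).transHomeomorph
        (EuclideanSpace.equiv (Fin n) ℝ).toHomeomorph) (hB a).1.2 (hB a).2 hU (by simp [hc])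
    · rw [h]
      exact ⟨fun _ => ∅, by simp, by simp, by simp, fun x => ⟨∅, by simp, by simp⟩⟩

/-- On a manifold of dimension `n`, an open cover indexed by points can be replaced by `2 ^ n` open
sets, on each of which a member of the cover is chosen in a locally constant way. -/
theorem exists_coloured_cover {n : ℕ} {C : Type u} [TopologicalSpace C]
    [T2Space C] [SecondCountableTopology C] [ChartedSpace (EuclideanSpace ℝ (Fin n)) C]
    {U : C → Set C} (hU : ∀ i, IsOpen (U i)) (hc : ∀ x, x ∈ U x) :
    ∃ (G : Fin (2 ^ n) → Set C) (p : Fin (2 ^ n) → C → C), (∀ c, IsOpen (G c)) ∧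
      (∀ x, ∃ c, x ∈ G c) ∧ ∀ c, ∀ x ∈ G c, x ∈ U (p c x) ∧ ∀ᶠ y in 𝓝 x, p c y = p c x := by
  classical
  have : LocallyCompactSpace C := ChartedSpace.locallyCompactSpace (EuclideanSpace ℝ (Fin n)) C
  obtain ⟨W, hW, hWU, hWc, hm⟩ := exists_shrinking_of_chartedSpace (n := n) hU
    (eq_univ_of_forall fun x => mem_iUnion.2 ⟨x, hc x⟩)
  obtain ⟨f, hf⟩ := PartitionOfUnity.exists_isSubordinate isClosed_univ W hW hWc.symm.subset
  -- V I is the locus where every function indexed by I is positive and strictly larger than all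
  -- functions outside I. It is open because near a point only finitely many of the functions
  -- matter.
  let V : Finset C → Set C := fun I => {x | ∀ i ∈ I, 0 < f i x ∧ ∀ j ∉ I, f j x < f i x}
  have hVo : ∀ I, IsOpen (V I) := by
    refine fun I => isOpen_iff_mem_nhds.2 fun x hx => ?_
    have key : ∀ i ∈ I, ∀ᶠ y in 𝓝 x, 0 < f i y ∧ ∀ j ∉ I, f j y < f i y := by
      intro i hi
      obtain ⟨t, ht, hfin⟩ := f.locallyFinite x
      have h1 : ∀ᶠ y in 𝓝 x, 0 < f i y :=
        (f i).continuous.continuousAt.eventually (lt_mem_nhds (hx i hi).1)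
      have h2 : ∀ᶠ y in 𝓝 x, ∀ j ∈ {j | (Function.support (f j) ∩ t).Nonempty}, j ∉ I →
          f j y < f i y := by
        rw [Filter.eventually_all_finite hfin]
        intro j _
        by_cases hj : j ∈ I
        · exact Filter.Eventually.of_forall fun y h => absurd hj h
        · exact ((f j).continuous.continuousAt.eventually_lt (f i).continuous.continuousAt
            ((hx i hi).2 j hj)).mono fun y h _ => h
      filter_upwards [ht, h1, h2] with y hy h1 h2
      refine ⟨h1, fun j hj => ?_⟩
      by_cases h0 : f j y = 0
      · rwa [h0]
      · exact h2 j ⟨y, h0, hy⟩ hj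
    exact (Filter.eventually_all_finset I).2 key
  -- Two different sets of the same size each contain an index missing from the other, and those two
  -- functions would have to dominate each other. So the V I of one size are disjoint, and a choice
  -- depending on I is locally constant on their union.
  have hVd : ∀ I I' : Finset C, I.card = I'.card → ∀ x, x ∈ V I → x ∈ V I' → I = I' := by
    intro I I' hcard x hx hx'
    by_contra hne
    obtain ⟨i, hi, hi'⟩ := Finset.not_subset.1 fun h => hne (Finset.eq_of_subset_of_card_le h hcard.ge)
    obtain ⟨j, hj, hj'⟩ := Finset.not_subset.1 fun h =>
      hne (Finset.eq_of_subset_of_card_le h hcard.le).symm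
    exact lt_asymm ((hx i hi).2 j hj') ((hx' j hj).2 i hi')
  let pick : Finset C → C → C := fun I x => if h : I.Nonempty then h.choose else x
  let p : Fin (2 ^ n) → C → C := fun c x =>
    if h : ∃ I : Finset C, I.card = c + 1 ∧ x ∈ V I then pick h.choose x else x
  have hp : ∀ (c : Fin (2 ^ n)) (I : Finset C), I.card = c + 1 → ∃ i ∈ I, ∀ x ∈ V I, p c x = i := by
    intro c I hI
    have hne : I.Nonempty := Finset.card_pos.1 (by omega)
    refine ⟨hne.choose, hne.choose_spec, fun x hx => ?_⟩
    have h : ∃ I : Finset C, I.card = c + 1 ∧ x ∈ V I := ⟨I, hI, hx⟩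
    have hIh : h.choose = I := hVd _ _ (h.choose_spec.1.trans hI.symm) x h.choose_spec.2 hx
    have e : p c x = pick h.choose x := dif_pos h
    rw [e, hIh]
    exact dif_pos hne
  refine ⟨fun c => ⋃ I : Finset C, ⋃ (_ : I.card = c + 1), V I, p,
    fun c => isOpen_iUnion fun I => isOpen_iUnion fun _ => hVo I, fun x => ?_,
    fun c x hx => ?_⟩
  · obtain ⟨s, hs, h⟩ := hm x
    have hpos : ∀ i, 0 < f i x → x ∈ W i := fun i hi =>
      hf i (subset_tsupport _ (Function.mem_support.2 hi.ne'))
    set I := s.filter fun i => 0 < f i x with hI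
    have hxI : x ∈ V I := by
      intro i hi
      refine ⟨(Finset.mem_filter.1 hi).2, fun j hj => ?_⟩
      have : ¬ 0 < f j x := fun h0 => hj (Finset.mem_filter.2 ⟨h j (hpos j h0), h0⟩)
      exact (not_lt.1 this).trans_lt (Finset.mem_filter.1 hi).2
    obtain ⟨i, hi⟩ := f.exists_pos (mem_univ x)
    have hne : 0 < I.card := Finset.card_pos.2 ⟨i, Finset.mem_filter.2 ⟨h i (hpos i hi), hi⟩⟩
    have hle : I.card ≤ 2 ^ n := (Finset.card_filter_le _ _).trans hs
    refine ⟨⟨I.card - 1, by omega⟩, mem_iUnion.2 ⟨I, mem_iUnion.2 ⟨?_, hxI⟩⟩⟩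
    simp only
    omega
  · simp only [mem_iUnion] at hx
    obtain ⟨I, hI, hx⟩ := hx
    obtain ⟨i, hi, h⟩ := hp c I hI
    refine ⟨?_, ?_⟩
    · rw [h x hx]
      exact hWU i (hf i (subset_tsupport _ (Function.mem_support.2 (hx i hi).1.ne')))
    · filter_upwards [(hVo I).mem_nhds hx] with y hy
      rw [h x hx, h y hy]

end Cover

end GradedHKR

/-! ## Hadamard's lemma -/

namespace GradedHKR

section Hadamard

open MeasureTheory Set Metric

variable {n : ℕ} {V : Type*} [NormedAddCommGroup V] [NormedSpace ℝ V] [CompleteSpace V]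

/-- The integral over [0, 1] is the convolution, at 0, of the indicator of [0, 1] with u ↦ ψ(u) ∂_v
f(x - u(y - x)), and convolutions depend smoothly on a parameter such as y. The bump ψ is 1 on [-1,
1] and makes the support in u compact; inside |u| < 2 the point x - u(y - x) stays in the ball of
radius r since |y - x| < r/2. -/
theorem contDiffOn_integral_fderiv_lineMap {f : EuclideanSpace ℝ (Fin n) → V}
    {x : EuclideanSpace ℝ (Fin n)} {r : ℝ} (hr : 0 < r) (hf : ContDiffOn ℝ ∞ f (ball x r))
    (v : EuclideanSpace ℝ (Fin n)) :
    ContDiffOn ℝ ∞ (fun y => ∫ t in (0 : ℝ)..1, fderiv ℝ f (x + t • (y - x)) v)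
      (ball x (r / 2)) := by
  let ψ : ContDiffBump (0 : ℝ) := ⟨1, 3 / 2, by norm_num, by norm_num⟩
  let g : EuclideanSpace ℝ (Fin n) → ℝ → V := fun y u => ψ u • fderiv ℝ f (x - u • (y - x)) v
  have hg : ContDiffOn ℝ ∞ (↿g) (ball x (r / 2) ×ˢ univ) := by
    have hf' : ContDiffOn ℝ ∞ (fun z => fderiv ℝ f z v) (ball x r) :=
      (hf.fderiv_of_isOpen isOpen_ball (by simp)).clm_apply contDiffOn_const
    rintro ⟨y, u⟩ ⟨hy, -⟩
    refine ContDiffAt.contDiffWithinAt ?_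
    by_cases hu : |u| < 2
    · have hm : x - u • (y - x) ∈ ball x r := by
        rw [mem_ball, dist_eq_norm, sub_sub_cancel_left, norm_neg, norm_smul, Real.norm_eq_abs]
        rw [mem_ball, dist_eq_norm] at hy
        nlinarith [norm_nonneg (y - x), abs_nonneg u]
      have h1 : ContDiffAt ℝ ∞ (fun q : EuclideanSpace ℝ (Fin n) × ℝ => x - q.2 • (q.1 - x))
          (y, u) := by fun_prop
      have h2 : ContDiffAt ℝ ∞ (fun z => fderiv ℝ f z v) (x - u • (y - x)) :=
        hf'.contDiffAt (isOpen_ball.mem_nhds hm)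
      exact ContDiffAt.smul (ContDiffAt.comp (g := ψ) (y, u) ψ.contDiff.contDiffAt contDiffAt_snd)
        (ContDiffAt.comp (g := fun z => fderiv ℝ f z v) (y, u) h2 h1)
    · have hev : ↿g =ᶠ[nhds (y, u)] fun _ => 0 := by
        have : ∀ᶠ q : EuclideanSpace ℝ (Fin n) × ℝ in nhds (y, u), 3 / 2 < |q.2| :=
          (continuous_abs.comp continuous_snd).continuousAt.eventually
            (lt_mem_nhds (by simp only [Function.comp]; linarith))
        filter_upwards [this] with q hq
        change ψ q.2 • fderiv ℝ f (x - q.2 • (q.1 - x)) v = 0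
        rw [ψ.zero_of_le_dist (by rw [Real.dist_0_eq_abs]; exact hq.le), zero_smul]
      exact contDiffAt_const.congr_of_eventuallyEq hev
  have hc := contDiffOn_convolution_right_with_param_comp (μ := volume) (𝕜 := ℝ)
    (ContinuousLinearMap.lsmul ℝ ℝ) (v := fun _ => (0 : ℝ)) (n := ⊤)
    (f := (Icc (0 : ℝ) 1).indicator fun _ => (1 : ℝ)) (g := g) (k := closedBall 0 (3 / 2))
    (s := ball x (r / 2)) contDiffOn_const isOpen_ball (isCompact_closedBall _ _)
    (fun y u _ hu => by
      change ψ u • _ = _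
      rw [ψ.zero_of_le_dist (le_of_lt (by simpa using hu)), zero_smul])
    (((integrable_indicator_iff measurableSet_Icc).2
      (integrableOn_const (by simp))).locallyIntegrable) hg
  refine hc.congr fun y hy => ?_
  rw [convolution_def, intervalIntegral.integral_of_le zero_le_one, ← integral_Icc_eq_integral_Ioc,
    ← integral_indicator measurableSet_Icc]
  congr 1
  ext t
  by_cases ht : t ∈ Icc (0 : ℝ) 1
  · have : ψ (-t) = 1 := ψ.one_of_mem_closedBall (by
      rw [mem_closedBall, Real.dist_0_eq_abs, abs_neg, abs_of_nonneg ht.1]; exact ht.2)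
    simp [indicator_of_mem ht, g, this]
  · simp [indicator_of_notMem ht]

/-- Hadamard's lemma. -/
theorem exists_eq_add_sum_smul {f : EuclideanSpace ℝ (Fin n) → V}
    {x : EuclideanSpace ℝ (Fin n)} {r : ℝ} (hr : 0 < r) (hf : ContDiffOn ℝ ∞ f (ball x r)) :
    ∃ g : Fin n → EuclideanSpace ℝ (Fin n) → V, (∀ i, ContDiffOn ℝ ∞ (g i) (ball x (r / 2))) ∧
      ∀ y ∈ ball x (r / 2), f y = f x + ∑ i, (y i - x i) • g i y := by
  refine ⟨fun i y => ∫ t in (0 : ℝ)..1, fderiv ℝ f (x + t • (y - x)) (EuclideanSpace.single i 1),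
    fun i => contDiffOn_integral_fderiv_lineMap hr hf _, fun y hy => ?_⟩
  have hm : ∀ t ∈ uIcc (0 : ℝ) 1, x + t • (y - x) ∈ ball x r := by
    intro t ht
    rw [uIcc_of_le zero_le_one] at ht
    rw [mem_ball, dist_eq_norm, add_sub_cancel_left, norm_smul, Real.norm_of_nonneg ht.1]
    rw [mem_ball, dist_eq_norm] at hy
    nlinarith [norm_nonneg (y - x), ht.1, ht.2]
  have hc : ∀ v, ContinuousOn (fun t : ℝ => fderiv ℝ f (x + t • (y - x)) v) (uIcc 0 1) := by
    intro v
    have h1 : ContinuousOn (fun z => fderiv ℝ f z v) (ball x r) :=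
      ((hf.fderiv_of_isOpen (m := ∞) isOpen_ball (by simp)).clm_apply
        contDiffOn_const).continuousOn
    exact h1.comp (by fun_prop) hm
  have hd : ∀ t ∈ uIcc (0 : ℝ) 1, HasDerivAt (fun t : ℝ => f (x + t • (y - x)))
      (fderiv ℝ f (x + t • (y - x)) (y - x)) t := by
    intro t ht
    have h1 : HasFDerivAt f (fderiv ℝ f (x + t • (y - x))) (x + t • (y - x)) :=
      ((hf.contDiffAt (isOpen_ball.mem_nhds (hm t ht))).differentiableAt (by simp)).hasFDerivAt
    have h2 : HasDerivAt (fun t : ℝ => x + t • (y - x)) (y - x) t := by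
      simpa using ((hasDerivAt_id t).smul_const (y - x)).const_add x
    exact h1.comp_hasDerivAt t h2
  have hF := intervalIntegral.integral_eq_sub_of_hasDerivAt hd (hc _).intervalIntegrable
  simp only [one_smul, zero_smul, add_zero, add_sub_cancel] at hF
  have hsum : ∀ t : ℝ, fderiv ℝ f (x + t • (y - x)) (y - x) =
      ∑ i, (y i - x i) • fderiv ℝ f (x + t • (y - x)) (EuclideanSpace.single i 1) := by
    intro t
    have : y - x = ∑ i, (y i - x i) • EuclideanSpace.single i (1 : ℝ) := by
      ext i
      simp [Finset.sum_apply, Pi.single_apply]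
    conv_lhs => rw [← ContinuousLinearMap.coe_coe, this]
    rw [map_sum]
    simp only [map_smul, ContinuousLinearMap.coe_coe]
    rw [← this]
  simp only [hsum] at hF
  rw [intervalIntegral.integral_finsetSum] at hF
  · simp only [intervalIntegral.integral_smul] at hF
    rw [hF]; abel
  · intro i _
    exact ((hc _).intervalIntegrable).smul _

end Hadamard

end GradedHKR

/-! ## Graded symmetric algebras -/

namespace GradedHKR

namespace GSym

open _root_.GSym

variable {k : Type} [Field k] {W : ℤ → Type v} [∀ j, AddCommGroup (W j)] [∀ j, Module k (W j)]
  {W' : ℤ → Type w} [∀ j, AddCommGroup (W' j)] [∀ j, Module k (W' j)]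
  {B : Type*} [Ring B] [Algebra k B]

/-- The universal property of the graded symmetric algebra. -/
noncomputable def lift (f : ∀ j, W j →ₗ[k] B)
    (hf : ∀ i j v w, f i v * f j w = (i * j).negOnePow • (f j w * f i v)) :
    GSym k W →ₐ[k] B :=
  RingQuot.liftAlgHom k ⟨TensorAlgebra.lift k (DirectSum.toModule k ℤ B f), by
    rintro _ _ ⟨v, w⟩
    rw [Units.smul_def, map_zsmul, ← Units.smul_def]
    simpa using hf _ _ v w⟩

@[simp] theorem lift_gen (f : ∀ j, W j →ₗ[k] B)
    (hf : ∀ i j v w, f i v * f j w = (i * j).negOnePow • (f j w * f i v)) (j : ℤ) (v : W j) :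
    lift f hf (gen k j v) = f j v := by
  have h := RingQuot.liftAlgHom_mkAlgHom_apply k
    (f := TensorAlgebra.lift k (DirectSum.toModule k ℤ B f)) (s := GSymRel k W) (by
      rintro _ _ ⟨v, w⟩
      rw [Units.smul_def, map_zsmul, ← Units.smul_def]
      simpa using hf _ _ v w) (TensorAlgebra.ι k (DirectSum.lof k ℤ W j v))
  refine Eq.trans h ?_
  simp

theorem algHom_ext {f g : GSym k W →ₐ[k] B}
    (h : ∀ j v, f (gen k j v) = g (gen k j v)) : f = g := by
  refine RingQuot.ringQuot_ext' k f g (TensorAlgebra.hom_ext (DirectSum.linearMap_ext k ?_))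
  intro j
  exact LinearMap.ext fun v => h j v

-- The universal property gives a map into the subalgebra generated by W. Followed by the inclusion
-- it fixes the generators, so it is the identity and the inclusion is onto.
variable (k W) in
theorem adjoin_gen : Algebra.adjoin k {x : GSym k W | ∃ j v, x = gen k j v} = ⊤ := by
  set S := Algebra.adjoin k {x : GSym k W | ∃ j v, x = gen k j v} with hS
  have hm : ∀ j v, gen k j v ∈ S := fun j v => Algebra.subset_adjoin ⟨j, v, rfl⟩
  let f : GSym k W →ₐ[k] S := lift
    (fun j => LinearMap.codRestrict S.toSubmodule (gen k j) (hm j))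
    (fun i j v w => Subtype.ext (gen_mul_gen k W v w))
  have : S.val.comp f = AlgHom.id k _ := algHom_ext fun j v => by
    rw [AlgHom.comp_apply, lift_gen]
    rfl
  refine eq_top_iff.2 fun x _ => ?_
  have hx := DFunLike.congr_fun this x
  rw [AlgHom.comp_apply, AlgHom.id_apply] at hx
  rw [← hx]
  exact (f x).2

/-- Functoriality of the graded symmetric algebra. -/
noncomputable def map (f : ∀ j, W j →ₗ[k] W' j) : GSym k W →ₐ[k] GSym k W' :=
  lift (fun j => gen k j ∘ₗ f j) fun _ _ v w => gen_mul_gen k W' (f _ v) (f _ w)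

@[simp] theorem map_gen (f : ∀ j, W j →ₗ[k] W' j) (j : ℤ) (v : W j) :
    map f (gen k j v) = gen k j (f j v) := lift_gen _ _ _ _

theorem map_map_of_leftInverse {f : ∀ j, W j →ₗ[k] W' j} {g : ∀ j, W' j →ₗ[k] W j}
    (h : ∀ j v, g j (f j v) = v) (x : GSym k W) : map g (map f x) = x := by
  have : (map g).comp (map f) = AlgHom.id k _ := algHom_ext fun j v => by simp [h]
  exact DFunLike.congr_fun this x

theorem map_prod_gen (f : ∀ j, W j →ₗ[k] W' j) (l : List (Σ j, W j)) :
    map f (l.map fun p => gen k p.1 p.2).prod =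
      ((l.map fun p => (⟨p.1, f p.1 p.2⟩ : Σ j, W' j)).map fun p => gen k p.1 p.2).prod := by
  induction l with
  | nil => simp
  | cons p l ih =>
    simp only [List.map_cons, List.prod_cons, map_mul, ih, map_gen]

theorem map_mem_homPart (f : ∀ j, W j →ₗ[k] W' j) {d : ℤ} {x : GSym k W}
    (hx : x ∈ homPart k W d) : map f x ∈ homPart k W' d := by
  induction hx using Submodule.span_induction with
  | zero => rw [map_zero]; exact zero_mem _
  | add a b _ _ ha hb => rw [map_add]; exact add_mem ha hb
  | smul c a _ ha => rw [map_smul]; exact Submodule.smul_mem _ _ ha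
  | mem x hx =>
    obtain ⟨l, rfl, rfl⟩ := hx
    rw [map_prod_gen]
    refine Submodule.subset_span ⟨_, ?_, rfl⟩
    rw [List.map_map]
    rfl

theorem gen_mem_homPart {j : ℤ} (v : W j) : gen k j v ∈ homPart k W j :=
  Submodule.subset_span ⟨[⟨j, v⟩], by simp⟩

theorem algebraMap_mem_homPart (c : k) : algebraMap k (GSym k W) c ∈ homPart k W 0 := by
  rw [Algebra.algebraMap_eq_smul_one]
  exact Submodule.smul_mem _ _ (one_mem_homPart k W)

/-- To prove a statement about homogeneous elements, it suffices to consider `1` and products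
of a generator with a homogeneous element. -/
theorem homPart_induction {motive : (d : ℤ) → GSym k W → Prop}
    (zero : ∀ d, motive d 0) (one : motive 0 1)
    (add : ∀ d x y, motive d x → motive d y → motive d (x + y))
    (smul : ∀ d (c : k) x, motive d x → motive d (c • x))
    (gen_mul : ∀ d j v x, x ∈ homPart k W d → motive d x → motive (j + d) (gen k j v * x))
    {d : ℤ} {x : GSym k W} (hx : x ∈ homPart k W d) : motive d x := by
  induction hx using Submodule.span_induction with
  | zero => exact zero d
  | add a b _ _ ha hb => exact add _ _ _ ha hb
  | smul c a _ ha => exact smul _ _ _ ha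
  | mem x hx =>
    obtain ⟨l, rfl, rfl⟩ := hx
    induction l with
    | nil => simpa using one
    | cons p l ih =>
      simp only [List.map_cons, List.prod_cons, List.sum_cons]
      exact gen_mul _ _ _ _ (Submodule.subset_span ⟨l, rfl, rfl⟩) ih

/-- The coaction `x ↦ ∑ d, x_d T^d` encoding the grading of `S(W)`. -/
noncomputable def coaction : GSym k W →ₐ[k] AddMonoidAlgebra (GSym k W) ℤ :=
  lift (fun j => (AddMonoidAlgebra.lsingle j) ∘ₗ gen k j) fun i j v w => by
    change AddMonoidAlgebra.single i _ * AddMonoidAlgebra.single j _ =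
      _ • (AddMonoidAlgebra.single j _ * AddMonoidAlgebra.single i _)
    rw [AddMonoidAlgebra.single_mul_single, AddMonoidAlgebra.single_mul_single, gen_mul_gen,
      add_comm j i, Units.smul_def, Units.smul_def, AddMonoidAlgebra.smul_single]

theorem coaction_of_mem {d : ℤ} {x : GSym k W} (hx : x ∈ homPart k W d) :
    coaction x = AddMonoidAlgebra.single d x := by
  refine homPart_induction (motive := fun d x => coaction x = AddMonoidAlgebra.single d x)
    (fun d => ?_) ?_ (fun d x y hx hy => ?_)
    (fun d c x hx => ?_) (fun d j v x _ hx => ?_) hx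
  · rw [map_zero, AddMonoidAlgebra.single_zero]
  · rw [map_one, AddMonoidAlgebra.one_def]
  · rw [map_add, hx, hy, AddMonoidAlgebra.single_add]
  · rw [map_smul, hx, AddMonoidAlgebra.smul_single]
  · rw [map_mul, hx, coaction, lift_gen]
    exact AddMonoidAlgebra.single_mul_single _ _ _ _

/-- The homogeneous components of `S(W)` are independent. -/
theorem eq_zero_of_sum_eq_zero {s : Finset ℤ} {x : ℤ → GSym k W}
    (hx : ∀ d, x d ∈ homPart k W d) (h : ∑ d ∈ s, x d = 0) : ∀ d ∈ s, x d = 0 := by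
  intro d hd
  -- The coaction places the component of degree d at T^d, so the coefficient at d isolates it.
  have := congrArg (fun y => (coaction y).coeff d) h
  simp only [map_sum, coaction_of_mem (hx _), map_zero, AddMonoidAlgebra.coeff_sum,
    AddMonoidAlgebra.coeff_single, AddMonoidAlgebra.coeff_zero, Finsupp.coe_zero, Pi.zero_apply,
    Finsupp.finsetSum_apply, Finsupp.single_apply] at this
  rwa [Finset.sum_ite_eq' s d, if_pos hd] at this

theorem negOnePow_smul_comm (p : ℤ) (c : k) (x : GSym k W) :
    p.negOnePow • (c • x) = c • p.negOnePow • x := by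
  rw [Units.smul_def, Units.smul_def, smul_comm]

theorem negOnePow_smul_negOnePow_neg_smul (i j : ℤ) (x : GSym k W) :
    (i * j).negOnePow • (-i * j).negOnePow • x = x := by
  rw [smul_smul, ← Int.negOnePow_add, neg_mul, add_neg_cancel, Int.negOnePow_zero, one_smul]

/-- The values on generators of the matrix representation encoding a contraction. -/
noncomputable def contractionGen (j₀ : ℤ) (δ : ∀ i, W i →ₗ[k] k) (i : ℤ) :
    W i →ₗ[k] Matrix (Fin 2) (Fin 2) (GSym k W) where
  toFun v := !![(-j₀ * i).negOnePow • gen k i v, algebraMap k _ (δ i v); 0, gen k i v]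
  map_add' v w := by
    ext a b
    fin_cases a <;> fin_cases b
    · change (-j₀ * i).negOnePow • gen k i (v + w) =
        (-j₀ * i).negOnePow • gen k i v + (-j₀ * i).negOnePow • gen k i w
      rw [map_add, smul_add]
    · change algebraMap k (GSym k W) (δ i (v + w)) =
        algebraMap k (GSym k W) (δ i v) + algebraMap k (GSym k W) (δ i w)
      rw [map_add, map_add]
    · exact (add_zero _).symm
    · exact map_add (gen k i) v w
  map_smul' c v := by
    ext a b
    fin_cases a <;> fin_cases b
    · change (-j₀ * i).negOnePow • gen k i (c • v) = c • (-j₀ * i).negOnePow • gen k i v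
      rw [map_smul, negOnePow_smul_comm]
    · change algebraMap k (GSym k W) (δ i (c • v)) = c • algebraMap k (GSym k W) (δ i v)
      rw [map_smul, smul_eq_mul, map_mul, Algebra.smul_def]
    · exact (smul_zero c).symm
    · exact map_smul (gen k i) c v

/-- Only the upper right entry is not immediate. There δ is nonzero in degree j₀ alone, and in that
degree the sign on the diagonal is exactly the Koszul sign of the exchange. -/
theorem contractionGen_mul {j₀ : ℤ} {δ : ∀ i, W i →ₗ[k] k} (hδ : ∀ i, i ≠ j₀ → δ i = 0)
    (i j : ℤ) (v : W i) (w : W j) : contractionGen j₀ δ i v * contractionGen j₀ δ j w =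
      (i * j).negOnePow • (contractionGen j₀ δ j w * contractionGen j₀ δ i v) := by
  ext a b
  rw [Matrix.mul_apply, Matrix.smul_apply, Matrix.mul_apply, Fin.sum_univ_two,
    Fin.sum_univ_two]
  fin_cases a <;> fin_cases b
  · change (-j₀ * i).negOnePow • gen k i v * (-j₀ * j).negOnePow • gen k j w +
        algebraMap k _ (δ i v) * 0 =
      (i * j).negOnePow • ((-j₀ * j).negOnePow • gen k j w * (-j₀ * i).negOnePow • gen k i v +
        algebraMap k _ (δ j w) * 0)
    rw [mul_zero, mul_zero, add_zero, add_zero, smul_mul_smul_comm, smul_mul_smul_comm,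
      gen_mul_gen, smul_comm (i * j).negOnePow, mul_comm]
  · change (-j₀ * i).negOnePow • gen k i v * algebraMap k _ (δ j w) +
        algebraMap k _ (δ i v) * gen k j w =
      (i * j).negOnePow • ((-j₀ * j).negOnePow • gen k j w * algebraMap k _ (δ i v) +
        algebraMap k _ (δ j w) * gen k i v)
    have h1 : (-j₀ * i).negOnePow • gen k i v * algebraMap k _ (δ j w) =
        (i * j).negOnePow • (algebraMap k _ (δ j w) * gen k i v) := by
      by_cases hj : j = j₀
      · subst hj
        rw [Algebra.commutes, smul_mul_assoc, neg_mul, Int.negOnePow_neg, mul_comm j i]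
      · simp [hδ j hj]
    have h2 : (i * j).negOnePow • ((-j₀ * j).negOnePow • gen k j w * algebraMap k _ (δ i v)) =
        algebraMap k _ (δ i v) * gen k j w := by
      by_cases hi : i = j₀
      · subst hi
        rw [smul_mul_assoc, negOnePow_smul_negOnePow_neg_smul, Algebra.commutes]
      · simp [hδ i hi]
    rw [h1, smul_add, h2, add_comm]
  · change 0 * _ + gen k i v * 0 = _ • (0 * _ + gen k j w * 0)
    simp only [zero_mul, mul_zero, add_zero, smul_zero]
  · change 0 * algebraMap k _ (δ j w) + gen k i v * gen k j w =
      (i * j).negOnePow • (0 * algebraMap k _ (δ i v) + gen k j w * gen k i v)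
    rw [zero_mul, zero_mul, zero_add, zero_add, gen_mul_gen]

/-- Contraction with an element of the dual of `W j₀`. -/
theorem exists_contraction {j₀ : ℤ} (δ : ∀ i, W i →ₗ[k] k) (hδ : ∀ i, i ≠ j₀ → δ i = 0) :
    ∃ D : GSym k W →ₗ[k] GSym k W, (∀ i v, D (gen k i v) = algebraMap k _ (δ i v)) ∧
      ∀ p x y, x ∈ homPart k W p →
        D (x * y) = D x * y + (-j₀ * p).negOnePow • (x * D y) := by
  -- Matrices with rows (±x, D x) and (0, x) multiply precisely according to the graded Leibniz
  -- rule. So an algebra map with this shape on generators has a graded derivation as its upper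
  -- right entry.
  let Φ : GSym k W →ₐ[k] Matrix (Fin 2) (Fin 2) (GSym k W) :=
    lift (contractionGen j₀ δ) (contractionGen_mul hδ)
  have hgen : ∀ i v, Φ (gen k i v) =
      !![(-j₀ * i).negOnePow • gen k i v, algebraMap k _ (δ i v); 0, gen k i v] :=
    fun i v => lift_gen _ _ _ _
  clear_value Φ
  have hΦ : ∀ x, Φ x 1 0 = 0 ∧ Φ x 1 1 = x := by
    intro x
    have hx : x ∈ Algebra.adjoin k {x : GSym k W | ∃ j v, x = gen k j v} := by
      rw [adjoin_gen]; trivial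
    induction hx using Algebra.adjoin_induction with
    | mem x hx =>
      obtain ⟨j, v, rfl⟩ := hx
      rw [hgen]
      exact ⟨rfl, rfl⟩
    | algebraMap c =>
      rw [AlgHom.commutes, Matrix.algebraMap_eq_diagonal]
      exact ⟨by simp, by simp⟩
    | add x y _ _ hx hy =>
      rw [map_add, Matrix.add_apply, Matrix.add_apply, hx.1, hx.2, hy.1, hy.2, add_zero]
      exact ⟨rfl, rfl⟩
    | mul x y _ _ hx hy =>
      rw [map_mul, Matrix.mul_apply, Matrix.mul_apply, Fin.sum_univ_two, Fin.sum_univ_two, hx.1,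
        hx.2, hy.1, hy.2]
      simp
  have hΦ0 : ∀ p x, x ∈ homPart k W p → Φ x 0 0 = (-j₀ * p).negOnePow • x := by
    intro p x hx
    refine homPart_induction (motive := fun p x => Φ x 0 0 = (-j₀ * p).negOnePow • x)
      (fun d => ?_) ?_ (fun d x y hx hy => ?_)
      (fun d c x hx => ?_) (fun d j v x _ hx => ?_) hx
    · rw [map_zero, smul_zero]; rfl
    · rw [map_one, mul_zero, Int.negOnePow_zero, one_smul]; rfl
    · rw [map_add, Matrix.add_apply, hx, hy, smul_add]
    · rw [map_smul, Matrix.smul_apply, hx, negOnePow_smul_comm]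
    · rw [map_mul, Matrix.mul_apply, Fin.sum_univ_two, (hΦ x).1, mul_zero, add_zero, hx, hgen]
      change (-j₀ * j).negOnePow • gen k j v * _ = _
      rw [smul_mul_smul_comm, ← Int.negOnePow_add, mul_add]
  refine ⟨(Matrix.entryLinearMap k (GSym k W) 0 1) ∘ₗ Φ.toLinearMap, fun i v => ?_,
    fun p x y hx => ?_⟩
  · rw [LinearMap.comp_apply, AlgHom.toLinearMap_apply, hgen]
    rfl
  · simp only [LinearMap.comp_apply, AlgHom.toLinearMap_apply, Matrix.entryLinearMap_apply, map_mul,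
      Matrix.mul_apply, Fin.sum_univ_two, (hΦ y).2, hΦ0 p x hx, smul_mul_assoc]
    rw [add_comm]

/-- An operator which satisfies the Leibniz rule and has degree `e` on generators has degree
`e`. -/
theorem mem_homPart_of_leibniz {e : ℤ} {D : GSym k W →ₗ[k] GSym k W}
    (h : ∀ j v, D (gen k j v) ∈ homPart k W (j + e))
    (hD : ∀ p x y, x ∈ homPart k W p → D (x * y) = D x * y + (e * p).negOnePow • (x * D y))
    {d : ℤ} {x : GSym k W} (hx : x ∈ homPart k W d) : D x ∈ homPart k W (d + e) := by
  refine homPart_induction (motive := fun d x => D x ∈ homPart k W (d + e))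
    (fun d => by rw [map_zero]; exact zero_mem _) ?_
    (fun d x y hx hy => by rw [map_add]; exact add_mem hx hy)
    (fun d c x hx => by rw [map_smul]; exact Submodule.smul_mem _ _ hx)
    (fun d j v x hx hDx => ?_) hx
  · have := hD 0 1 1 (one_mem_homPart k W)
    rw [mul_zero, Int.negOnePow_zero, one_smul, mul_one, one_mul, mul_one, left_eq_add] at this
    rw [this]
    exact zero_mem _
  · rw [hD j _ _ (gen_mem_homPart v)]
    refine add_mem ?_ ?_
    · rw [add_right_comm]
      exact mul_mem_homPart k W (h j v) hx
    · rw [Units.smul_def, add_assoc]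
      exact zsmul_mem (mul_mem_homPart k W (gen_mem_homPart v) hDx) _

end GSym

end GradedHKR

/-! ## Derivations of functions with values in a vector space -/

namespace GradedHKR

section CoeffDer

variable {k : Type} [Field k] {X : Type*} (𝒮 : Subalgebra k (X → k)) (R : Type*)

/-- The functions with values in `R` which are finite sums of products of a function in `𝒮` and a
constant in `R`. -/
def coeffSpan [AddCommGroup R] [Module k R] : Submodule k (X → R) :=
  Submodule.span k {h | ∃ f ∈ 𝒮, ∃ r : R, h = fun y => f y • r}

/-- `∂` restricts to a derivation on `𝒮` along `G`. -/
structure IsDerOn (G : Set X) (der : (X → k) → X → k) : Prop where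
  mem : ∀ f ∈ 𝒮, der f ∈ 𝒮
  add : ∀ f ∈ 𝒮, ∀ g ∈ 𝒮, ∀ x ∈ G, der (f + g) x = der f x + der g x
  smul : ∀ (c : k), ∀ f ∈ 𝒮, ∀ x ∈ G, der (c • f) x = c * der f x
  mul : ∀ f ∈ 𝒮, ∀ g ∈ 𝒮, ∀ x ∈ G, der (f * g) x = der f x * g x + f x * der g x

variable {𝒮 R}

/-- The extension of an operator on functions with values in `k` to functions with values in a
vector space, acting on coefficients. -/
noncomputable def coeffDer [AddCommGroup R] [Module k R] (der : (X → k) → X → k) (h : X → R)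
    (x : X) : R :=
  ∑ᶠ I, der (fun z => (Module.Basis.ofVectorSpace k R).repr (h z) I) x •
    Module.Basis.ofVectorSpace k R I

section Module

variable [AddCommGroup R] [Module k R]

theorem smul_mem_coeffSpan {f : X → k} (hf : f ∈ 𝒮) (r : R) :
    (fun y => f y • r) ∈ coeffSpan 𝒮 R := Submodule.subset_span ⟨f, hf, r, rfl⟩

theorem const_mem_coeffSpan (r : R) : (fun _ => r) ∈ coeffSpan 𝒮 R := by
  simpa using smul_mem_coeffSpan (one_mem 𝒮) r

theorem comp_mem_coeffSpan {R' : Type*} [AddCommGroup R'] [Module k R'] (L : R →ₗ[k] R')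
    {h : X → R} (hh : h ∈ coeffSpan 𝒮 R) : (fun x => L (h x)) ∈ coeffSpan 𝒮 R' := by
  induction hh using Submodule.span_induction with
  | zero =>
    convert zero_mem (coeffSpan 𝒮 R') using 1
    ext y; simp
  | add a b _ _ ha hb =>
    convert add_mem ha hb using 1
    ext y; simp
  | smul c a _ ha =>
    convert Submodule.smul_mem _ c ha using 1
    ext y; simp
  | mem h hh =>
    obtain ⟨f, hf, r, rfl⟩ := hh
    simpa using smul_mem_coeffSpan hf (L r)

/-- Each such function has only finitely many nonzero coordinates, all in 𝒮. Thus coefficientwise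
differentiation is a finite sum even when R, such as a symmetric algebra, is infinite-dimensional.
-/
theorem coeffSpan_coord {h : X → R} (hh : h ∈ coeffSpan 𝒮 R) {ι : Type*}
    (b : Module.Basis ι k R) :
    (∀ I, (fun z => b.repr (h z) I) ∈ 𝒮) ∧ ∃ S : Finset ι, ∀ I ∉ S, ∀ z, b.repr (h z) I = 0 := by
  classical
  induction hh using Submodule.span_induction with
  | zero =>
    refine ⟨fun I => ?_, ∅, by simp⟩
    convert zero_mem 𝒮 using 1
    ext z; simp
  | add a b _ _ ha hb =>
    obtain ⟨ha, S, hS⟩ := ha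
    obtain ⟨hb, T, hT⟩ := hb
    refine ⟨fun I => ?_, S ∪ T, fun I hI z => ?_⟩
    · convert add_mem (ha I) (hb I) using 1
      ext z; simp
    rw [Finset.notMem_union] at hI
    simp [hS I hI.1 z, hT I hI.2 z]
  | smul c a _ ha =>
    obtain ⟨ha, S, hS⟩ := ha
    refine ⟨fun I => ?_, S, fun I hI z => by simp [hS I hI z]⟩
    convert Subalgebra.smul_mem 𝒮 (ha I) c using 1
    ext z; simp
  | mem h hh =>
    obtain ⟨f, hf, r, rfl⟩ := hh
    refine ⟨fun I => ?_, (b.repr r).support, fun I hI z => ?_⟩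
    · have := Subalgebra.smul_mem 𝒮 hf (b.repr r I)
      convert this using 1
      ext z
      simp [mul_comm]
    · simp [Finsupp.notMem_support_iff.1 hI]

variable {G : Set X} {der : (X → k) → X → k}

theorem IsDerOn.map_zero (hd : IsDerOn 𝒮 G der) {x : X} (hx : x ∈ G) : der 0 x = 0 := by
  simpa using hd.smul 0 0 (zero_mem _) x hx

theorem coeffDer_eq_sum (hd : IsDerOn 𝒮 G der) {x : X} (hx : x ∈ G) {h : X → R}
    {S : Finset (Module.Basis.ofVectorSpaceIndex k R)}
    (hS : ∀ I ∉ S, ∀ z, (Module.Basis.ofVectorSpace k R).repr (h z) I = 0) :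
    coeffDer der h x = ∑ I ∈ S, der (fun z => (Module.Basis.ofVectorSpace k R).repr (h z) I) x •
      Module.Basis.ofVectorSpace k R I := by
  refine finsum_eq_sum_of_support_subset _ fun I hI => ?_
  by_contra hIS
  refine hI ?_
  have : (fun z => (Module.Basis.ofVectorSpace k R).repr (h z) I) = 0 := funext (hS I hIS)
  simp only
  rw [this, hd.map_zero hx, zero_smul]

theorem coeffDer_smul_const (hd : IsDerOn 𝒮 G der) {x : X} (hx : x ∈ G) {f : X → k}
    (hf : f ∈ 𝒮) (r : R) : coeffDer der (fun y => f y • r) x = der f x • r := by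
  have h1 : ∀ I, (fun z => (Module.Basis.ofVectorSpace k R).repr (f z • r) I) =
      (Module.Basis.ofVectorSpace k R).repr r I • f := fun I => by
    ext z; simp [mul_comm]
  rw [coeffDer_eq_sum hd hx (S := ((Module.Basis.ofVectorSpace k R).repr r).support)
    (fun I hI z => by simp [Finsupp.notMem_support_iff.1 hI])]
  conv_rhs => rw [← (Module.Basis.ofVectorSpace k R).linearCombination_repr r,
    Finsupp.linearCombination_apply, Finsupp.sum, Finset.smul_sum]
  refine Finset.sum_congr rfl fun I _ => ?_
  rw [h1, hd.smul _ _ hf x hx, smul_smul, mul_comm]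

theorem coeffDer_add (hd : IsDerOn 𝒮 G der) {x : X} (hx : x ∈ G) {h h' : X → R}
    (hh : h ∈ coeffSpan 𝒮 R) (hh' : h' ∈ coeffSpan 𝒮 R) :
    coeffDer der (h + h') x = coeffDer der h x + coeffDer der h' x := by
  classical
  obtain ⟨h1, S, hS⟩ := coeffSpan_coord hh (Module.Basis.ofVectorSpace k R)
  obtain ⟨h1', T, hT⟩ := coeffSpan_coord hh' (Module.Basis.ofVectorSpace k R)
  rw [coeffDer_eq_sum hd hx (S := S ∪ T) (h := h) fun I hI =>
      hS I (Finset.notMem_union.1 hI).1,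
    coeffDer_eq_sum hd hx (S := S ∪ T) (h := h') fun I hI => hT I (Finset.notMem_union.1 hI).2,
    coeffDer_eq_sum hd hx (S := S ∪ T) fun I hI z => by
      rw [Finset.notMem_union] at hI
      simp [hS I hI.1 z, hT I hI.2 z], ← Finset.sum_add_distrib]
  refine Finset.sum_congr rfl fun I _ => ?_
  rw [← add_smul, ← hd.add _ (h1 I) _ (h1' I) x hx]
  congr 2
  ext z
  simp

theorem coeffDer_smul (hd : IsDerOn 𝒮 G der) {x : X} (hx : x ∈ G) (c : k) {h : X → R}
    (hh : h ∈ coeffSpan 𝒮 R) : coeffDer der (c • h) x = c • coeffDer der h x := by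
  obtain ⟨h1, S, hS⟩ := coeffSpan_coord hh (Module.Basis.ofVectorSpace k R)
  rw [coeffDer_eq_sum hd hx hS, coeffDer_eq_sum hd hx (S := S) fun I hI z => by simp [hS I hI z],
    Finset.smul_sum]
  refine Finset.sum_congr rfl fun I _ => ?_
  rw [smul_smul, ← hd.smul c _ (h1 I) x hx]
  congr 2
  ext z
  simp

/-- `coeffDer` agrees along `G` with a function in `coeffSpan`. -/
theorem exists_coeffDer_eq (hd : IsDerOn 𝒮 G der) {h : X → R} (hh : h ∈ coeffSpan 𝒮 R) :
    ∃ h' ∈ coeffSpan 𝒮 R, ∀ x ∈ G, coeffDer der h x = h' x := by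
  obtain ⟨h1, S, hS⟩ := coeffSpan_coord hh (Module.Basis.ofVectorSpace k R)
  refine ⟨∑ I ∈ S, fun x => der (fun z => (Module.Basis.ofVectorSpace k R).repr (h z) I) x •
      Module.Basis.ofVectorSpace k R I,
    Submodule.sum_mem _ fun I _ => smul_mem_coeffSpan (hd.mem _ (h1 I)) _, fun x hx => ?_⟩
  rw [Finset.sum_apply, coeffDer_eq_sum hd hx hS]

/-- Coefficientwise differentiation commutes with linear maps of the values; in particular it
respects linear subspaces, and so the grading. -/
theorem coeffDer_comp (hd : IsDerOn 𝒮 G der) {x : X} (hx : x ∈ G) {R' : Type*} [AddCommGroup R']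
    [Module k R'] (L : R →ₗ[k] R') {h : X → R} (hh : h ∈ coeffSpan 𝒮 R) :
    coeffDer der (fun y => L (h y)) x = L (coeffDer der h x) := by
  induction hh using Submodule.span_induction with
  | zero =>
    have h0 : coeffDer der (0 : X → R) x = 0 := by
      simpa using coeffDer_smul hd hx (0 : k) (zero_mem (coeffSpan 𝒮 R))
    have h0' : coeffDer der (0 : X → R') x = 0 := by
      simpa using coeffDer_smul hd hx (0 : k) (zero_mem (coeffSpan 𝒮 R'))
    rw [h0, _root_.map_zero, ← h0']
    congr 1
    ext y
    simp
  | add a b ha hb iha ihb =>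
    rw [coeffDer_add hd hx ha hb, map_add, ← iha, ← ihb,
      ← coeffDer_add hd hx (comp_mem_coeffSpan L ha) (comp_mem_coeffSpan L hb)]
    congr 1
    ext y
    simp
  | smul c a ha iha =>
    rw [coeffDer_smul hd hx c ha, map_smul, ← iha, ← coeffDer_smul hd hx c (comp_mem_coeffSpan L ha)]
    congr 1
    ext y
    simp
  | mem h hh =>
    obtain ⟨f, hf, r, rfl⟩ := hh
    simp only [map_smul]
    rw [coeffDer_smul_const hd hx hf, coeffDer_smul_const hd hx hf, map_smul]

end Module

section Ring

variable [Ring R] [Algebra k R]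

theorem mul_mem_coeffSpan {h h' : X → R} (hh : h ∈ coeffSpan 𝒮 R) (hh' : h' ∈ coeffSpan 𝒮 R) :
    h * h' ∈ coeffSpan 𝒮 R := by
  have := Submodule.mul_mem_mul hh hh'
  rw [coeffSpan, Submodule.span_mul_span] at this
  refine Submodule.span_mono ?_ this
  rintro _ ⟨_, ⟨f, hf, r, rfl⟩, _, ⟨g, hg, s, rfl⟩, rfl⟩
  exact ⟨f * g, mul_mem hf hg, r * s, funext fun y => smul_mul_smul_comm _ _ _ _⟩

theorem coeffDer_mul {G : Set X} {der : (X → k) → X → k} (hd : IsDerOn 𝒮 G der) {x : X}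
    (hx : x ∈ G) {h h' : X → R} (hh : h ∈ coeffSpan 𝒮 R) (hh' : h' ∈ coeffSpan 𝒮 R) :
    coeffDer der (h * h') x = coeffDer der h x * h' x + h x * coeffDer der h' x := by
  have h0 : coeffDer der (0 : X → R) x = 0 := by
    simpa using coeffDer_smul hd hx (0 : k) (zero_mem (coeffSpan 𝒮 R))
  induction hh using Submodule.span_induction with
  | zero => simp [h0]
  | add a b ha hb iha ihb =>
    rw [add_mul, coeffDer_add hd hx (mul_mem_coeffSpan ha hh') (mul_mem_coeffSpan hb hh'), iha,
      ihb, coeffDer_add hd hx ha hb, Pi.add_apply]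
    noncomm_ring
  | smul c a ha iha =>
    rw [smul_mul_assoc, coeffDer_smul hd hx c (mul_mem_coeffSpan ha hh'), iha,
      coeffDer_smul hd hx c ha, Pi.smul_apply, smul_mul_assoc, smul_mul_assoc, smul_add]
  | mem h hh =>
    obtain ⟨f, hf, r, rfl⟩ := hh
    induction hh' using Submodule.span_induction with
    | zero => simp [h0]
    | add a b ha hb iha ihb =>
      have hf := smul_mem_coeffSpan hf r
      rw [mul_add, coeffDer_add hd hx (mul_mem_coeffSpan hf ha) (mul_mem_coeffSpan hf hb), iha,
        ihb, coeffDer_add hd hx ha hb, Pi.add_apply]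
      noncomm_ring
    | smul c a ha iha =>
      have hf := smul_mem_coeffSpan hf r
      rw [mul_smul_comm, coeffDer_smul hd hx c (mul_mem_coeffSpan hf ha), iha,
        coeffDer_smul hd hx c ha, Pi.smul_apply, mul_smul_comm, mul_smul_comm, smul_add]
    | mem h hh =>
      obtain ⟨g, hg, s, rfl⟩ := hh
      have : ((fun y => f y • r) * fun y => g y • s) = fun y => (f * g) y • (r * s) :=
        funext fun y => smul_mul_smul_comm _ _ _ _
      rw [this, coeffDer_smul_const hd hx (mul_mem hf hg), coeffDer_smul_const hd hx hf,
        coeffDer_smul_const hd hx hg, hd.mul f hf g hg x hx, smul_mul_smul_comm,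
        smul_mul_smul_comm, ← add_smul]

end Ring

end CoeffDer

/-! ### Partial derivatives in a locally constant choice of charts -/

section PartialDeriv

open Topology

variable {k : Type} [RCLike k] {n : ℕ} {C : Type u} [TopologicalSpace C]
  [ChartedSpace (EuclideanSpace ℝ (Fin n)) C]

theorem contMDiffOn_mul {G : Set C} {f g : C → k} (hf : ContMDiffOn (𝓡 n) 𝓘(ℝ, k) ∞ f G)
    (hg : ContMDiffOn (𝓡 n) 𝓘(ℝ, k) ∞ g G) :
    ContMDiffOn (𝓡 n) 𝓘(ℝ, k) ∞ (f * g) G := by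
  have h : ContMDiff 𝓘(ℝ, k × k) 𝓘(ℝ, k) ∞ fun q : k × k => q.1 * q.2 :=
    contDiff_mul.contMDiff
  exact h.comp_contMDiffOn (hf.prodMk_space hg)

variable (k n) in
/-- The functions which are smooth on `G`. -/
def smoothOn [IsManifold (𝓡 n) ∞ C] (G : Set C) : Subalgebra k (C → k) where
  carrier := {f | ContMDiffOn (𝓡 n) 𝓘(ℝ, k) ∞ f G}
  mul_mem' hf hg := contMDiffOn_mul hf hg
  add_mem' hf hg := ContMDiffOn.add hf hg
  algebraMap_mem' _ := contMDiffOn_const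

theorem mem_smoothOn [IsManifold (𝓡 n) ∞ C] {G : Set C} {f : C → k} :
    f ∈ smoothOn k n G ↔ ContMDiffOn (𝓡 n) 𝓘(ℝ, k) ∞ f G := Iff.rfl

/-- The `i`th partial derivative at `x` in the chart around `p x`. -/
noncomputable def partialDeriv (p : C → C) (i : Fin n) (f : C → k) (x : C) : k :=
  fderiv ℝ (f ∘ (chartAt (EuclideanSpace ℝ (Fin n)) (p x)).symm)
    (chartAt (EuclideanSpace ℝ (Fin n)) (p x) x) (EuclideanSpace.single i 1)

theorem partialDeriv_congr {p : C → C} {i : Fin n} {f g : C → k} {x : C}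
    (hx : x ∈ (chartAt (EuclideanSpace ℝ (Fin n)) (p x)).source) (h : f =ᶠ[𝓝 x] g) :
    partialDeriv p i f x = partialDeriv p i g x := by
  set φ := chartAt (EuclideanSpace ℝ (Fin n)) (p x) with hφ
  have h1 : f ∘ φ.symm =ᶠ[𝓝 (φ x)] g ∘ φ.symm := by
    have h2 := φ.continuousAt_symm (φ.map_source hx)
    rw [ContinuousAt, φ.left_inv hx] at h2
    exact h2.eventually h
  rw [partialDeriv, partialDeriv, ← hφ, h1.fderiv_eq]

variable [IsManifold (𝓡 n) ∞ C] {G : Set C} {p : C → C}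

theorem contDiffOn_comp_chart_symm {V : Type*} [NormedAddCommGroup V] [NormedSpace ℝ V] {f : C → V}
    (hf : ContMDiffOn (𝓡 n) 𝓘(ℝ, V) ∞ f G) (q : C) :
    ContDiffOn ℝ ∞ (f ∘ (chartAt (EuclideanSpace ℝ (Fin n)) q).symm)
      ((chartAt (EuclideanSpace ℝ (Fin n)) q).target ∩
        (chartAt (EuclideanSpace ℝ (Fin n)) q).symm ⁻¹' G) := by
  rw [← contMDiffOn_iff_contDiffOn]
  exact hf.comp ((contMDiffOn_chart_symm (I := 𝓡 n)).mono Set.inter_subset_left) fun x hx => hx.2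

theorem contDiffAt_comp_chart_symm {V : Type*} [NormedAddCommGroup V] [NormedSpace ℝ V] {f : C → V}
    (hG : IsOpen G) (hf : ContMDiffOn (𝓡 n) 𝓘(ℝ, V) ∞ f G) {q x : C} (hx : x ∈ G)
    (hxq : x ∈ (chartAt (EuclideanSpace ℝ (Fin n)) q).source) :
    ContDiffAt ℝ ∞ (f ∘ (chartAt (EuclideanSpace ℝ (Fin n)) q).symm)
      (chartAt (EuclideanSpace ℝ (Fin n)) q x) := by
  refine (contDiffOn_comp_chart_symm hf q).contDiffAt
    (((chartAt (EuclideanSpace ℝ (Fin n)) q).isOpen_inter_preimage_symm hG).mem_nhds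
      ⟨(chartAt (EuclideanSpace ℝ (Fin n)) q).map_source hxq, ?_⟩)
  rwa [Set.mem_preimage, (chartAt (EuclideanSpace ℝ (Fin n)) q).left_inv hxq]

/-- Near each point of G the centre p is constant, so the operator is an ordinary directional
derivative in one fixed chart. -/
theorem isDerOn_partialDeriv (hG : IsOpen G)
    (hp : ∀ x ∈ G, x ∈ (chartAt (EuclideanSpace ℝ (Fin n)) (p x)).source)
    (hc : ∀ x ∈ G, ∀ᶠ y in 𝓝 x, p y = p x) (i : Fin n) :
    IsDerOn (smoothOn k n G) G (partialDeriv p i) where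
  mem f hf := by
    rw [mem_smoothOn]
    intro x hx
    refine ContMDiffAt.contMDiffWithinAt ?_
    set φ := chartAt (EuclideanSpace ℝ (Fin n)) (p x) with hφ
    have h1 : partialDeriv p i f =ᶠ[𝓝 x] fun y =>
        fderiv ℝ (f ∘ φ.symm) (φ y) (EuclideanSpace.single i 1) := by
      filter_upwards [hc x hx] with y hy
      rw [partialDeriv, hy]
    refine ContMDiffAt.congr_of_eventuallyEq ?_ h1
    have h2 : ContDiffAt ℝ ∞ (fun z => fderiv ℝ (f ∘ φ.symm) z (EuclideanSpace.single i 1))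
        (φ x) :=
      ((contDiffAt_comp_chart_symm hG (mem_smoothOn.1 hf) hx (hp x hx)).fderiv_right (m := ∞) (by simp)).clm_apply
        contDiffAt_const
    exact h2.contMDiffAt.comp x (contMDiffAt_of_mem_maximalAtlas
      (IsManifold.chart_mem_maximalAtlas _) (hp x hx))
  add f hf g hg x hx := by
    have h1 := (contDiffAt_comp_chart_symm hG (mem_smoothOn.1 hf) hx (hp x hx)).differentiableAt (by simp)
    have h2 := (contDiffAt_comp_chart_symm hG (mem_smoothOn.1 hg) hx (hp x hx)).differentiableAt (by simp)
    rw [partialDeriv, Pi.add_comp, fderiv_add h1 h2]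
    rfl
  smul c f hf x hx := by
    have h1 := (contDiffAt_comp_chart_symm hG (mem_smoothOn.1 hf) hx (hp x hx)).differentiableAt (by simp)
    rw [partialDeriv]
    change fderiv ℝ (c • (f ∘ _)) _ _ = _
    rw [fderiv_const_smul h1]
    rfl
  mul f hf g hg x hx := by
    have h1 := (contDiffAt_comp_chart_symm hG (mem_smoothOn.1 hf) hx (hp x hx)).differentiableAt (by simp)
    have h2 := (contDiffAt_comp_chart_symm hG (mem_smoothOn.1 hg) hx (hp x hx)).differentiableAt (by simp)
    rw [partialDeriv, Pi.mul_comp, fderiv_mul h1 h2]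
    simp only [_root_.add_apply, _root_.smul_apply, Function.comp_apply,
      (chartAt (EuclideanSpace ℝ (Fin n)) (p x)).left_inv (hp x hx), smul_eq_mul]
    rw [add_comm, mul_comm (g x)]
    rfl

end PartialDeriv

end GradedHKR

/-! ## Cutoff functions and frames -/

namespace GradedHKR

open Bundle Topology

section Cutoff

variable {n : ℕ} {C : Type u} [TopologicalSpace C] [ChartedSpace (EuclideanSpace ℝ (Fin n)) C]
  [IsManifold (𝓡 n) ∞ C] [T2Space C] [SecondCountableTopology C]

variable (n) in
/-- Smooth cutoff functions. -/
theorem exists_cutoff {S G : Set C} (hS : IsClosed S) (hG : IsOpen G) (h : S ⊆ G) :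
    ∃ χ : C → ℝ, ContMDiff (𝓡 n) 𝓘(ℝ, ℝ) ∞ χ ∧ (∀ x ∈ S, ∀ᶠ y in 𝓝 x, χ y = 1) ∧
      tsupport χ ⊆ G := by
  have : LocallyCompactSpace C := ChartedSpace.locallyCompactSpace (EuclideanSpace ℝ (Fin n)) C
  obtain ⟨f, h0, h1, -⟩ := exists_contMDiffMap_zero_one_nhds_of_isClosed (𝓡 n) (n := ⊤)
    hG.isClosed_compl hS (Set.disjoint_compl_left_iff_subset.2 h)
  refine ⟨f, f.contMDiff, fun x hx => eventually_nhdsSet_iff_forall.1 h1 x hx, fun x hx => ?_⟩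
  by_contra hxG
  exact (notMem_tsupport_iff_eventuallyEq.2 (eventually_nhdsSet_iff_forall.1 h0 x hxG)) hx

variable {k : Type} [RCLike k]

theorem contMDiff_ofReal {χ : C → ℝ} (hχ : ContMDiff (𝓡 n) 𝓘(ℝ, ℝ) ∞ χ) :
    ContMDiff (𝓡 n) 𝓘(ℝ, k) ∞ fun x => (χ x : k) :=
  (RCLike.ofRealCLM (K := k)).contDiff.contMDiff.comp hχ

theorem contMDiff_cutoff_mul {χ : C → ℝ} (hχ : ContMDiff (𝓡 n) 𝓘(ℝ, ℝ) ∞ χ) {G : Set C}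
    (hG : IsOpen G) (hχG : tsupport χ ⊆ G) {f : C → k} (hf : ContMDiffOn (𝓡 n) 𝓘(ℝ, k) ∞ f G) :
    ContMDiff (𝓡 n) 𝓘(ℝ, k) ∞ fun x => (χ x : k) * f x := by
  refine contMDiff_of_tsupport fun x hx => ?_
  have hxG : x ∈ G := hχG (closure_mono (fun y hy => ?_) hx)
  · exact (contMDiffOn_mul (contMDiff_ofReal hχ).contMDiffOn hf).contMDiffAt (hG.mem_nhds hxG)
  · intro h0
    exact hy (by simp [h0])

end Cutoff

/-! ### Frames: passing between sections of S(E) and functions with values in a fixed algebra -/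

section Frame

variable {k : Type} [RCLike k] {n : ℕ} {C : Type u} [TopologicalSpace C]
    [ChartedSpace (EuclideanSpace ℝ (Fin n)) C] [IsManifold (𝓡 n) ∞ C] [T2Space C]
    [SecondCountableTopology C]
    {F : ℤ → Type w} [∀ j, NormedAddCommGroup (F j)] [∀ j, NormedSpace ℝ (F j)]
    [∀ j, NormedSpace k (F j)] [∀ j, IsScalarTower ℝ k (F j)] [∀ j, FiniteDimensional k (F j)]
    {E : ℤ → C → Type v} [∀ j x, AddCommGroup (E j x)] [∀ j x, Module ℝ (E j x)]
    [∀ j x, Module k (E j x)] [∀ j x, IsScalarTower ℝ k (E j x)]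
    [∀ j x, TopologicalSpace (E j x)] [∀ j, TopologicalSpace (Bundle.TotalSpace (F j) (E j))]
    [∀ j, FiberBundle (F j) (E j)] [∀ j, VectorBundle ℝ (F j) (E j)]
    [∀ j, VectorBundle k (F j) (E j)] [∀ j, ContMDiffVectorBundle ∞ (F j) (E j) (𝓡 n)]

variable (n F E) in
/-- An open set on which a chart and local trivialisations are chosen in a locally constant way:
those centred at `base x`. -/
structure FrameDomain where
  /-- The open set. -/
  carrier : Set C
  /-- The centre of the chosen chart and trivialisations. -/
  base : C → C
  isOpen : IsOpen carrier
  mem_source : ∀ x ∈ carrier, x ∈ (chartAt (EuclideanSpace ℝ (Fin n)) (base x)).source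
  mem_baseSet : ∀ x ∈ carrier, ∀ j, Nontrivial (F j) →
    x ∈ (trivializationAt (F j) (E j) (base x)).baseSet
  locConst : ∀ x ∈ carrier, ∀ᶠ y in 𝓝 x, base y = base x

namespace FrameDomain

variable (Φ : FrameDomain n F E)

variable (k) in
/-- The trivialisation of the fibre `E j x`. -/
noncomputable def triv (x : C) (j : ℤ) : E j x →ₗ[k] F j :=
  (trivializationAt (F j) (E j) (Φ.base x)).linearMapAt k x

variable (k) in
/-- The inverse of `triv`. -/
noncomputable def trivSymm (x : C) (j : ℤ) : F j →ₗ[k] E j x :=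
  (trivializationAt (F j) (E j) (Φ.base x)).symmₗ k x

/-- The domain is contained in the trivialising sets only for the nonzero model fibres. For the
others the fibre of E is zero as well and nothing is to be shown. -/
theorem trivSymm_triv {x : C} (hx : x ∈ Φ.carrier) (j : ℤ) (v : E j x) :
    Φ.trivSymm k x j (Φ.triv k x j v) = v := by
  rcases subsingleton_or_nontrivial (F j) with h | h
  · have : Subsingleton (E j x) :=
      ((trivializationAt (F j) (E j) x).linearEquivAt k x
        (mem_baseSet_trivializationAt (F j) (E j) x)).toEquiv.subsingleton
    exact Subsingleton.elim _ _
  · exact Trivialization.symmₗ_linearMapAt _ (Φ.mem_baseSet x hx j h) v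

theorem triv_trivSymm {x : C} (hx : x ∈ Φ.carrier) (j : ℤ) (v : F j) :
    Φ.triv k x j (Φ.trivSymm k x j v) = v := by
  rcases subsingleton_or_nontrivial (F j) with h | h
  · exact Subsingleton.elim _ _
  · exact Trivialization.linearMapAt_symmₗ _ (Φ.mem_baseSet x hx j h) v

variable (k) in
/-- The trivialisation of the fibre of `S(E)`. -/
noncomputable def toFib (x : C) : GSym k (fun j => E j x) →ₐ[k] GSym k F := GSym.map (Φ.triv k x)

variable (k) in
/-- The inverse of `toFib`. -/
noncomputable def ofFib (x : C) : GSym k F →ₐ[k] GSym k (fun j => E j x) :=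
  GSym.map (Φ.trivSymm k x)

theorem ofFib_toFib {x : C} (hx : x ∈ Φ.carrier) (s : GSym k (fun j => E j x)) :
    Φ.ofFib k x (Φ.toFib k x s) = s :=
  GSym.map_map_of_leftInverse (Φ.trivSymm_triv hx) s

theorem smoothOn_triv_section {j : ℤ} (e : (x : C) → E j x)
    (he : ContMDiff (𝓡 n) ((𝓡 n).prod 𝓘(ℝ, F j)) ∞ (fun x => TotalSpace.mk' (F j) x (e x)))
    (a : Fin (Module.finrank k (F j))) :
    (fun x => (Module.finBasis k (F j)).repr (Φ.triv k x j (e x)) a) ∈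
      smoothOn k n Φ.carrier := by
  have hnt : Nontrivial (F j) := Module.nontrivial_of_finrank_pos (R := k) a.pos
  rw [mem_smoothOn]
  intro x hx
  refine ContMDiffAt.contMDiffWithinAt ?_
  set t := trivializationAt (F j) (E j) (Φ.base x) with ht
  have hxt := Φ.mem_baseSet x hx j hnt
  have h1 := (t.contMDiffAt_section_iff (IB := 𝓡 n) (n := ∞) hxt).1 (he x)
  let L : F j →L[ℝ] k :=
    ((Module.finBasis k (F j)).coord a).toContinuousLinearMap.restrictScalars ℝ
  refine (L.contDiff.contMDiff.contMDiffAt.comp x h1).congr_of_eventuallyEq ?_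
  filter_upwards [Φ.locConst x hx, t.open_baseSet.mem_nhds hxt] with y hy hyt
  simp only [triv, hy, ← ht]
  rw [t.linearMapAt_apply, if_pos hyt]
  rfl

/-- A section of E j is a finite combination of frame vectors with smooth coefficients, and such
expressions are closed under sums and products. So polynomial sections have smooth coefficients with
respect to constants. -/
theorem toFib_mem_coeffSpan {t : SymSection k E} (ht : t ∈ polySections k n F E) :
    (fun x => Φ.toFib k x (t x)) ∈ coeffSpan (smoothOn k n Φ.carrier) (GSym k F) := by
  induction ht using Algebra.adjoin_induction with
  | mem t ht =>
    rcases ht with ⟨f, hf, rfl⟩ | ⟨j, e, he, rfl⟩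
    · have := smul_mem_coeffSpan (𝒮 := smoothOn k n Φ.carrier) (f := f)
        (mem_smoothOn.2 hf.contMDiffOn) (1 : GSym k F)
      convert this using 1
      ext x
      rw [AlgHom.commutes, Algebra.algebraMap_eq_smul_one]
    · have : (fun x => Φ.toFib k x (GSym.gen k j (e x))) =
          ∑ a, fun x => (Module.finBasis k (F j)).repr (Φ.triv k x j (e x)) a •
            GSym.gen k j (Module.finBasis k (F j) a) := by
        ext x
        rw [toFib, GSym.map_gen, Finset.sum_apply]
        conv_lhs => rw [← (Module.finBasis k (F j)).sum_repr (Φ.triv k x j (e x))]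
        rw [map_sum]
        simp only [map_smul]
      rw [this]
      exact Submodule.sum_mem _ fun a _ =>
        smul_mem_coeffSpan (Φ.smoothOn_triv_section e he a) _
  | algebraMap c =>
    convert const_mem_coeffSpan (𝒮 := smoothOn k n Φ.carrier) (algebraMap k (GSym k F) c) using 1
    ext x
    exact AlgHom.commutes _ _
  | add s t _ _ hs ht =>
    convert add_mem hs ht using 1
    ext x
    exact map_add _ _ _
  | mul s t _ _ hs ht =>
    convert mul_mem_coeffSpan hs ht using 1
    ext x
    exact map_mul _ _ _

theorem algebraMap_mem_polySections {f : C → k} (hf : ContMDiff (𝓡 n) 𝓘(ℝ, k) ∞ f) :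
    (fun x => algebraMap k (GSym k (fun j => E j x)) (f x)) ∈ polySections k n F E :=
  Algebra.subset_adjoin (Or.inl ⟨f, hf, rfl⟩)

theorem gen_mem_polySections {j : ℤ} (e : (x : C) → E j x)
    (he : ContMDiff (𝓡 n) ((𝓡 n).prod 𝓘(ℝ, F j)) ∞ (fun x => TotalSpace.mk' (F j) x (e x))) :
    (fun x => GSym.gen k j (e x)) ∈ polySections k n F E :=
  Algebra.subset_adjoin (Or.inr ⟨j, e, he, rfl⟩)

theorem contMDiff_cutoff_trivSymm {χ : C → ℝ} (hχ : ContMDiff (𝓡 n) 𝓘(ℝ, ℝ) ∞ χ)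
    (hχG : tsupport χ ⊆ Φ.carrier) {j : ℤ} (v : F j) :
    ContMDiff (𝓡 n) ((𝓡 n).prod 𝓘(ℝ, F j)) ∞
      (fun x => TotalSpace.mk' (F j) x ((χ x : k) • Φ.trivSymm k x j v)) := by
  have h : ContMDiffOn (𝓡 n) ((𝓡 n).prod 𝓘(ℝ, F j)) ∞
      (fun x => TotalSpace.mk' (F j) x (Φ.trivSymm k x j v)) Φ.carrier := by
    intro x hx
    refine ContMDiffAt.contMDiffWithinAt ?_
    rcases subsingleton_or_nontrivial (F j) with hs | hnt
    · exact contMDiffAt_section_of_subsingleton ..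
    set t := trivializationAt (F j) (E j) (Φ.base x) with ht
    have hxt := Φ.mem_baseSet x hx j hnt
    refine (t.contMDiffAt_section_iff (IB := 𝓡 n) (n := ∞) hxt).2 ?_
    refine (contMDiffAt_const (c := v)).congr_of_eventuallyEq ?_
    filter_upwards [Φ.locConst x hx, t.open_baseSet.mem_nhds hxt] with y hy hyt
    simp only [trivSymm, hy, ← ht]
    rw [t.symmₗ_apply hyt, t.apply_mk_symm hyt]
  have := ContMDiffOn.smul_section_of_tsupport (V := E j) hχ.contMDiffOn Φ.isOpen hχG h
  convert this using 3 with x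
  rw [Pi.smul_apply', RCLike.real_smul_eq_coe_smul (K := k)]

/-- The converse, near a point: a cutoff equal to 1 near x extends both the coefficient function and
the frame vectors to global smooth objects without changing anything near x. -/
theorem exists_polySections_ofFib {h : C → GSym k F}
    (hh : h ∈ coeffSpan (smoothOn k n Φ.carrier) (GSym k F)) {x : C} (hx : x ∈ Φ.carrier) :
    ∃ t ∈ polySections k n F E, ∀ᶠ y in 𝓝 x, Φ.ofFib k y (h y) = t y := by
  obtain ⟨χ, hχ, hχ1, hχG⟩ := exists_cutoff n (isClosed_singleton (x := x)) Φ.isOpen (by simpa)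
  have hχ1 := hχ1 x rfl
  induction hh using Submodule.span_induction with
  | zero => exact ⟨0, zero_mem _, by simp⟩
  | add a b _ _ ha hb =>
    obtain ⟨s, hs, h1⟩ := ha
    obtain ⟨t, ht, h2⟩ := hb
    refine ⟨s + t, add_mem hs ht, ?_⟩
    filter_upwards [h1, h2] with y h1 h2
    rw [Pi.add_apply, map_add, h1, h2, Pi.add_apply]
  | smul c a _ ha =>
    obtain ⟨s, hs, h1⟩ := ha
    refine ⟨c • s, Subalgebra.smul_mem _ hs c, ?_⟩
    filter_upwards [h1] with y h1
    rw [Pi.smul_apply, map_smul, h1, Pi.smul_apply]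
  | mem h hh =>
    obtain ⟨f, hf, r, rfl⟩ := hh
    have hr : ∃ t ∈ polySections k n F E, ∀ᶠ y in 𝓝 x, Φ.ofFib k y r = t y := by
      have hr : r ∈ Algebra.adjoin k {r : GSym k F | ∃ j v, r = GSym.gen k j v} := by
        rw [GSym.adjoin_gen]; trivial
      induction hr using Algebra.adjoin_induction with
      | mem r hr =>
        obtain ⟨j, v, rfl⟩ := hr
        refine ⟨_, gen_mem_polySections _ (Φ.contMDiff_cutoff_trivSymm (k := k) hχ hχG v), ?_⟩
        filter_upwards [hχ1] with y hy
        rw [hy, RCLike.ofReal_one, one_smul, ofFib, GSym.map_gen]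
      | algebraMap c => exact ⟨algebraMap k _ c, algebraMap_mem _ c, by simp [AlgHom.commutes]⟩
      | add a b _ _ ha hb =>
        obtain ⟨s, hs, h1⟩ := ha
        obtain ⟨t, ht, h2⟩ := hb
        refine ⟨s + t, add_mem hs ht, ?_⟩
        filter_upwards [h1, h2] with y h1 h2
        rw [map_add, h1, h2, Pi.add_apply]
      | mul a b _ _ ha hb =>
        obtain ⟨s, hs, h1⟩ := ha
        obtain ⟨t, ht, h2⟩ := hb
        refine ⟨s * t, mul_mem hs ht, ?_⟩
        filter_upwards [h1, h2] with y h1 h2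
        rw [map_mul, h1, h2, Pi.mul_apply]
    obtain ⟨t, ht, h1⟩ := hr
    refine ⟨_, mul_mem (algebraMap_mem_polySections
      (contMDiff_cutoff_mul hχ Φ.isOpen hχG (mem_smoothOn.1 hf))) ht, ?_⟩
    filter_upwards [h1, hχ1] with y h1 h2
    rw [Pi.mul_apply, h2, RCLike.ofReal_one, one_mul, map_smul, h1, Algebra.smul_def]

end FrameDomain

end Frame

end GradedHKR

/-! ## Derivations of the algebra of functions -/

namespace GradedHKR

/-! ### Operators on a graded direct sum given by their components -/

section GradedSumDer

variable {k : Type} [Field k] {B : Type u} [Ring B] [Algebra k B] {ℬ : ℤ → Submodule k B}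
  [SetLike.GradedMonoid ℬ]

theorem incl_eq_incl {d e : ℤ} {z : ℬ d} {w : ℬ e} (hd : d = e) (h : (z : B) = w) :
    GradedSum.incl ℬ d z = GradedSum.incl ℬ e w := by
  subst hd
  rw [Subtype.ext h]

theorem incl_mem_summand {d : ℤ} (z : ℬ d) : GradedSum.incl ℬ d z ∈ GradedSum.summand ℬ d :=
  ⟨z, rfl⟩

/-- The operator on `⨁ d, ℬ d` with given components. -/
noncomputable def endOfFamily {e : ℤ} (f : ∀ d, ℬ d →ₗ[k] ℬ (d + e)) :
    Module.End k (GradedSum ℬ) where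
  toFun := DirectSum.toModule k ℤ (GradedSum ℬ) fun d => GradedSum.incl ℬ (d + e) ∘ₗ f d
  map_add' := map_add (DirectSum.toModule k ℤ (GradedSum ℬ) fun d =>
    GradedSum.incl ℬ (d + e) ∘ₗ f d)
  map_smul' := map_smul (DirectSum.toModule k ℤ (GradedSum ℬ) fun d =>
    GradedSum.incl ℬ (d + e) ∘ₗ f d)

theorem endOfFamily_incl {e : ℤ} (f : ∀ d, ℬ d →ₗ[k] ℬ (d + e)) {d : ℤ} (z : ℬ d) :
    endOfFamily f (GradedSum.incl ℬ d z) = GradedSum.incl ℬ (d + e) (f d z) :=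
  DirectSum.toModule_lof (M := fun d => ℬ d) (N := GradedSum ℬ)
    (φ := fun d => GradedSum.incl ℬ (d + e) ∘ₗ f d) k d z

theorem endOfFamily_mem_gradedDer {e : ℤ} {f : ∀ d, ℬ d →ₗ[k] ℬ (d + e)}
    (hf : ∀ (d d' : ℤ) (z : ℬ d) (z' : ℬ d'),
      (f (d + d') ⟨z * z', SetLike.mul_mem_graded z.2 z'.2⟩ : B) =
        f d z * z' + (e * d).negOnePow • ((z : B) * f d' z')) :
    endOfFamily f ∈ gradedDer (GradedSum.summand ℬ) e := by
  refine ⟨?_, ?_⟩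
  · rintro d _ ⟨z, rfl⟩
    exact ⟨f d z, (endOfFamily_incl f z).symm⟩
  · rintro d _ b ⟨z, rfl⟩
    have : endOfFamily f ∘ₗ LinearMap.mulLeft k (GradedSum.incl ℬ d z) =
        LinearMap.mulLeft k (endOfFamily f (GradedSum.incl ℬ d z)) +
          (e * d).negOnePow • (LinearMap.mulLeft k (GradedSum.incl ℬ d z) ∘ₗ endOfFamily f) := by
      refine ext_homogeneous (𝒜 := GradedSum.summand ℬ) ?_
      rintro d' _ ⟨z', rfl⟩
      simp only [LinearMap.comp_apply, LinearMap.mulLeft_apply, LinearMap.add_apply,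
        LinearMap.smul_apply, endOfFamily_incl, GradedSum.incl_mul]
      rw [incl_eq_incl (w := ⟨(f d z : B) * z', SetLike.mul_mem_graded (f d z).2 z'.2⟩ +
        (e * d).negOnePow • ⟨(z : B) * f d' z', by
          have := SetLike.mul_mem_graded z.2 (f d' z').2
          rwa [← add_assoc, add_right_comm] at this⟩) (add_right_comm d d' e) (hf d d' z z'),
        map_add, Units.smul_def, map_zsmul, ← Units.smul_def]
      congr 2
      exact incl_eq_incl (by ring) rfl
    exact LinearMap.congr_fun this b

end GradedSumDer

open Bundle Topology

/-! ### Derivations in a frame, cut off and transported to sections -/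

section Frame

variable {k : Type} [RCLike k] {n : ℕ} {C : Type u} [TopologicalSpace C]
    [ChartedSpace (EuclideanSpace ℝ (Fin n)) C] [IsManifold (𝓡 n) ∞ C] [T2Space C]
    [SecondCountableTopology C]
    {F : ℤ → Type w} [∀ j, NormedAddCommGroup (F j)] [∀ j, NormedSpace ℝ (F j)]
    [∀ j, NormedSpace k (F j)] [∀ j, IsScalarTower ℝ k (F j)] [∀ j, FiniteDimensional k (F j)]
    {E : ℤ → C → Type v} [∀ j x, AddCommGroup (E j x)] [∀ j x, Module ℝ (E j x)]
    [∀ j x, Module k (E j x)] [∀ j x, IsScalarTower ℝ k (E j x)]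
    [∀ j x, TopologicalSpace (E j x)] [∀ j, TopologicalSpace (Bundle.TotalSpace (F j) (E j))]
    [∀ j, FiberBundle (F j) (E j)] [∀ j, VectorBundle ℝ (F j) (E j)]
    [∀ j, VectorBundle k (F j) (E j)] [∀ j, ContMDiffVectorBundle ∞ (F j) (E j) (𝓡 n)]

variable (k n F) in
/-- A graded derivation of degree `e` of the functions on `G` with values in the graded symmetric
algebra of the model fibre. -/
structure FrameDer (G : Set C) (e : ℤ) where
  /-- The underlying operator. -/
  toFun : (C → GSym k F) → C → GSym k F
  congr : ∀ x ∈ G, ∀ {h h' : C → GSym k F}, h =ᶠ[𝓝 x] h' → toFun h x = toFun h' x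
  exists_eq : ∀ h ∈ coeffSpan (smoothOn k n G) (GSym k F),
    ∃ h' ∈ coeffSpan (smoothOn k n G) (GSym k F), ∀ x ∈ G, toFun h x = h' x
  map_add : ∀ h ∈ coeffSpan (smoothOn k n G) (GSym k F),
    ∀ h' ∈ coeffSpan (smoothOn k n G) (GSym k F), ∀ x ∈ G,
      toFun (h + h') x = toFun h x + toFun h' x
  map_smul : ∀ (c : k), ∀ h ∈ coeffSpan (smoothOn k n G) (GSym k F), ∀ x ∈ G,
      toFun (c • h) x = c • toFun h x
  leibniz : ∀ h ∈ coeffSpan (smoothOn k n G) (GSym k F),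
    ∀ h' ∈ coeffSpan (smoothOn k n G) (GSym k F), ∀ x ∈ G, ∀ d, h x ∈ GSym.homPart k F d →
      toFun (h * h') x = toFun h x * h' x + (e * d).negOnePow • (h x * toFun h' x)
  mem_homPart : ∀ h ∈ coeffSpan (smoothOn k n G) (GSym k F), ∀ x ∈ G, ∀ d,
    (∀ᶠ y in 𝓝 x, h y ∈ GSym.homPart k F d) → toFun h x ∈ GSym.homPart k F (d + e)

namespace FrameDomain

variable (Φ : FrameDomain n F E)

variable (k) in
theorem isDerOn_partialDeriv (i : Fin n) :
    IsDerOn (smoothOn k n Φ.carrier) Φ.carrier (partialDeriv Φ.base i) :=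
  GradedHKR.isDerOn_partialDeriv Φ.isOpen Φ.mem_source Φ.locConst i

variable (k) in
theorem coeffDer_partialDeriv_congr {R : Type*} [AddCommGroup R] [Module k R] (i : Fin n) {x : C}
    (hx : x ∈ Φ.carrier) {h h' : C → R} (hh : h =ᶠ[𝓝 x] h') :
    coeffDer (k := k) (partialDeriv Φ.base i) h x =
      coeffDer (k := k) (partialDeriv Φ.base i) h' x := by
  refine finsum_congr fun I => ?_
  rw [partialDeriv_congr (Φ.mem_source x hx)]
  filter_upwards [hh] with y hy
  rw [hy]

variable (k) in
/-- The partial derivatives. -/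
noncomputable def partialFrameDer (i : Fin n) : FrameDer k n F Φ.carrier 0 where
  toFun := coeffDer (partialDeriv Φ.base i)
  congr x hx _ _ h := Φ.coeffDer_partialDeriv_congr k i hx h
  exists_eq h hh := exists_coeffDer_eq (Φ.isDerOn_partialDeriv k i) hh
  map_add h hh h' hh' x hx := coeffDer_add (Φ.isDerOn_partialDeriv k i) hx hh hh'
  map_smul c h hh x hx := coeffDer_smul (Φ.isDerOn_partialDeriv k i) hx c hh
  leibniz h hh h' hh' x hx d _ := by
    rw [coeffDer_mul (Φ.isDerOn_partialDeriv k i) hx hh hh', zero_mul, Int.negOnePow_zero, one_smul]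
  mem_homPart h hh x hx d hd := by
    -- P is a linear projection onto the homogeneous part. Near x it fixes h, and it commutes with
    -- coefficientwise differentiation, so the derivative has values in that part too.
    obtain ⟨P, hP⟩ := (GSym.homPart k F d).subtype.exists_leftInverse_of_injective
      (Submodule.ker_subtype _)
    have h1 : h =ᶠ[𝓝 x] fun y => ((GSym.homPart k F d).subtype ∘ₗ P) (h y) := by
      filter_upwards [hd] with y hy
      have := LinearMap.congr_fun hP ⟨h y, hy⟩
      exact (congrArg Subtype.val this).symm
    rw [Φ.coeffDer_partialDeriv_congr k i hx h1,
      coeffDer_comp (Φ.isDerOn_partialDeriv k i) hx _ hh, add_zero]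
    exact (P _).2

/-- Contraction with a linear form on `F j`, on the graded symmetric algebra. -/
noncomputable def contraction (j : ℤ) (l : F j →ₗ[k] k) : GSym k F →ₗ[k] GSym k F :=
  (GSym.exists_contraction (k := k) (W := F) (j₀ := j)
    (Function.update (β := fun i => F i →ₗ[k] k) 0 j l)
    fun _ hi => Function.update_of_ne (β := fun i => F i →ₗ[k] k) hi _ _).choose

theorem contraction_gen (j : ℤ) (l : F j →ₗ[k] k) (i : ℤ) (v : F i) :
    contraction j l (GSym.gen k i v) =
      algebraMap k _ (Function.update (β := fun i => F i →ₗ[k] k) 0 j l i v) :=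
  (GSym.exists_contraction (k := k) (W := F) (j₀ := j)
    (Function.update (β := fun i => F i →ₗ[k] k) 0 j l)
    fun _ hi => Function.update_of_ne (β := fun i => F i →ₗ[k] k) hi _ _).choose_spec.1 i v

theorem contraction_mul (j : ℤ) (l : F j →ₗ[k] k) (d : ℤ) (x y : GSym k F)
    (hx : x ∈ GSym.homPart k F d) : contraction j l (x * y) =
      contraction j l x * y + (-j * d).negOnePow • (x * contraction j l y) :=
  (GSym.exists_contraction (k := k) (W := F) (j₀ := j)
    (Function.update (β := fun i => F i →ₗ[k] k) 0 j l)
    fun _ hi => Function.update_of_ne (β := fun i => F i →ₗ[k] k) hi _ _).choose_spec.2 d x y hx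

theorem contraction_algebraMap (j : ℤ) (l : F j →ₗ[k] k) (c : k) :
    contraction j l (algebraMap k (GSym k F) c) = 0 := by
  have h := contraction_mul j l 0 1 1 (GSym.one_mem_homPart k F)
  rw [mul_zero, Int.negOnePow_zero, one_smul, mul_one, one_mul, mul_one, left_eq_add] at h
  rw [Algebra.algebraMap_eq_smul_one, map_smul, h, smul_zero]

/-- Contraction with a linear form on `F j`. -/
noncomputable def contractionFrameDer (G : Set C) (j : ℤ) (l : F j →ₗ[k] k) :
    FrameDer k n F G (-j) where
  toFun h x := contraction j l (h x)
  congr _ _ _ _ h := congrArg _ h.eq_of_nhds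
  exists_eq _ hh := ⟨_, comp_mem_coeffSpan (contraction j l) hh, fun _ _ => rfl⟩
  map_add _ _ _ _ _ _ := map_add (contraction j l) _ _
  map_smul c _ _ _ _ := map_smul (contraction j l) c _
  leibniz _ _ _ _ _ _ d hd := contraction_mul j l d _ _ hd
  mem_homPart h _ x _ d hd := GSym.mem_homPart_of_leibniz (fun i v => by
    rw [contraction_gen]
    by_cases hi : i = j
    · subst hi
      rw [add_neg_cancel]
      exact GSym.algebraMap_mem_homPart _
    · rw [Function.update_of_ne (β := fun i => F i →ₗ[k] k) hi, Pi.zero_apply,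
        LinearMap.zero_apply, map_zero]
      exact zero_mem _) (contraction_mul j l) hd.self_of_nhds

theorem contractionFrameDer_apply (G : Set C) (j : ℤ) (l : F j →ₗ[k] k) (h : C → GSym k F)
    (x : C) : (contractionFrameDer (n := n) G j l).toFun h x = contraction j l (h x) := rfl

variable {Φ} {e : ℤ} (Δ : FrameDer k n F Φ.carrier e) (ρ : C → ℝ)

/-- The operator on sections of `S(E)` obtained from a derivation in the frame by multiplication
with a function supported in the domain of the frame. -/
noncomputable def op (s : SymSection k E) : SymSection k E := fun x =>
  (ρ x : k) • Φ.ofFib k x (Δ.toFun (fun y => Φ.toFib k y (s y)) x)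

variable {ρ}

theorem op_congr {x : C} {s s' : SymSection k E} (h : ∀ᶠ y in 𝓝 x, s y = s' y)
    (hρ : tsupport ρ ⊆ Φ.carrier) : op Δ ρ s x = op Δ ρ s' x := by
  by_cases hx : x ∈ tsupport ρ
  · rw [op, op, Δ.congr x (hρ hx)]
    filter_upwards [h] with y hy
    rw [hy]
  · simp [op, image_eq_zero_of_notMem_tsupport hx]

theorem op_of_eq_zero {x : C} (s : SymSection k E) (hx : ρ x = 0) : op Δ ρ s x = 0 := by
  simp [op, hx]

variable (k E) in
/-- Near each point the section is a polynomial in smooth sections. -/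
def IsLocallyPoly (s : SymSection k E) : Prop :=
  ∀ x, ∃ t ∈ polySections k n F E, ∀ᶠ y in 𝓝 x, s y = t y

/-- The axioms of a `FrameDer` concern polynomial sections, whereas s and s' are only locally such.
As the operator depends on germs, both are replaced near x by polynomials; outside the frame ρ
vanishes. The same device gives homogeneity and the Leibniz rule below. -/
theorem op_add (hρ : tsupport ρ ⊆ Φ.carrier) {s s' : SymSection k E}
    (hs : IsLocallyPoly (n := n) (F := F) k E s) (hs' : IsLocallyPoly (n := n) (F := F) k E s') :
    op Δ ρ (s + s') = op Δ ρ s + op Δ ρ s' := by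
  ext x
  by_cases hx : x ∈ Φ.carrier
  · obtain ⟨t, ht, h⟩ := hs x
    obtain ⟨t', ht', h'⟩ := hs' x
    rw [Pi.add_apply, op_congr Δ h hρ, op_congr Δ h' hρ, op_congr (s' := t + t') Δ (by
      filter_upwards [h, h'] with y h h'
      rw [Pi.add_apply, h, h', Pi.add_apply]) hρ, op, op, op, ← smul_add, ← map_add,
      ← Δ.map_add _ (Φ.toFib_mem_coeffSpan ht) _ (Φ.toFib_mem_coeffSpan ht') x hx]
    congr 3
    ext y
    simp
  · have h0 : ρ x = 0 := image_eq_zero_of_notMem_tsupport fun h => hx (hρ h)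
    simp [op, h0]

theorem op_smul (hρ : tsupport ρ ⊆ Φ.carrier) (c : k) {s : SymSection k E}
    (hs : IsLocallyPoly (n := n) (F := F) k E s) : op Δ ρ (c • s) = c • op Δ ρ s := by
  ext x
  by_cases hx : x ∈ Φ.carrier
  · obtain ⟨t, ht, h⟩ := hs x
    rw [Pi.smul_apply, op_congr Δ h hρ, op_congr (s' := c • t) Δ (by
      filter_upwards [h] with y h
      rw [Pi.smul_apply, h, Pi.smul_apply]) hρ, op, op, smul_comm c, ← map_smul (Φ.ofFib k x) c,
      ← Δ.map_smul c _ (Φ.toFib_mem_coeffSpan ht) x hx]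
    congr 3
    ext y
    simp
  · have h0 : ρ x = 0 := image_eq_zero_of_notMem_tsupport fun h => hx (hρ h)
    simp [op, h0]

theorem op_mul (hρ : tsupport ρ ⊆ Φ.carrier) {s s' : SymSection k E}
    (hs : IsLocallyPoly (n := n) (F := F) k E s) (hs' : IsLocallyPoly (n := n) (F := F) k E s')
    {d : ℤ} (hd : ∀ x, s x ∈ GSym.homPart k (fun j => E j x) d) :
    op Δ ρ (s * s') = op Δ ρ s * s' + (e * d).negOnePow • (s * op Δ ρ s') := by
  ext x
  rw [Pi.add_apply, Pi.smul_apply, Pi.mul_apply, Pi.mul_apply]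
  by_cases hx : x ∈ Φ.carrier
  · obtain ⟨t, ht, h⟩ := hs x
    obtain ⟨t', ht', h'⟩ := hs' x
    have h1 := Δ.leibniz _ (Φ.toFib_mem_coeffSpan ht) _ (Φ.toFib_mem_coeffSpan ht') x hx d
      (by rw [← h.self_of_nhds]; exact GSym.map_mem_homPart _ (hd x))
    rw [op_congr Δ h hρ, op_congr Δ h' hρ, op_congr (s' := t * t') Δ (by
      filter_upwards [h, h'] with y h h'
      rw [Pi.mul_apply, h, h', Pi.mul_apply]) hρ, h.self_of_nhds, h'.self_of_nhds, op, op, op]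
    have h2 : (fun y => Φ.toFib k y ((t * t') y)) =
        (fun y => Φ.toFib k y (t y)) * fun y => Φ.toFib k y (t' y) := by
      ext y
      simp
    rw [h2, h1, map_add, map_mul, Units.smul_def, map_zsmul, map_mul, Φ.ofFib_toFib hx,
      Φ.ofFib_toFib hx, smul_add, smul_mul_assoc, mul_smul_comm, smul_comm (ρ x : k),
      ← Units.smul_def]
  · have h0 : ρ x = 0 := image_eq_zero_of_notMem_tsupport fun h => hx (hρ h)
    rw [op_of_eq_zero Δ _ h0, op_of_eq_zero Δ _ h0, op_of_eq_zero Δ _ h0]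
    simp

/-- Inside the frame the derivative of a local polynomial is again locally polynomial. A point
outside lies off the closed support of ρ, so the section vanishes in a whole neighbourhood. -/
theorem op_mem_homSections (hρ : tsupport ρ ⊆ Φ.carrier) (hρs : ContMDiff (𝓡 n) 𝓘(ℝ, ℝ) ∞ ρ)
    {d : ℤ} {s : SymSection k E} (hs : s ∈ homSections k n F E d) :
    op Δ ρ s ∈ homSections k n F E (d + e) := by
  have h0 : ∀ x, x ∉ Φ.carrier → ρ x = 0 :=
    fun x hx => image_eq_zero_of_notMem_tsupport fun h => hx (hρ h)
  refine ⟨fun x => ?_, fun x => ?_⟩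
  · by_cases hx : x ∈ Φ.carrier
    · obtain ⟨t, ht, h⟩ := hs.2 x
      rw [op_congr Δ h hρ]
      refine Submodule.smul_mem _ _ (GSym.map_mem_homPart _ ?_)
      refine Δ.mem_homPart _ (Φ.toFib_mem_coeffSpan ht) x hx d ?_
      filter_upwards [h] with y hy
      rw [← hy]
      exact GSym.map_mem_homPart _ (hs.1 y)
    · rw [op_of_eq_zero Δ _ (h0 x hx)]
      exact zero_mem _
  · by_cases hx : x ∈ Φ.carrier
    · obtain ⟨t, ht, h⟩ := hs.2 x
      obtain ⟨h', hh', h1⟩ := Δ.exists_eq _ (Φ.toFib_mem_coeffSpan ht)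
      obtain ⟨t', ht', h2⟩ := Φ.exists_polySections_ofFib hh' hx
      refine ⟨_, mul_mem (algebraMap_mem_polySections (k := k) (contMDiff_ofReal hρs)) ht', ?_⟩
      filter_upwards [h2, h.eventually_nhds, Φ.isOpen.mem_nhds hx] with y hy h hyG
      rw [op_congr Δ h hρ, op, h1 y hyG, hy, Pi.mul_apply, Algebra.smul_def]
    · refine ⟨0, zero_mem _, ?_⟩
      have : x ∉ tsupport ρ := fun h => hx (hρ h)
      filter_upwards [notMem_tsupport_iff_eventuallyEq.1 this] with y hy
      rw [op_of_eq_zero Δ _ hy]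
      rfl

/-- The derivation of the algebra of functions given by `op`. -/
noncomputable def der (hρ : tsupport ρ ⊆ Φ.carrier) (hρs : ContMDiff (𝓡 n) 𝓘(ℝ, ℝ) ∞ ρ) :
    Module.End k (SuperFun k n F E) :=
  endOfFamily (e := e) fun _ =>
    { toFun := fun s => ⟨op Δ ρ s, op_mem_homSections Δ hρ hρs s.2⟩
      map_add' := fun s t => Subtype.ext (op_add Δ hρ s.2.2 t.2.2)
      map_smul' := fun c s => Subtype.ext (op_smul Δ hρ c s.2.2) }

theorem der_incl (hρ : tsupport ρ ⊆ Φ.carrier) (hρs : ContMDiff (𝓡 n) 𝓘(ℝ, ℝ) ∞ ρ) {d : ℤ}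
    (s : homSections k n F E d) : der Δ hρ hρs (GradedSum.incl (homSections k n F E) d s) =
      GradedSum.incl (homSections k n F E) (d + e) ⟨op Δ ρ s, op_mem_homSections Δ hρ hρs s.2⟩ :=
  endOfFamily_incl _ s

theorem der_mem_gradedDer (hρ : tsupport ρ ⊆ Φ.carrier) (hρs : ContMDiff (𝓡 n) 𝓘(ℝ, ℝ) ∞ ρ) :
    der Δ hρ hρs ∈ gradedDer (superGrading k n F E) e :=
  endOfFamily_mem_gradedDer fun _ _ s t => op_mul Δ hρ s.2.2 t.2.2 s.2.1

end FrameDomain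

end Frame

end GradedHKR

/-! ## Locality of derivations -/

namespace GradedHKR

open Bundle Topology

/-! ### From the graded direct sum to the ambient algebra -/

section Total

variable {k : Type} [Field k] {B : Type u} [Ring B] [Algebra k B] (ℬ : ℤ → Submodule k B)
  [SetLike.GradedMonoid ℬ]

/-- The sum map `⨁ d, ℬ d → B`. -/
noncomputable def totalHom : GradedSum ℬ →ₐ[k] B := DirectSum.coeAlgHom ℬ

@[simp] theorem totalHom_incl {d : ℤ} (z : ℬ d) : totalHom ℬ (GradedSum.incl ℬ d z) = z :=
  DirectSum.coeAlgHom_of ℬ d z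

variable {ℬ} in
theorem exists_eq_sum_incl (a : GradedSum ℬ) :
    ∃ (s : Finset ℤ) (z : ∀ d, ℬ d), a = ∑ d ∈ s, GradedSum.incl ℬ d (z d) := by
  classical
  exact ⟨DFinsupp.support (β := fun d => ℬ d) a, fun d => DFinsupp.toFun a d,
    (DirectSum.sum_support_of (β := fun d => ℬ d) a).symm⟩

end Total

section Frame

variable {k : Type} [RCLike k] {n : ℕ} {C : Type u} [TopologicalSpace C]
    [ChartedSpace (EuclideanSpace ℝ (Fin n)) C] [IsManifold (𝓡 n) ∞ C] [T2Space C]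
    [SecondCountableTopology C]
    {F : ℤ → Type w} [∀ j, NormedAddCommGroup (F j)] [∀ j, NormedSpace ℝ (F j)]
    [∀ j, NormedSpace k (F j)] [∀ j, IsScalarTower ℝ k (F j)] [∀ j, FiniteDimensional k (F j)]
    {E : ℤ → C → Type v} [∀ j x, AddCommGroup (E j x)] [∀ j x, Module ℝ (E j x)]
    [∀ j x, Module k (E j x)] [∀ j x, IsScalarTower ℝ k (E j x)]
    [∀ j x, TopologicalSpace (E j x)] [∀ j, TopologicalSpace (Bundle.TotalSpace (F j) (E j))]
    [∀ j, FiberBundle (F j) (E j)] [∀ j, VectorBundle ℝ (F j) (E j)]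
    [∀ j, VectorBundle k (F j) (E j)] [∀ j, ContMDiffVectorBundle ∞ (F j) (E j) (𝓡 n)]

variable (k n F E) in
/-- The section of `S(E)` underlying a function on the supermanifold. -/
noncomputable def toSection : SuperFun k n F E →ₐ[k] SymSection k E :=
  totalHom (homSections k n F E)

theorem toSection_incl {d : ℤ} (s : homSections k n F E d) :
    toSection k n F E (GradedSum.incl (homSections k n F E) d s) = s := totalHom_incl _ s

/-- Homogeneous components of S(E_x) are independent in every fibre. Hence identities in the algebra
of functions may be checked pointwise on sections. -/
theorem toSection_injective : Function.Injective (toSection k n F E) := by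
  refine (injective_iff_map_eq_zero _).2 fun a ha => ?_
  obtain ⟨s, z, rfl⟩ := exists_eq_sum_incl a
  simp only [map_sum, toSection_incl] at ha
  refine Finset.sum_eq_zero fun d hd => ?_
  have : z d = 0 := Subtype.ext (funext fun x => by
    refine GSym.eq_zero_of_sum_eq_zero (s := s) (x := fun d => (z d : SymSection k E) x)
      (fun d => (z d).2.1 x) ?_ d hd
    rw [← Finset.sum_apply, ha]
    rfl)
  rw [this, map_zero]

variable (F E) in
/-- A smooth function on the body, as a function on the supermanifold. -/
noncomputable def ofFun (f : C → k) (hf : ContMDiff (𝓡 n) 𝓘(ℝ, k) ∞ f) : SuperFun k n F E :=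
  GradedSum.incl (homSections k n F E) 0 ⟨fun x => algebraMap k _ (f x),
    fun _ => GSym.algebraMap_mem_homPart _,
    fun _ => ⟨_, FrameDomain.algebraMap_mem_polySections hf, by simp⟩⟩

/-- A smooth section of `E j`, as a function on the supermanifold. -/
noncomputable def ofSec {j : ℤ} (e : (x : C) → E j x)
    (he : ContMDiff (𝓡 n) ((𝓡 n).prod 𝓘(ℝ, F j)) ∞ (fun x => TotalSpace.mk' (F j) x (e x))) :
    SuperFun k n F E :=
  GradedSum.incl (homSections k n F E) j ⟨fun x => GSym.gen k j (e x),
    fun _ => GSym.gen_mem_homPart _,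
    fun _ => ⟨_, FrameDomain.gen_mem_polySections e he, by simp⟩⟩

theorem ofFun_mem (f : C → k) (hf : ContMDiff (𝓡 n) 𝓘(ℝ, k) ∞ f) :
    ofFun F E f hf ∈ superGrading k n F E 0 := incl_mem_summand _

theorem ofSec_mem {j : ℤ} (e : (x : C) → E j x)
    (he : ContMDiff (𝓡 n) ((𝓡 n).prod 𝓘(ℝ, F j)) ∞ (fun x => TotalSpace.mk' (F j) x (e x))) :
    ofSec (k := k) e he ∈ superGrading k n F E j := incl_mem_summand _

@[simp] theorem toSection_ofFun (f : C → k) (hf : ContMDiff (𝓡 n) 𝓘(ℝ, k) ∞ f) (x : C) :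
    toSection k n F E (ofFun F E f hf) x = algebraMap k _ (f x) := by
  rw [ofFun, toSection_incl]

@[simp] theorem toSection_ofSec {j : ℤ} (e : (x : C) → E j x)
    (he : ContMDiff (𝓡 n) ((𝓡 n).prod 𝓘(ℝ, F j)) ∞ (fun x => TotalSpace.mk' (F j) x (e x)))
    (x : C) : toSection k n F E (ofSec e he) x = GSym.gen k j (e x) := by
  rw [ofSec, toSection_incl]

section Der

variable {e : ℤ} {D : Module.End k (SuperFun k n F E)}

theorem der_mul_of_mem_zero (hD : D ∈ gradedDer (superGrading k n F E) e)
    {a : SuperFun k n F E} (ha : a ∈ superGrading k n F E 0)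
    (b : SuperFun k n F E) : D (a * b) = D a * b + a * D b := by
  rw [hD.2 0 a b ha, mul_zero, Int.negOnePow_zero, one_smul]

theorem der_algebraMap (hD : D ∈ gradedDer (superGrading k n F E) e) (c : k) :
    D (algebraMap k _ c) = 0 := by
  have h1 := der_mul_of_mem_zero hD (SetLike.GradedOne.one_mem (A := superGrading k n F E)) 1
  rw [mul_one, one_mul, mul_one, left_eq_add] at h1
  rw [Algebra.algebraMap_eq_smul_one, map_smul, h1, smul_zero]

/-- Derivations are local. -/
theorem der_local (hD : D ∈ gradedDer (superGrading k n F E) e) {a b : SuperFun k n F E} {x : C}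
    (h : ∀ᶠ y in 𝓝 x, toSection k n F E a y = toSection k n F E b y) :
    toSection k n F E (D a) x = toSection k n F E (D b) x := by
  obtain ⟨G, hG, hGo, hxG⟩ := eventually_nhds_iff.1 h
  obtain ⟨χ, hχ, hχ1, hχG⟩ := exists_cutoff n (isClosed_singleton (x := x)) hGo (by simpa)
  -- The cutoff times the difference is zero. Differentiating this product, the term with D χ
  -- disappears at x because a = b there, and χ(x) = 1 leaves the difference of the derivatives.
  have h0 : ofFun F E (fun y => (χ y : k)) (contMDiff_ofReal hχ) * (a - b) = 0 := by
    refine toSection_injective ?_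
    rw [map_mul, map_sub, map_zero]
    ext y
    rw [Pi.mul_apply, toSection_ofFun, Pi.sub_apply]
    by_cases hy : y ∈ G
    · rw [hG y hy, sub_self, mul_zero]
      rfl
    · rw [image_eq_zero_of_notMem_tsupport fun h => hy (hχG h)]
      simp
  have h1 := congrArg (fun c => toSection k n F E (D c) x) h0
  simp only [der_mul_of_mem_zero hD (ofFun_mem _ _), map_add, map_mul, map_sub, map_zero,
    Pi.add_apply, Pi.mul_apply, Pi.sub_apply, Pi.zero_apply, hG x hxG, sub_self, mul_zero,
    zero_add, toSection_ofFun, (hχ1 x rfl).self_of_nhds, map_one, one_mul] at h1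
  exact sub_eq_zero.1 h1

/-- A derivation which vanishes at `x` on smooth functions and smooth sections of the bundles
`E j` vanishes at `x`. -/
theorem der_eq_zero_of_generators (hD : D ∈ gradedDer (superGrading k n F E) e) {x : C}
    (h1 : ∀ f hf, toSection k n F E (D (ofFun F E f hf)) x = 0)
    (h2 : ∀ j (s : (x : C) → E j x) hs, toSection k n F E (D (ofSec s hs)) x = 0)
    {d : ℤ} (s : homSections k n F E d) :
    toSection k n F E (D (GradedSum.incl (homSections k n F E) d s)) x = 0 := by
  obtain ⟨t, ht, h⟩ := s.2.2 x
  -- The local polynomial t is lifted to an element b of the algebra built from functions and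
  -- sections, on which the Leibniz rule gives vanishing at x; locality carries this over to s.
  have key : ∃ b, toSection k n F E b = t ∧ toSection k n F E (D b) x = 0 := by
    clear h
    induction ht using Algebra.adjoin_induction with
    | mem t ht =>
      rcases ht with ⟨f, hf, rfl⟩ | ⟨j, s, hs, rfl⟩
      · exact ⟨_, funext fun x => toSection_ofFun f hf x, h1 f hf⟩
      · exact ⟨_, funext fun x => toSection_ofSec s hs x, h2 j s hs⟩
    | algebraMap c =>
      refine ⟨algebraMap k _ c, AlgHom.commutes _ _, ?_⟩
      rw [der_algebraMap hD, map_zero]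
      rfl
    | add a b _ _ ha hb =>
      obtain ⟨a, rfl, ha⟩ := ha
      obtain ⟨b, rfl, hb⟩ := hb
      refine ⟨a + b, map_add _ _ _, ?_⟩
      rw [map_add, map_add, Pi.add_apply, ha, hb, add_zero]
    | mul a b _ _ ha hb =>
      obtain ⟨a, rfl, ha⟩ := ha
      obtain ⟨b, rfl, hb⟩ := hb
      refine ⟨a * b, map_mul _ _ _, ?_⟩
      rw [gradedDer_leibniz hD, map_add, map_mul, map_mul, Pi.add_apply, Pi.mul_apply,
        Pi.mul_apply, ha, hb, zero_mul, mul_zero, add_zero]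
  obtain ⟨b, rfl, hb⟩ := key
  rw [der_local hD (b := b) (by rwa [toSection_incl]), hb]

end Der

end Frame

end GradedHKR

/-! ## Coordinates in a frame -/

namespace GradedHKR

open Bundle Topology

section Frame

variable {k : Type} [RCLike k] {n : ℕ} {C : Type u} [TopologicalSpace C]
    [ChartedSpace (EuclideanSpace ℝ (Fin n)) C] [IsManifold (𝓡 n) ∞ C] [T2Space C]
    [SecondCountableTopology C]
    {F : ℤ → Type w} [∀ j, NormedAddCommGroup (F j)] [∀ j, NormedSpace ℝ (F j)]
    [∀ j, NormedSpace k (F j)] [∀ j, IsScalarTower ℝ k (F j)] [∀ j, FiniteDimensional k (F j)]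
    {E : ℤ → C → Type v} [∀ j x, AddCommGroup (E j x)] [∀ j x, Module ℝ (E j x)]
    [∀ j x, Module k (E j x)] [∀ j x, IsScalarTower ℝ k (E j x)]
    [∀ j x, TopologicalSpace (E j x)] [∀ j, TopologicalSpace (Bundle.TotalSpace (F j) (E j))]
    [∀ j, FiberBundle (F j) (E j)] [∀ j, VectorBundle ℝ (F j) (E j)]
    [∀ j, VectorBundle k (F j) (E j)] [∀ j, ContMDiffVectorBundle ∞ (F j) (E j) (𝓡 n)]

namespace FrameDomain

variable (Φ : FrameDomain n F E)

variable (k) in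
/-- The coordinate functions on the domain of a frame. -/
noncomputable def coord (i : Fin n) (x : C) : k :=
  ((chartAt (EuclideanSpace ℝ (Fin n)) (Φ.base x) x i : ℝ) : k)

theorem coord_eventuallyEq {x : C} (hx : x ∈ Φ.carrier) (i : Fin n) :
    Φ.coord k i =ᶠ[𝓝 x] fun y =>
      ((chartAt (EuclideanSpace ℝ (Fin n)) (Φ.base x) y i : ℝ) : k) := by
  filter_upwards [Φ.locConst x hx] with y hy
  rw [coord, hy]

theorem coord_mem_smoothOn (i : Fin n) : Φ.coord k i ∈ smoothOn k n Φ.carrier := by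
  rw [mem_smoothOn]
  intro x hx
  refine ContMDiffAt.contMDiffWithinAt
    (ContMDiffAt.congr_of_eventuallyEq ?_ (Φ.coord_eventuallyEq hx i))
  have h1 : ContMDiffAt (𝓡 n) (𝓡 n) ∞ (chartAt (EuclideanSpace ℝ (Fin n)) (Φ.base x)) x :=
    contMDiffAt_of_mem_maximalAtlas (IsManifold.chart_mem_maximalAtlas _) (Φ.mem_source x hx)
  have h2 : ContDiff ℝ ∞ fun z : EuclideanSpace ℝ (Fin n) => ((z i : ℝ) : k) :=
    (RCLike.ofRealCLM (K := k)).contDiff.comp (EuclideanSpace.proj (𝕜 := ℝ) i).contDiff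
  exact h2.contMDiff.contMDiffAt.comp x h1

theorem partialDeriv_coord {x : C} (hx : x ∈ Φ.carrier) (i i' : Fin n) :
    partialDeriv Φ.base i (Φ.coord k i') x = if i = i' then 1 else 0 := by
  rw [partialDeriv_congr (Φ.mem_source x hx) (Φ.coord_eventuallyEq hx i'), partialDeriv]
  set φ := chartAt (EuclideanSpace ℝ (Fin n)) (Φ.base x) with hφ
  let L : EuclideanSpace ℝ (Fin n) →L[ℝ] k :=
    (RCLike.ofRealCLM (K := k)).comp (EuclideanSpace.proj (𝕜 := ℝ) i')
  have h1 : (fun y => ((φ y i' : ℝ) : k)) ∘ φ.symm =ᶠ[𝓝 (φ x)] L := by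
    filter_upwards [φ.open_target.mem_nhds (φ.map_source (Φ.mem_source x hx))] with z hz
    rw [Function.comp_apply, φ.right_inv hz]
    rfl
  rw [h1.fderiv_eq, L.fderiv]
  change ((EuclideanSpace.single i (1 : ℝ) i' : ℝ) : k) = _
  rw [PiLp.single_apply]
  rcases eq_or_ne i i' with rfl | h
  · rw [if_pos rfl, if_pos rfl, RCLike.ofReal_one]
  · rw [if_neg h, if_neg h.symm, RCLike.ofReal_zero]

/-- Hadamard's lemma in a chart. -/
theorem exists_eq_add_sum_mul {f : C → k} (hf : ContMDiff (𝓡 n) 𝓘(ℝ, k) ∞ f) {x : C}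
    (hx : x ∈ Φ.carrier) : ∃ g : Fin n → C → k, (∀ i, ContMDiff (𝓡 n) 𝓘(ℝ, k) ∞ (g i)) ∧
      ∀ᶠ y in 𝓝 x, f y = f x + ∑ i, (Φ.coord k i y - Φ.coord k i x) * g i y := by
  set φ := chartAt (EuclideanSpace ℝ (Fin n)) (Φ.base x) with hφ
  have hxφ := Φ.mem_source x hx
  have h1 := contDiffOn_comp_chart_symm (hf.contMDiffOn (s := Set.univ)) (Φ.base x)
  rw [Set.preimage_univ, Set.inter_univ, ← hφ] at h1
  obtain ⟨r, hr, hrφ⟩ := Metric.isOpen_iff.1 φ.open_target (φ x) (φ.map_source hxφ)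
  obtain ⟨g, hg, hfg⟩ := exists_eq_add_sum_smul hr (h1.mono hrφ)
  set G : Set C := φ.source ∩ φ ⁻¹' Metric.ball (φ x) (r / 2) with hG
  have hGo : IsOpen G := φ.isOpen_inter_preimage Metric.isOpen_ball
  have hxG : x ∈ G := ⟨hxφ, Metric.mem_ball_self (half_pos hr)⟩
  obtain ⟨χ, hχ, hχ1, hχG⟩ := exists_cutoff n (isClosed_singleton (x := x)) hGo (by simpa)
  have hgφ : ∀ i, ContMDiffOn (𝓡 n) 𝓘(ℝ, k) ∞ (fun y => g i (φ y)) G := fun i =>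
    (contMDiffOn_iff_contDiffOn.2 (hg i)).comp
      ((contMDiffOn_chart (I := 𝓡 n)).mono Set.inter_subset_left) fun y hy => hy.2
  refine ⟨fun i y => (χ y : k) * g i (φ y),
    fun i => contMDiff_cutoff_mul hχ hGo hχG (hgφ i), ?_⟩
  filter_upwards [hχ1 x rfl, hGo.mem_nhds hxG, Φ.locConst x hx] with y hy hyG hyb
  have h2 := hfg (φ y) hyG.2
  rw [Function.comp_apply, Function.comp_apply, φ.left_inv hyG.1, φ.left_inv hxφ] at h2
  rw [h2]
  congr 1
  refine Finset.sum_congr rfl fun i _ => ?_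
  rw [hy, RCLike.ofReal_one, one_mul, coord, coord, hyb, ← hφ, ← RCLike.ofReal_sub,
    ← RCLike.real_smul_eq_coe_mul]

variable {χ : C → ℝ} (hχ : ContMDiff (𝓡 n) 𝓘(ℝ, ℝ) ∞ χ) (hχG : tsupport χ ⊆ Φ.carrier)

variable (k) in
/-- The even coordinates of degree zero, cut off by `χ`. -/
noncomputable def coordFun (i : Fin n) : SuperFun k n F E :=
  ofFun F E (fun x => (χ x : k) * Φ.coord k i x)
    (contMDiff_cutoff_mul hχ Φ.isOpen hχG (mem_smoothOn.1 (Φ.coord_mem_smoothOn i)))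

variable (k) in
/-- The fibre coordinates, cut off by `χ`. -/
noncomputable def coordSec {j : ℤ} (a : Fin (Module.finrank k (F j))) : SuperFun k n F E :=
  ofSec (fun x => (χ x : k) • Φ.trivSymm k x j (Module.finBasis k (F j) a))
    (Φ.contMDiff_cutoff_trivSymm hχ hχG _)

theorem coordFun_mem (i : Fin n) : Φ.coordFun k hχ hχG i ∈ superGrading k n F E 0 :=
  ofFun_mem _ _

theorem coordSec_mem {j : ℤ} (a : Fin (Module.finrank k (F j))) :
    Φ.coordSec k hχ hχG a ∈ superGrading k n F E j := ofSec_mem _ _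

section Complete

variable {e : ℤ} {D : Module.End k (SuperFun k n F E)}

/-- By Hadamard's lemma f is near x a constant plus a sum of terms (coordinate minus its value at x)
times a smooth function. In the Leibniz rule at x one factor is the derivative of a coordinate and
the other vanishes at x. -/
theorem der_ofFun_eq_zero (hD : D ∈ gradedDer (superGrading k n F E) e) {x : C}
    (hx : ∀ᶠ y in 𝓝 x, χ y = 1)
    (h1 : ∀ i, toSection k n F E (D (Φ.coordFun k hχ hχG i)) x = 0)
    (f : C → k) (hf : ContMDiff (𝓡 n) 𝓘(ℝ, k) ∞ f) :
    toSection k n F E (D (ofFun F E f hf)) x = 0 := by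
  have hxG : x ∈ Φ.carrier := hχG (subset_tsupport _ (by
    rw [Function.mem_support, hx.self_of_nhds]; exact one_ne_zero))
  obtain ⟨g, hg, h⟩ := Φ.exists_eq_add_sum_mul hf hxG
  have hc : ∀ i, Φ.coordFun k hχ hχG i - algebraMap k _ (Φ.coord k i x) ∈
      superGrading k n F E 0 := fun i => by
    refine sub_mem (Φ.coordFun_mem hχ hχG i) ?_
    rw [Algebra.algebraMap_eq_smul_one]
    exact Submodule.smul_mem _ _ SetLike.GradedOne.one_mem
  rw [der_local hD (b := algebraMap k _ (f x) + ∑ i, (Φ.coordFun k hχ hχG i -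
    algebraMap k _ (Φ.coord k i x)) * ofFun F E (g i) (hg i))]
  · rw [map_add, der_algebraMap hD, zero_add, map_sum, map_sum, Finset.sum_apply]
    refine Finset.sum_eq_zero fun i _ => ?_
    rw [der_mul_of_mem_zero hD (hc i), map_sub, der_algebraMap hD, sub_zero, map_add, map_mul,
      map_mul, Pi.add_apply, Pi.mul_apply, Pi.mul_apply, h1 i, zero_mul, zero_add, map_sub,
      Pi.sub_apply, coordFun, toSection_ofFun, hx.self_of_nhds, AlgHom.commutes,
      Pi.algebraMap_apply, RCLike.ofReal_one, one_mul, sub_self, zero_mul]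
  · filter_upwards [h, hx] with y h hy
    rw [toSection_ofFun, h, map_add, map_sum, map_add, map_sum, Pi.add_apply, Finset.sum_apply,
      AlgHom.commutes, Pi.algebraMap_apply]
    congr 1
    refine Finset.sum_congr rfl fun i _ => ?_
    rw [map_mul, map_mul, Pi.mul_apply, map_sub, map_sub, Pi.sub_apply, coordFun, toSection_ofFun,
      toSection_ofFun, AlgHom.commutes, Pi.algebraMap_apply, hy, RCLike.ofReal_one, one_mul]

/-- It remains to treat sections of E j: near x such a section is a combination of the cut-off frame
vectors with smooth coefficients, and the derivation kills both at x. -/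
theorem der_incl_eq_zero (hD : D ∈ gradedDer (superGrading k n F E) e) {x : C}
    (hx : ∀ᶠ y in 𝓝 x, χ y = 1)
    (h1 : ∀ i, toSection k n F E (D (Φ.coordFun k hχ hχG i)) x = 0)
    (h2 : ∀ j (a : Fin (Module.finrank k (F j))),
      toSection k n F E (D (Φ.coordSec k hχ hχG a)) x = 0)
    {d : ℤ} (s : homSections k n F E d) :
    toSection k n F E (D (GradedSum.incl (homSections k n F E) d s)) x = 0 := by
  have hf := Φ.der_ofFun_eq_zero hχ hχG hD hx h1
  refine der_eq_zero_of_generators hD hf (fun j s hs => ?_) s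
  have hsm := fun a => contMDiff_cutoff_mul hχ Φ.isOpen hχG
    (mem_smoothOn.1 (Φ.smoothOn_triv_section (k := k) s hs a))
  rw [der_local hD (b := ∑ a, ofFun F E _ (hsm a) * Φ.coordSec k hχ hχG a)]
  · rw [map_sum, map_sum, Finset.sum_apply]
    refine Finset.sum_eq_zero fun a _ => ?_
    rw [der_mul_of_mem_zero hD (ofFun_mem _ _), map_add, map_mul, map_mul, Pi.add_apply,
      Pi.mul_apply, Pi.mul_apply, hf, h2, zero_mul, mul_zero, add_zero]
  · filter_upwards [hx] with y hy
    have hyG : y ∈ Φ.carrier := hχG (subset_tsupport _ (by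
      rw [Function.mem_support, hy]; exact one_ne_zero))
    rw [toSection_ofSec, map_sum, Finset.sum_apply]
    conv_lhs => rw [← Φ.trivSymm_triv (k := k) hyG j (s y),
      ← (Module.finBasis k (F j)).sum_repr (Φ.triv k y j (s y)), map_sum, map_sum]
    refine Finset.sum_congr rfl fun a _ => ?_
    rw [map_mul, Pi.mul_apply, toSection_ofFun, coordSec, toSection_ofSec, hy, RCLike.ofReal_one,
      one_mul, one_smul, map_smul, map_smul, Algebra.smul_def]

end Complete

end FrameDomain

end Frame

end GradedHKR

/-! ## Systems of local coordinates -/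

namespace GradedHKR

open Bundle Topology

section Frame

variable {k : Type} [RCLike k] {n : ℕ} {C : Type u} [TopologicalSpace C]
    [ChartedSpace (EuclideanSpace ℝ (Fin n)) C] [IsManifold (𝓡 n) ∞ C] [T2Space C]
    [SecondCountableTopology C]
    {F : ℤ → Type w} [∀ j, NormedAddCommGroup (F j)] [∀ j, NormedSpace ℝ (F j)]
    [∀ j, NormedSpace k (F j)] [∀ j, IsScalarTower ℝ k (F j)] [∀ j, FiniteDimensional k (F j)]
    {E : ℤ → C → Type v} [∀ j x, AddCommGroup (E j x)] [∀ j x, Module ℝ (E j x)]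
    [∀ j x, Module k (E j x)] [∀ j x, IsScalarTower ℝ k (E j x)]
    [∀ j x, TopologicalSpace (E j x)] [∀ j, TopologicalSpace (Bundle.TotalSpace (F j) (E j))]
    [∀ j, FiberBundle (F j) (E j)] [∀ j, VectorBundle ℝ (F j) (E j)]
    [∀ j, VectorBundle k (F j) (E j)] [∀ j, ContMDiffVectorBundle ∞ (F j) (E j) (𝓡 n)]

namespace FrameDomain

variable (Φ : FrameDomain n F E)

theorem toSection_der_incl {e : ℤ} (Δ : FrameDer k n F Φ.carrier e) {ρ : C → ℝ}
    (hρG : tsupport ρ ⊆ Φ.carrier) (hρ : ContMDiff (𝓡 n) 𝓘(ℝ, ℝ) ∞ ρ) {d : ℤ}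
    (s : homSections k n F E d) (x : C) :
    toSection k n F E (der Δ hρG hρ (GradedSum.incl (homSections k n F E) d s)) x =
      op Δ ρ s x := by
  rw [der_incl, toSection_incl]

variable {Φ} in
theorem op_eq {e : ℤ} (Δ : FrameDer k n F Φ.carrier e) {ρ : C → ℝ} {s : SymSection k E}
    {h : C → GSym k F} {x : C} (hx : x ∈ Φ.carrier)
    (hh : ∀ᶠ y in 𝓝 x, Φ.toFib k y (s y) = h y) :
    op Δ ρ s x = (ρ x : k) • Φ.ofFib k x (Δ.toFun h x) := by
  rw [op, Δ.congr x hx hh]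

variable (F) in
theorem partialFrameDer_smul_const (i : Fin n) {f : C → k} (hf : f ∈ smoothOn k n Φ.carrier)
    (r : GSym k F) {x : C} (hx : x ∈ Φ.carrier) :
    (Φ.partialFrameDer k i).toFun (fun y => f y • r) x = partialDeriv Φ.base i f x • r :=
  coeffDer_smul_const (Φ.isDerOn_partialDeriv k i) hx hf r

variable {χ ρ : C → ℝ} (hχ : ContMDiff (𝓡 n) 𝓘(ℝ, ℝ) ∞ χ) (hχG : tsupport χ ⊆ Φ.carrier)
  (hρG : tsupport ρ ⊆ Φ.carrier) (hρ : ContMDiff (𝓡 n) 𝓘(ℝ, ℝ) ∞ ρ)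

/-- Where ρ is nonzero the cutoff χ is identically 1 nearby, so the cut-off coordinate agrees with
the true one; elsewhere both sides vanish. The remaining duality relations follow the same pattern.
-/
theorem der_partial_coordFun (hχ1 : ∀ x ∈ tsupport ρ, ∀ᶠ y in 𝓝 x, χ y = 1) (i i' : Fin n) :
    der (E := E) (Φ.partialFrameDer k i) hρG hρ (Φ.coordFun k hχ hχG i') =
      if i = i' then ofFun F E (fun x => (ρ x : k)) (contMDiff_ofReal hρ) else 0 := by
  refine toSection_injective (funext fun x => ?_)
  rw [coordFun, ofFun, toSection_der_incl]
  by_cases h0 : ρ x = 0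
  · rw [op_of_eq_zero _ _ h0]
    split_ifs
    · rw [toSection_ofFun, h0, RCLike.ofReal_zero, map_zero]
    · rw [map_zero]; rfl
  · have hxt : x ∈ tsupport ρ := subset_tsupport _ h0
    have hx := hρG hxt
    rw [op_eq (h := fun y => Φ.coord k i' y • 1) _ hx, Φ.partialFrameDer_smul_const F i
      (Φ.coord_mem_smoothOn i') 1 hx, Φ.partialDeriv_coord hx]
    · split_ifs
      · rw [toSection_ofFun, one_smul, map_one, Algebra.algebraMap_eq_smul_one]
      · rw [zero_smul, map_zero, smul_zero, map_zero]; rfl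
    · filter_upwards [hχ1 x hxt] with y hy
      rw [hy, RCLike.ofReal_one, one_mul, AlgHom.commutes, Algebra.algebraMap_eq_smul_one]

theorem toFib_cutoff_trivSymm {x : C} (hx : x ∈ Φ.carrier) (hχ1 : ∀ᶠ y in 𝓝 x, χ y = 1) {j : ℤ}
    (v : F j) : ∀ᶠ y in 𝓝 x,
      Φ.toFib k y (GSym.gen k j ((χ y : k) • Φ.trivSymm k y j v)) = GSym.gen k j v := by
  filter_upwards [hχ1, Φ.isOpen.mem_nhds hx] with y hy hyG
  rw [hy, RCLike.ofReal_one, one_smul, toFib, GSym.map_gen, Φ.triv_trivSymm hyG]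

theorem der_partial_coordSec (hχ1 : ∀ x ∈ tsupport ρ, ∀ᶠ y in 𝓝 x, χ y = 1) (i : Fin n) {j : ℤ}
    (a : Fin (Module.finrank k (F j))) :
    der (E := E) (Φ.partialFrameDer k i) hρG hρ (Φ.coordSec k hχ hχG a) = 0 := by
  refine toSection_injective (funext fun x => ?_)
  rw [coordSec, ofSec, toSection_der_incl, map_zero, Pi.zero_apply]
  by_cases h0 : ρ x = 0
  · rw [op_of_eq_zero _ _ h0]
  · have hxt : x ∈ tsupport ρ := subset_tsupport _ h0
    have hx := hρG hxt
    have h1 : partialDeriv Φ.base i (1 : C → k) x = 0 := by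
      have := (Φ.isDerOn_partialDeriv k i).mul 1 (one_mem _) 1 (one_mem _) x hx
      rwa [mul_one, Pi.one_apply, mul_one, one_mul, left_eq_add] at this
    rw [op_eq (h := fun y => (1 : C → k) y • GSym.gen k j (Module.finBasis k (F j) a)) _ hx,
      Φ.partialFrameDer_smul_const F i (one_mem _) _ hx, h1, zero_smul, map_zero, smul_zero]
    filter_upwards [Φ.toFib_cutoff_trivSymm (k := k) hx (hχ1 x hxt) (Module.finBasis k (F j) a)] with y hy
    rw [hy, Pi.one_apply, one_smul]

theorem der_contraction_coordFun {j : ℤ} (l : F j →ₗ[k] k) (i : Fin n) :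
    der (E := E) (contractionFrameDer Φ.carrier j l) hρG hρ (Φ.coordFun k hχ hχG i) = 0 := by
  refine toSection_injective (funext fun x => ?_)
  rw [coordFun, ofFun, toSection_der_incl, map_zero, Pi.zero_apply]
  by_cases h0 : ρ x = 0
  · rw [op_of_eq_zero _ _ h0]
  · have hx := hρG (subset_tsupport _ h0)
    rw [op_eq (h := fun y => algebraMap k _ ((χ y : k) * Φ.coord k i y)) _ hx,
      contractionFrameDer_apply, contraction_algebraMap, map_zero, smul_zero]
    filter_upwards with y
    exact AlgHom.commutes _ _

theorem der_contraction_coordSec (hχ1 : ∀ x ∈ tsupport ρ, ∀ᶠ y in 𝓝 x, χ y = 1) {j j' : ℤ}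
    (l : F j →ₗ[k] k) (a : Fin (Module.finrank k (F j'))) :
    der (E := E) (contractionFrameDer Φ.carrier j l) hρG hρ (Φ.coordSec k hχ hχG a) =
      Function.update (β := fun i => F i →ₗ[k] k) 0 j l j' (Module.finBasis k (F j') a) •
        ofFun F E (fun x => (ρ x : k)) (contMDiff_ofReal hρ) := by
  refine toSection_injective (funext fun x => ?_)
  rw [coordSec, ofSec, toSection_der_incl, map_smul, Pi.smul_apply, toSection_ofFun]
  by_cases h0 : ρ x = 0
  · rw [op_of_eq_zero _ _ h0, h0, RCLike.ofReal_zero, map_zero, smul_zero]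
  · have hxt : x ∈ tsupport ρ := subset_tsupport _ h0
    have hx := hρG hxt
    rw [op_eq (h := fun y => GSym.gen k j' (Module.finBasis k (F j') a)) _ hx,
      contractionFrameDer_apply, contraction_gen, AlgHom.commutes, Algebra.algebraMap_eq_smul_one,
      Algebra.algebraMap_eq_smul_one, smul_comm]
    exact Φ.toFib_cutoff_trivSymm hx (hχ1 x hxt) _

theorem toSection_der_of_eq_zero {e : ℤ} (Δ : FrameDer k n F Φ.carrier e) {d : ℤ}
    (s : homSections k n F E d) {x : C} (h0 : ρ x = 0) :
    toSection k n F E (der Δ hρG hρ (GradedSum.incl (homSections k n F E) d s)) x = 0 := by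
  rw [toSection_der_incl, op_of_eq_zero _ _ h0]

/-- The difference of the two sides is a derivation which kills every coordinate, by duality and
because ρ is central of degree zero. Derivations killing the coordinates vanish wherever χ is 1
nearby. -/
theorem smul_eq_sum_smul_of_coords {ι : Type} [Fintype ι] [DecidableEq ι]
    {ξ : ι → SuperFun k n F E} {deg : ι → ℤ} {X : ι → Module.End k (SuperFun k n F E)}
    (hξ : ∀ t, ξ t ∈ superGrading k n F E (deg t))
    (hX : ∀ t, X t ∈ gradedDer (superGrading k n F E) (-deg t))
    (hXξ : ∀ s t, X s (ξ t) =
      if s = t then ofFun F E (fun x => (ρ x : k)) (contMDiff_ofReal hρ) else 0)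
    (hX0 : ∀ t d (s : homSections k n F E d) x, ρ x = 0 →
      toSection k n F E (X t (GradedSum.incl (homSections k n F E) d s)) x = 0)
    (hχ1 : ∀ x ∈ tsupport ρ, ∀ᶠ y in 𝓝 x, χ y = 1)
    (h1 : ∀ i, ∃ t, ξ t = Φ.coordFun k hχ hχG i)
    (h2 : ∀ j (a : Fin (Module.finrank k (F j))), ∃ t, ξ t = Φ.coordSec k hχ hχG a)
    {e : ℤ} {D : Module.End k (SuperFun k n F E)} (hD : D ∈ gradedDer (superGrading k n F E) e) :
    ofFun F E (fun x => (ρ x : k)) (contMDiff_ofReal hρ) • D = ∑ t, D (ξ t) • X t := by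
  set r := ofFun F E (fun x => (ρ x : k)) (contMDiff_ofReal hρ) with hr
  have hr0 : r ∈ superGrading k n F E 0 := ofFun_mem _ _
  have hD' : r • D - ∑ t, D (ξ t) • X t ∈ gradedDer (superGrading k n F E) e := by
    refine sub_mem ?_ (Submodule.sum_mem _ fun t _ => ?_)
    · have := smul_mem_gradedDer hr0 hD
      rwa [zero_add] at this
    · have := smul_mem_gradedDer (hD.1 _ _ (hξ t)) (hX t)
      rwa [add_neg_cancel_comm] at this
  have h0 : ∀ s, (r • D - ∑ t, D (ξ t) • X t) (ξ s) = 0 := by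
    intro s
    rw [LinearMap.sub_apply, LinearMap.smul_apply, LinearMap.sum_apply, sub_eq_zero, smul_eq_mul,
      Finset.sum_eq_single s, LinearMap.smul_apply, smul_eq_mul, hXξ, if_pos rfl]
    · exact (mul_comm_of_mem_zero hr0 _).symm
    · intro t _ ht
      rw [LinearMap.smul_apply, hXξ, if_neg ht, smul_zero]
    · simp
  refine ext_homogeneous (𝒜 := superGrading k n F E) ?_
  rintro d _ ⟨s, rfl⟩
  refine toSection_injective (funext fun x => ?_)
  -- At zeros of ρ nothing is known about the coordinates, but there both sides vanish term by term.
  by_cases hx : ρ x = 0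
  · rw [LinearMap.smul_apply, LinearMap.sum_apply, smul_eq_mul, map_mul, map_sum, Pi.mul_apply,
      Finset.sum_apply, hr, toSection_ofFun, hx, RCLike.ofReal_zero, map_zero, zero_mul]
    refine (Finset.sum_eq_zero fun t _ => ?_).symm
    rw [LinearMap.smul_apply, smul_eq_mul, map_mul, Pi.mul_apply, hX0 t d s x hx, mul_zero]
  · have := Φ.der_incl_eq_zero hχ hχG hD' (hχ1 x (subset_tsupport _ hx)) (fun i => by
      obtain ⟨t, ht⟩ := h1 i
      rw [← ht, h0, map_zero]
      rfl) (fun j a => by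
      obtain ⟨t, ht⟩ := h2 j a
      rw [← ht, h0, map_zero]
      rfl) s
    rwa [LinearMap.sub_apply, map_sub, Pi.sub_apply, sub_eq_zero] at this

variable (k) in
/-- The coordinates given by a frame. -/
noncomputable def frameCoord {J : Finset ℤ} :
    Fin n ⊕ (Σ j : J, Fin (Module.finrank k (F j))) → SuperFun k n F E :=
  Sum.elim (Φ.coordFun k hχ hχG) fun t => Φ.coordSec k hχ hχG t.2

/-- The degrees of the coordinates given by a frame. -/
def frameDeg {m : ℕ} {J : Finset ℤ} {r : J → ℕ} : Fin m ⊕ (Σ j : J, Fin (r j)) → ℤ :=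
  Sum.elim (fun _ => 0) fun t => t.1

variable (k) in
/-- The derivations dual to the coordinates given by a frame. -/
noncomputable def frameVec {J : Finset ℤ} :
    Fin n ⊕ (Σ j : J, Fin (Module.finrank k (F j))) → Module.End k (SuperFun k n F E) :=
  Sum.elim (fun i => der (Φ.partialFrameDer k i) hρG hρ) fun t =>
    der (contractionFrameDer Φ.carrier t.1 ((Module.finBasis k (F t.1)).coord t.2)) hρG hρ

theorem frameCoord_mem {J : Finset ℤ} (t : Fin n ⊕ (Σ j : J, Fin (Module.finrank k (F j)))) :
    Φ.frameCoord k hχ hχG t ∈ superGrading k n F E (frameDeg t) := by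
  rcases t with i | ⟨j, a⟩
  · exact Φ.coordFun_mem hχ hχG i
  · exact Φ.coordSec_mem hχ hχG a

theorem frameVec_mem {J : Finset ℤ} (t : Fin n ⊕ (Σ j : J, Fin (Module.finrank k (F j)))) :
    Φ.frameVec k hρG hρ t ∈ gradedDer (superGrading k n F E) (-frameDeg t) := by
  rcases t with i | ⟨j, a⟩
  · exact der_mem_gradedDer (Φ.partialFrameDer k i) hρG hρ
  · exact der_mem_gradedDer _ hρG hρ

theorem frameVec_frameCoord (hχ1 : ∀ x ∈ tsupport ρ, ∀ᶠ y in 𝓝 x, χ y = 1) {J : Finset ℤ}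
    (s t : Fin n ⊕ (Σ j : J, Fin (Module.finrank k (F j)))) :
    Φ.frameVec (E := E) k hρG hρ s (Φ.frameCoord k hχ hχG t) =
      if s = t then ofFun F E (fun x => (ρ x : k)) (contMDiff_ofReal hρ) else 0 := by
  rcases s with i | ⟨j, a⟩ <;> rcases t with i' | ⟨j', a'⟩
  · rw [frameVec, frameCoord, Sum.elim_inl, Sum.elim_inl,
      Φ.der_partial_coordFun hχ hχG hρG hρ hχ1]
    simp only [Sum.inl.injEq]
  · rw [frameVec, frameCoord, Sum.elim_inl, Sum.elim_inr,
      Φ.der_partial_coordSec hχ hχG hρG hρ hχ1, if_neg (by simp)]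
  · rw [frameVec, frameCoord, Sum.elim_inl, Sum.elim_inr,
      Φ.der_contraction_coordFun hχ hχG hρG hρ, if_neg (by simp)]
  · rw [frameVec, frameCoord, Sum.elim_inr, Sum.elim_inr,
      Φ.der_contraction_coordSec hχ hχG hρG hρ hχ1]
    by_cases hj : j = j'
    · subst hj
      rw [Function.update_self, Module.Basis.coord_apply, Module.Basis.repr_self,
        Finsupp.single_apply]
      by_cases ha : a = a'
      · subst ha
        rw [if_pos rfl, if_pos rfl, one_smul]
      · rw [if_neg (Ne.symm ha), if_neg (by simpa using ha), zero_smul]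
    · rw [Function.update_of_ne (fun h => hj (Subtype.ext h.symm)), if_neg (by
        intro h
        simp only [Sum.inr.injEq, Sigma.mk.injEq] at h
        exact hj h.1)]
      exact zero_smul _ _

/-- The local coordinates given by a frame. -/
noncomputable def localCoords {J : Finset ℤ} (hJ : ∀ j, Nontrivial (F j) → j ∈ J)
    (hχ1 : ∀ x ∈ tsupport ρ, ∀ᶠ y in 𝓝 x, χ y = 1) :
    LocalCoords (superGrading k n F E) (Fin n ⊕ Σ j : J, Fin (Module.finrank k (F j))) where
  ρ := ofFun F E (fun x => (ρ x : k)) (contMDiff_ofReal hρ)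
  ρ_mem := ofFun_mem _ _
  x := Φ.frameCoord k hχ hχG
  deg := frameDeg
  x_mem := Φ.frameCoord_mem hχ hχG
  X := Φ.frameVec k hρG hρ
  X_mem := Φ.frameVec_mem hρG hρ
  X_x := Φ.frameVec_frameCoord hχ hχG hρG hρ hχ1
  complete _ _ hD := by
    refine Φ.smul_eq_sum_smul_of_coords hχ hχG hρ (Φ.frameCoord_mem hχ hχG)
      (Φ.frameVec_mem hρG hρ) (Φ.frameVec_frameCoord hχ hχG hρG hρ hχ1) ?_ hχ1
      (fun i => ⟨Sum.inl i, rfl⟩) (fun j a => ?_) hD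
    · rintro (i | ⟨j, a⟩) d s x hx
      · exact Φ.toSection_der_of_eq_zero hρG hρ _ s hx
      · exact Φ.toSection_der_of_eq_zero hρG hρ _ s hx
    · have hj : j ∈ J := hJ j (Module.nontrivial_of_finrank_pos (R := k) a.pos)
      exact ⟨Sum.inr ⟨⟨j, hj⟩, a⟩, rfl⟩

end FrameDomain

variable (k n F E) in
/-- The algebra of functions on a graded supermanifold has finitely many systems of local
coordinates, with the corresponding bump functions adding up to `1`. -/
theorem exists_localCoords (hF : {j | Nontrivial (F j)}.Finite) :
    ∃ c : Fin (2 ^ n) → LocalCoords (superGrading k n F E)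
      (Fin n ⊕ Σ j : hF.toFinset, Fin (Module.finrank k (F j))), ∑ i, (c i).ρ = 1 := by
  -- Only finitely many E j are nonzero, so the trivialising sets can be intersected with the chart
  -- domain and remain an open neighbourhood of p.
  obtain ⟨G, p, hGo, hGc, hG⟩ := exists_coloured_cover (n := n) (C := C)
    (U := fun p => (chartAt (EuclideanSpace ℝ (Fin n)) p).source ∩
      ⋂ j ∈ hF.toFinset, (trivializationAt (F j) (E j) p).baseSet)
    (fun p => (chartAt (EuclideanSpace ℝ (Fin n)) p).open_source.inter
      (isOpen_biInter_finset fun j _ => (trivializationAt (F j) (E j) p).open_baseSet))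
    (fun p => ⟨mem_chart_source _ p,
      Set.mem_iInter₂.2 fun j _ => mem_baseSet_trivializationAt (F j) (E j) p⟩)
  let Φ : Fin (2 ^ n) → FrameDomain n F E := fun c =>
    { carrier := G c
      base := p c
      isOpen := hGo c
      mem_source := fun x hx => (hG c x hx).1.1
      mem_baseSet := fun x hx j hj => Set.mem_iInter₂.1 (hG c x hx).1.2 j (hF.mem_toFinset.2 hj)
      locConst := fun x hx => (hG c x hx).2 }
  have : LocallyCompactSpace C := ChartedSpace.locallyCompactSpace (EuclideanSpace ℝ (Fin n)) C
  -- The partition functions serve as the ρ. A second cutoff χ, equal to 1 near the support of ρ, is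
  -- needed to make the coordinates themselves global.
  obtain ⟨ρ, hρ⟩ := SmoothPartitionOfUnity.exists_isSubordinate (𝓡 n) isClosed_univ G hGo
    fun x _ => Set.mem_iUnion.2 (hGc x)
  have hχ := fun c => exists_cutoff n (isClosed_tsupport (ρ c)) (hGo c) (hρ c)
  choose χ hχ hχ1 hχG using hχ
  refine ⟨fun c => (Φ c).localCoords (hχ c) (hχG c) (hρ c) (ρ c).contMDiff
    (fun j hj => hF.mem_toFinset.2 hj) (hχ1 c), ?_⟩
  refine toSection_injective (funext fun x => ?_)
  have h1 : ∑ c, ρ c x = 1 := by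
    rw [← finsum_eq_sum_of_fintype]
    exact ρ.sum_eq_one (Set.mem_univ x)
  rw [map_sum, map_one, Finset.sum_apply, Pi.one_apply]
  simp only [FrameDomain.localCoords, toSection_ofFun]
  rw [← map_sum, ← RCLike.ofReal_sum, h1, RCLike.ofReal_one, map_one]

end Frame

end GradedHKR

theorem mainTheorem11 {k : Type} [RCLike k] {n : ℕ} {C : Type u} [TopologicalSpace C]
    [ChartedSpace (EuclideanSpace ℝ (Fin n)) C] [IsManifold (𝓡 n) ∞ C] [T2Space C]
    [SecondCountableTopology C]
    (F : ℤ → Type w) [∀ j, NormedAddCommGroup (F j)] [∀ j, NormedSpace ℝ (F j)]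
    [∀ j, NormedSpace k (F j)] [∀ j, IsScalarTower ℝ k (F j)] [∀ j, FiniteDimensional k (F j)]
    (hF : {j | Nontrivial (F j)}.Finite)
    (E : ℤ → C → Type v) [∀ j x, AddCommGroup (E j x)] [∀ j x, Module ℝ (E j x)]
    [∀ j x, Module k (E j x)] [∀ j x, IsScalarTower ℝ k (E j x)]
    [∀ j x, TopologicalSpace (E j x)] [∀ j, TopologicalSpace (Bundle.TotalSpace (F j) (E j))]
    [∀ j, FiberBundle (F j) (E j)] [∀ j, VectorBundle ℝ (F j) (E j)]
    [∀ j, VectorBundle k (F j) (E j)] [∀ j, ContMDiffVectorBundle ∞ (F j) (E j) (𝓡 n)] :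
    (∀ (m : ℕ) (d : ℤ),
      Function.Injective (hkrMap (superGrading k n F E) m d) ∧
      LinearMap.range (hkrMap (superGrading k n F E) m d) =
        hkrCochain (superGrading k n F E) d m ∧
      hkrCochain (superGrading k n F E) d m ≤ diffCochain (superGrading k n F E) d m) ∧
    QuasiIso (hkrHom (superGrading k n F E)) := by
  classical
  obtain ⟨c, hc⟩ := GradedHKR.exists_localCoords k n F E hF
  -- The ρ already add up to 1, so constant weights 1 suffice.
  exact GradedHKR.hkr_of_localCoords c (u := fun _ => 1)
    (fun _ => SetLike.GradedOne.one_mem) (by simpa using hc)
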